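/- Let $d\ge 3$, $\varepsilon>0$, and let $\sigma_1,\sigma_3$ be the Pauli matrices and $\mathcal M_2$ the complex $2\times2$ matrices. Assume: (A1) $\omega:\mathbb R^d\to(0,\infty)$ is $C^2$, has a unique global minimum $\kappa=\omega(0)$, which is non-degenerate, $\nabla\omega(q)\ne0$ for $q\neq0$, $|\nabla\omega(q)|/\omega(q)\to0$ as $q\to\infty$, and the sets $\{\omega\le c\}$, $c<2\kappa$, are bounded. (A2) $\lambda:\mathbb R^d\to\mathbb C$ is $C^1$, and there are a continuous square-integrable $h:\mathbb R^d\to(0,1]$ and $C>0$ with $|\lambda|\le h$, $|\nabla\lambda|\le Ch$. (A3) For every $x\ge\kappa$, $\lambda$ does not vanish identically on $\{\omega=x\}$. *Coefficient functions.* For $n\ge0$, $\eta>0$ let $D_{n,\eta}=\{z\in\mathbb C:\operatorname{Re}z<-\varepsilon+(n+1)\kappa-\eta\}$. For a finite set $Q\subset\mathbb R^d$ put $\omega(Q)=\sum_{q\in Q}\omega(q)$. Let $\mathcal B_n$ be the space of families $\mu=(\mu^{(m)})_{0\le m\le n}$ of $C^1$ functions $\mu^{(m)}(Q_1;Q_2;k_1,\dots,k_m)\in\mathcal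 M_2$ of finite sets $Q_1,Q_2\subset\mathbb R^d$ with $|Q_2|=n-m$ (that is, symmetric functions of the tuples of their elements) and of $k_i\in\mathbb R^d$, which vanish for $|Q_1|\le m$ and which, together with their gradients in each single variable, are bounded by $M\prod_{q\in Q_1}h(q)\prod_{i}h(k_i)$ for some constant $M$. For a coupling constant $\alpha\ge0$ and $z\in D_{n,\eta}$ let $\mu_n(z)\in\mathcal B_n$ be the solution of the system, for $0\le m\le n$ and $|Q_1|>m$, $$\mu^{(m)}(Q_1;Q_2;k)+\alpha(\varepsilon\sigma_3+\omega(Q_1)+\omega(Q_2)-z)^{-1}\sigma_1\Big\{\sum_{q\in Q_1}\lambda(q)\mu^{(m)}(Q_1\setminus q;Q_2;k)+\int\overline{\lambda(q')}\mu^{(m)}(Q_1\cup q';Q_2;k)\,dq'+\overline{\lambda(k_m)}\mu^{(m-1)}(Q_1;Q_2\cup k_m;k_1,\dots,k_{m-1})\Big\}$$ $$=\delta_{m,0}\,\delta_{|Q_1|,1}\,\alpha(\varepsilon\sigma_3+\omega(Q_1)+\omega(Q_2)-z)^{-1}\sigma_1\lambda(q_1)\qquad(Q_1=\{q_1\}\text{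 on the right}),$$ where the last term in the braces is absent for $m=0$. Define $$m(z)=\alpha\sigma_1\int\overline{\lambda(q')}\mu_0^{(0)}(z;q';\emptyset;\emptyset)\,dq',\qquad \hat D(z;q,k)=\alpha\sigma_1\int\overline{\lambda(q')}\mu_1^{(1)}(z;\{q,q'\};\emptyset;k)\,dq'+\alpha\sigma_1\overline{\lambda(k)}\,\mu_1^{(0)}(z;q;k;\emptyset).$$ For $z\in D_{1,\eta}$ put $R(z,q)=[\varepsilon\sigma_3-(z-\omega(q))-m(z-\omega(q))]^{-1}$, and let the one-boson operator $B(z)$ act in $L^2(\mathbb R^d,\mathbb C^2)$, with domain $\{u:\omega u\in L^2\}$, by $$[B(z)u](q)=[\varepsilon\sigma_3-z+\omega(q)-m(z-\omega(q))]u(q)-\int\hat D(z;q,k)u(k)\,dk .$$ *The space $\mathcal K_1$* consists of the kernels $f:\mathbb R^d\times\mathbb R^d\to\mathcal M_2$ for which $f,\partial_qf,\partial_kf,\partial_q\partial_kf$ exist, are continuous and are bounded by $C\,h(q)h(k)$ for some $C$; its norm is the infimum of such $C$. **Proposition.** There is $\eta_0>0$ such that for every $\eta\in(0,\eta_0)$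 there is $\alpha_0>0$ such that for every $0\le\alpha<\alpha_0$ the following holds. For $n=0,1$ and all $z\in D_{n,\eta}$ the system above has a unique solution $\mu_n(z)\in\mathcal B_n$; the equation $\det(\varepsilon\sigma_3-m(x)-x)=0$ has a smallest real solution $e_0$ in $(-\infty,-\varepsilon+\kappa-\eta)$. Put $I=[e_0+\kappa,\infty)$. There is a function $K:D_{1,\eta}\setminus I\to\mathcal K_1$ such that: 1. For every $z\in D_{1,\eta}\setminus I$ all the matrices $\varepsilon\sigma_3-(z-\omega(q))-m(z-\omega(q))$ are invertible, $B(z)$ is well defined and has a bounded two-sided inverse, and $$[B(z)^{-1}f](q)=R(z,q)\Big\{f(q)+\int K(z;q,k)R(z,k)f(k)\,dk\Big\}.$$ 2. $\|K(z)\|_{\mathcal K_1}$ is bounded uniformly in $z$ with $\operatorname{Re}z<e_0+\kappa$. 3. $K$ is $\mathcal K_1$-valued analytic in $D_{1,\eta}\setminus I$. 4. For all $x\in[e_0+\kappa,\,-\varepsilon+2\kappa-\eta)$ the limits $K^\pm(x)=\lim_{\epsilon\searrow0}K(x\pm i\epsilon)$ exist in $\mathcal K_1$, and $K^\pm$ are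 Hölder continuous $\mathcal K_1$-valued functions on this interval: for some $C\ge0$ and $r\in(0,1]$, $\|K^\pm(x_1)-K^\pm(x_2)\|_{\mathcal K_1}\le C|x_1-x_2|^r$. -/

import Mathlib

set_option maxSynthPendingDepth 3

open Set Filter Topology MeasureTheory

noncomputable section

namespace SpinBoson

/-- Momentum space `ℝ^d`. -/
abbrev Mom (d : ℕ) := EuclideanSpace ℝ (Fin d)

/-- The spin space `ℂ²`. -/
abbrev Spin := EuclideanSpace ℂ (Fin 2)

/-- The complex `2 × 2` matrices, as operators on `ℂ²`, with the operator norm. -/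
abbrev M₂ := Spin →L[ℂ] Spin

/-- The one-boson space `L²(ℝ^d, ℂ²)`. -/
abbrev OneBoson (d : ℕ) := Lp Spin 2 (volume : Measure (Mom d))

/-- The Pauli matrix `σ₁`. -/
def σ₁ : M₂ := Matrix.toEuclideanCLM (n := Fin 2) (𝕜 := ℂ) !![0, 1; 1, 0]

/-- The Pauli matrix `σ₃`. -/
def σ₃ : M₂ := Matrix.toEuclideanCLM (n := Fin 2) (𝕜 := ℂ) !![1, 0; 0, -1]

/-- The data of a spin-boson model, apart from the coupling constant: the spin energy `ε`, the boson
dispersion law `ω` and the form factor `lam`. -/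
structure Model (d : ℕ) where
  ε : ℝ
  ω : Mom d → ℝ
  lam : Mom d → ℂ

/-- Assumptions on the dispersion law. -/
structure DispersionLaw {d : ℕ} (ω : Mom d → ℝ) : Prop where
  pos : ∀ q, 0 < ω q
  contDiff : ContDiff ℝ 2 ω
  unique_min : ∀ q, q ≠ 0 → ω 0 < ω q
  nondegenerate : ∀ v, v ≠ 0 → 0 < fderiv ℝ (fderiv ℝ ω) 0 v v
  no_critical : ∀ q, q ≠ 0 → fderiv ℝ ω q ≠ 0
  gradient_decay : Tendsto (fun q => ‖fderiv ℝ ω q‖ / ω q) (cocompact (Mom d)) (𝓝 0)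
  bounded_sublevel : ∀ c, c < 2 * ω 0 → Bornology.IsBounded {q | ω q ≤ c}

/-- The form factor `lam` is continuously differentiable and dominated, with its gradient, by the
continuous square integrable function `h : ℝ^d → (0,1]`. -/
structure FormFactor {d : ℕ} (lam : Mom d → ℂ) (h : Mom d → ℝ) : Prop where
  contDiff : ContDiff ℝ 1 lam
  h_pos : ∀ q, 0 < h q
  h_le_one : ∀ q, h q ≤ 1
  h_continuous : Continuous h
  h_memLp : MemLp h 2 volume
  bound : ∀ q, ‖lam q‖ ≤ h q
  gradient_bound : ∃ C : ℝ, 0 < C ∧ ∀ q, ‖fderiv ℝ lam q‖ ≤ C * h q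

/-! ### The kernel space `𝒦₁` -/

section Kernels

variable {d : ℕ}

/-- `∂_q f (q, k)`. -/
def dq (f : Mom d → Mom d → M₂) (q k : Mom d) : Mom d →L[ℝ] M₂ :=
  fderiv ℝ (fun q' => f q' k) q

/-- `∂_k f (q, k)`. -/
def dk (f : Mom d → Mom d → M₂) (q k : Mom d) : Mom d →L[ℝ] M₂ :=
  fderiv ℝ (fun k' => f q k') k

/-- `∂_k ∂_q f (q, k)`. -/
def dkdq (f : Mom d → Mom d → M₂) (q k : Mom d) : Mom d →L[ℝ] Mom d →L[ℝ] M₂ :=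
  fderiv ℝ (fun k' => dq f q k') k

/-- `f` is continuously differentiable and has a continuous mixed derivative. -/
structure KernelSmooth (f : Mom d → Mom d → M₂) : Prop where
  contDiff : ContDiff ℝ 1 (Function.uncurry f)
  differentiable_dq : ∀ q, Differentiable ℝ (fun k => dq f q k)
  continuous_dkdq : Continuous (Function.uncurry (dkdq f))

/-- `|∂_q^a ∂_k^b f (q, k)| ≤ C h(q) h(k)` for `a, b ∈ {0, 1}`. -/
structure KernelBound (h : Mom d → ℝ) (f : Mom d → Mom d → M₂) (C : ℝ) : Prop where
  nonneg : 0 ≤ C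
  b00 : ∀ q k, ‖f q k‖ ≤ C * (h q * h k)
  b10 : ∀ q k, ‖dq f q k‖ ≤ C * (h q * h k)
  b01 : ∀ q k, ‖dk f q k‖ ≤ C * (h q * h k)
  b11 : ∀ q k, ‖dkdq f q k‖ ≤ C * (h q * h k)

theorem KernelSmooth.diff_q {f : Mom d → Mom d → M₂} (hf : KernelSmooth f) (k : Mom d) :
    Differentiable ℝ (fun q => f q k) :=
  (hf.contDiff.differentiable (by norm_num)).comp
    (differentiable_id.prodMk (differentiable_const k))

theorem KernelSmooth.diff_k {f : Mom d → Mom d → M₂} (hf : KernelSmooth f) (q : Mom d) :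
    Differentiable ℝ (fun k => f q k) :=
  (hf.contDiff.differentiable (by norm_num)).comp
    ((differentiable_const q).prodMk differentiable_id)

theorem dq_add {f g : Mom d → Mom d → M₂} (hf : KernelSmooth f) (hg : KernelSmooth g) :
    dq (f + g) = dq f + dq g := by
  funext q k
  exact fderiv_add (hf.diff_q k q) (hg.diff_q k q)

theorem dk_add {f g : Mom d → Mom d → M₂} (hf : KernelSmooth f) (hg : KernelSmooth g) :
    dk (f + g) = dk f + dk g := by
  funext q k
  exact fderiv_add (hf.diff_k q k) (hg.diff_k q k)

theorem dkdq_add {f g : Mom d → Mom d → M₂} (hf : KernelSmooth f) (hg : KernelSmooth g) :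
    dkdq (f + g) = dkdq f + dkdq g := by
  funext q k
  simp only [dkdq, dq_add hf hg]
  exact fderiv_add (hf.differentiable_dq q k) (hg.differentiable_dq q k)

theorem dq_smul {f : Mom d → Mom d → M₂} (hf : KernelSmooth f) (c : ℂ) :
    dq (c • f) = c • dq f := by
  funext q k
  exact fderiv_const_smul (hf.diff_q k q) c

theorem dk_smul {f : Mom d → Mom d → M₂} (hf : KernelSmooth f) (c : ℂ) :
    dk (c • f) = c • dk f := by
  funext q k
  exact fderiv_const_smul (hf.diff_k q k) c

theorem dkdq_smul {f : Mom d → Mom d → M₂} (hf : KernelSmooth f) (c : ℂ) :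
    dkdq (c • f) = c • dkdq f := by
  funext q k
  simp only [dkdq, dq_smul hf]
  exact fderiv_const_smul (hf.differentiable_dq q k) c

theorem dq_zero : dq (0 : Mom d → Mom d → M₂) = 0 := by
  funext q k
  exact fderiv_const_apply (0 : M₂)

theorem dk_zero : dk (0 : Mom d → Mom d → M₂) = 0 := by
  funext q k
  exact fderiv_const_apply (0 : M₂)

theorem dkdq_zero : dkdq (0 : Mom d → Mom d → M₂) = 0 := by
  funext q k
  simp only [dkdq, dq_zero]
  exact fderiv_const_apply (0 : Mom d →L[ℝ] M₂)

theorem KernelSmooth.add {f g : Mom d → Mom d → M₂} (hf : KernelSmooth f)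
    (hg : KernelSmooth g) : KernelSmooth (f + g) where
  contDiff := hf.contDiff.add hg.contDiff
  differentiable_dq q := by
    rw [dq_add hf hg]
    exact (hf.differentiable_dq q).add (hg.differentiable_dq q)
  continuous_dkdq := by
    rw [dkdq_add hf hg]
    exact hf.continuous_dkdq.add hg.continuous_dkdq

theorem KernelSmooth.smul {f : Mom d → Mom d → M₂} (hf : KernelSmooth f) (c : ℂ) :
    KernelSmooth (c • f) where
  contDiff := hf.contDiff.const_smul c
  differentiable_dq q := by
    rw [dq_smul hf]
    exact (hf.differentiable_dq q).const_smul c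
  continuous_dkdq := by
    rw [dkdq_smul hf]
    exact hf.continuous_dkdq.const_smul c

theorem kernelSmooth_zero : KernelSmooth (0 : Mom d → Mom d → M₂) where
  contDiff := contDiff_const (c := (0 : M₂))
  differentiable_dq q := by
    rw [dq_zero]
    exact differentiable_const _
  continuous_dkdq := by
    rw [dkdq_zero]
    exact continuous_const (y := (0 : Mom d →L[ℝ] Mom d →L[ℝ] M₂))

theorem kernelBound_zero (h : Mom d → ℝ) : KernelBound h 0 0 where
  nonneg := le_rfl
  b00 q k := by simp
  b10 q k := by simp [dq_zero]
  b01 q k := by simp [dk_zero]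
  b11 q k := by simp [dkdq_zero]

theorem KernelBound.add {h : Mom d → ℝ} {f g : Mom d → Mom d → M₂} {A B : ℝ}
    (hf : KernelSmooth f) (hg : KernelSmooth g) (hA : KernelBound h f A)
    (hB : KernelBound h g B) : KernelBound h (f + g) (A + B) where
  nonneg := add_nonneg hA.nonneg hB.nonneg
  b00 q k := (norm_add_le _ _).trans (by linarith [hA.b00 q k, hB.b00 q k])
  b10 q k := by
    rw [dq_add hf hg]
    exact (norm_add_le _ _).trans (by linarith [hA.b10 q k, hB.b10 q k])
  b01 q k := by
    rw [dk_add hf hg]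
    exact (norm_add_le _ _).trans (by linarith [hA.b01 q k, hB.b01 q k])
  b11 q k := by
    rw [dkdq_add hf hg]
    exact (norm_add_le _ _).trans (by linarith [hA.b11 q k, hB.b11 q k])

theorem KernelBound.smul {h : Mom d → ℝ} {f : Mom d → Mom d → M₂} {A : ℝ}
    (hf : KernelSmooth f) (hA : KernelBound h f A) (c : ℂ) :
    KernelBound h (c • f) (‖c‖ * A) where
  nonneg := mul_nonneg (norm_nonneg c) hA.nonneg
  b00 q k := by
    simp only [Pi.smul_apply, norm_smul, mul_assoc]
    exact mul_le_mul_of_nonneg_left (hA.b00 q k) (norm_nonneg c)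
  b10 q k := by
    simp only [dq_smul hf, Pi.smul_apply, norm_smul, mul_assoc]
    exact mul_le_mul_of_nonneg_left (hA.b10 q k) (norm_nonneg c)
  b01 q k := by
    simp only [dk_smul hf, Pi.smul_apply, norm_smul, mul_assoc]
    exact mul_le_mul_of_nonneg_left (hA.b01 q k) (norm_nonneg c)
  b11 q k := by
    simp only [dkdq_smul hf, Pi.smul_apply, norm_smul, mul_assoc]
    exact mul_le_mul_of_nonneg_left (hA.b11 q k) (norm_nonneg c)

/-- The smooth kernels dominated by `h`, as a linear space. -/
def kernelSubmodule (h : Mom d → ℝ) : Submodule ℂ (Mom d → Mom d → M₂) where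
  carrier := {f | KernelSmooth f ∧ ∃ C, KernelBound h f C}
  add_mem' := by
    rintro f g ⟨hf, A, hA⟩ ⟨hg, B, hB⟩
    exact ⟨hf.add hg, A + B, hA.add hf hg hB⟩
  zero_mem' := ⟨kernelSmooth_zero, 0, kernelBound_zero h⟩
  smul_mem' := by
    rintro c f ⟨hf, A, hA⟩
    exact ⟨hf.smul c, ‖c‖ * A, hA.smul hf c⟩

/-- The space `𝒦₁` of kernels dominated by `h`; its norm (below) is the infimum of the constants `C`
in `KernelBound h f C`. -/
def K₁ (h : Mom d → ℝ) : Type := kernelSubmodule h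

instance (h : Mom d → ℝ) : AddCommGroup (K₁ h) :=
  inferInstanceAs (AddCommGroup (kernelSubmodule h))

instance (h : Mom d → ℝ) : Module ℂ (K₁ h) :=
  inferInstanceAs (Module ℂ (kernelSubmodule h))

/-- The kernel function of an element of `𝒦₁`. -/
def K₁.ker {h : Mom d → ℝ} (f : K₁ h) : Mom d → Mom d → M₂ := f.1

theorem K₁.ker_add {h : Mom d → ℝ} (f g : K₁ h) : (f + g).ker = f.ker + g.ker := rfl

theorem K₁.ker_smul {h : Mom d → ℝ} (c : ℂ) (f : K₁ h) : (c • f).ker = c • f.ker := rfl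

theorem K₁.ker_zero {h : Mom d → ℝ} : (0 : K₁ h).ker = 0 := rfl

theorem K₁.smooth {h : Mom d → ℝ} (f : K₁ h) : KernelSmooth f.ker := f.2.1

theorem K₁.exists_bound {h : Mom d → ℝ} (f : K₁ h) : ∃ C, KernelBound h f.ker C := f.2.2

theorem K₁.ext {h : Mom d → ℝ} {f g : K₁ h} (hfg : f.ker = g.ker) : f = g := Subtype.ext hfg

instance (h : Mom d → ℝ) : Norm (K₁ h) := ⟨fun f => sInf {C | KernelBound h f.ker C}⟩

theorem K₁.norm_def {h : Mom d → ℝ} (f : K₁ h) : ‖f‖ = sInf {C | KernelBound h f.ker C} := rfl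

theorem K₁.norm_le {h : Mom d → ℝ} {f : K₁ h} {C : ℝ} (hC : KernelBound h f.ker C) : ‖f‖ ≤ C :=
  csInf_le ⟨0, fun _ hx => hx.nonneg⟩ hC

theorem K₁.bound_norm {h : Mom d → ℝ} (f : K₁ h) : KernelBound h f.ker ‖f‖ := by
  have hcl : IsClosed {C : ℝ | KernelBound h f.ker C} := by
    have : {C : ℝ | KernelBound h f.ker C} = Ici 0 ∩ ⋂ q, ⋂ k,
        ({C : ℝ | ‖f.ker q k‖ ≤ C * (h q * h k)} ∩ {C : ℝ | ‖dq f.ker q k‖ ≤ C * (h q * h k)} ∩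
        {C : ℝ | ‖dk f.ker q k‖ ≤ C * (h q * h k)} ∩
        {C : ℝ | ‖dkdq f.ker q k‖ ≤ C * (h q * h k)}) := by
      ext C
      simp only [mem_ofPred_eq, mem_inter_iff, mem_Ici, mem_iInter]
      constructor
      · intro hC
        exact ⟨hC.nonneg, fun q k => ⟨⟨⟨hC.b00 q k, hC.b10 q k⟩, hC.b01 q k⟩, hC.b11 q k⟩⟩
      · rintro ⟨h0, hC⟩
        exact ⟨h0, fun q k => (hC q k).1.1.1, fun q k => (hC q k).1.1.2, fun q k => (hC q k).1.2,
          fun q k => (hC q k).2⟩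
    rw [this]
    refine isClosed_Ici.inter (isClosed_iInter fun q => isClosed_iInter fun k => ?_)
    refine ((IsClosed.inter ?_ ?_).inter ?_).inter ?_ <;>
      exact isClosed_le continuous_const (continuous_id.mul continuous_const)
  exact hcl.csInf_mem f.exists_bound ⟨0, fun _ hx => hx.nonneg⟩

theorem K₁.norm_smul_le' {h : Mom d → ℝ} (c : ℂ) (f : K₁ h) : ‖c • f‖ ≤ ‖c‖ * ‖f‖ :=
  K₁.norm_le (by rw [K₁.ker_smul]; exact f.bound_norm.smul f.smooth c)

theorem K₁.core (h : Mom d → ℝ) : NormedSpace.Core ℂ (K₁ h) where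
  norm_nonneg f := f.bound_norm.nonneg
  norm_smul c f := by
    refine le_antisymm (K₁.norm_smul_le' c f) ?_
    rcases eq_or_ne c 0 with rfl | hc
    · simpa using (K₁.bound_norm ((0 : ℂ) • f)).nonneg
    · have := K₁.norm_smul_le' c⁻¹ (c • f)
      rw [inv_smul_smul₀ hc, norm_inv] at this
      rwa [← div_eq_inv_mul, le_div_iff₀' (norm_pos_iff.mpr hc)] at this
  norm_triangle f g :=
    K₁.norm_le (by rw [K₁.ker_add]; exact f.bound_norm.add f.smooth g.smooth g.bound_norm)
  norm_eq_zero_iff f := by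
    constructor
    · intro hf
      have hb := f.bound_norm
      rw [hf] at hb
      refine K₁.ext (funext fun q => funext fun k => ?_)
      simpa [K₁.ker_zero] using hb.b00 q k
    · rintro rfl
      exact le_antisymm (K₁.norm_le (kernelBound_zero h)) (K₁.bound_norm (0 : K₁ h)).nonneg

instance (h : Mom d → ℝ) : NormedAddCommGroup (K₁ h) := NormedAddCommGroup.ofCore (K₁.core h)

instance (h : Mom d → ℝ) : NormedSpace ℂ (K₁ h) := NormedSpace.ofCore (K₁.core h)

end Kernels

/-! ### Coefficient functions -/

/-- Families of matrix functions `μ^{(m)}(Q₁; Q₂; k₁,…,k_m)`. Here `μ l j m` is the component with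
`|Q₁| = l`, `|Q₂| = j`; a function of a finite set `Q` is written as a symmetric function of the
tuple of its elements. For a given `n` only the components with `j + m = n` are used. -/
abbrev Family (d : ℕ) :=
  (l j m : ℕ) → (Fin l → Mom d) → (Fin j → Mom d) → (Fin m → Mom d) → M₂

/-- `M` bounds the components of `μ` and all their partial gradients (with respect to one variable
of `ℝ^d` at a time) relative to `∏_{q ∈ Q₁} h(q) ∏ᵢ h(kᵢ)`. -/
structure FamilyBound {d : ℕ} (h : Mom d → ℝ) (μ : Family d) (M : ℝ) : Prop where
  value : ∀ l j m q p k, ‖μ l j m q p k‖ ≤ M * ((∏ i, h (q i)) * ∏ i, h (k i))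
  grad_q : ∀ l j m q p k i, ‖fderiv ℝ (fun x => μ l j m (Function.update q i x) p k) (q i)‖
    ≤ M * ((∏ i, h (q i)) * ∏ i, h (k i))
  grad_p : ∀ l j m q p k i, ‖fderiv ℝ (fun x => μ l j m q (Function.update p i x) k) (p i)‖
    ≤ M * ((∏ i, h (q i)) * ∏ i, h (k i))
  grad_k : ∀ l j m q p k i, ‖fderiv ℝ (fun x => μ l j m q p (Function.update k i x)) (k i)‖
    ≤ M * ((∏ i, h (q i)) * ∏ i, h (k i))

/-- Membership in the space `ℬ_n` of coefficient functions. -/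
structure IsCoeffFamily {d : ℕ} (h : Mom d → ℝ) (n : ℕ) (μ : Family d) : Prop where
  index : ∀ l j m, j + m ≠ n → μ l j m = 0
  vanish : ∀ l j m, l ≤ m → μ l j m = 0
  symm : ∀ l j m (π : Equiv.Perm (Fin l)) (ρ : Equiv.Perm (Fin j)) q p k,
    μ l j m (q ∘ π) (p ∘ ρ) k = μ l j m q p k
  contDiff : ∀ l j m, ContDiff ℝ 1
    (fun x : (Fin l → Mom d) × (Fin j → Mom d) × (Fin m → Mom d) => μ l j m x.1 x.2.1 x.2.2)
  bound : ∃ M, FamilyBound h μ M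

namespace Model

variable {d : ℕ} (S : Model d)

/-- The minimum `κ = ω(0)` of the dispersion law. -/
def κ : ℝ := S.ω 0

/-- The half-plane `D_{n,η} = {Re z < -ε + (n+1)κ - η}`. -/
def halfPlane (n : ℕ) (η : ℝ) : Set ℂ := {z | z.re < -S.ε + (n + 1) * S.κ - η}

/-- `ω(Q) = ∑_{q ∈ Q} ω(q)`. -/
def energy {l : ℕ} (q : Fin l → Mom d) : ℝ := ∑ i, S.ω (q i)

/-- `(ε σ₃ + s - z)⁻¹`; here `Ring.inverse` is the inverse matrix (`0` for a singular matrix). -/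
def freeRes (z : ℂ) (s : ℝ) : M₂ := Ring.inverse ((S.ε : ℂ) • σ₃ + ((s : ℂ) - z) • (1 : M₂))

/-- `∑_{q ∈ Q₁} λ(q) μ^{(m)}(Q₁ ∖ q; Q₂; k₁,…,k_m)`. -/
def createTerm (μ : Family d) :
    (l j m : ℕ) → (Fin l → Mom d) → (Fin j → Mom d) → (Fin m → Mom d) → M₂
  | 0, _, _, _, _, _ => 0
  | l + 1, j, m, q, p, k => ∑ i, S.lam (q i) • μ l j m (fun a => q (i.succAbove a)) p k

/-- `∫ conj λ(q') μ^{(m)}(Q₁ ∪ q'; Q₂; k₁,…,k_m) dq'`. -/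
def annihilateTerm (μ : Family d) (l j m : ℕ) (q : Fin l → Mom d) (p : Fin j → Mom d)
    (k : Fin m → Mom d) : M₂ :=
  ∫ x, star (S.lam x) • μ (l + 1) j m (Fin.snoc (α := fun _ => Mom d) q x) p k

/-- `conj λ(k_m) μ^{(m-1)}(Q₁; Q₂ ∪ k_m; k₁,…,k_{m-1})`, absent for `m = 0`. -/
def transferTerm (μ : Family d) :
    (l j m : ℕ) → (Fin l → Mom d) → (Fin j → Mom d) → (Fin m → Mom d) → M₂
  | _, _, 0, _, _, _ => 0
  | l, j, m + 1, q, p, k => star (S.lam (k (Fin.last m))) •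
      μ l (j + 1) m q (Fin.snoc (α := fun _ => Mom d) p (k (Fin.last m))) (fun a => k a.castSucc)

/-- The operator `Γ(z)` on coefficient functions. -/
def Gam (α : ℝ) (z : ℂ) (μ : Family d) : Family d := fun l j m q p k =>
  (α : ℂ) • (S.freeRes z (S.energy q + S.energy p) * σ₁ *
    (S.createTerm μ l j m q p k + S.annihilateTerm μ l j m q p k + S.transferTerm μ l j m q p k))

/-- The inhomogeneous term, supported on `m = 0`, `|Q₁| = 1`, where it is
`α (ε σ₃ + ω(Q₁ ∪ Q₂) - z)⁻¹ σ₁ λ(q₁)`. -/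
def source (α : ℝ) (z : ℂ) : Family d
  | 1, _, 0, q, p, _ => ((α : ℂ) * S.lam (q 0)) • (S.freeRes z (S.energy q + S.energy p) * σ₁)
  | _, _, _, _, _, _ => 0

/-- `μ ∈ ℬ_n` solves `μ + Γ(z) μ = source` (an equation between functions supported on
`|Q₁| > m`). -/
structure IsCoeff (h : Mom d → ℝ) (α : ℝ) (n : ℕ) (z : ℂ) (μ : Family d) : Prop where
  mem : IsCoeffFamily h n μ
  eqn : ∀ l j m, j + m = n → m < l → ∀ q p k,
    μ l j m q p k + S.Gam α z μ l j m q p k = S.source α z l j m q p k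

open Classical in
/-- The solution `μ_n(z) ∈ ℬ_n` of the coefficient equation. -/
def coeff (h : Mom d → ℝ) (α : ℝ) (n : ℕ) (z : ℂ) : Family d :=
  if hex : ∃ μ, S.IsCoeff h α n z μ then hex.choose else 0

/-! ### The one-boson operator -/

/-- `m(z) = α σ₁ ∫ conj λ(q') μ₀^{(0)}(z; q'; ∅; ∅) dq'`. -/
def mMat (h : Mom d → ℝ) (α : ℝ) (z : ℂ) : M₂ :=
  (α : ℂ) • (σ₁ * ∫ x, star (S.lam x) • S.coeff h α 0 z 1 0 0 ![x] ![] ![])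

/-- `D̂_{1,1}(z; q; ∅; k) = α σ₁ ∫ conj λ(q') μ₁^{(1)}(z; {q, q'}; ∅; k) dq'
+ α σ₁ conj λ(k) μ₁^{(0)}(z; q; k; ∅)`. -/
def dKer (h : Mom d → ℝ) (α : ℝ) (z : ℂ) (q k : Mom d) : M₂ :=
  (α : ℂ) • (σ₁ * ∫ x, star (S.lam x) • S.coeff h α 1 z 2 0 1 ![q, x] ![] ![k])
    + (α : ℂ) • (σ₁ * (star (S.lam k) • S.coeff h α 1 z 1 1 0 ![q] ![k] ![]))

/-- `ε σ₃ - ζ - m(ζ)`. -/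
def effMat (h : Mom d → ℝ) (α : ℝ) (ζ : ℂ) : M₂ :=
  (S.ε : ℂ) • σ₃ - ζ • (1 : M₂) - S.mMat h α ζ

/-- The real zeros of `det (ε σ₃ - m(x) - x)` below `λ⁰_{0,1} - η = -ε + κ - η`. -/
def effZeros (h : Mom d → ℝ) (α η : ℝ) : Set ℝ :=
  {x | x < -S.ε + S.κ - η ∧ (S.effMat h α (x : ℂ)).det = 0}

/-- `ε σ₃ - (z - ω(q)) - m(z - ω(q))`. -/
def multMat (h : Mom d → ℝ) (α : ℝ) (z : ℂ) (q : Mom d) : M₂ :=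
  S.effMat h α (z - (S.ω q : ℂ))

/-- The domain of the operators `B(z)`: the `u ∈ L²` with `ω u ∈ L²`. -/
def opDomain : Set (OneBoson d) := {u | MemLp (fun q => (S.ω q : ℂ) • u q) 2 volume}

/-- `[B(z) u](q) = [ε σ₃ - z + ω(q) - m(z - ω(q))] u(q) - ∫ D̂_{1,1}(z; q; ∅; k) u(k) dk`. -/
def opB (h : Mom d → ℝ) (α : ℝ) (z : ℂ) (u : OneBoson d) (q : Mom d) : Spin :=
  S.multMat h α z q (u q) - ∫ k, S.dKer h α z q k (u k)

/-- `B(z)` is a well-defined operator in `L²(ℝ^d, ℂ²)` with the domain `opDomain`, and the bounded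
operator `T` is its two-sided inverse. -/
structure IsInverse (h : Mom d → ℝ) (α : ℝ) (z : ℂ) (T : OneBoson d →L[ℂ] OneBoson d) : Prop where
  integrable : ∀ (u : OneBoson d) (q : Mom d), Integrable (fun k => S.dKer h α z q k (u k))
  maps : ∀ u ∈ S.opDomain, MemLp (S.opB h α z u) 2 volume
  mem_domain : ∀ g, T g ∈ S.opDomain
  right_inv : ∀ g, S.opB h α z (T g) =ᵐ[volume] g
  left_inv : ∀ u ∈ S.opDomain, ∀ g : OneBoson d, S.opB h α z u =ᵐ[volume] g → T g = u

end Model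

/-- The cut `[a, ∞)`, as a subset of the complex plane. -/
def cut (a : ℝ) : Set ℂ := {z | z.im = 0 ∧ a ≤ z.re}

end SpinBoson

end

set_option linter.unusedSectionVars false

noncomputable section

namespace SpinBoson

/-! ### Holomorphic functions on open subsets of normed spaces -/

section Holomorphic

variable {E F : Type*} [NormedAddCommGroup E] [NormedSpace ℂ E] [NormedAddCommGroup F]
  [NormedSpace ℂ F] {f : E → F} {x y : E} {r M : ℝ} {W : Set E}

/-! Reduction to scalars. Each term of the coefficient system carries one factor `σ₁`, and `σ₁`
exchanges the two diagonal entries of the free resolvent. Hence the solution is ∏ λ(q) ∏ conj λ(k) ·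
σ₁^(|Q₁|+m) · diag(x, y), where x and y depend on the momenta only through their energies and are
bounded and holomorphic when the energies range over a half-plane Re t > κ - δ (`isCoeff_fam`). The
scalar equations are contractions for small α: creation contributes |Q₁| terms, but the denominators
grow at least like |Q₁| (`exists_sys`); the same estimate in a weighted sup norm gives uniqueness
(`isCoeff_unique`). It follows that m(z) = diag(m₁, m₂) and D̂(z; q, k) = λ(q) conj λ(k) diag(X₁,
X₂)(z; ω(q), ω(k)), all of order α (`exists_coeff_data`). Momentum gradients are free of charge:
Cauchy's estimate at ω(q) costs 1/(ω(q) - a), and |∇ω| ≤ C (ω - a).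

The poles. Since m₁ and m₂ are small, holomorphic and real on the real axis, each entry ±ε - ζ -
m_j(ζ) has at most one zero e_j in a slightly smaller half-plane; it is real and simple, and the
reciprocal is ρ/(e_j - ζ) + g(ζ) with g bounded (`exists_simple_zero`). The zero near -ε is e₀.
Therefore R(z, q) is diagonal with entries ρ/(ω(q) - (z - e_j)) + g(z - ω(q)), and its singularities
lie on the cut.

The kernel equation. B(z) is R(z)⁻¹ minus the integral operator D̂, so B(z)⁻¹ = R(1 + K R) with K =
D̂ + D̂ R K. As D̂ is of order α, a Neumann series in the Banach space 𝒦₁ produces K, provided that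
the product (f, g) ↦ ∫ f R g is bounded on 𝒦₁ uniformly up to the cut.

The decisive estimate. Only one derivative of the kernels is available. Integration by parts along
the field ∇ω/|∇ω|² bounds ∫ u'(ω) F by a multiple of ∫ |u(ω)| |q|⁻² (`exists_norm_integral_le`); the
singularity at the non-degenerate minimum is integrable because d ≥ 3. With u = log((y - ζ₁)/(y -
ζ₂)) this makes resolvent integrals Hölder continuous of order 1/10 on either side of the real axis
(`exists_norm_integral_resolvent_sub_le`), and comparison with a point at distance one makes them
bounded. Large momenta are harmless since z - e_j stays to the left of 2κ, below which the sublevel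
sets of ω are bounded.

These integral bounds, recorded as `TameBound`, pass to products in 𝒦₁ (`TameBound.kernelBound`),
then to K (`norm_solK_sub_le`), and give the uniform bound and the boundary values. Analyticity
holds because differences in the Banach spaces are controlled by those of bounded holomorphic
families (`differentiableAt_of_family`). -/

theorem norm_nonneg_of_ball (hr : 0 < r) (hM : ∀ y ∈ Metric.ball x r, ‖f y‖ ≤ M) : 0 ≤ M :=
  (norm_nonneg _).trans (hM x (Metric.mem_ball_self hr))

/-- The Schwarz lemma concerns maps between balls. Centring the target at `f x` costs the factor 2
that recurs in every Cauchy estimate below. -/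
theorem mapsTo_of_norm_le (hr : 0 < r) (hM : ∀ y ∈ Metric.ball x r, ‖f y‖ ≤ M) :
    MapsTo f (Metric.ball x r) (Metric.closedBall (f x) (2 * M)) := fun y hy => by
  rw [mem_closedBall_iff_norm]
  refine (norm_sub_le _ _).trans ?_
  linarith [hM y hy, hM x (Metric.mem_ball_self hr)]

/-- Cauchy's estimate for the Fréchet derivative. -/
theorem norm_fderiv_le_of_ball (hr : 0 < r) (hd : DifferentiableOn ℂ f (Metric.ball x r))
    (hM : ∀ y ∈ Metric.ball x r, ‖f y‖ ≤ M) : ‖fderiv ℂ f x‖ ≤ 2 * M / r :=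
  Complex.norm_fderiv_le_div_of_mapsTo_ball hd (mapsTo_of_norm_le hr hM) hr

theorem norm_sub_le_of_ball (hr : 0 < r) (hd : DifferentiableOn ℂ f (Metric.ball x r))
    (hM : ∀ y ∈ Metric.ball x r, ‖f y‖ ≤ M) (hy : y ∈ Metric.ball x r) :
    ‖f y - f x‖ ≤ 2 * M / r * ‖y - x‖ := by
  simpa [dist_eq_norm] using
    Complex.dist_le_div_mul_dist_of_mapsTo_ball hd (mapsTo_of_norm_le hr hM) hy

/-- Second derivatives are avoided: with h = y - x, Cauchy's estimate is applied at x to z ↦ f(z +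
h) - f(z), which is itself of order ‖h‖ on a smaller ball. The radii 3r/4 and r/4 produce the
constant 64/3, rounded up to 22. -/
theorem norm_fderiv_sub_le_of_ball (hr : 0 < r) (hd : DifferentiableOn ℂ f (Metric.ball x r))
    (hM : ∀ y ∈ Metric.ball x r, ‖f y‖ ≤ M) (hy : y ∈ Metric.ball x (r / 2)) :
    ‖fderiv ℂ f y - fderiv ℂ f x‖ ≤ 22 * M / r ^ 2 * ‖y - x‖ := by
  have hM0 := norm_nonneg_of_ball hr hM
  have hyx : ‖y - x‖ < r / 2 := by simpa [dist_eq_norm] using hy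
  set h := y - x
  have hsub : ∀ z ∈ Metric.ball x (r / 4), Metric.ball z (3 * r / 4) ⊆ Metric.ball x r := by
    intro z hz w hw
    rw [Metric.mem_ball] at *
    linarith [dist_triangle w z x]
  have hmem : ∀ z ∈ Metric.ball x (r / 4), z + h ∈ Metric.ball z (3 * r / 4) := by
    intro z hz
    simp only [Metric.mem_ball, dist_eq_norm, add_sub_cancel_left]
    linarith
  have hopen : IsOpen (Metric.ball x r) := Metric.isOpen_ball
  have hb : ∀ z ∈ Metric.ball x (r / 4), ‖f (z + h) - f z‖ ≤ 2 * M / (3 * r / 4) * ‖h‖ := by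
    intro z hz
    have := norm_sub_le_of_ball (f := f) (x := z) (r := 3 * r / 4) (M := M) (by linarith)
      (hd.mono (hsub z hz)) (fun w hw => hM w (hsub z hz hw)) (hmem z hz)
    simpa using this
  have hdiff : ∀ z ∈ Metric.ball x (r / 4), DifferentiableAt ℂ (fun z => f (z + h)) z := by
    intro z hz
    have : DifferentiableAt ℂ f (z + h) :=
      (hd _ (hsub z hz (hmem z hz))).differentiableAt (hopen.mem_nhds (hsub z hz (hmem z hz)))
    exact this.comp z ((differentiableAt_id).add_const h)
  have hdiff2 : ∀ z ∈ Metric.ball x (r / 4), DifferentiableAt ℂ f z := by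
    intro z hz
    have : z ∈ Metric.ball x r := Metric.ball_subset_ball (by linarith) hz
    exact (hd _ this).differentiableAt (hopen.mem_nhds this)
  have := norm_fderiv_le_of_ball (f := fun z => f (z + h) - f z) (x := x) (r := r / 4)
    (by linarith) (fun z hz => ((hdiff z hz).sub (hdiff2 z hz)).differentiableWithinAt) hb
  have hx : x ∈ Metric.ball x (r / 4) := Metric.mem_ball_self (by linarith)
  rw [fderiv_fun_sub (hdiff x hx) (hdiff2 x hx), fderiv_comp_add_right] at this
  have hxy : x + h = y := by simp [h]
  rw [hxy] at this
  refine this.trans ?_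
  have h1 : 2 * (2 * M / (3 * r / 4) * ‖h‖) / (r / 4) = (64 / 3 * M / r ^ 2) * ‖h‖ := by
    field_simp; ring
  rw [h1]
  gcongr
  norm_num

theorem continuousOn_fderiv_of_isOpen (hW : IsOpen W) (hd : DifferentiableOn ℂ f W) :
    ContinuousOn (fderiv ℂ f) W := by
  intro x hx
  have hc : ContinuousAt f x := (hd.continuousOn).continuousAt (hW.mem_nhds hx)
  obtain ⟨r₁, hr₁, h₁⟩ := Metric.isOpen_iff.mp hW x hx
  obtain ⟨r₂, hr₂, h₂⟩ := Metric.continuousAt_iff.mp hc 1 one_pos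
  have hr : 0 < min r₁ r₂ := lt_min hr₁ hr₂
  have hb : ∀ y ∈ Metric.ball x (min r₁ r₂), ‖f y‖ ≤ ‖f x‖ + 1 := by
    intro y hy
    have := h₂ (lt_of_lt_of_le hy (min_le_right _ _))
    rw [dist_eq_norm] at this
    linarith [norm_sub_norm_le (f y) (f x)]
  have hd' : DifferentiableOn ℂ f (Metric.ball x (min r₁ r₂)) :=
    hd.mono ((Metric.ball_subset_ball (min_le_left _ _)).trans h₁)
  refine ContinuousAt.continuousWithinAt ?_
  rw [ContinuousAt, tendsto_iff_norm_sub_tendsto_zero]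
  have hev : ∀ᶠ y in 𝓝 x, ‖fderiv ℂ f y - fderiv ℂ f x‖
      ≤ 22 * (‖f x‖ + 1) / (min r₁ r₂) ^ 2 * ‖y - x‖ := by
    filter_upwards [Metric.ball_mem_nhds x (half_pos hr)] with y hy
    exact norm_fderiv_sub_le_of_ball hr hd' hb hy
  refine squeeze_zero' (Eventually.of_forall fun _ => norm_nonneg _) hev ?_
  have : Continuous fun y => 22 * (‖f x‖ + 1) / (min r₁ r₂) ^ 2 * ‖y - x‖ := by fun_prop
  simpa using this.tendsto x

/-- Holomorphic functions are continuously differentiable. -/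
theorem contDiffOn_one_of_isOpen (hW : IsOpen W) (hd : DifferentiableOn ℂ f W) :
    ContDiffOn ℂ 1 f W :=
  (contDiffOn_succ_iff_fderiv_of_isOpen (n := 0) hW).mpr
    ⟨hd, by simp, contDiffOn_zero.mpr (continuousOn_fderiv_of_isOpen hW hd)⟩

theorem contDiffAt_one_of_isOpen (hW : IsOpen W) (hd : DifferentiableOn ℂ f W) (hx : x ∈ W) :
    ContDiffAt ℝ 1 f x :=
  ((contDiffOn_one_of_isOpen hW hd).contDiffAt (hW.mem_nhds hx)).restrict_scalars ℝ

/-- Uniform limits of holomorphic functions are holomorphic. -/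
theorem differentiableOn_of_tendstoUniformlyOn [CompleteSpace F] {f : ℕ → E → F} {g : E → F}
    (hW : IsOpen W) (hd : ∀ n, DifferentiableOn ℂ (f n) W)
    (hf : TendstoUniformlyOn f g atTop W) : DifferentiableOn ℂ g W := by
  intro x hx
  obtain ⟨r, hr, h₁⟩ := Metric.isOpen_iff.mp hW x hx
  have hsub : ∀ z ∈ Metric.ball x (r / 2), Metric.ball z (r / 2) ⊆ W := by
    intro z hz w hw
    refine h₁ ?_
    rw [Metric.mem_ball] at *
    linarith [dist_triangle w z x]
  have hda : ∀ n, ∀ z ∈ W, DifferentiableAt ℂ (f n) z := fun n z hz =>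
    (hd n z hz).differentiableAt (hW.mem_nhds hz)
  -- Cauchy's estimate for `f m - f n` turns uniform convergence of the functions into uniform
  -- convergence of the derivatives on a smaller ball.
  have hcau : UniformCauchySeqOn (fun n => fderiv ℂ (f n)) atTop (Metric.ball x (r / 2)) := by
    rw [Metric.uniformCauchySeqOn_iff]
    intro ε hε
    obtain ⟨N, hN⟩ := (Metric.uniformCauchySeqOn_iff.mp hf.uniformCauchySeqOn) (ε * r / 8)
      (by positivity)
    refine ⟨N, fun m hm n hn z hz => ?_⟩
    have hzW : z ∈ W := hsub z hz (Metric.mem_ball_self (by linarith))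
    have := norm_fderiv_le_of_ball (f := fun w => f m w - f n w) (x := z) (r := r / 2)
      (M := ε * r / 8) (by linarith)
      (((hd m).sub (hd n)).mono (hsub z hz))
      (fun w hw => by simpa [dist_eq_norm] using (hN m hm n hn w (hsub z hz hw)).le)
    rw [fderiv_fun_sub (hda m z hzW) (hda n z hzW)] at this
    rw [dist_eq_norm]
    refine this.trans_lt ?_
    have : 2 * (ε * r / 8) / (r / 2) = ε / 2 := by field_simp; ring
    rw [this]; linarith
  have hlim : ∀ z ∈ Metric.ball x (r / 2), ∃ l, Tendsto (fun n => fderiv ℂ (f n) z) atTop (𝓝 l) :=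
    fun z hz => cauchySeq_tendsto_of_complete (hcau.cauchySeq hz)
  choose! g' hg' using hlim
  have hu := hcau.tendstoUniformlyOn_of_tendsto hg'
  have hxb : x ∈ Metric.ball x (r / 2) := Metric.mem_ball_self (by linarith)
  have hbW : ∀ z ∈ Metric.ball x (r / 2), z ∈ W := fun z hz =>
    hsub z hz (Metric.mem_ball_self (by linarith))
  exact (hasFDerivAt_of_tendstoUniformlyOn Metric.isOpen_ball hu
    (fun n z hz => (hda n z (hbW z hz)).hasFDerivAt)
    (fun z hz => hf.tendsto_at (hbW z hz)) hxb).differentiableAt.differentiableWithinAt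

/-- Directional derivatives of holomorphic functions are holomorphic. -/
theorem differentiableOn_fderiv_apply [CompleteSpace F] (hW : IsOpen W)
    (hd : DifferentiableOn ℂ f W) (v : E) : DifferentiableOn ℂ (fun x => fderiv ℂ f x v) W := by
  intro x hx
  have hc : ContinuousAt f x := (hd.continuousOn).continuousAt (hW.mem_nhds hx)
  obtain ⟨r₁, hr₁, h₁⟩ := Metric.isOpen_iff.mp hW x hx
  obtain ⟨r₂, hr₂, h₂⟩ := Metric.continuousAt_iff.mp hc 1 one_pos
  set r := min r₁ r₂ with hr_def
  have hr : 0 < r := lt_min hr₁ hr₂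
  set M := ‖f x‖ + 1
  have hb : ∀ y ∈ Metric.ball x r, ‖f y‖ ≤ M := by
    intro y hy
    have := h₂ (lt_of_lt_of_le hy (min_le_right _ _))
    rw [dist_eq_norm] at this
    linarith [norm_sub_norm_le (f y) (f x)]
  have hd' : DifferentiableOn ℂ f (Metric.ball x r) :=
    hd.mono ((Metric.ball_subset_ball (min_le_left _ _)).trans h₁)
  have hsub : ∀ z ∈ Metric.ball x (r / 2), Metric.ball z (r / 2) ⊆ Metric.ball x r := by
    intro z hz w hw
    rw [Metric.mem_ball] at *
    linarith [dist_triangle w z x]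
  have hda : ∀ z ∈ Metric.ball x r, DifferentiableAt ℂ f z := fun z hz =>
    (hd' z hz).differentiableAt (Metric.isOpen_ball.mem_nhds hz)
  -- The increments `t n • v` must be shorter than r/4, so that all difference quotients live on one
  -- fixed ball.
  set A := r / (8 * (‖v‖ + 1)) with hA
  have hApos : 0 < A := by positivity
  have hAv : A * ‖v‖ < r / 4 := by
    rw [hA, div_mul_eq_mul_div, div_lt_div_iff₀ (by positivity) (by norm_num)]
    nlinarith [norm_nonneg v]
  set t : ℕ → ℝ := fun n => A / (n + 1) with ht
  have htpos : ∀ n, 0 < t n := fun n => by positivity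
  have htA : ∀ n, t n ≤ A := fun n => by
    refine div_le_self hApos.le ?_
    have : (0 : ℝ) ≤ n := n.cast_nonneg
    linarith
  have htv : ∀ n, ‖((t n : ℂ)) • v‖ < r / 4 := fun n => by
    rw [norm_smul, Complex.norm_real, Real.norm_of_nonneg (htpos n).le]
    exact (mul_le_mul_of_nonneg_right (htA n) (norm_nonneg v)).trans_lt hAv
  have hmem : ∀ n, ∀ z ∈ Metric.ball x (r / 2), z + ((t n : ℂ)) • v ∈ Metric.ball z (r / 2 / 2) :=
    fun n z hz => by
      rw [Metric.mem_ball, dist_eq_norm, add_sub_cancel_left]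
      linarith [htv n]
  -- The derivative is locally Lipschitz, so the difference quotient misses the directional
  -- derivative by O(t‖v‖²), uniformly in z. A uniform limit of holomorphic functions is
  -- holomorphic.
  have key : TendstoUniformlyOn (fun n z => ((t n : ℂ))⁻¹ • (f (z + ((t n : ℂ)) • v) - f z))
      (fun z => fderiv ℂ f z v) atTop (Metric.ball x (r / 2)) := by
    rw [Metric.tendstoUniformlyOn_iff]
    intro ε hε
    have hlim : Tendsto (fun n => 22 * M / (r / 2) ^ 2 * ‖v‖ ^ 2 * t n) atTop (𝓝 0) := by
      have h0 : Tendsto t atTop (𝓝 0) := by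
        have := (tendsto_one_div_add_atTop_nhds_zero_nat (𝕜 := ℝ)).const_mul A
        simpa [ht, div_eq_mul_inv] using this
      simpa using h0.const_mul (22 * M / (r / 2) ^ 2 * ‖v‖ ^ 2)
    filter_upwards [hlim.eventually_lt_const hε] with n hn z hz
    refine lt_of_le_of_lt ?_ hn
    set h := ((t n : ℂ)) • v with hh
    have hhn : ‖h‖ = t n * ‖v‖ := by
      rw [hh, norm_smul, Complex.norm_real, Real.norm_of_nonneg (htpos n).le]
    have hseg : segment ℝ z (z + h) ⊆ Metric.ball z (r / 2 / 2) :=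
      (convex_ball _ _).segment_subset (Metric.mem_ball_self (by linarith)) (hmem n z hz)
    have hsb : Metric.ball z (r / 2 / 2) ⊆ Metric.ball x r :=
      (Metric.ball_subset_ball (by linarith)).trans (hsub z hz)
    have hmv := (convex_segment z (z + h)).norm_image_sub_le_of_norm_hasFDerivWithin_le'
      (𝕜 := ℂ) (f := f) (f' := fderiv ℂ f) (φ := fderiv ℂ f z)
      (C := 22 * M / (r / 2) ^ 2 * ‖h‖)
      (fun w hw => (hda w (hsb (hseg hw))).hasFDerivAt.hasFDerivWithinAt)
      (fun w hw => by
        refine (norm_fderiv_sub_le_of_ball (half_pos hr) (hd'.mono (hsub z hz))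
          (fun w hw => hb w (hsub z hz hw)) (hseg hw)).trans ?_
        gcongr
        · obtain ⟨a, b, ha, hb', hab, rfl⟩ := hw
          have : a • z + b • (z + h) - z = b • h := by
            have : a = 1 - b := by linarith
            rw [this]; module
          rw [this, norm_smul, Real.norm_of_nonneg hb']
          exact mul_le_of_le_one_left (norm_nonneg _) (by linarith))
      (left_mem_segment ℝ z (z + h)) (right_mem_segment ℝ z (z + h))
    rw [add_sub_cancel_left] at hmv
    have htc : (t n : ℂ) ≠ 0 := by exact_mod_cast (htpos n).ne'
    have e1 : fderiv ℂ f z v - ((t n : ℂ))⁻¹ • (f (z + h) - f z)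
        = -(((t n : ℂ))⁻¹ • (f (z + h) - f z - fderiv ℂ f z h)) := by
      rw [hh, map_smul, smul_sub, smul_sub, inv_smul_smul₀ htc]; simp [smul_sub]
    rw [dist_eq_norm, e1, norm_neg, norm_smul, norm_inv, Complex.norm_real,
      Real.norm_of_nonneg (htpos n).le]
    rw [inv_mul_le_iff₀ (htpos n)]
    refine hmv.trans (le_of_eq ?_)
    rw [hhn]; ring
  have hfin := differentiableOn_of_tendstoUniformlyOn Metric.isOpen_ball (fun n => ?_) key
  · exact (hfin x (Metric.mem_ball_self (half_pos hr))).differentiableAt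
      (Metric.ball_mem_nhds x (half_pos hr)) |>.differentiableWithinAt
  · intro z hz
    have h1 : DifferentiableAt ℂ (fun z => f (z + ((t n : ℂ)) • v)) z :=
      (hda _ (hsub z hz (Metric.ball_subset_ball (by linarith) (hmem n z hz)))).comp z
        (differentiableAt_id.add_const _)
    have h2 : DifferentiableAt ℂ f z :=
      hda z (hsub z hz (Metric.mem_ball_self (by linarith)))
    exact ((h1.sub h2).const_smul _).differentiableWithinAt

end Holomorphic

/-- A difference of two slopes is a combination of three values of the function with coefficients
that do not depend on the function. An estimate for such combinations therefore transfers from one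
function to another. -/
theorem slope_sub_slope {Y : Type*} [AddCommGroup Y] [Module ℂ Y] (f : ℂ → Y) (z₀ z₁ z₂ : ℂ) :
    slope f z₀ z₁ - slope f z₀ z₂ = ((z₂ - z₀)⁻¹ - (z₁ - z₀)⁻¹) • f z₀ + (z₁ - z₀)⁻¹ • f z₁
      + (-(z₂ - z₀)⁻¹) • f z₂ := by
  simp only [slope_def_module]
  module

/-- A function into a Banach space whose differences are controlled by those of a uniformly bounded
family of holomorphic functions is complex differentiable. -/
theorem differentiableAt_of_family {X G ι : Type*} [NormedAddCommGroup X] [NormedSpace ℂ X]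
    [CompleteSpace X] [NormedAddCommGroup G] [NormedSpace ℂ G] [CompleteSpace G]
    {F : ℂ → X} {φ : ι → ℂ → G} {z₀ : ℂ} {r M C : ℝ} (hr : 0 < r) (hC : 0 ≤ C) (hM0 : 0 ≤ M)
    (hφ : ∀ i, DifferentiableOn ℂ (φ i) (Metric.ball z₀ r))
    (hM : ∀ i, ∀ z ∈ Metric.ball z₀ r, ‖φ i z‖ ≤ M)
    (hF : ∀ z₁ ∈ Metric.ball z₀ r, ∀ z₂ ∈ Metric.ball z₀ r, ∀ c₀ c₁ c₂ : ℂ, ∀ B : ℝ, 0 ≤ B →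
      (∀ i, ‖c₀ • φ i z₀ + c₁ • φ i z₁ + c₂ • φ i z₂‖ ≤ B) →
      ‖c₀ • F z₀ + c₁ • F z₁ + c₂ • F z₂‖ ≤ C * B) :
    DifferentiableAt ℂ F z₀ := by
  have hz₀ : z₀ ∈ Metric.ball z₀ r := Metric.mem_ball_self hr
  set K := 2 * (2 * M / r) / (r / 2)
  have hK : 0 ≤ K := by positivity
  -- The functions `dslope (φ i) z₀` are holomorphic and bounded by 2M/r, hence equi-Lipschitz near
  -- `z₀`. The hypothesis on three-point combinations carries this over to the slopes of `F`, which
  -- then converge by completeness.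
  have hlip : ∀ z₁ ∈ Metric.ball z₀ (r / 4), ∀ z₂ ∈ Metric.ball z₀ (r / 4), z₁ ≠ z₀ → z₂ ≠ z₀ →
      ‖slope F z₀ z₁ - slope F z₀ z₂‖ ≤ C * (K * ‖z₁ - z₂‖) := by
    intro z₁ h₁ z₂ h₂ n₁ n₂
    rw [slope_sub_slope F]
    refine hF z₁ (Metric.ball_subset_ball (by linarith) h₁) z₂
      (Metric.ball_subset_ball (by linarith) h₂) _ _ _ _ (by positivity) fun i => ?_
    rw [← slope_sub_slope (φ i), ← dslope_of_ne _ n₁, ← dslope_of_ne _ n₂]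
    have hsub : Metric.ball z₂ (r / 2) ⊆ Metric.ball z₀ r := by
      intro w hw
      rw [Metric.mem_ball] at *
      linarith [dist_triangle w z₂ z₀]
    refine norm_sub_le_of_ball (f := dslope (φ i) z₀) (x := z₂) (r := r / 2) (M := 2 * M / r)
      (by linarith) ?_ ?_ ?_
    · exact ((Complex.differentiableOn_dslope (Metric.ball_mem_nhds z₀ hr)).mpr (hφ i)).mono hsub
    · intro w hw
      exact Complex.norm_dslope_le_div_of_mapsTo_ball (hφ i) (mapsTo_of_norm_le hr (hM i))
        (hsub hw)
    · rw [Metric.mem_ball] at *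
      linarith [dist_triangle_right z₁ z₂ z₀]
  have hcau : Cauchy (map (slope F z₀) (𝓝[≠] z₀)) := by
    rw [Metric.cauchy_iff]
    refine ⟨inferInstance, fun ε hε => ?_⟩
    have hCK : 0 < C * K + 1 := by positivity
    set s := min (r / 4) (ε / (2 * (C * K + 1))) with hs
    have hs0 : 0 < s := lt_min (by linarith) (by positivity)
    refine ⟨slope F z₀ '' (Metric.ball z₀ s ∩ {z₀}ᶜ), image_mem_map
      (inter_mem (mem_nhdsWithin_of_mem_nhds (Metric.ball_mem_nhds z₀ hs0)) self_mem_nhdsWithin), ?_⟩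
    rintro _ ⟨z₁, ⟨h₁, n₁⟩, rfl⟩ _ ⟨z₂, ⟨h₂, n₂⟩, rfl⟩
    rw [dist_eq_norm]
    refine (hlip z₁ (Metric.ball_subset_ball (min_le_left _ _) h₁) z₂
      (Metric.ball_subset_ball (min_le_left _ _) h₂) n₁ n₂).trans_lt ?_
    have h3 : ‖z₁ - z₂‖ < 2 * s := by
      rw [← dist_eq_norm]
      rw [Metric.mem_ball] at h₁ h₂
      linarith [dist_triangle_right z₁ z₂ z₀]
    have h4 : s ≤ ε / (2 * (C * K + 1)) := min_le_right _ _
    rw [le_div_iff₀ (by positivity)] at h4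
    nlinarith [norm_nonneg (z₁ - z₂), mul_nonneg hC hK]
  obtain ⟨l, hl⟩ := cauchy_map_iff_exists_tendsto.mp hcau
  exact (hasDerivAt_iff_tendsto_slope.mpr hl).differentiableAt

/-! ### A scalar system for families of functions of complex energies -/

/-- Families `x_l(p; t₁,…,t_l)` of functions of a parameter `p ∈ ℂ²` and of `l` energies. -/
abbrev EFam := (l : ℕ) → (ℂ × ℂ) → (Fin l → ℂ) → ℂ

/-- The tuples of energies in the half-plane `{Re t > a}`. -/
def tube (a : ℝ) (l : ℕ) : Set (Fin l → ℂ) := {t | ∀ i, a < (t i).re}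

theorem isOpen_tube (a : ℝ) (l : ℕ) : IsOpen (tube a l) := by
  simp only [tube, ofPred_forall]
  exact isOpen_iInter_of_finite fun i =>
    isOpen_lt continuous_const (Complex.continuous_re.comp (continuous_apply i))

theorem tube_comp {a : ℝ} {l m : ℕ} {t : Fin l → ℂ} (ht : t ∈ tube a l) (f : Fin m → Fin l) :
    (fun i => t (f i)) ∈ tube a m := fun i => ht (f i)

theorem tube_snoc {a : ℝ} {l : ℕ} {t : Fin l → ℂ} (ht : t ∈ tube a l) {s : ℂ} (hs : a < s.re) :
    (Fin.snoc (α := fun _ => ℂ) t s) ∈ tube a (l + 1) := by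
  intro i
  induction i using Fin.lastCases with
  | last => simpa using hs
  | cast j => simpa using ht j

theorem tube_star {a : ℝ} {l : ℕ} {t : Fin l → ℂ} (ht : t ∈ tube a l) : star t ∈ tube a l :=
  fun i => by simpa using ht i

/-- Bounded holomorphic families that are symmetric and real. -/
structure HolFam (a : ℝ) (W : Set (ℂ × ℂ)) (x : EFam) : Prop where
  diff : ∀ l, DifferentiableOn ℂ (fun y : (ℂ × ℂ) × (Fin l → ℂ) => x l y.1 y.2) (W ×ˢ tube a l)
  bdd : ∃ M, ∀ l, ∀ p ∈ W, ∀ t ∈ tube a l, ‖x l p t‖ ≤ M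
  symm : ∀ l, ∀ p ∈ W, ∀ t ∈ tube a l, ∀ π : Equiv.Perm (Fin l), x l p (t ∘ π) = x l p t
  real : ∀ l, ∀ p ∈ W, ∀ t ∈ tube a l, x l (star p) (star t) = star (x l p t)

theorem HolFam.zero (a : ℝ) (W : Set (ℂ × ℂ)) : HolFam a W 0 where
  diff l := differentiableOn_const (c := (0 : ℂ))
  bdd := ⟨0, by simp⟩
  symm := by simp
  real := by simp

/-- The convergence is uniform in `l` as well, so the limit inherits one bound for all numbers of
energies. -/
theorem HolFam.of_tendsto {a : ℝ} {W : Set (ℂ × ℂ)} (hW : IsOpen W)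
    (hWs : ∀ p ∈ W, star p ∈ W) {x : ℕ → EFam} {y : EFam}
    (hx : ∀ n, HolFam a W (x n))
    (hu : ∀ ε > 0, ∃ N, ∀ n ≥ N, ∀ l, ∀ p ∈ W, ∀ t ∈ tube a l, ‖x n l p t - y l p t‖ ≤ ε) :
    HolFam a W y := by
  have hlim : ∀ l, ∀ p ∈ W, ∀ t ∈ tube a l, Tendsto (fun n => x n l p t) atTop (𝓝 (y l p t)) := by
    intro l p hp t ht
    rw [Metric.tendsto_atTop]
    intro ε hε
    obtain ⟨N, hN⟩ := hu (ε / 2) (by linarith)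
    refine ⟨N, fun n hn => ?_⟩
    rw [dist_eq_norm]
    linarith [hN n hn l p hp t ht]
  refine ⟨fun l => ?_, ?_, ?_, ?_⟩
  · refine differentiableOn_of_tendstoUniformlyOn (hW.prod (isOpen_tube a l))
      (fun n => (hx n).diff l) ?_
    rw [Metric.tendstoUniformlyOn_iff]
    intro ε hε
    obtain ⟨N, hN⟩ := hu (ε / 2) (by linarith)
    filter_upwards [eventually_ge_atTop N] with n hn z hz
    rw [dist_comm, dist_eq_norm]
    linarith [hN n hn l z.1 hz.1 z.2 hz.2]
  · obtain ⟨N, hN⟩ := hu 1 one_pos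
    obtain ⟨M, hM⟩ := (hx N).bdd
    refine ⟨M + 1, fun l p hp t ht => ?_⟩
    have h1 := hN N le_rfl l p hp t ht
    have h2 := hM l p hp t ht
    have h3 := norm_sub_norm_le (y l p t) (x N l p t)
    rw [norm_sub_rev] at h3
    linarith
  · intro l p hp t ht π
    refine tendsto_nhds_unique (hlim l p hp _ (tube_comp ht π)) ?_
    refine (hlim l p hp t ht).congr fun n => ((hx n).symm l p hp t ht π).symm
  · intro l p hp t ht
    refine tendsto_nhds_unique (hlim l _ (hWs p hp) _ (tube_star ht)) ?_
    refine ((continuous_star.tendsto _).comp (hlim l p hp t ht)).congr fun n => ?_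
    exact ((hx n).real l p hp t ht).symm

/-- The creation part `∑ᵢ x_{l-1}(p; t ∖ tᵢ)`. -/
def crt (x : EFam) : (l : ℕ) → (ℂ × ℂ) → (Fin l → ℂ) → ℂ
  | 0, _, _ => 0
  | l + 1, p, t => ∑ i : Fin (l + 1), x l p (fun a => t (i.succAbove a))

section System

variable {X : Type*} [MeasurableSpace X] (ρ : Measure X) (ω : X → ℝ)

/-- The annihilation part `∫ x_{l+1}(p; t, ω(s)) dρ(s)`. -/
def ann (x : EFam) (l : ℕ) (p : ℂ × ℂ) (t : Fin l → ℂ) : ℂ :=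
  ∫ s, x (l + 1) p (Fin.snoc (α := fun _ => ℂ) t (ω s : ℂ)) ∂ρ

/-- The denominators `(-1)^l e + ∑ tᵢ - z`. -/
def den (e : ℝ) (l : ℕ) (p : ℂ × ℂ) (t : Fin l → ℂ) : ℂ := (-1) ^ l * e + ∑ i, t i - p.1

/-- The right-hand side of the system in fixed-point form. -/
def sysOp (e α : ℝ) (l₀ : ℕ) (g x : EFam) : EFam := fun l p t =>
  if l₀ ≤ l then -(α : ℂ) * (den e l p t)⁻¹ * (crt x l p t + ann ρ ω x l p t + g l p t) else 0

/-- Adding an energy, as an affine map: its linear part. -/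
def snocLin (l : ℕ) : (ℂ × ℂ) × (Fin l → ℂ) →L[ℂ] (ℂ × ℂ) × (Fin (l + 1) → ℂ) :=
  (ContinuousLinearMap.fst ℂ (ℂ × ℂ) (Fin l → ℂ)).prod
    (ContinuousLinearMap.pi fun i : Fin (l + 1) =>
      Fin.lastCases (motive := fun _ => (ℂ × ℂ) × (Fin l → ℂ) →L[ℂ] ℂ) 0
        (fun j => (ContinuousLinearMap.proj j).comp (ContinuousLinearMap.snd ℂ (ℂ × ℂ) (Fin l → ℂ))) i)

theorem hasFDerivAt_snoc (l : ℕ) (s : ℂ) (y : (ℂ × ℂ) × (Fin l → ℂ)) :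
    HasFDerivAt (fun y : (ℂ × ℂ) × (Fin l → ℂ) =>
      ((y.1, Fin.snoc (α := fun _ => ℂ) y.2 s) : (ℂ × ℂ) × (Fin (l + 1) → ℂ))) (snocLin l) y := by
  refine HasFDerivAt.prodMk hasFDerivAt_fst ?_
  rw [hasFDerivAt_pi]
  intro i
  induction i using Fin.lastCases with
  | last => simpa using hasFDerivAt_const s y
  | cast j =>
    simp only [Fin.snoc_castSucc, Fin.lastCases_castSucc]
    exact ((ContinuousLinearMap.proj (R := ℂ) (φ := fun _ : Fin l => ℂ) j).comp
      (ContinuousLinearMap.snd ℂ (ℂ × ℂ) (Fin l → ℂ))).hasFDerivAt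

theorem continuous_snoc (l : ℕ) (p : ℂ × ℂ) (t : Fin l → ℂ) :
    Continuous fun s : ℂ =>
      ((p, Fin.snoc (α := fun _ => ℂ) t s) : (ℂ × ℂ) × (Fin (l + 1) → ℂ)) := by
  refine continuous_const.prodMk (continuous_pi fun i => ?_)
  induction i using Fin.lastCases with
  | last => simpa using continuous_id'
  | cast j => simpa using continuous_const

/-- A function that is continuous on a half-plane is measurable along energies in it. -/
theorem stronglyMeasurable_comp_energy {a : ℝ} {G : Type*} [NormedAddCommGroup G] {ω : X → ℝ}
    (hω : Measurable ω) (ha : ∀ s, a < ω s) {f : ℂ → G}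
    (hf : ContinuousOn f {s : ℂ | a < s.re}) : StronglyMeasurable fun s => f (ω s) := by
  have h1 : Measurable fun s => (⟨(ω s : ℂ), by simpa using ha s⟩ : {s : ℂ | a < s.re}) :=
    (Complex.measurable_ofReal.comp hω).subtype_mk
  exact (continuousOn_iff_continuous_domRestrict.mp hf).stronglyMeasurable.comp_measurable h1

variable {ρ ω} [IsFiniteMeasure ρ] {a : ℝ} {W : Set (ℂ × ℂ)}

theorem HolFam.integrable_ann (hω : Measurable ω) (ha : ∀ s, a < ω s) {x : EFam}
    (hx : HolFam a W x) {l : ℕ} {p : ℂ × ℂ} (hp : p ∈ W) {t : Fin l → ℂ} (ht : t ∈ tube a l) :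
    Integrable (fun s => x (l + 1) p (Fin.snoc (α := fun _ => ℂ) t (ω s : ℂ))) ρ := by
  obtain ⟨M, hM⟩ := hx.bdd
  refine Integrable.of_bound (C := M) ?_ (Eventually.of_forall fun s =>
    hM _ p hp _ (tube_snoc ht (by simpa using ha s)))
  refine (stronglyMeasurable_comp_energy hω ha (f := fun s => x (l + 1) p (Fin.snoc t s)) ?_)
    |>.aestronglyMeasurable
  exact (hx.diff (l + 1)).continuousOn.comp (continuous_snoc l p t).continuousOn
    fun s hs => ⟨hp, tube_snoc ht hs⟩

/-- Differentiation under the integral. The integrand is bounded uniformly in the integration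
variable and holomorphic on one and the same ball around `y`, so Cauchy's estimate supplies a
constant dominating function, integrable for a finite measure. -/
theorem HolFam.diff_ann (hW : IsOpen W) (hω : Measurable ω) (ha : ∀ s, a < ω s) {x : EFam}
    (hx : HolFam a W x) (l : ℕ) :
    DifferentiableOn ℂ (fun y : (ℂ × ℂ) × (Fin l → ℂ) => ann ρ ω x l y.1 y.2)
      (W ×ˢ tube a l) := by
  intro y hy
  obtain ⟨M, hM⟩ := hx.bdd
  have hD : IsOpen (W ×ˢ tube a (l + 1)) := hW.prod (isOpen_tube a (l + 1))
  have hDl : IsOpen (W ×ˢ tube a l) := hW.prod (isOpen_tube a l)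
  obtain ⟨r, hr, hball⟩ := Metric.isOpen_iff.mp hDl y hy
  set Xf : (ℂ × ℂ) × (Fin (l + 1) → ℂ) → ℂ := fun y => x (l + 1) y.1 y.2
  have hmem : ∀ z ∈ W ×ˢ tube a l, ∀ s, ((z.1, Fin.snoc (α := fun _ => ℂ) z.2 (ω s : ℂ)) :
      (ℂ × ℂ) × (Fin (l + 1) → ℂ)) ∈ W ×ˢ tube a (l + 1) := fun z hz s =>
    ⟨hz.1, tube_snoc hz.2 (by simpa using ha s)⟩
  have hder : ∀ z ∈ W ×ˢ tube a l, ∀ s, HasFDerivAt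
      (fun z : (ℂ × ℂ) × (Fin l → ℂ) => x (l + 1) z.1 (Fin.snoc (α := fun _ => ℂ) z.2 (ω s : ℂ)))
      ((fderiv ℂ Xf (z.1, Fin.snoc (α := fun _ => ℂ) z.2 (ω s : ℂ))).comp (snocLin l)) z := by
    intro z hz s
    have h1 : HasFDerivAt Xf (fderiv ℂ Xf (z.1, Fin.snoc (α := fun _ => ℂ) z.2 (ω s : ℂ)))
        (z.1, Fin.snoc (α := fun _ => ℂ) z.2 (ω s : ℂ)) :=
      ((hx.diff (l + 1) _ (hmem z hz s)).differentiableAt (hD.mem_nhds (hmem z hz s))).hasFDerivAt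
    exact h1.comp z (hasFDerivAt_snoc l _ z)
  have hmain := hasFDerivAt_integral_of_dominated_of_fderiv_le (𝕜 := ℂ) (μ := ρ)
    (F := fun z s => x (l + 1) z.1 (Fin.snoc (α := fun _ => ℂ) z.2 (ω s : ℂ)))
    (F' := fun z s => (fderiv ℂ Xf (z.1, Fin.snoc (α := fun _ => ℂ) z.2 (ω s : ℂ))).comp (snocLin l))
    (x₀ := y) (s := Metric.ball y (r / 2)) (bound := fun _ => 2 * M / (r / 2))
    (Metric.ball_mem_nhds y (half_pos hr)) ?_
    (hx.integrable_ann hω ha hy.1 hy.2) ?_ ?_ (integrable_const _) ?_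
  · exact hmain.differentiableAt.differentiableWithinAt
  · filter_upwards [hDl.mem_nhds hy] with z hz
    exact (hx.integrable_ann hω ha hz.1 hz.2).aestronglyMeasurable
  · refine (stronglyMeasurable_comp_energy hω ha (f := fun s =>
      (fderiv ℂ Xf (y.1, Fin.snoc (α := fun _ => ℂ) y.2 s)).comp (snocLin l)) ?_)
      |>.aestronglyMeasurable
    refine ContinuousOn.clm_comp ?_ continuousOn_const
    exact (continuousOn_fderiv_of_isOpen hD (hx.diff (l + 1))).comp
      (continuous_snoc l y.1 y.2).continuousOn fun s hs => ⟨hy.1, tube_snoc hy.2 hs⟩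
  · refine Eventually.of_forall fun s z hz => ?_
    have hzb : Metric.ball z (r / 2) ⊆ W ×ˢ tube a l := by
      intro w hw
      refine hball ?_
      rw [Metric.mem_ball] at *
      linarith [dist_triangle w z y]
    have hz' : z ∈ W ×ˢ tube a l := hzb (Metric.mem_ball_self (half_pos hr))
    rw [← (hder z hz' s).fderiv]
    refine norm_fderiv_le_of_ball (half_pos hr) (fun w hw =>
      (hder w (hzb hw) s).differentiableAt.differentiableWithinAt) fun w hw => ?_
    exact hM _ _ (hzb hw).1 _ (hmem w (hzb hw) s).2
  · refine Eventually.of_forall fun s z hz => hder z (hball ?_) s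
    exact Metric.ball_subset_ball (by linarith) hz

/-- Deleting an entry of a permuted tuple leaves a permutation of the tuple with the corresponding
entry deleted. This gives the symmetry of the creation sum. -/
theorem exists_perm_succAbove {l : ℕ} (π : Equiv.Perm (Fin (l + 1))) (i : Fin (l + 1)) :
    ∃ π' : Equiv.Perm (Fin l), ∀ b, π (i.succAbove b) = (π i).succAbove (π' b) := by
  have hsub : ∀ a, a ≠ i ↔ π a ≠ π i := fun a => by simp
  refine ⟨(finSuccAboveEquiv i).trans
    ((π.subtypeEquiv hsub).trans (finSuccAboveEquiv (π i)).symm), fun b => ?_⟩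
  have : ∀ c : {x // x ≠ π i}, (π i).succAbove ((finSuccAboveEquiv (π i)).symm c) = c := by
    intro c
    have := congrArg Subtype.val ((finSuccAboveEquiv (π i)).apply_symm_apply c)
    exact this
  simp only [Equiv.trans_apply, this]
  rfl

theorem exists_perm_snoc {l : ℕ} (π : Equiv.Perm (Fin l)) :
    ∃ π' : Equiv.Perm (Fin (l + 1)), ∀ (t : Fin l → ℂ) (s : ℂ),
      Fin.snoc (α := fun _ => ℂ) (t ∘ π) s = Fin.snoc (α := fun _ => ℂ) t s ∘ π' := by
  refine ⟨finSuccEquivLast.trans ((Equiv.optionCongr π).trans finSuccEquivLast.symm),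
    fun t s => ?_⟩
  funext i
  induction i using Fin.lastCases with
  | last => simp
  | cast j => simp

theorem HolFam.diff_crt {x : EFam} (hx : HolFam a W x) (l : ℕ) :
    DifferentiableOn ℂ (fun y : (ℂ × ℂ) × (Fin l → ℂ) => crt x l y.1 y.2) (W ×ˢ tube a l) := by
  cases l with
  | zero => exact differentiableOn_const (c := (0 : ℂ))
  | succ l =>
    refine DifferentiableOn.fun_sum fun i _ => ?_
    refine (hx.diff l).comp (f := fun y : (ℂ × ℂ) × (Fin (l + 1) → ℂ) =>
      ((y.1, fun b => y.2 (i.succAbove b)) : (ℂ × ℂ) × (Fin l → ℂ))) ?_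
      fun y hy => ⟨hy.1, tube_comp hy.2 _⟩
    exact Differentiable.differentiableOn (by fun_prop)

theorem diff_den (e : ℝ) (l : ℕ) :
    Differentiable ℂ (fun y : (ℂ × ℂ) × (Fin l → ℂ) => den e l y.1 y.2) := by
  unfold den; fun_prop

theorem den_perm (e : ℝ) (l : ℕ) (p : ℂ × ℂ) (t : Fin l → ℂ) (π : Equiv.Perm (Fin l)) :
    den e l p (t ∘ π) = den e l p t := by
  simp only [den, Function.comp_apply]
  rw [Equiv.sum_comp π t]

theorem den_star (e : ℝ) (l : ℕ) (p : ℂ × ℂ) (t : Fin l → ℂ) :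
    den e l (star p) (star t) = star (den e l p t) := by
  simp [den]

theorem HolFam.crt_perm {x : EFam} (hx : HolFam a W x) {l : ℕ} {p : ℂ × ℂ} (hp : p ∈ W)
    {t : Fin l → ℂ} (ht : t ∈ tube a l) (π : Equiv.Perm (Fin l)) :
    crt x l p (t ∘ π) = crt x l p t := by
  cases l with
  | zero => rfl
  | succ l =>
    simp only [crt, Function.comp_apply]
    rw [← Equiv.sum_comp π (fun i => x l p fun a => t (i.succAbove a))]
    refine Finset.sum_congr rfl fun i _ => ?_
    obtain ⟨π', hπ'⟩ := exists_perm_succAbove π i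
    rw [← hx.symm l p hp _ (tube_comp ht (π i).succAbove) π']
    simp [Function.comp_def, hπ']

theorem HolFam.ann_perm (ha : ∀ s, a < ω s) {x : EFam} (hx : HolFam a W x) {l : ℕ} {p : ℂ × ℂ}
    (hp : p ∈ W) {t : Fin l → ℂ} (ht : t ∈ tube a l) (π : Equiv.Perm (Fin l)) :
    ann ρ ω x l p (t ∘ π) = ann ρ ω x l p t := by
  obtain ⟨π', hπ'⟩ := exists_perm_snoc π
  refine integral_congr_ae (Eventually.of_forall fun s => ?_)
  simp only [hπ' t (ω s)]
  exact hx.symm _ p hp _ (tube_snoc ht (s := (ω s : ℂ)) (by simpa using ha s)) π'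

theorem HolFam.crt_star {x : EFam} (hx : HolFam a W x) {l : ℕ} {p : ℂ × ℂ} (hp : p ∈ W)
    {t : Fin l → ℂ} (ht : t ∈ tube a l) : crt x l (star p) (star t) = star (crt x l p t) := by
  cases l with
  | zero => simp [crt]
  | succ l =>
    simp only [crt, star_sum]
    exact Finset.sum_congr rfl fun i _ => hx.real l p hp _ (tube_comp ht _)

theorem snoc_star {l : ℕ} (t : Fin l → ℂ) (r : ℝ) :
    Fin.snoc (α := fun _ => ℂ) (star t) (r : ℂ) = star (Fin.snoc (α := fun _ => ℂ) t (r : ℂ)) := by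
  funext i
  induction i using Fin.lastCases with
  | last => simp
  | cast j => simp

theorem HolFam.ann_star (ha : ∀ s, a < ω s) {x : EFam} (hx : HolFam a W x) {l : ℕ} {p : ℂ × ℂ}
    (hp : p ∈ W) {t : Fin l → ℂ} (ht : t ∈ tube a l) :
    ann ρ ω x l (star p) (star t) = star (ann ρ ω x l p t) := by
  simp only [ann]
  rw [← starRingEnd_apply (R := ℂ), ← integral_conj]
  refine integral_congr_ae (Eventually.of_forall fun s => ?_)
  simp only [snoc_star]
  exact hx.real _ p hp _ (tube_snoc ht (by simpa using ha s))

theorem norm_ann_le (ha : ∀ s, a < ω s) {x : EFam} {M : ℝ} {l : ℕ} {p : ℂ × ℂ}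
    (hM : ∀ t ∈ tube a (l + 1), ‖x (l + 1) p t‖ ≤ M) {t : Fin l → ℂ} (ht : t ∈ tube a l) :
    ‖ann ρ ω x l p t‖ ≤ M * ρ.real univ :=
  norm_integral_le_of_norm_le_const (Eventually.of_forall fun s =>
    hM _ (tube_snoc ht (by simpa using ha s)))

/-- The factor `l` is the only growth in the system. It is absorbed by the denominators, which are
at least `c * l`. -/
theorem norm_crt_le {x : EFam} {M : ℝ} {l : ℕ} {p : ℂ × ℂ}
    (hM : ∀ l, ∀ t ∈ tube a l, ‖x l p t‖ ≤ M) {t : Fin l → ℂ} (ht : t ∈ tube a l) :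
    ‖crt x l p t‖ ≤ l * M := by
  cases l with
  | zero => simp [crt]
  | succ l =>
    refine (norm_sum_le_of_le _ fun i _ => hM l _ (tube_comp ht _)).trans ?_
    simp

theorem HolFam.sysOp (hW : IsOpen W) (hω : Measurable ω) (ha : ∀ s, a < ω s)
    {e α c : ℝ} {l₀ : ℕ} (hα : 0 ≤ α) (hc : 0 < c) (hl₀ : 1 ≤ l₀)
    (hden : ∀ l, l₀ ≤ l → ∀ p ∈ W, ∀ t ∈ tube a l, c * l ≤ ‖den e l p t‖)
    {g x : EFam} (hg : HolFam a W g) (hx : HolFam a W x) :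
    HolFam a W (sysOp ρ ω e α l₀ g x) := by
  have hne : ∀ l, l₀ ≤ l → ∀ p ∈ W, ∀ t ∈ tube a l, den e l p t ≠ 0 := by
    intro l hl p hp t ht
    have h1 : (0 : ℝ) < l := by exact_mod_cast (by omega : 0 < l)
    exact norm_pos_iff.mp ((mul_pos hc h1).trans_le (hden l hl p hp t ht))
  refine ⟨fun l => ?_, ?_, ?_, ?_⟩
  · by_cases hl : l₀ ≤ l
    · simp only [SpinBoson.sysOp, if_pos hl]
      refine DifferentiableOn.mul (DifferentiableOn.mul (differentiableOn_const _) ?_) ?_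
      · exact (diff_den e l).differentiableOn.inv fun y hy => hne l hl _ hy.1 _ hy.2
      · exact ((hx.diff_crt l).add (hx.diff_ann hW hω ha l)).add (hg.diff l)
    · simp only [SpinBoson.sysOp, if_neg hl]
      exact differentiableOn_const _
  · obtain ⟨M, hM⟩ := hx.bdd
    obtain ⟨N, hN⟩ := hg.bdd
    refine ⟨α / c * (|M| + |M| * ρ.real univ + |N|), fun l p hp t ht => ?_⟩
    by_cases hl : l₀ ≤ l
    · simp only [SpinBoson.sysOp, if_pos hl]
      have h1 : (1 : ℝ) ≤ l := by exact_mod_cast hl₀.trans hl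
      have hd := hden l hl p hp t ht
      have e1 := norm_crt_le (fun l t ht => (hM l p hp t ht).trans (le_abs_self M)) ht
      have e2 := norm_ann_le (ρ := ρ) ha (fun t ht => (hM (l + 1) p hp t ht).trans (le_abs_self M)) ht
      have e3 := (hN l p hp t ht).trans (le_abs_self N)
      have hsum : ‖crt x l p t + ann ρ ω x l p t + g l p t‖
          ≤ l * (|M| + |M| * ρ.real univ + |N|) := by
        refine (norm_add₃_le).trans ?_
        have : 0 ≤ |M| * ρ.real univ := by positivity
        nlinarith [abs_nonneg N]
      have hinv : ‖(den e l p t)⁻¹‖ ≤ (c * l)⁻¹ := by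
        rw [norm_inv]; exact inv_anti₀ (by positivity) hd
      rw [norm_mul, norm_mul, norm_neg, Complex.norm_real, Real.norm_of_nonneg hα]
      calc α * ‖(den e l p t)⁻¹‖ * ‖crt x l p t + ann ρ ω x l p t + g l p t‖
          ≤ α * (c * l)⁻¹ * (l * (|M| + |M| * ρ.real univ + |N|)) := by gcongr
        _ = _ := by field_simp
    · simp only [SpinBoson.sysOp, if_neg hl, norm_zero]
      positivity
  · intro l p hp t ht π
    simp only [SpinBoson.sysOp]
    rw [den_perm, hx.crt_perm hp ht, hx.ann_perm ha hp ht, hg.symm l p hp t ht]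
  · intro l p hp t ht
    simp only [SpinBoson.sysOp]
    split_ifs
    · rw [den_star, hx.crt_star hp ht, hx.ann_star ha hp ht, hg.real l p hp t ht]
      simp
    · simp

/-- The contraction estimate. The inhomogeneity drops out, creation contributes `l`, annihilation
the mass of `ρ`, and the denominator divides by `c * l`. -/
theorem norm_sysOp_sub_le (hω : Measurable ω) (ha : ∀ s, a < ω s)
    {e α c : ℝ} {l₀ : ℕ} (hα : 0 ≤ α) (hc : 0 < c) (hl₀ : 1 ≤ l₀)
    (hden : ∀ l, l₀ ≤ l → ∀ p ∈ W, ∀ t ∈ tube a l, c * l ≤ ‖den e l p t‖)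
    {g x y : EFam} (hx : HolFam a W x) (hy : HolFam a W y) {M : ℝ} (hM0 : 0 ≤ M)
    (hM : ∀ l, ∀ p ∈ W, ∀ t ∈ tube a l, ‖x l p t - y l p t‖ ≤ M) (l : ℕ) {p : ℂ × ℂ} (hp : p ∈ W)
    {t : Fin l → ℂ} (ht : t ∈ tube a l) :
    ‖sysOp ρ ω e α l₀ g x l p t - sysOp ρ ω e α l₀ g y l p t‖
      ≤ α / c * (1 + ρ.real univ) * M := by
  by_cases hl : l₀ ≤ l
  · have h1 : (1 : ℝ) ≤ l := by exact_mod_cast hl₀.trans hl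
    have hd := hden l hl p hp t ht
    have ecrt : crt x l p t - crt y l p t = crt (x - y) l p t := by
      cases l with
      | zero => simp [crt]
      | succ l => simp [crt, Finset.sum_sub_distrib]
    have eann : ann ρ ω x l p t - ann ρ ω y l p t = ann ρ ω (x - y) l p t := by
      simp only [ann]
      rw [← integral_sub (hx.integrable_ann hω ha hp ht) (hy.integrable_ann hω ha hp ht)]
      rfl
    have e0 : sysOp ρ ω e α l₀ g x l p t - sysOp ρ ω e α l₀ g y l p t
        = -(α : ℂ) * (den e l p t)⁻¹ * (crt (x - y) l p t + ann ρ ω (x - y) l p t) := by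
      simp only [sysOp, if_pos hl]
      rw [← ecrt, ← eann]; ring
    have e1 := norm_crt_le (x := x - y) (fun l t ht => hM l p hp t ht) ht
    have e2 := norm_ann_le (x := x - y) (ρ := ρ) ha (fun t ht => hM (l + 1) p hp t ht) ht
    have hsum : ‖crt (x - y) l p t + ann ρ ω (x - y) l p t‖ ≤ l * ((1 + ρ.real univ) * M) := by
      refine (norm_add_le _ _).trans ?_
      have : 0 ≤ M * ρ.real univ := by positivity
      nlinarith
    have hinv : ‖(den e l p t)⁻¹‖ ≤ (c * l)⁻¹ := by
      rw [norm_inv]; exact inv_anti₀ (by positivity) hd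
    rw [e0, norm_mul, norm_mul, norm_neg, Complex.norm_real, Real.norm_of_nonneg hα]
    calc α * ‖(den e l p t)⁻¹‖ * ‖crt (x - y) l p t + ann ρ ω (x - y) l p t‖
        ≤ α * (c * l)⁻¹ * (l * ((1 + ρ.real univ) * M)) := by gcongr
      _ = _ := by field_simp
  · simp only [sysOp, if_neg hl, sub_self, norm_zero]
    positivity

/-- For a small coupling the system has a solution. -/
theorem exists_sys (hW : IsOpen W) (hWs : ∀ p ∈ W, star p ∈ W) (hω : Measurable ω)
    (ha : ∀ s, a < ω s) {e α c N : ℝ} {l₀ : ℕ} (hα : 0 ≤ α) (hc : 0 < c) (hl₀ : 1 ≤ l₀)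
    (hden : ∀ l, l₀ ≤ l → ∀ p ∈ W, ∀ t ∈ tube a l, c * l ≤ ‖den e l p t‖)
    (hsmall : α / c * (1 + ρ.real univ) ≤ 1 / 2)
    {g : EFam} (hg : HolFam a W g) (hN0 : 0 ≤ N) (hN : ∀ l, ∀ p ∈ W, ∀ t ∈ tube a l, ‖g l p t‖ ≤ N) :
    ∃ x : EFam, HolFam a W x ∧
      (∀ l, ∀ p ∈ W, ∀ t ∈ tube a l, x l p t = sysOp ρ ω e α l₀ g x l p t) ∧
      ∀ l, ∀ p ∈ W, ∀ t ∈ tube a l, ‖x l p t‖ ≤ 2 * (α / c) * N := by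
  set Φ : EFam → EFam := SpinBoson.sysOp ρ ω e α l₀ g
  set Y : ℕ → EFam := fun n => Φ^[n] 0
  have hYs : ∀ n, Y (n + 1) = Φ (Y n) := fun n => Function.iterate_succ_apply' _ _ _
  have hY : ∀ n, HolFam a W (Y n) := by
    intro n
    induction n with
    | zero => exact HolFam.zero a W
    | succ n ih => rw [hYs]; exact HolFam.sysOp hW hω ha hα hc hl₀ hden hg ih
  -- This is the size of the first Picard iterate started from 0. With contraction factor 1/2 the
  -- geometric series sums to 2B, the asserted bound.
  set B := α / c * N with hB
  have hB0 : 0 ≤ B := by positivity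
  have hstep : ∀ n, ∀ l, ∀ p ∈ W, ∀ t ∈ tube a l,
      ‖Y n l p t - Y (n + 1) l p t‖ ≤ B * (1 / 2) ^ n := by
    intro n
    induction n with
    | zero =>
      intro l p hp t ht
      rw [hYs]
      have h0 : crt 0 l p t = 0 := by cases l <;> simp [crt]
      simp only [Y, Function.iterate_zero, id, Pi.zero_apply, zero_sub, norm_neg, pow_zero,
        mul_one, Φ, SpinBoson.sysOp]
      split_ifs with hl
      · have h1 : (1 : ℝ) ≤ l := by exact_mod_cast hl₀.trans hl
        have hinv : ‖(den e l p t)⁻¹‖ ≤ c⁻¹ := by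
          rw [norm_inv]
          refine inv_anti₀ hc (le_trans ?_ (hden l hl p hp t ht))
          nlinarith
        simp only [h0, ann, Pi.zero_apply, integral_zero, zero_add]
        rw [norm_mul, norm_mul, norm_neg, Complex.norm_real, Real.norm_of_nonneg hα, hB,
          div_eq_mul_inv]
        gcongr
        exact hN l p hp t ht
      · simpa using hB0
    | succ n ih =>
      intro l p hp t ht
      have := norm_sysOp_sub_le (g := g) (ρ := ρ) hω ha hα hc hl₀ hden (hY n) (hY (n + 1)) (by positivity)
        ih l hp ht
      rw [hYs n, hYs (n + 1)]
      refine this.trans ?_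
      rw [pow_succ]
      have h2 : 0 ≤ B * (1 / 2 : ℝ) ^ n := by positivity
      nlinarith
  have hlim : ∀ l, ∀ p ∈ W, ∀ t ∈ tube a l, ∃ y, Tendsto (fun n => Y n l p t) atTop (𝓝 y) := by
    intro l p hp t ht
    exact cauchySeq_tendsto_of_complete (cauchySeq_of_le_geometric (1 / 2) B (by norm_num)
      fun n => by rw [dist_eq_norm]; exact hstep n l p hp t ht)
  choose! x hx using hlim
  have hrate : ∀ n, ∀ l, ∀ p ∈ W, ∀ t ∈ tube a l, ‖Y n l p t - x l p t‖ ≤ 2 * B * (1 / 2) ^ n := by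
    intro n l p hp t ht
    have := dist_le_of_le_geometric_of_tendsto (1 / 2) B (by norm_num)
      (fun n => by rw [dist_eq_norm]; exact hstep n l p hp t ht) (hx l p hp t ht) n
    rw [dist_eq_norm] at this
    refine this.trans (le_of_eq ?_)
    ring
  have hpow : Tendsto (fun n : ℕ => 2 * B * (1 / 2 : ℝ) ^ n) atTop (𝓝 0) := by
    simpa using (tendsto_pow_atTop_nhds_zero_of_lt_one (r := (1 / 2 : ℝ)) (by norm_num)
      (by norm_num)).const_mul (2 * B)
  have hHol : HolFam a W x := by
    refine HolFam.of_tendsto hW hWs hY fun ε hε => ?_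
    obtain ⟨K, hK⟩ := (hpow.eventually_le_const hε).exists_forall_of_atTop
    exact ⟨K, fun n hn l p hp t ht => (hrate n l p hp t ht).trans (hK n hn)⟩
  refine ⟨x, hHol, fun l p hp t ht => ?_, fun l p hp t ht => ?_⟩
  · refine tendsto_nhds_unique (((tendsto_add_atTop_iff_nat 1).mpr (hx l p hp t ht))) ?_
    rw [tendsto_iff_norm_sub_tendsto_zero]
    refine squeeze_zero (fun _ => norm_nonneg _) (fun n => ?_) hpow
    rw [hYs]
    have := norm_sysOp_sub_le (g := g) (ρ := ρ) hω ha hα hc hl₀ hden (hY n) hHol (by positivity)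
      (hrate n) l hp ht
    refine this.trans ?_
    have h2 : 0 ≤ 2 * B * (1 / 2 : ℝ) ^ n := by positivity
    nlinarith
  · have := hrate 0 l p hp t ht
    simp only [Y, Function.iterate_zero, id, Pi.zero_apply, zero_sub, norm_neg, pow_zero,
        mul_one, hB] at this
    linarith

end System

/-! ### Diagonal matrices -/

/-- The diagonal matrix with entries `x`, `y`, as a linear function of the entries. -/
def dg (x y : ℂ) : M₂ := Matrix.toEuclideanCLM (n := Fin 2) (𝕜 := ℂ) !![x, 0; 0, y]

theorem dg_add (x y x' y' : ℂ) : dg x y + dg x' y' = dg (x + x') (y + y') := by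
  simp only [dg, ← map_add]; congr 1; ext i j; fin_cases i <;> fin_cases j <;> simp

theorem dg_smul (c x y : ℂ) : c • dg x y = dg (c * x) (c * y) := by
  simp only [dg, ← map_smul]; congr 1; ext i j; fin_cases i <;> fin_cases j <;> simp

theorem dg_mul (x y x' y' : ℂ) : dg x y * dg x' y' = dg (x * x') (y * y') := by
  simp only [dg, ← map_mul]; congr 1; ext i j; fin_cases i <;> fin_cases j <;> simp

theorem dg_one : dg 1 1 = 1 := by
  rw [dg, ← map_one (Matrix.toEuclideanCLM (n := Fin 2) (𝕜 := ℂ))]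
  congr 1; ext i j; fin_cases i <;> fin_cases j <;> simp

theorem dg_zero : dg 0 0 = 0 := by simpa using (dg_smul 0 0 0).symm

theorem dg_sub (x y x' y' : ℂ) : dg x y - dg x' y' = dg (x - x') (y - y') := by
  rw [sub_eq_iff_eq_add, dg_add]; simp

theorem σ₁_sq : σ₁ * σ₁ = 1 := by
  rw [σ₁, ← map_mul, ← map_one (Matrix.toEuclideanCLM (n := Fin 2) (𝕜 := ℂ))]
  congr 1; ext i j; fin_cases i <;> fin_cases j <;> simp

/-- The source of the parity structure: a spin flip exchanges the two entries of a diagonal matrix.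
-/
theorem dg_mul_σ₁ (x y : ℂ) : dg x y * σ₁ = σ₁ * dg y x := by
  simp only [σ₁, dg, ← map_mul]
  congr 1; ext i j; fin_cases i <;> fin_cases j <;> simp

theorem σ₃_eq_dg : σ₃ = dg 1 (-1) := rfl

theorem dg_decomp (x y : ℂ) : dg x y = x • dg 1 0 + y • dg 0 1 := by
  rw [dg_smul, dg_smul, dg_add]; simp

/-- A bound for diagonal matrices in terms of their entries. -/
def dgC : ℝ := ‖dg 1 0‖ + ‖dg 0 1‖

theorem dgC_nonneg : 0 ≤ dgC := by unfold dgC; positivity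

theorem norm_dg_le {x y : ℂ} {M : ℝ} (hx : ‖x‖ ≤ M) (hy : ‖y‖ ≤ M) : ‖dg x y‖ ≤ dgC * M := by
  rw [dg_decomp, dgC, add_mul]
  refine (norm_add_le _ _).trans ?_
  rw [norm_smul, norm_smul, mul_comm, mul_comm ‖y‖]
  gcongr

/-- The diagonal matrices as a continuous linear function of the entries. -/
def dgL : ℂ × ℂ →L[ℂ] M₂ :=
  (ContinuousLinearMap.fst ℂ ℂ ℂ).smulRight (dg 1 0) + (ContinuousLinearMap.snd ℂ ℂ ℂ).smulRight (dg 0 1)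

theorem dgL_apply (x : ℂ × ℂ) : dgL x = dg x.1 x.2 := by
  simp [dgL, dg_decomp x.1 x.2]

theorem isUnit_dg {x y : ℂ} (hx : x ≠ 0) (hy : y ≠ 0) : IsUnit (dg x y) :=
  ⟨⟨dg x y, dg x⁻¹ y⁻¹, by rw [dg_mul, mul_inv_cancel₀ hx, mul_inv_cancel₀ hy, dg_one],
    by rw [dg_mul, inv_mul_cancel₀ hx, inv_mul_cancel₀ hy, dg_one]⟩, rfl⟩

theorem inverse_dg {x y : ℂ} (hx : x ≠ 0) (hy : y ≠ 0) : Ring.inverse (dg x y) = dg x⁻¹ y⁻¹ :=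
  Ring.inverse_unit (⟨dg x y, dg x⁻¹ y⁻¹,
    by rw [dg_mul, mul_inv_cancel₀ hx, mul_inv_cancel₀ hy, dg_one],
    by rw [dg_mul, inv_mul_cancel₀ hx, inv_mul_cancel₀ hy, dg_one]⟩ : M₂ˣ)

theorem det_dg (x y : ℂ) : (dg x y).det = x * y := by
  rw [ContinuousLinearMap.det, dg, Matrix.coe_toEuclideanCLM_eq_toEuclideanLin,
    Matrix.toEuclideanLin, Matrix.toLpLin_eq_toLin, LinearMap.det_toLin]
  simp

/-! ### The free resolvent and spin flips. -/

namespace Model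

variable {d : ℕ} (S : Model d)

theorem freeRes_eq {z : ℂ} {s : ℝ} (h₁ : (S.ε : ℂ) + s - z ≠ 0) (h₂ : -(S.ε : ℂ) + s - z ≠ 0) :
    S.freeRes z s = dg ((S.ε : ℂ) + s - z)⁻¹ (-(S.ε : ℂ) + s - z)⁻¹ := by
  rw [freeRes, σ₃_eq_dg, ← dg_one, dg_smul, dg_smul, dg_add, ← inverse_dg h₁ h₂]
  congr 2 <;> ring

/-- Moving n spin flips through the free resolvent replaces ε by (-1)ⁿ ε. This decouples the matrix
system into two scalar systems, with spin energies ε and -ε, whose sign alternates with the number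
of flips. -/
theorem freeRes_mul_pow {z : ℂ} {s : ℝ} (n : ℕ) (h₁ : (-1) ^ n * (S.ε : ℂ) + s - z ≠ 0)
    (h₂ : (-1) ^ n * (-S.ε : ℂ) + s - z ≠ 0) :
    S.freeRes z s * σ₁ ^ n = σ₁ ^ n *
      dg ((-1) ^ n * (S.ε : ℂ) + s - z)⁻¹ ((-1) ^ n * (-S.ε : ℂ) + s - z)⁻¹ := by
  rcases Nat.even_or_odd n with hn | hn
  · have e : σ₁ ^ n = 1 := by
      obtain ⟨k, rfl⟩ := hn
      rw [← two_mul, pow_mul, pow_two, σ₁_sq, one_pow]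
    simp only [hn.neg_one_pow, one_mul] at *
    rw [e, mul_one, one_mul, S.freeRes_eq h₁ h₂]
  · have e : σ₁ ^ n = σ₁ := by
      obtain ⟨k, rfl⟩ := hn
      rw [pow_succ, pow_mul, pow_two, σ₁_sq, one_pow, one_mul]
    simp only [hn.neg_one_pow, neg_mul, one_mul, neg_neg] at *
    rw [e, S.freeRes_eq h₂ h₁, dg_mul_σ₁]

end Model

/-! ### Coefficient families from scalar functions of the energies -/

/-- A bound for the powers of `σ₁`. -/
def sC : ℝ := 1 + ‖σ₁‖

theorem sC_nonneg : 0 ≤ sC := by unfold sC; positivity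

theorem norm_σ₁_pow_le (n : ℕ) : ‖σ₁ ^ n‖ ≤ sC := by
  rcases Nat.even_or_odd n with ⟨k, rfl⟩ | ⟨k, rfl⟩
  · rw [← two_mul, pow_mul, pow_two, σ₁_sq, one_pow, norm_one, sC]
    linarith [norm_nonneg σ₁]
  · rw [pow_succ, pow_mul, pow_two, σ₁_sq, one_pow, one_mul, sC]
    linarith

/-! ### Gradients of holomorphic functions of the energy. -/

section Energy

variable {d : ℕ} {ω : Mom d → ℝ}

theorem DispersionLaw.min_le (hω : DispersionLaw ω) (q : Mom d) : ω 0 ≤ ω q := by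
  rcases eq_or_ne q 0 with rfl | hq
  · exact le_rfl
  · exact (hω.unique_min q hq).le

/-- Outside a compact set |∇ω| ≤ ω, and on it |∇ω| is bounded. Since a lies strictly below the
minimum, both 1 and ω are at most multiples of ω - a. -/
theorem DispersionLaw.exists_gradient_bound (hω : DispersionLaw ω) {a : ℝ} (ha : a < ω 0) :
    ∃ C, 0 ≤ C ∧ ∀ q, ‖fderiv ℝ ω q‖ ≤ C * (ω q - a) := by
  have hev : ∀ᶠ q in cocompact (Mom d), ‖fderiv ℝ ω q‖ / ω q ≤ 1 :=
    (hω.gradient_decay.eventually_le_const one_pos)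
  obtain ⟨K, hK, hKc⟩ := mem_cocompact.mp hev
  have hcont : Continuous fun q => ‖fderiv ℝ ω q‖ :=
    (hω.contDiff.continuous_fderiv (by norm_num)).norm
  obtain ⟨B, hB⟩ := hK.bddAbove_image hcont.continuousOn
  have hpos : ∀ q, 0 < ω q - a := fun q => by linarith [hω.min_le q]
  have h0 : 0 < ω 0 - a := by linarith
  refine ⟨|B| / (ω 0 - a) + (1 + |a| / (ω 0 - a)), by positivity, fun q => ?_⟩
  have hmin : ω 0 - a ≤ ω q - a := by linarith [hω.min_le q]
  have e1 : |B| ≤ |B| / (ω 0 - a) * (ω q - a) := by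
    rw [div_mul_eq_mul_div, le_div_iff₀ h0]
    exact mul_le_mul_of_nonneg_left hmin (abs_nonneg _)
  have e2 : ω q ≤ (1 + |a| / (ω 0 - a)) * (ω q - a) := by
    have : |a| ≤ |a| / (ω 0 - a) * (ω q - a) := by
      rw [div_mul_eq_mul_div, le_div_iff₀ h0]
      exact mul_le_mul_of_nonneg_left hmin (abs_nonneg _)
    nlinarith [le_abs_self a]
  by_cases hq : q ∈ K
  · have : ‖fderiv ℝ ω q‖ ≤ |B| := (hB ⟨q, hq, rfl⟩).trans (le_abs_self B)
    nlinarith [hω.pos q]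
  · have h3 : ‖fderiv ℝ ω q‖ / ω q ≤ 1 := hKc hq
    rw [div_le_one (hω.pos q)] at h3
    nlinarith [abs_nonneg B]

/-- The disc of radius ω(q) - a around ω(q) lies in the half-plane, so Cauchy's estimate bounds V'
there by 2M/(ω(q) - a). The denominator cancels against |∇ω| ≤ C(ω - a), which makes the gradient
bound uniform even where ∇ω is unbounded. -/
theorem hasFDerivAt_energy {G : Type*} [NormedAddCommGroup G] [NormedSpace ℂ G]
    (hω : ContDiff ℝ 2 ω) {a C M : ℝ} (hC : ∀ q, ‖fderiv ℝ ω q‖ ≤ C * (ω q - a))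
    (ha : ∀ q, a < ω q)
    {V : ℂ → G} (hV : DifferentiableOn ℂ V {s | a < s.re}) (hM : ∀ s, a < s.re → ‖V s‖ ≤ M)
    (q : Mom d) :
    DifferentiableAt ℝ (fun x => V (ω x)) q ∧ ‖fderiv ℝ (fun x => V (ω x)) q‖ ≤ 2 * C * M := by
  have hopen : IsOpen {s : ℂ | a < s.re} := isOpen_lt continuous_const Complex.continuous_re
  have hmem : ((ω q : ℂ)) ∈ {s : ℂ | a < s.re} := by simpa using ha q
  have h1 : HasFDerivAt V (fderiv ℂ V (ω q)) (ω q : ℂ) :=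
    ((hV _ hmem).differentiableAt (hopen.mem_nhds hmem)).hasFDerivAt
  have h2 : HasFDerivAt (fun x => (ω x : ℂ)) (Complex.ofRealCLM.comp (fderiv ℝ ω q)) q :=
    Complex.ofRealCLM.hasFDerivAt.comp q (hω.differentiable (by norm_num) q).hasFDerivAt
  have h3 := (h1.restrictScalars ℝ).comp q h2
  refine ⟨h3.differentiableAt, ?_⟩
  have h3' : fderiv ℝ (fun x => V (ω x)) q = _ := h3.fderiv
  rw [h3']
  have hr : 0 < ω q - a := by linarith [ha q]
  have hball : Metric.ball (ω q : ℂ) (ω q - a) ⊆ {s : ℂ | a < s.re} := by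
    intro s hs
    rw [Metric.mem_ball, dist_eq_norm] at hs
    have := (Complex.abs_re_le_norm (s - ω q)).trans_lt hs
    simp only [Complex.sub_re, Complex.ofReal_re] at this
    have := (abs_lt.mp this).1
    simp only [mem_ofPred_eq]
    linarith
  have h4 := norm_fderiv_le_of_ball hr (hV.mono hball) (fun s hs => hM s (hball hs))
  have hM0 : 0 ≤ M := (norm_nonneg _).trans (hM _ hmem)
  refine (ContinuousLinearMap.opNorm_comp_le _ _).trans ?_
  rw [ContinuousLinearMap.norm_restrictScalars]
  have h5 : ‖Complex.ofRealCLM.comp (fderiv ℝ ω q)‖ ≤ C * (ω q - a) := by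
    refine (ContinuousLinearMap.opNorm_comp_le _ _).trans ?_
    rw [Complex.ofRealCLM_norm, one_mul]
    exact hC q
  calc ‖fderiv ℂ V (ω q)‖ * ‖Complex.ofRealCLM.comp (fderiv ℝ ω q)‖
      ≤ (2 * M / (ω q - a)) * (C * (ω q - a)) := by gcongr
    _ = _ := by field_simp

theorem norm_fderiv_smul_energy_le {G : Type*} [NormedAddCommGroup G] [NormedSpace ℂ G]
    (hω : ContDiff ℝ 2 ω) {a C M : ℝ} (hC : ∀ q, ‖fderiv ℝ ω q‖ ≤ C * (ω q - a))
    (ha : ∀ q, a < ω q)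
    {V : ℂ → G} (hV : DifferentiableOn ℂ V {s | a < s.re}) (hM : ∀ s, a < s.re → ‖V s‖ ≤ M)
    {h : Mom d → ℝ} {f : Mom d → ℂ} {C' : ℝ} (hf : Differentiable ℝ f)
    (hfb : ∀ q, ‖f q‖ ≤ h q) (hfg : ∀ q, ‖fderiv ℝ f q‖ ≤ C' * h q) (q : Mom d) :
    ‖fderiv ℝ (fun x => f x • V (ω x)) q‖ ≤ (C' + 2 * |C|) * M * h q := by
  obtain ⟨h1, h2⟩ := hasFDerivAt_energy hω hC ha hV hM q
  have hM0 : 0 ≤ M := (norm_nonneg _).trans (hM (ω q) (by simpa using ha q))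
  rw [fderiv_fun_smul (hf q) h1]
  refine (norm_add_le _ _).trans ?_
  have e1 : ‖f q • fderiv ℝ (fun x => V (ω x)) q‖ ≤ h q * (2 * |C| * M) := by
    rw [norm_smul]
    refine mul_le_mul (hfb q) (h2.trans ?_) (norm_nonneg _) ((norm_nonneg _).trans (hfb q))
    have := le_abs_self C
    gcongr
  have e2 : ‖(fderiv ℝ f q).smulRight (V (ω q))‖ ≤ C' * h q * M := by
    have hq0 : 0 ≤ C' * h q := (norm_nonneg _).trans (hfg q)
    refine ContinuousLinearMap.opNorm_le_bound _ (mul_nonneg hq0 hM0) fun v => ?_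
    rw [ContinuousLinearMap.smulRight_apply, norm_smul, mul_right_comm]
    exact mul_le_mul (((fderiv ℝ f q).le_opNorm v).trans
      (mul_le_mul_of_nonneg_right (hfg q) (norm_nonneg v))) (hM _ (by simpa using ha q))
      (norm_nonneg _) (mul_nonneg hq0 (norm_nonneg v))
  linarith

end Energy

/-- Scalar functions of three groups of energies. -/
abbrev XFam := (l j m : ℕ) → (Fin l → ℂ) → (Fin j → ℂ) → (Fin m → ℂ) → ℂ

/-- Uniformly bounded symmetric holomorphic functions of three groups of energies. -/
structure XHol (a M : ℝ) (X : XFam) : Prop where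
  diff : ∀ l j m, DifferentiableOn ℂ
    (fun y : (Fin l → ℂ) × (Fin j → ℂ) × (Fin m → ℂ) => X l j m y.1 y.2.1 y.2.2)
    (tube a l ×ˢ tube a j ×ˢ tube a m)
  bdd : ∀ l j m, ∀ t ∈ tube a l, ∀ s ∈ tube a j, ∀ u ∈ tube a m, ‖X l j m t s u‖ ≤ M
  symm : ∀ l j m, ∀ t ∈ tube a l, ∀ s ∈ tube a j, ∀ u ∈ tube a m,
    ∀ (π : Equiv.Perm (Fin l)) (π' : Equiv.Perm (Fin j)),
    X l j m (t ∘ π) (s ∘ π') u = X l j m t s u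

theorem tube_update {a : ℝ} {l : ℕ} {t : Fin l → ℂ} (ht : t ∈ tube a l) (i : Fin l) {s : ℂ}
    (hs : a < s.re) : Function.update t i s ∈ tube a l := by
  intro b
  rcases eq_or_ne b i with rfl | hb
  · simpa using hs
  · simpa [hb] using ht b

theorem differentiable_update {l : ℕ} (t : Fin l → ℂ) (i : Fin l) :
    Differentiable ℂ fun s : ℂ => Function.update t i s := by
  rw [differentiable_pi]
  intro b
  rcases eq_or_ne b i with rfl | hb
  · simp
  · simp [hb]

/-! ### From scalar functions of the energies to members of `ℬ_n`. -/

namespace Model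

variable {d : ℕ} (S : Model d)

/-- The energies of a tuple of momenta. -/
def en {l : ℕ} (q : Fin l → Mom d) : Fin l → ℂ := fun i => (S.ω (q i) : ℂ)

/-- `∏ λ(qᵢ) ∏ conj λ(kᵢ)`. -/
def wt {l m : ℕ} (q : Fin l → Mom d) (k : Fin m → Mom d) : ℂ :=
  (∏ i, S.lam (q i)) * ∏ i, star (S.lam (k i))

/-- The matrix family with the diagonal scalar functions `X`, `Y`. -/
def fam (X Y : XFam) : Family d := fun l j m q p k =>
  S.wt q k • (σ₁ ^ (l + m) * dg (X l j m (S.en q) (S.en p) (S.en k))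
    (Y l j m (S.en q) (S.en p) (S.en k)))

theorem en_mem {a : ℝ} (ha : ∀ q, a < S.ω q) {l : ℕ} (q : Fin l → Mom d) : S.en q ∈ tube a l :=
  fun i => by simpa [en] using ha (q i)

theorem en_update {l : ℕ} (q : Fin l → Mom d) (i : Fin l) (x : Mom d) :
    S.en (Function.update q i x) = Function.update (S.en q) i (S.ω x : ℂ) := by
  funext b
  rcases eq_or_ne b i with rfl | hb
  · simp [en]
  · simp [en, hb]

theorem en_comp {l m : ℕ} (q : Fin l → Mom d) (f : Fin m → Fin l) : S.en (q ∘ f) = S.en q ∘ f := rfl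

theorem prod_update {R : Type*} [CommMonoid R] {l : ℕ} (f : Mom d → R) (q : Fin l → Mom d)
    (i : Fin l) (x : Mom d) :
    ∏ b, f (Function.update q i x b) = f x * ∏ b ∈ Finset.univ \ {i}, f (q b) := by
  rw [← Finset.prod_update_of_mem (Finset.mem_univ i) (fun b => f (q b)) (f x)]
  refine Finset.prod_congr rfl fun b _ => ?_
  rcases eq_or_ne b i with rfl | hb
  · simp
  · simp [hb]

variable {S} {h : Mom d → ℝ} {a M : ℝ} {X Y : XFam}

theorem norm_pow_mul_dg_le {x y : ℂ} (n : ℕ) (hx : ‖x‖ ≤ M) (hy : ‖y‖ ≤ M) :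
    ‖σ₁ ^ n * dg x y‖ ≤ sC * (dgC * M) :=
  (norm_mul_le _ _).trans (mul_le_mul (norm_σ₁_pow_le n) (norm_dg_le hx hy) (norm_nonneg _)
    sC_nonneg)

theorem differentiableOn_pow_mul_dg {E : Type*} [NormedAddCommGroup E] [NormedSpace ℂ E]
    {D : Set E} {x y : E → ℂ} (n : ℕ) (hx : DifferentiableOn ℂ x D) (hy : DifferentiableOn ℂ y D) :
    DifferentiableOn ℂ (fun s => σ₁ ^ n * dg (x s) (y s)) D := by
  have : (fun s => σ₁ ^ n * dg (x s) (y s)) = fun s => σ₁ ^ n * dgL (x s, y s) := by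
    funext s; rw [dgL_apply]
  rw [this]
  exact (dgL.differentiable.comp_differentiableOn (hx.prodMk hy)).const_mul _

/-- With all variables but one frozen, the family is λ (or conj λ, or 1) of that variable times a
holomorphic function of its energy. The product rule and the energy estimate then bound each
gradient, and the remaining factors λ supply the weights h. -/
theorem isCoeffFamily_fam (hω : DispersionLaw S.ω) (hlam : FormFactor S.lam h) (ha : a < S.ω 0)
    (hM0 : 0 ≤ M) (hX : XHol a M X) (hY : XHol a M Y) {n : ℕ}
    (hidx : ∀ l j m, j + m ≠ n → X l j m = 0 ∧ Y l j m = 0)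
    (hvan : ∀ l j m, l ≤ m → ∀ q p k, X l j m (S.en q) (S.en p) (S.en k) = 0 ∧
      Y l j m (S.en q) (S.en p) (S.en k) = 0) :
    IsCoeffFamily h n (S.fam X Y) := by
  have haω : ∀ q, a < S.ω q := fun q => ha.trans_le (hω.min_le q)
  obtain ⟨C, hC0, hC⟩ := hω.exists_gradient_bound ha
  obtain ⟨C', hC'0, hC'⟩ := hlam.gradient_bound
  have hωc : ∀ l, ContDiff ℝ 1 (fun q : Fin l → Mom d => S.en q) := fun l =>
    contDiff_pi.mpr fun i => Complex.ofRealCLM.contDiff.comp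
      ((hω.contDiff.of_le (by norm_num)).comp (contDiff_apply ℝ (Mom d) i))
  have hstar : ContDiff ℝ 1 (fun q => star (S.lam q)) :=
    (Complex.conjCLE.contDiff (n := 1)).comp hlam.contDiff
  have hstarb : ∀ q, ‖star (S.lam q)‖ ≤ h q := fun q => by rw [norm_star]; exact hlam.bound q
  have hstarg : ∀ q, ‖fderiv ℝ (fun q => star (S.lam q)) q‖ ≤ C' * h q := by
    intro q
    have e : fderiv ℝ (fun q => star (S.lam q)) q
        = (Complex.conjLIE.toContinuousLinearEquiv : ℂ →L[ℝ] ℂ).comp (fderiv ℝ S.lam q) :=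
      ((Complex.conjLIE.toContinuousLinearEquiv : ℂ →L[ℝ] ℂ).hasFDerivAt.comp q
        (hlam.contDiff.differentiable (by norm_num) q).hasFDerivAt).fderiv
    rw [e]
    refine le_trans (le_of_eq ?_) (hC' q)
    exact LinearIsometry.norm_toContinuousLinearMap_comp (Complex.conjLIE.toLinearIsometry)
  have hlamd : Differentiable ℝ S.lam := hlam.contDiff.differentiable (by norm_num)
  have hh0 : ∀ q, 0 ≤ h q := fun q => (hlam.h_pos q).le
  have hprod : ∀ {l : ℕ} (s : Finset (Fin l)) (q : Fin l → Mom d),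
      ‖∏ i ∈ s, S.lam (q i)‖ ≤ ∏ i ∈ s, h (q i) := fun s q => by
    rw [norm_prod]
    exact Finset.prod_le_prod (fun _ _ => norm_nonneg _) fun i _ => hlam.bound _
  have hprod' : ∀ {l : ℕ} (s : Finset (Fin l)) (q : Fin l → Mom d),
      ‖∏ i ∈ s, star (S.lam (q i))‖ ≤ ∏ i ∈ s, h (q i) := fun s q => by
    rw [norm_prod]
    exact Finset.prod_le_prod (fun _ _ => norm_nonneg _) fun i _ => hstarb _
  have hp0 : ∀ {l : ℕ} (s : Finset (Fin l)) (q : Fin l → Mom d), 0 ≤ ∏ i ∈ s, h (q i) :=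
    fun s q => Finset.prod_nonneg fun i _ => hh0 _
  have hwt : ∀ {l m : ℕ} (q : Fin l → Mom d) (k : Fin m → Mom d),
      ‖S.wt q k‖ ≤ (∏ i, h (q i)) * ∏ i, h (k i) := fun q k => by
    rw [wt, norm_mul]
    exact mul_le_mul (hprod _ q) (hprod' _ k) (norm_nonneg _) (hp0 _ q)
  have hem : ∀ {l : ℕ} (q : Fin l → Mom d), S.en q ∈ tube a l := S.en_mem haω
  set K := sC * (dgC * M) with hK
  have hK0 : 0 ≤ K := mul_nonneg sC_nonneg (mul_nonneg dgC_nonneg hM0)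
  -- One constant for all bounds: 1 serves the values, `C'` the gradient of λ, and `2 * |C|` the
  -- Cauchy estimate in the energy.
  refine ⟨?_, ?_, ?_, ?_, ⟨(1 + C' + 2 * |C|) * K, ?_⟩⟩
  · intro l j m hjm
    funext q p k
    simp [fam, (hidx l j m hjm).1, (hidx l j m hjm).2, dg_zero]
  · intro l j m hlm
    funext q p k
    simp [fam, (hvan l j m hlm q p k).1, (hvan l j m hlm q p k).2, dg_zero]
  · intro l j m π π' q p k
    simp only [fam, en_comp]
    rw [hX.symm l j m _ (hem q) _ (hem p) _ (hem k), hY.symm l j m _ (hem q) _ (hem p) _ (hem k)]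
    congr 1
    simp only [wt, Function.comp_apply]
    rw [Equiv.prod_comp π (fun i => S.lam (q i))]
  · intro l j m
    have hD : IsOpen (tube a l ×ˢ tube a j ×ˢ tube a m) :=
      (isOpen_tube a l).prod ((isOpen_tube a j).prod (isOpen_tube a m))
    simp only [fam]
    refine ContDiff.fun_smul ?_ ?_
    · refine ContDiff.mul (contDiff_prod fun i _ => ?_) (contDiff_prod fun i _ => ?_)
      · exact hlam.contDiff.comp ((contDiff_apply ℝ (Mom d) i).comp contDiff_fst)
      · exact hstar.comp ((contDiff_apply ℝ (Mom d) i).comp (contDiff_snd.comp contDiff_snd))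
    · rw [contDiff_iff_contDiffAt]
      rintro ⟨q, p, k⟩
      have h1 := contDiffAt_one_of_isOpen hD (differentiableOn_pow_mul_dg (l + m)
        (hX.diff l j m) (hY.diff l j m)) (x := (S.en q, S.en p, S.en k)) ⟨hem q, hem p, hem k⟩
      have h2 : ContDiff ℝ 1 (fun x : (Fin l → Mom d) × (Fin j → Mom d) × (Fin m → Mom d) =>
          (S.en x.1, S.en x.2.1, S.en x.2.2)) :=
        ((hωc l).comp contDiff_fst).prodMk (((hωc j).comp (contDiff_fst.comp contDiff_snd)).prodMk
          ((hωc m).comp (contDiff_snd.comp contDiff_snd)))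
      have h3 := ContDiffAt.comp (x := (q, p, k)) (f := fun x : (Fin l → Mom d) × (Fin j → Mom d) ×
        (Fin m → Mom d) => (S.en x.1, S.en x.2.1, S.en x.2.2)) h1 h2.contDiffAt
      exact h3
  · have hcst : ∀ {w : ℝ}, 0 ≤ w → K * w ≤ (1 + C' + 2 * |C|) * K * w := fun {w} hw => by
      have : 0 ≤ (C' + 2 * |C|) * K * w := by positivity
      linarith
    have hval : ∀ {l j m : ℕ} {t : Fin l → ℂ} {s : Fin j → ℂ} {u : Fin m → ℂ}, t ∈ tube a l →
        s ∈ tube a j → u ∈ tube a m → ‖σ₁ ^ (l + m) * dg (X l j m t s u) (Y l j m t s u)‖ ≤ K :=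
      fun ht hs hu => norm_pow_mul_dg_le _ (hX.bdd _ _ _ _ ht _ hs _ hu)
        (hY.bdd _ _ _ _ ht _ hs _ hu)
    refine ⟨?_, ?_, ?_, ?_⟩
    · intro l j m q p k
      rw [fam, norm_smul]
      refine (mul_le_mul (hwt q k) (hval (hem q) (hem p) (hem k)) (norm_nonneg _)
        (mul_nonneg (hp0 _ _) (hp0 _ _))).trans ?_
      rw [mul_comm]
      exact hcst (mul_nonneg (hp0 _ _) (hp0 _ _))
    · intro l j m q p k i
      set V : ℂ → M₂ := fun s => ((∏ b ∈ Finset.univ \ {i}, S.lam (q b)) * ∏ b, star (S.lam (k b))) •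
        (σ₁ ^ (l + m) * dg (X l j m (Function.update (S.en q) i s) (S.en p) (S.en k))
          (Y l j m (Function.update (S.en q) i s) (S.en p) (S.en k)))
      have hrest : ‖(∏ b ∈ Finset.univ \ {i}, S.lam (q b)) * ∏ b, star (S.lam (k b))‖
          ≤ (∏ b ∈ Finset.univ \ {i}, h (q b)) * ∏ b, h (k b) := by
        rw [norm_mul]
        exact mul_le_mul (hprod _ q) (hprod' _ k) (norm_nonneg _) (hp0 _ q)
      have hVd : DifferentiableOn ℂ V {s | a < s.re} := by
        have hmap : DifferentiableOn ℂ (fun s : ℂ =>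
            (Function.update (S.en q) i s, S.en p, S.en k)) {s | a < s.re} :=
          ((differentiable_update _ i).prodMk (differentiable_const _)).differentiableOn
        have hmt : MapsTo (fun s : ℂ => (Function.update (S.en q) i s, S.en p, S.en k))
            {s | a < s.re} (tube a l ×ˢ tube a j ×ˢ tube a m) := fun s hs =>
          ⟨tube_update (hem q) i hs, hem p, hem k⟩
        exact ((differentiableOn_pow_mul_dg (l + m) (hX.diff l j m) (hY.diff l j m)).comp
          hmap hmt).fun_const_smul _
      have hVM : ∀ s, a < s.re → ‖V s‖ ≤ ((∏ b ∈ Finset.univ \ {i}, h (q b)) * ∏ b, h (k b)) * K := by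
        intro s hs
        rw [norm_smul]
        exact mul_le_mul hrest (hval (tube_update (hem q) i hs) (hem p) (hem k)) (norm_nonneg _)
          (mul_nonneg (hp0 _ _) (hp0 _ _))
      have hfun : (fun x => S.fam X Y l j m (Function.update q i x) p k)
          = fun x => S.lam x • V (S.ω x) := by
        funext x
        simp only [fam, V, wt, en_update, prod_update, smul_smul, mul_assoc]
      rw [hfun]
      refine (norm_fderiv_smul_energy_le (h := h) hω.contDiff hC haω hVd hVM hlamd hlam.bound
        hC' (q i)).trans ?_
      have e : h (q i) * ∏ b ∈ Finset.univ \ {i}, h (q b) = ∏ b, h (q b) := by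
        rw [← prod_update h q i (q i), Function.update_eq_self]
      rw [← e]
      have e2 : (1 + C' + 2 * |C|) * K * (h (q i) * (∏ b ∈ Finset.univ \ {i}, h (q b)) * ∏ b, h (k b))
        = (C' + 2 * |C|) * ((∏ b ∈ Finset.univ \ {i}, h (q b)) * (∏ b, h (k b)) * K) * h (q i)
          + K * (h (q i) * ((∏ b ∈ Finset.univ \ {i}, h (q b)) * ∏ b, h (k b))) := by ring
      rw [e2]
      have := mul_nonneg hK0 (mul_nonneg (hh0 (q i)) (mul_nonneg (hp0 (Finset.univ \ {i}) q)
        (hp0 Finset.univ k)))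
      linarith
    · intro l j m q p k i
      -- The momenta in Q₂ carry no factor λ, so only the chain rule through the energy is needed
      -- here.
      set V : ℂ → M₂ := fun s => S.wt q k •
        (σ₁ ^ (l + m) * dg (X l j m (S.en q) (Function.update (S.en p) i s) (S.en k))
          (Y l j m (S.en q) (Function.update (S.en p) i s) (S.en k)))
      have hVd : DifferentiableOn ℂ V {s | a < s.re} := by
        have hmap : DifferentiableOn ℂ (fun s : ℂ =>
            (S.en q, Function.update (S.en p) i s, S.en k)) {s | a < s.re} :=
          ((differentiable_const _).prodMk
            ((differentiable_update _ i).prodMk (differentiable_const _))).differentiableOn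
        have hmt : MapsTo (fun s : ℂ => (S.en q, Function.update (S.en p) i s, S.en k))
            {s | a < s.re} (tube a l ×ˢ tube a j ×ˢ tube a m) := fun s hs =>
          ⟨hem q, tube_update (hem p) i hs, hem k⟩
        exact ((differentiableOn_pow_mul_dg (l + m) (hX.diff l j m) (hY.diff l j m)).comp
          hmap hmt).fun_const_smul _
      have hVM : ∀ s, a < s.re → ‖V s‖ ≤ ((∏ b, h (q b)) * ∏ b, h (k b)) * K := by
        intro s hs
        rw [norm_smul]
        exact mul_le_mul (hwt q k) (hval (hem q) (tube_update (hem p) i hs) (hem k)) (norm_nonneg _)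
          (mul_nonneg (hp0 _ _) (hp0 _ _))
      have hfun : (fun x => S.fam X Y l j m q (Function.update p i x) k)
          = fun x => V (S.ω x) := by
        funext x
        simp only [fam, V, en_update]
      rw [hfun]
      refine (hasFDerivAt_energy hω.contDiff hC haω hVd hVM (p i)).2.trans ?_
      have hw := mul_nonneg (hp0 Finset.univ q) (hp0 Finset.univ k)
      have e3 := mul_nonneg hK0 hw
      have e4 := mul_nonneg hC'0.le e3
      rw [abs_of_nonneg hC0]
      linarith
    · intro l j m q p k i
      set V : ℂ → M₂ := fun s => ((∏ b, S.lam (q b)) * ∏ b ∈ Finset.univ \ {i}, star (S.lam (k b))) •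
        (σ₁ ^ (l + m) * dg (X l j m (S.en q) (S.en p) (Function.update (S.en k) i s))
          (Y l j m (S.en q) (S.en p) (Function.update (S.en k) i s)))
      have hrest : ‖(∏ b, S.lam (q b)) * ∏ b ∈ Finset.univ \ {i}, star (S.lam (k b))‖
          ≤ (∏ b, h (q b)) * ∏ b ∈ Finset.univ \ {i}, h (k b) := by
        rw [norm_mul]
        exact mul_le_mul (hprod _ q) (hprod' _ k) (norm_nonneg _) (hp0 _ q)
      have hVd : DifferentiableOn ℂ V {s | a < s.re} := by
        have hmap : DifferentiableOn ℂ (fun s : ℂ =>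
            (S.en q, S.en p, Function.update (S.en k) i s)) {s | a < s.re} :=
          ((differentiable_const _).prodMk
            ((differentiable_const _).prodMk (differentiable_update _ i))).differentiableOn
        have hmt : MapsTo (fun s : ℂ => (S.en q, S.en p, Function.update (S.en k) i s))
            {s | a < s.re} (tube a l ×ˢ tube a j ×ˢ tube a m) := fun s hs =>
          ⟨hem q, hem p, tube_update (hem k) i hs⟩
        exact ((differentiableOn_pow_mul_dg (l + m) (hX.diff l j m) (hY.diff l j m)).comp
          hmap hmt).fun_const_smul _
      have hVM : ∀ s, a < s.re → ‖V s‖ ≤ ((∏ b, h (q b)) * ∏ b ∈ Finset.univ \ {i}, h (k b)) * K := by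
        intro s hs
        rw [norm_smul]
        exact mul_le_mul hrest (hval (hem q) (hem p) (tube_update (hem k) i hs)) (norm_nonneg _)
          (mul_nonneg (hp0 _ _) (hp0 _ _))
      have hfun : (fun x => S.fam X Y l j m q p (Function.update k i x))
          = fun x => star (S.lam x) • V (S.ω x) := by
        funext x
        simp only [fam, V, wt, en_update, smul_smul]
        rw [prod_update (fun x => star (S.lam x))]
        congr 1
        ring
      rw [hfun]
      refine (norm_fderiv_smul_energy_le (h := h) hω.contDiff hC haω hVd hVM
        (hstar.differentiable (by norm_num)) hstarb hstarg (k i)).trans ?_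
      have e : h (k i) * ∏ b ∈ Finset.univ \ {i}, h (k b) = ∏ b, h (k b) := by
        rw [← prod_update h k i (k i), Function.update_eq_self]
      rw [← e]
      have e2 : (1 + C' + 2 * |C|) * K * ((∏ b, h (q b)) * (h (k i) * ∏ b ∈ Finset.univ \ {i}, h (k b)))
        = (C' + 2 * |C|) * ((∏ b, h (q b)) * (∏ b ∈ Finset.univ \ {i}, h (k b)) * K) * h (k i)
          + K * (h (k i) * ((∏ b, h (q b)) * ∏ b ∈ Finset.univ \ {i}, h (k b))) := by ring
      rw [e2]
      have := mul_nonneg hK0 (mul_nonneg (hh0 (k i)) (mul_nonneg (hp0 Finset.univ q)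
        (hp0 (Finset.univ \ {i}) k)))
      linarith

end Model

/-! ### The scalar form of the coefficient equation. -/

/-- The creation part for functions of three groups of energies. -/
def XFam.crt (X : XFam) : (l j m : ℕ) → (Fin l → ℂ) → (Fin j → ℂ) → (Fin m → ℂ) → ℂ
  | 0, _, _, _, _, _ => 0
  | l + 1, j, m, t, s, u => ∑ i : Fin (l + 1), X l j m (fun b => t (i.succAbove b)) s u

/-- The transfer part for functions of three groups of energies. -/
def XFam.tr (X : XFam) : (l j m : ℕ) → (Fin l → ℂ) → (Fin j → ℂ) → (Fin m → ℂ) → ℂ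
  | _, _, 0, _, _, _ => 0
  | l, j, m + 1, t, s, u =>
      X l (j + 1) m t (Fin.snoc (α := fun _ => ℂ) s (u (Fin.last m))) (fun b => u b.castSucc)

theorem dg_sum {ι : Type*} (s : Finset ι) (x y : ι → ℂ) :
    ∑ i ∈ s, dg (x i) (y i) = dg (∑ i ∈ s, x i) (∑ i ∈ s, y i) := by
  have h := map_sum dgL (fun i => (x i, y i)) s
  simp only [dgL_apply, Prod.fst_sum, Prod.snd_sum] at h
  exact h.symm

theorem integral_mul_dg {X : Type*} [MeasurableSpace X] {ρ : Measure X} (T : M₂) {x y : X → ℂ}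
    (hx : Integrable x ρ) (hy : Integrable y ρ) :
    ∫ s, T * dg (x s) (y s) ∂ρ = T * dg (∫ s, x s ∂ρ) (∫ s, y s ∂ρ) := by
  have h := ((ContinuousLinearMap.mul ℂ M₂ T).comp dgL).integral_comp_comm (hx.prodMk hy)
  rw [integral_pair hx hy] at h
  simpa [dgL_apply] using h

namespace Model

variable {d : ℕ} (S : Model d)

/-- The finite measure `|λ|² dq`. -/
def lamMeasure : Measure (Mom d) := volume.withDensity fun x => ((‖S.lam x‖₊ ^ 2 : NNReal) : ENNReal)

/-- The annihilation part for functions of three groups of energies. -/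
def Xann (X : XFam) (l j m : ℕ) (t : Fin l → ℂ) (s : Fin j → ℂ) (u : Fin m → ℂ) : ℂ :=
  ∫ x, X (l + 1) j m (Fin.snoc (α := fun _ => ℂ) t (S.ω x : ℂ)) s u ∂S.lamMeasure

/-- The scalar form of the coefficient equation, for the column with spin energy `c`. -/
def ScalarEq (c α : ℝ) (n : ℕ) (z : ℂ) (X : XFam) : Prop :=
  ∀ l j m, j + m = n → m < l → ∀ (q : Fin l → Mom d) (p : Fin j → Mom d) (k : Fin m → Mom d),
    (-1) ^ (l + m) * (c : ℂ) + ((S.energy q + S.energy p : ℝ) : ℂ) - z ≠ 0 ∧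
    X l j m (S.en q) (S.en p) (S.en k) =
      -(α : ℂ) * ((-1) ^ (l + m) * (c : ℂ) + ((S.energy q + S.energy p : ℝ) : ℂ) - z)⁻¹ *
        (X.crt l j m (S.en q) (S.en p) (S.en k) + S.Xann X l j m (S.en q) (S.en p) (S.en k)
          + X.tr l j m (S.en q) (S.en p) (S.en k) - if l = 1 ∧ m = 0 then 1 else 0)

variable {S} {h : Mom d → ℝ}

theorem integral_lamMeasure (hlam : FormFactor S.lam h) (f : Mom d → ℂ) :
    ∫ x, f x ∂S.lamMeasure = ∫ x, ((‖S.lam x‖ ^ 2 : ℝ) : ℂ) * f x := by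
  have hm : Measurable fun x => ‖S.lam x‖₊ ^ 2 :=
    (hlam.contDiff.continuous.nnnorm.pow 2).measurable
  rw [lamMeasure, integral_withDensity_eq_integral_smul hm]
  refine integral_congr_ae (Eventually.of_forall fun x => ?_)
  simp [NNReal.smul_def, Complex.real_smul]

theorem integrable_lamMeasure (hlam : FormFactor S.lam h) {f : Mom d → ℂ}
    (hf : Integrable f S.lamMeasure) :
    Integrable (fun x => ((‖S.lam x‖ ^ 2 : ℝ) : ℂ) * f x) := by
  have hm : Measurable fun x => ‖S.lam x‖₊ ^ 2 :=
    (hlam.contDiff.continuous.nnnorm.pow 2).measurable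
  rw [lamMeasure, integrable_withDensity_iff_integrable_smul hm] at hf
  refine hf.congr (Eventually.of_forall fun x => ?_)
  simp [NNReal.smul_def, Complex.real_smul]

theorem isFiniteMeasure_lamMeasure (hlam : FormFactor S.lam h) :
    IsFiniteMeasure S.lamMeasure := by
  refine isFiniteMeasure_withDensity (ne_of_lt ?_)
  have h2 := hlam.h_memLp.integrable_sq
  refine lt_of_le_of_lt (lintegral_mono fun x => ?_) h2.lintegral_lt_top
  rw [ENNReal.ofReal]
  refine ENNReal.coe_le_coe.mpr ?_
  rw [← NNReal.coe_le_coe, Real.coe_toNNReal _ (by positivity)]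
  have := hlam.bound x
  simp only [NNReal.coe_pow, coe_nnnorm]
  gcongr

theorem wt_succAbove {l m : ℕ} (q : Fin (l + 1) → Mom d) (k : Fin m → Mom d) (i : Fin (l + 1)) :
    S.lam (q i) * S.wt (fun b => q (i.succAbove b)) k = S.wt q k := by
  simp only [wt]
  rw [Fin.prod_univ_succAbove (fun b => S.lam (q b)) i, mul_assoc]

theorem wt_snoc {l m : ℕ} (q : Fin l → Mom d) (k : Fin m → Mom d) (x : Mom d) :
    S.wt (Fin.snoc (α := fun _ => Mom d) q x) k = S.wt q k * S.lam x := by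
  simp only [wt]
  rw [Fin.prod_univ_castSucc]
  simp only [Fin.snoc_castSucc, Fin.snoc_last]
  ring

theorem en_snoc {l : ℕ} (q : Fin l → Mom d) (x : Mom d) :
    S.en (Fin.snoc (α := fun _ => Mom d) q x) = Fin.snoc (α := fun _ => ℂ) (S.en q) (S.ω x : ℂ) := by
  funext i
  induction i using Fin.lastCases with
  | last => simp [en]
  | cast j => simp [en]

theorem createTerm_fam (X Y : XFam) (l j m : ℕ) (q : Fin (l + 1) → Mom d) (p : Fin j → Mom d)
    (k : Fin m → Mom d) :
    S.createTerm (S.fam X Y) (l + 1) j m q p k = S.wt q k • (σ₁ ^ (l + m) *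
      dg (X.crt (l + 1) j m (S.en q) (S.en p) (S.en k))
        (Y.crt (l + 1) j m (S.en q) (S.en p) (S.en k))) := by
  simp only [createTerm, fam, smul_smul, wt_succAbove, XFam.crt]
  rw [← Finset.smul_sum, ← Finset.mul_sum, dg_sum]
  rfl

theorem transferTerm_fam (X Y : XFam) (l j m : ℕ) (q : Fin l → Mom d) (p : Fin j → Mom d)
    (k : Fin (m + 1) → Mom d) :
    S.transferTerm (S.fam X Y) l j (m + 1) q p k = S.wt q k • (σ₁ ^ (l + m) *
      dg (X.tr l j (m + 1) (S.en q) (S.en p) (S.en k))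
        (Y.tr l j (m + 1) (S.en q) (S.en p) (S.en k))) := by
  have hw : star (S.lam (k (Fin.last m))) * S.wt q (fun b : Fin m => k b.castSucc) = S.wt q k := by
    simp only [wt]
    rw [Fin.prod_univ_castSucc (fun b => star (S.lam (k b)))]
    ring
  simp only [transferTerm, fam, smul_smul, XFam.tr, en_snoc, hw]
  rfl

/-- The weight of Q₁ ∪ {x} contains λ(x), which meets the conj λ(x) of the annihilation term. The
product is the density |λ(x)|² of `lamMeasure`, so a scalar integral over energies remains, with one
more spin flip. -/
theorem annihilateTerm_fam (hlam : FormFactor S.lam h) (X Y : XFam) (l j m : ℕ)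
    (q : Fin l → Mom d) (p : Fin j → Mom d) (k : Fin m → Mom d)
    (hX : Integrable (fun x => X (l + 1) j m (Fin.snoc (α := fun _ => ℂ) (S.en q) (S.ω x : ℂ))
      (S.en p) (S.en k)) S.lamMeasure)
    (hY : Integrable (fun x => Y (l + 1) j m (Fin.snoc (α := fun _ => ℂ) (S.en q) (S.ω x : ℂ))
      (S.en p) (S.en k)) S.lamMeasure) :
    S.annihilateTerm (S.fam X Y) l j m q p k = S.wt q k • (σ₁ ^ (l + m + 1) *
      dg (S.Xann X l j m (S.en q) (S.en p) (S.en k)) (S.Xann Y l j m (S.en q) (S.en p) (S.en k))) := by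
  rw [Xann, Xann, integral_lamMeasure hlam, integral_lamMeasure hlam,
    ← integral_mul_dg _ (integrable_lamMeasure hlam hX) (integrable_lamMeasure hlam hY),
    annihilateTerm, ← integral_smul]
  refine integral_congr_ae (Eventually.of_forall fun x => ?_)
  simp only [fam, wt_snoc, en_snoc, smul_smul]
  have h1 : star (S.lam x) * (S.wt q k * S.lam x) = S.wt q k * ((‖S.lam x‖ ^ 2 : ℝ) : ℂ) := by
    have : star (S.lam x) * S.lam x = ((‖S.lam x‖ ^ 2 : ℝ) : ℂ) := by
      rw [← starRingEnd_apply, Complex.conj_mul']; push_cast; rfl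
    rw [← this]; ring
  rw [h1, mul_smul, ← dg_smul, mul_smul_comm, show l + 1 + m = l + m + 1 by omega]

/-- The scalar equations give the coefficient equation. -/
theorem isCoeff_fam (hlam : FormFactor S.lam h) {α : ℝ} {n : ℕ} {z : ℂ} {X Y : XFam}
    (hmem : IsCoeffFamily h n (S.fam X Y)) (hX : S.ScalarEq S.ε α n z X)
    (hY : S.ScalarEq (-S.ε) α n z Y)
    (hXi : ∀ l j m, ∀ (q : Fin l → Mom d) (p : Fin j → Mom d) (k : Fin m → Mom d),
      Integrable (fun x => X (l + 1) j m (Fin.snoc (α := fun _ => ℂ) (S.en q) (S.ω x : ℂ))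
      (S.en p) (S.en k)) S.lamMeasure)
    (hYi : ∀ l j m, ∀ (q : Fin l → Mom d) (p : Fin j → Mom d) (k : Fin m → Mom d),
      Integrable (fun x => Y (l + 1) j m (Fin.snoc (α := fun _ => ℂ) (S.en q) (S.ω x : ℂ))
      (S.en p) (S.en k)) S.lamMeasure) :
    S.IsCoeff h α n z (S.fam X Y) := by
  refine ⟨hmem, fun l j m hjm hml q p k => ?_⟩
  obtain ⟨hx0, hx⟩ := hX l j m hjm hml q p k
  obtain ⟨hy0, hy⟩ := hY l j m hjm hml q p k
  obtain ⟨l, rfl⟩ : ∃ l', l = l' + 1 := ⟨l - 1, by omega⟩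
  set E : ℝ := S.energy q + S.energy p
  rw [Complex.ofReal_neg] at hy0 hy
  set Dx := ((-1) ^ (l + 1 + m) * (S.ε : ℂ) + (E : ℂ) - z)⁻¹
  set Dy := ((-1) ^ (l + 1 + m) * (-S.ε : ℂ) + (E : ℂ) - z)⁻¹
  have hR : S.freeRes z E * σ₁ ^ (l + 1 + m) = σ₁ ^ (l + 1 + m) * dg Dx Dy :=
    S.freeRes_mul_pow _ hx0 hy0
  -- All terms end with the same power of `σ₁`. Creation and transfer lower |Q₁| + m by one, which
  -- the leading `σ₁` restores; annihilation raises it by one, and the surplus pair of flips is `σ₁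
  -- * σ₁ = 1`.
  have hR1 : S.freeRes z E * σ₁ * σ₁ ^ (l + m) = σ₁ ^ (l + 1 + m) * dg Dx Dy := by
    rw [← hR, mul_assoc, ← pow_succ', add_right_comm]
  have hR2 : S.freeRes z E * σ₁ * σ₁ ^ (l + 1 + m + 1) = σ₁ ^ (l + 1 + m) * dg Dx Dy := by
    rw [pow_succ', mul_assoc, ← mul_assoc σ₁ σ₁, σ₁_sq, one_mul, hR]
  have htr : S.transferTerm (S.fam X Y) (l + 1) j m q p k = S.wt q k • (σ₁ ^ (l + m) *
      dg (X.tr (l + 1) j m (S.en q) (S.en p) (S.en k))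
        (Y.tr (l + 1) j m (S.en q) (S.en p) (S.en k))) := by
    cases m with
    | zero => simp [transferTerm, XFam.tr, dg_zero]
    | succ m =>
      rw [transferTerm_fam, show l + 1 + m = l + (m + 1) by omega]
  have hsrc : S.source α z (l + 1) j m q p k = S.wt q k • (σ₁ ^ (l + 1 + m) *
      dg ((α : ℂ) * Dx * if l + 1 = 1 ∧ m = 0 then 1 else 0)
        ((α : ℂ) * Dy * if l + 1 = 1 ∧ m = 0 then 1 else 0)) := by
    by_cases hlm : l = 0 ∧ m = 0
    · obtain ⟨rfl, rfl⟩ := hlm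
      simp only [zero_add, and_self, if_true, mul_one, source]
      rw [← dg_smul, mul_smul_comm, smul_smul]
      congr 1
      simp [wt, mul_comm]
    · have : ¬ (l + 1 = 1 ∧ m = 0) := fun hc => hlm ⟨by omega, hc.2⟩
      simp only [if_neg this, mul_zero, dg_zero, smul_zero]
      match l, m, hlm with
      | 0, 0, h => exact absurd ⟨rfl, rfl⟩ h
      | 0, m + 1, _ => rfl
      | l + 1, m, _ => rfl
  rw [hsrc, Gam, createTerm_fam, htr, annihilateTerm_fam hlam X Y _ _ _ _ _ _ (hXi _ _ _ _ _ _)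
    (hYi _ _ _ _ _ _), mul_add, mul_add, mul_smul_comm, mul_smul_comm, mul_smul_comm,
    ← mul_assoc, ← mul_assoc, ← mul_assoc, hR1, hR2]
  simp only [fam]
  rw [hx, hy, ← smul_add, ← smul_add, smul_comm (α : ℂ), ← smul_add]
  congr 1
  simp only [mul_assoc, dg_mul, ← mul_add, dg_add, ← mul_smul_comm, dg_smul]
  congr 2 <;> ring

end Model

/-! ### Solution of the scalar equations for n = 0 and n = 1. -/

/-- The scalar functions for `n = 0`. -/
def zeroFam (z : ℂ) (A : EFam) : XFam
  | l, 0, 0, t, _, _ => A l (z, 0) t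
  | _, _, _, _, _, _ => 0

/-- The scalar functions for `n = 1`. -/
def oneFam (z : ℂ) (A B : EFam) : XFam
  | l, 1, 0, t, s, _ => A l (z - s 0, 0) t
  | l, 0, 1, t, _, u => B l (z, u 0) t
  | _, _, _, _, _, _ => 0

/-- Parameters `(z, τ)` with `Re z < v`. -/
def halfDom (v : ℝ) : Set (ℂ × ℂ) := {p | p.1.re < v}

/-- Parameters `(z, τ)` with `Re z < v` and `Re τ > a`. -/
def quarterDom (v a : ℝ) : Set (ℂ × ℂ) := {p | p.1.re < v ∧ a < p.2.re}

theorem isOpen_halfDom (v : ℝ) : IsOpen (halfDom v) :=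
  isOpen_lt (Complex.continuous_re.comp continuous_fst) continuous_const

theorem isOpen_quarterDom (v a : ℝ) : IsOpen (quarterDom v a) :=
  (isOpen_halfDom v).inter (isOpen_lt continuous_const (Complex.continuous_re.comp continuous_snd))

theorem star_mem_halfDom {v : ℝ} : ∀ p ∈ halfDom v, star p ∈ halfDom v := fun p hp => by
  simpa [halfDom] using hp

theorem star_mem_quarterDom {v a : ℝ} : ∀ p ∈ quarterDom v a, star p ∈ quarterDom v a :=
  fun p hp => by simpa [quarterDom] using hp

/-- The real part is at least (l - l₀) a + δ ≥ (l - l₀ + 1) δ. For l ≥ l₀ and l₀ ≤ 2 this is at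
least l δ/2, which explains the halved constant. -/
theorem mul_le_norm_den {e δ a v : ℝ} {l l₀ : ℕ} (hl₀' : l₀ ≤ 2) (hδ : 0 < δ) (ha : δ ≤ a)
    (hv : v = -|e| + l₀ * a - δ) (hl : l₀ ≤ l) {p : ℂ × ℂ} (hp : p ∈ halfDom v)
    {t : Fin l → ℂ} (ht : t ∈ tube a l) : δ / 2 * l ≤ ‖den e l p t‖ := by
  refine le_trans ?_ (Complex.re_le_norm _)
  have h1 : -|e| ≤ ((-1) ^ l * (e : ℂ)).re := by
    rcases Nat.even_or_odd l with h | h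
    · simp [h.neg_one_pow, neg_abs_le]
    · simp [h.neg_one_pow, le_abs_self]
  have h2 : (l : ℝ) * a ≤ (∑ i, t i).re := by
    rw [Complex.re_sum]
    calc (l : ℝ) * a = ∑ i : Fin l, a := by simp
      _ ≤ _ := Finset.sum_le_sum fun i _ => (ht i).le
  have h3 : p.1.re < v := hp
  simp only [den, Complex.sub_re, Complex.add_re]
  have h4 : (l₀ : ℝ) ≤ l := by exact_mod_cast hl
  have h5 : (l₀ : ℝ) ≤ 2 := by exact_mod_cast hl₀'
  nlinarith

namespace Model

variable {d : ℕ} {S : Model d} {h : Mom d → ℝ}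

/-- The inhomogeneity for `n = 0`. -/
def unitSource : EFam := fun l _ _ => if l = 1 then -1 else 0

/-- The inhomogeneity for `n = 1`. -/
def shiftFam (A : EFam) : EFam := fun l p t => A l (p.1 - p.2, 0) t

theorem holFam_unitSource (a : ℝ) (W : Set (ℂ × ℂ)) : HolFam a W unitSource where
  diff l := differentiableOn_const _
  bdd := ⟨1, fun l p _ t _ => by simp only [unitSource]; split_ifs <;> simp⟩
  symm l p _ t _ π := rfl
  real l p _ t _ := by simp only [unitSource]; split_ifs <;> simp

theorem shift_mem {v v' a : ℝ} (hv : v' = v + a) {p : ℂ × ℂ} (hp : p ∈ quarterDom v' a) :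
    ((p.1 - p.2, 0) : ℂ × ℂ) ∈ halfDom v := by
  simp only [quarterDom, halfDom, mem_ofPred_eq, Complex.sub_re] at *
  linarith [hp.1, hp.2]

theorem holFam_shiftFam {a v v' : ℝ} (hv : v' = v + a) {A : EFam} (hA : HolFam a (halfDom v) A) :
    HolFam a (quarterDom v' a) (shiftFam A) := by
  refine ⟨fun l => ?_, ?_, ?_, ?_⟩
  · refine (hA.diff l).comp (f := fun y : (ℂ × ℂ) × (Fin l → ℂ) =>
      (((y.1.1 - y.1.2, 0) : ℂ × ℂ), y.2)) ?_ fun y hy => ⟨shift_mem hv hy.1, hy.2⟩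
    exact Differentiable.differentiableOn (by fun_prop)
  · obtain ⟨M, hM⟩ := hA.bdd
    exact ⟨M, fun l p hp t ht => hM l _ (shift_mem hv hp) t ht⟩
  · exact fun l p hp t ht π => hA.symm l _ (shift_mem hv hp) t ht π
  · intro l p hp t ht
    have e : (((star p).1 - (star p).2, 0) : ℂ × ℂ) = star (p.1 - p.2, 0) := by ext <;> simp
    have := hA.real l _ (shift_mem hv hp) t ht
    rw [← e] at this
    exact this

/-- Existence of the scalar functions. -/
theorem exists_scalar (hω : DispersionLaw S.ω) (hlam : FormFactor S.lam h) {δ a v v' α e : ℝ}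
    (hδ : 0 < δ) (hδ2 : 2 * δ ≤ S.ω 0) (ha : a = S.ω 0 - δ) (he : |e| = S.ε)
    (hv : v = -S.ε + a - δ) (hv' : v' = -S.ε + 2 * a - δ) (hα : 0 ≤ α)
    (hsmall : α / (δ / 2) * (1 + S.lamMeasure.real univ) ≤ 1 / 2) :
    ∃ A B : EFam, HolFam a (halfDom v) A ∧ HolFam a (quarterDom v' a) B ∧
      (∀ l, ∀ p ∈ halfDom v, ∀ t ∈ tube a l,
        A l p t = sysOp S.lamMeasure S.ω e α 1 unitSource A l p t) ∧
      (∀ l, ∀ p ∈ quarterDom v' a, ∀ t ∈ tube a l,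
        B l p t = sysOp S.lamMeasure S.ω (-e) α 2 (shiftFam A) B l p t) ∧
      (∀ l, ∀ p ∈ halfDom v, ∀ t ∈ tube a l, ‖A l p t‖ ≤ 2 * (α / (δ / 2))) ∧
      (∀ l, ∀ p ∈ quarterDom v' a, ∀ t ∈ tube a l, ‖B l p t‖ ≤ (2 * (α / (δ / 2))) ^ 2) := by
  have := isFiniteMeasure_lamMeasure hlam
  have hm : Measurable S.ω := hω.contDiff.continuous.measurable
  have haω : ∀ q, a < S.ω q := fun q => by linarith [hω.min_le q]
  have hδa : δ ≤ a := by linarith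
  obtain ⟨A, hA, hAe, hAb⟩ := exists_sys (isOpen_halfDom v) star_mem_halfDom hm haω (e := e) (N := 1)
    (l₀ := 1) hα (half_pos hδ) le_rfl
    (fun l hl p hp t ht => mul_le_norm_den (l₀ := 1) (by norm_num) hδ hδa
      (by rw [hv, he]; push_cast; ring) hl hp ht)
    hsmall (holFam_unitSource a _) zero_le_one
    (fun l p _ t _ => by simp only [unitSource]; split_ifs <;> simp)
  simp only [mul_one] at hAb
  have hvv : v' = v + a := by rw [hv, hv']; ring
  -- The m = 1 component has one more spin flip, hence spin energy `-e`, and at least two bosons in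
  -- Q₁. Its source is the transfer term, the n = 0 solution at the energy z - τ, so `B` is of
  -- second order in α.
  obtain ⟨B, hB, hBe, hBb⟩ := exists_sys (isOpen_quarterDom v' a) star_mem_quarterDom hm haω (e := -e)
    (N := 2 * (α / (δ / 2))) (l₀ := 2) hα (half_pos hδ) (by norm_num)
    (fun l hl p hp t ht => mul_le_norm_den (l₀ := 2) le_rfl hδ hδa
      (by rw [hv', abs_neg, he]; push_cast; ring) hl (v := v') hp.1 ht)
    hsmall (holFam_shiftFam hvv hA) (by positivity)
    (fun l p hp t ht => hAb l _ (shift_mem hvv hp) t ht)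
  exact ⟨A, B, hA, hB, hAe, hBe, hAb, fun l p hp t ht => (hBb l p hp t ht).trans (le_of_eq (by ring))⟩

section Fam

variable {δ a v v' α e : ℝ} {A B : EFam} {z : ℂ}

theorem xHol_zeroFam (hA : HolFam a (halfDom v) A) {M : ℝ} (hM0 : 0 ≤ M)
    (hM : ∀ l, ∀ p ∈ halfDom v, ∀ t ∈ tube a l, ‖A l p t‖ ≤ M) (hz : z.re < v) :
    XHol a M (zeroFam z A) := by
  have hp : ((z, 0) : ℂ × ℂ) ∈ halfDom v := hz
  refine ⟨fun l j m => ?_, fun l j m t ht s hs u hu => ?_, fun l j m t ht s hs u hu π π' => ?_⟩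
  · match j, m with
    | 0, 0 =>
      refine (hA.diff l).comp (f := fun y : (Fin l → ℂ) × (Fin 0 → ℂ) × (Fin 0 → ℂ) =>
        (((z, 0) : ℂ × ℂ), y.1)) ?_ fun y hy => ⟨hp, hy.1⟩
      exact Differentiable.differentiableOn (by fun_prop)
    | 0, m + 1 => exact differentiableOn_const (c := (0 : ℂ))
    | j + 1, m => exact differentiableOn_const (c := (0 : ℂ))
  · match j, m with
    | 0, 0 => exact hM l _ hp t ht
    | 0, m + 1 => simpa [zeroFam] using hM0
    | j + 1, m => simpa [zeroFam] using hM0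
  · match j, m with
    | 0, 0 => exact hA.symm l _ hp t ht π
    | 0, m + 1 => rfl
    | j + 1, m => rfl

theorem xHol_oneFam (hvv : v' = v + a) (hA : HolFam a (halfDom v) A)
    (hB : HolFam a (quarterDom v' a) B) {M : ℝ} (hM0 : 0 ≤ M)
    (hM : ∀ l, ∀ p ∈ halfDom v, ∀ t ∈ tube a l, ‖A l p t‖ ≤ M)
    (hM' : ∀ l, ∀ p ∈ quarterDom v' a, ∀ t ∈ tube a l, ‖B l p t‖ ≤ M) (hz : z.re < v') :
    XHol a M (oneFam z A B) := by
  have hpA : ∀ s : Fin 1 → ℂ, s ∈ tube a 1 → ((z - s 0, 0) : ℂ × ℂ) ∈ halfDom v := fun s hs =>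
    shift_mem hvv (p := (z, s 0)) ⟨hz, hs 0⟩
  have hpB : ∀ u : Fin 1 → ℂ, u ∈ tube a 1 → ((z, u 0) : ℂ × ℂ) ∈ quarterDom v' a := fun u hu =>
    ⟨hz, hu 0⟩
  refine ⟨fun l j m => ?_, fun l j m t ht s hs u hu => ?_, fun l j m t ht s hs u hu π π' => ?_⟩
  · match j, m with
    | 0, 0 => exact differentiableOn_const (c := (0 : ℂ))
    | 0, 1 =>
      refine (hB.diff l).comp (f := fun y : (Fin l → ℂ) × (Fin 0 → ℂ) × (Fin 1 → ℂ) =>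
        (((z, y.2.2 0) : ℂ × ℂ), y.1)) ?_ fun y hy => ⟨hpB _ hy.2.2, hy.1⟩
      exact Differentiable.differentiableOn (by fun_prop)
    | 1, 0 =>
      refine (hA.diff l).comp (f := fun y : (Fin l → ℂ) × (Fin 1 → ℂ) × (Fin 0 → ℂ) =>
        (((z - y.2.1 0, 0) : ℂ × ℂ), y.1)) ?_ fun y hy => ⟨hpA _ hy.2.1, hy.1⟩
      exact Differentiable.differentiableOn (by fun_prop)
    | 0, m + 2 => exact differentiableOn_const (c := (0 : ℂ))
    | 1, m + 1 => exact differentiableOn_const (c := (0 : ℂ))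
    | j + 2, m => exact differentiableOn_const (c := (0 : ℂ))
  · match j, m with
    | 0, 0 => simpa [oneFam] using hM0
    | 0, 1 => exact hM' l _ (hpB u hu) t ht
    | 1, 0 => exact hM l _ (hpA s hs) t ht
    | 0, m + 2 => simpa [oneFam] using hM0
    | 1, m + 1 => simpa [oneFam] using hM0
    | j + 2, m => simpa [oneFam] using hM0
  · match j, m with
    | 0, 0 => rfl
    | 0, 1 => exact hB.symm l _ (hpB u hu) t ht π
    | 1, 0 =>
      have : (s ∘ π') 0 = s 0 := by simp [Subsingleton.elim (π' 0) 0]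
      simp only [oneFam, this]
      exact hA.symm l _ (hpA s hs) t ht π
    | 0, m + 2 => rfl
    | 1, m + 1 => rfl
    | j + 2, m => rfl

theorem zeroFam_index (l j m : ℕ) (h : j + m ≠ 0) : zeroFam z A l j m = 0 := by
  match j, m with
  | 0, 0 => exact absurd rfl h
  | 0, m + 1 => rfl
  | j + 1, m => rfl

theorem oneFam_index (l j m : ℕ) (h : j + m ≠ 1) : oneFam z A B l j m = 0 := by
  match j, m with
  | 0, 0 => rfl
  | 0, 1 => exact absurd rfl h
  | 1, 0 => exact absurd rfl h
  | 0, m + 2 => rfl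
  | 1, m + 1 => rfl
  | j + 2, m => rfl

theorem sysOp_eq_zero {X : Type*} [MeasurableSpace X] {ρ : Measure X} {ω : X → ℝ} {l₀ l : ℕ}
    (hl : l < l₀) (g x : EFam) (p : ℂ × ℂ) (t : Fin l → ℂ) : sysOp ρ ω e α l₀ g x l p t = 0 :=
  if_neg (by omega)

theorem integrable_xHol (hω : DispersionLaw S.ω) (hlam : FormFactor S.lam h) (haω : ∀ q, a < S.ω q)
    {M : ℝ} {X : XFam} (hX : XHol a M X) (l j m : ℕ) (q : Fin l → Mom d) (p : Fin j → Mom d)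
    (k : Fin m → Mom d) :
    Integrable (fun x => X (l + 1) j m (Fin.snoc (α := fun _ => ℂ) (S.en q) (S.ω x : ℂ))
      (S.en p) (S.en k)) S.lamMeasure := by
  have := isFiniteMeasure_lamMeasure hlam
  refine Integrable.of_bound (C := M) ?_ (Eventually.of_forall fun x =>
    hX.bdd _ _ _ _ (tube_snoc (S.en_mem haω q) (by simpa using haω x)) _ (S.en_mem haω p) _
      (S.en_mem haω k))
  refine (stronglyMeasurable_comp_energy hω.contDiff.continuous.measurable haω
    (f := fun s => X (l + 1) j m (Fin.snoc (α := fun _ => ℂ) (S.en q) s) (S.en p) (S.en k)) ?_)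
    |>.aestronglyMeasurable
  refine (hX.diff (l + 1) j m).continuousOn.comp
    (f := fun s : ℂ => (Fin.snoc (α := fun _ => ℂ) (S.en q) s, S.en p, S.en k)) ?_
    fun s hs => ⟨tube_snoc (S.en_mem haω q) hs, S.en_mem haω p, S.en_mem haω k⟩
  exact ((continuous_snd.comp (continuous_snoc l (0 : ℂ × ℂ) (S.en q))).prodMk
    continuous_const).continuousOn

theorem sum_en {l : ℕ} (q : Fin l → Mom d) : ∑ i, S.en q i = ((S.energy q : ℝ) : ℂ) := by
  simp [en, energy]

theorem scalarEq_zeroFam (hδ : 0 < δ) (hδa : δ ≤ a) (haω : ∀ q, a < S.ω q) (he : |e| = S.ε)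
    (hv : v = -S.ε + a - δ)
    (hAe : ∀ l, ∀ p ∈ halfDom v, ∀ t ∈ tube a l,
        A l p t = sysOp S.lamMeasure S.ω e α 1 unitSource A l p t) (hz : z.re < v) :
    S.ScalarEq e α 0 z (zeroFam z A) := by
  intro l j m hjm hml q p k
  obtain ⟨rfl, rfl⟩ : j = 0 ∧ m = 0 := by omega
  have hp : ((z, 0) : ℂ × ℂ) ∈ halfDom v := hz
  have hq := S.en_mem haω q
  have hden := mul_le_norm_den (e := e) (l₀ := 1) (by norm_num) hδ hδa
    (by rw [hv, he]; push_cast; ring) hml hp hq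
  have hl : (0 : ℝ) < l := by exact_mod_cast hml
  have hE : (-1) ^ (l + 0) * (e : ℂ) + ((S.energy q + S.energy p : ℝ) : ℂ) - z
      = den e l (z, 0) (S.en q) := by
    rw [den, sum_en]; simp [energy]
  rw [hE]
  refine ⟨norm_pos_iff.mp (lt_of_lt_of_le (by positivity) hden), ?_⟩
  have h1 := hAe l _ hp _ hq
  rw [sysOp, if_pos (show 1 ≤ l from hml)] at h1
  have hg : unitSource l (z, 0) (S.en q) = -(if l = 1 ∧ (0 : ℕ) = 0 then (1 : ℂ) else 0) := by
    simp only [unitSource, and_true]; split_ifs <;> simp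
  have hcrt : (zeroFam z A).crt l 0 0 (S.en q) (S.en p) (S.en k) = crt A l (z, 0) (S.en q) := by
    cases l <;> rfl
  have htr : (zeroFam z A).tr l 0 0 (S.en q) (S.en p) (S.en k) = 0 := rfl
  have hann : S.Xann (zeroFam z A) l 0 0 (S.en q) (S.en p) (S.en k)
      = ann S.lamMeasure S.ω A l (z, 0) (S.en q) := rfl
  rw [hg, ← sub_eq_add_neg] at h1
  rw [hcrt, htr, hann, add_zero]
  exact h1

/-- For m = 0 the boson in Q₂ is a spectator: it merely lowers the energy to z - ω(p), so the n = 0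
solution applies. For m = 1 the variable k adds a spin flip, which turns e into -e, and the transfer
term becomes the inhomogeneity. -/
theorem scalarEq_oneFam (hδ : 0 < δ) (hδa : δ ≤ a) (haω : ∀ q, a < S.ω q) (he : |e| = S.ε)
    (hv : v = -S.ε + a - δ) (hv' : v' = -S.ε + 2 * a - δ)
    (hAe : ∀ l, ∀ p ∈ halfDom v, ∀ t ∈ tube a l,
        A l p t = sysOp S.lamMeasure S.ω e α 1 unitSource A l p t)
    (hBe : ∀ l, ∀ p ∈ quarterDom v' a, ∀ t ∈ tube a l,
        B l p t = sysOp S.lamMeasure S.ω (-e) α 2 (shiftFam A) B l p t) (hz : z.re < v') :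
    S.ScalarEq e α 1 z (oneFam z A B) := by
  have hvv : v' = v + a := by rw [hv, hv']; ring
  intro l j m hjm hml q p k
  have hq := S.en_mem haω q
  have hl : (0 : ℝ) < l := by exact_mod_cast (by omega : 0 < l)
  rcases (by omega : (j = 1 ∧ m = 0) ∨ (j = 0 ∧ m = 1)) with ⟨rfl, rfl⟩ | ⟨rfl, rfl⟩
  · have hp : ((z - S.en p 0, 0) : ℂ × ℂ) ∈ halfDom v :=
      shift_mem hvv (p := (z, S.en p 0)) ⟨hz, S.en_mem haω p 0⟩
    have hden := mul_le_norm_den (e := e) (l₀ := 1) (by norm_num) hδ hδa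
      (by rw [hv, he]; push_cast; ring) hml hp hq
    have hE : (-1) ^ (l + 0) * (e : ℂ) + ((S.energy q + S.energy p : ℝ) : ℂ) - z
        = den e l (z - S.en p 0, 0) (S.en q) := by
      rw [den, sum_en]
      simp [energy, en]
      ring
    rw [hE]
    refine ⟨norm_pos_iff.mp (lt_of_lt_of_le (by positivity) hden), ?_⟩
    have h1 := hAe l _ hp _ hq
    rw [sysOp, if_pos (show 1 ≤ l from hml)] at h1
    have hg : unitSource l (z - S.en p 0, 0) (S.en q)
        = -(if l = 1 ∧ (0 : ℕ) = 0 then (1 : ℂ) else 0) := by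
      simp only [unitSource, and_true]; split_ifs <;> simp
    have hcrt : (oneFam z A B).crt l 1 0 (S.en q) (S.en p) (S.en k)
        = crt A l (z - S.en p 0, 0) (S.en q) := by
      cases l <;> rfl
    have htr : (oneFam z A B).tr l 1 0 (S.en q) (S.en p) (S.en k) = 0 := rfl
    have hann : S.Xann (oneFam z A B) l 1 0 (S.en q) (S.en p) (S.en k)
        = ann S.lamMeasure S.ω A l (z - S.en p 0, 0) (S.en q) := rfl
    rw [hg, ← sub_eq_add_neg] at h1
    rw [hcrt, htr, hann, add_zero]
    exact h1
  · have hp : ((z, S.en k 0) : ℂ × ℂ) ∈ quarterDom v' a := ⟨hz, S.en_mem haω k 0⟩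
    have hden := mul_le_norm_den (e := -e) (l₀ := 2) le_rfl hδ hδa
      (by rw [hv', abs_neg, he]; push_cast; ring) hml (v := v') (p := (z, S.en k 0)) hp.1 hq
    have hE : (-1) ^ (l + 1) * (e : ℂ) + ((S.energy q + S.energy p : ℝ) : ℂ) - z
        = den (-e) l (z, S.en k 0) (S.en q) := by
      rw [den, sum_en]
      simp [energy, pow_succ]
    rw [hE]
    refine ⟨norm_pos_iff.mp (lt_of_lt_of_le (by positivity) hden), ?_⟩
    have h1 := hBe l _ hp _ hq
    rw [sysOp, if_pos (show 2 ≤ l from hml)] at h1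
    have hcrt : (oneFam z A B).crt l 0 1 (S.en q) (S.en p) (S.en k)
        = crt B l (z, S.en k 0) (S.en q) := by
      cases l <;> rfl
    have htr : (oneFam z A B).tr l 0 1 (S.en q) (S.en p) (S.en k)
        = shiftFam A l (z, S.en k 0) (S.en q) := by
      simp only [XFam.tr, oneFam, shiftFam]
      rfl
    have hann : S.Xann (oneFam z A B) l 0 1 (S.en q) (S.en p) (S.en k)
        = ann S.lamMeasure S.ω B l (z, S.en k 0) (S.en q) := rfl
    rw [hcrt, htr, hann, if_neg (by simp), sub_zero, add_right_comm]
    rw [add_right_comm] at h1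
    exact h1

end Fam

end Model

/-! ### Uniqueness of the coefficient functions. -/

namespace Model

variable {d : ℕ} {S : Model d} {h : Mom d → ℝ}

/-- The weight `∏ h(qᵢ) ∏ h(kᵢ)`. -/
def hw (h : Mom d → ℝ) {l m : ℕ} (q : Fin l → Mom d) (k : Fin m → Mom d) : ℝ :=
  (∏ i, h (q i)) * ∏ i, h (k i)

theorem hw_nonneg (hh : ∀ q, 0 < h q) {l m : ℕ} (q : Fin l → Mom d) (k : Fin m → Mom d) :
    0 ≤ hw h q k :=
  mul_nonneg (Finset.prod_nonneg fun _ _ => (hh _).le) (Finset.prod_nonneg fun _ _ => (hh _).le)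

theorem hw_succAbove {l m : ℕ} (q : Fin (l + 1) → Mom d) (k : Fin m → Mom d) (i : Fin (l + 1)) :
    h (q i) * hw h (fun b => q (i.succAbove b)) k = hw h q k := by
  simp only [hw]
  rw [Fin.prod_univ_succAbove (fun b => h (q b)) i, mul_assoc]

theorem hw_snoc {l m : ℕ} (q : Fin l → Mom d) (k : Fin m → Mom d) (x : Mom d) :
    hw h (Fin.snoc (α := fun _ => Mom d) q x) k = hw h q k * h x := by
  simp only [hw]
  rw [Fin.prod_univ_castSucc]
  simp only [Fin.snoc_castSucc, Fin.snoc_last]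
  ring

theorem hw_castSucc {l m : ℕ} (q : Fin l → Mom d) (k : Fin (m + 1) → Mom d) :
    h (k (Fin.last m)) * hw h q (fun b => k b.castSucc) = hw h q k := by
  simp only [hw]
  rw [Fin.prod_univ_castSucc (fun b => h (k b))]
  ring

theorem continuous_snoc_mom {l : ℕ} (q : Fin l → Mom d) :
    Continuous fun x : Mom d => Fin.snoc (α := fun _ => Mom d) q x := by
  refine continuous_pi fun i => ?_
  induction i using Fin.lastCases with
  | last => simpa using continuous_id'
  | cast j => simpa using continuous_const

theorem integrable_annihilate (hlam : FormFactor S.lam h) {n : ℕ} {μ : Family d}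
    (hμ : IsCoeffFamily h n μ) (l j m : ℕ) (q : Fin l → Mom d) (p : Fin j → Mom d)
    (k : Fin m → Mom d) :
    Integrable fun x => star (S.lam x) • μ (l + 1) j m (Fin.snoc (α := fun _ => Mom d) q x) p k := by
  obtain ⟨M, hM⟩ := hμ.bound
  have hc : Continuous fun x => star (S.lam x) •
      μ (l + 1) j m (Fin.snoc (α := fun _ => Mom d) q x) p k := by
    refine (continuous_star.comp hlam.contDiff.continuous).smul ?_
    exact (hμ.contDiff (l + 1) j m).continuous.comp
      (f := fun x => (Fin.snoc (α := fun _ => Mom d) q x, p, k))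
      ((continuous_snoc_mom q).prodMk continuous_const)
  refine (hlam.h_memLp.integrable_sq.const_mul (M * hw h q k)).mono' hc.aestronglyMeasurable
    (Eventually.of_forall fun x => ?_)
  have h1 := hM.value (l + 1) j m (Fin.snoc (α := fun _ => Mom d) q x) p k
  have h2 : (∏ i, h (Fin.snoc (α := fun _ => Mom d) q x i)) * ∏ i, h (k i) = hw h q k * h x :=
    hw_snoc q k x
  rw [h2] at h1
  rw [norm_smul, norm_star]
  calc ‖S.lam x‖ * _ ≤ h x * (M * (hw h q k * h x)) :=
        mul_le_mul (hlam.bound x) h1 (norm_nonneg _) (hlam.h_pos x).le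
    _ = _ := by ring

theorem norm_freeRes_le {z : ℂ} {s c : ℝ} (hc : 0 < c) (hs : c ≤ -|S.ε| + s - z.re) :
    ‖S.freeRes z s‖ ≤ dgC * c⁻¹ := by
  have key : ∀ e : ℝ, |e| = |S.ε| → c ≤ ‖(e : ℂ) + s - z‖ := by
    intro e he
    refine le_trans ?_ (Complex.re_le_norm _)
    simp only [Complex.sub_re, Complex.add_re, Complex.ofReal_re]
    linarith [neg_abs_le e]
  have h1 := key S.ε rfl
  have h2 := key (-S.ε) (abs_neg _)
  rw [Complex.ofReal_neg] at h2
  rw [S.freeRes_eq (norm_pos_iff.mp (hc.trans_le h1)) (norm_pos_iff.mp (hc.trans_le h2))]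
  refine norm_dg_le ?_ ?_ <;> rw [norm_inv]
  · exact inv_anti₀ hc h1
  · exact inv_anti₀ hc h2

/-- For a small coupling the coefficient equation has at most one solution. -/
theorem isCoeff_unique (hlam : FormFactor S.lam h) {α c : ℝ} {n : ℕ} {z : ℂ}
    (hα : 0 ≤ α) (hc : 0 < c)
    (hden : ∀ l j m, j + m = n → m < l → ∀ (q : Fin l → Mom d) (p : Fin j → Mom d),
      c * l ≤ -|S.ε| + (S.energy q + S.energy p) - z.re)
    (hsmall : α * (dgC * c⁻¹ * ‖σ₁‖) * (2 + ∫ x, h x ^ 2) ≤ 1 / 2)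
    {μ ν : Family d} (hμ : S.IsCoeff h α n z μ) (hν : S.IsCoeff h α n z ν) : μ = ν := by
  set Λ := ∫ x, h x ^ 2
  have hΛ : 0 ≤ Λ := integral_nonneg fun x => by positivity
  have hh := hlam.h_pos
  obtain ⟨M₁, hM₁⟩ := hμ.mem.bound
  obtain ⟨M₂, hM₂⟩ := hν.mem.bound
  -- An arbitrary solution in `ℬ_n` need not be known to depend on energies only, so the comparison
  -- is made in the sup norm weighted by ∏ h(qᵢ) ∏ h(kᵢ). Each use of the equation halves the bound
  -- for the difference of two solutions.
  have hstep : ∀ M : ℝ, 0 ≤ M → (∀ l j m q p k, ‖μ l j m q p k - ν l j m q p k‖ ≤ M * hw h q k) →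
      ∀ l j m q p k, ‖μ l j m q p k - ν l j m q p k‖ ≤ M / 2 * hw h q k := by
    intro M hM0 hM l j m q p k
    have hw0 := hw_nonneg hh q k
    by_cases hjm : j + m = n
    swap
    · rw [hμ.mem.index l j m hjm, hν.mem.index l j m hjm]
      simp only [Pi.zero_apply, sub_self, norm_zero]
      positivity
    by_cases hml : m < l
    swap
    · rw [hμ.mem.vanish l j m (not_lt.mp hml), hν.mem.vanish l j m (not_lt.mp hml)]
      simp only [Pi.zero_apply, sub_self, norm_zero]
      positivity
    have hl : (1 : ℝ) ≤ l := by exact_mod_cast (by omega : 1 ≤ l)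
    have e1 := hμ.eqn l j m hjm hml q p k
    have e2 := hν.eqn l j m hjm hml q p k
    have e3 : μ l j m q p k - ν l j m q p k = S.Gam α z ν l j m q p k - S.Gam α z μ l j m q p k := by
      rw [← e2] at e1
      rw [sub_eq_sub_iff_add_eq_add, e1, add_comm]
    set R := S.freeRes z (S.energy q + S.energy p) * σ₁
    set u := (S.createTerm ν l j m q p k - S.createTerm μ l j m q p k)
      + (S.annihilateTerm ν l j m q p k - S.annihilateTerm μ l j m q p k)
      + (S.transferTerm ν l j m q p k - S.transferTerm μ l j m q p k) with hu
    have e4 : μ l j m q p k - ν l j m q p k = (α : ℂ) • (R * u) := by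
      rw [e3, Gam, Gam, ← smul_sub, ← mul_sub]
      congr 2
      rw [hu]; abel
    have c1 : ‖S.createTerm ν l j m q p k - S.createTerm μ l j m q p k‖ ≤ l * (M * hw h q k) := by
      obtain ⟨l, rfl⟩ : ∃ l', l = l' + 1 := ⟨l - 1, by omega⟩
      simp only [createTerm]
      rw [← Finset.sum_sub_distrib]
      refine (norm_sum_le_of_le (n := fun _ => M * hw h q k) _ fun i _ => ?_).trans (by simp)
      rw [← smul_sub, norm_smul, ← hw_succAbove q k i, norm_sub_rev]
      calc _ ≤ h (q i) * (M * hw h (fun b => q (i.succAbove b)) k) :=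
            mul_le_mul (hlam.bound _) (hM _ _ _ _ _ _) (norm_nonneg _) (hh _).le
        _ = _ := by ring
    have c2 : ‖S.annihilateTerm ν l j m q p k - S.annihilateTerm μ l j m q p k‖
        ≤ M * hw h q k * Λ := by
      rw [annihilateTerm, annihilateTerm, ← integral_sub (integrable_annihilate hlam hν.mem l j m q p k)
        (integrable_annihilate hlam hμ.mem l j m q p k), ← integral_const_mul]
      refine norm_integral_le_of_norm_le (hlam.h_memLp.integrable_sq.const_mul _)
        (Eventually.of_forall fun x => ?_)
      rw [← smul_sub, norm_smul, norm_star, norm_sub_rev]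
      have := hM (l + 1) j m (Fin.snoc (α := fun _ => Mom d) q x) p k
      rw [hw_snoc] at this
      calc _ ≤ h x * (M * (hw h q k * h x)) :=
            mul_le_mul (hlam.bound _) this (norm_nonneg _) (hh _).le
        _ = _ := by ring
    have c3 : ‖S.transferTerm ν l j m q p k - S.transferTerm μ l j m q p k‖ ≤ M * hw h q k := by
      cases m with
      | zero =>
        simp only [transferTerm, sub_self, norm_zero]
        positivity
      | succ m =>
        simp only [transferTerm]
        rw [← smul_sub, norm_smul, norm_star, norm_sub_rev, ← hw_castSucc q k]
        calc _ ≤ h (k (Fin.last m)) * (M * hw h q (fun b => k b.castSucc)) :=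
              mul_le_mul (hlam.bound _) (hM _ _ _ _ _ _) (norm_nonneg _) (hh _).le
          _ = _ := by ring
    have hw1 : 0 ≤ M * hw h q k := mul_nonneg hM0 hw0
    -- Creation and transfer account for the 2, annihilation for Λ. The factor `l` cancels in the
    -- final estimate against `(c * l)⁻¹` from the free resolvent.
    have cu : ‖u‖ ≤ l * ((2 + Λ) * (M * hw h q k)) := by
      refine norm_add₃_le.trans ((add_le_add (add_le_add c1 c2) c3).trans ?_)
      have : M * hw h q k * Λ ≤ l * (M * hw h q k * Λ) :=
        le_mul_of_one_le_left (mul_nonneg hw1 hΛ) hl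
      have : M * hw h q k ≤ l * (M * hw h q k) := le_mul_of_one_le_left hw1 hl
      linarith
    have cR : ‖R‖ ≤ dgC * (c * l)⁻¹ * ‖σ₁‖ :=
      (norm_mul_le _ _).trans (mul_le_mul_of_nonneg_right
        (norm_freeRes_le (by positivity) (hden l j m hjm hml q p)) (norm_nonneg _))
    rw [e4, norm_smul, Complex.norm_real, Real.norm_of_nonneg hα]
    have hd0 := dgC_nonneg
    calc α * ‖R * u‖ ≤ α * ((dgC * (c * l)⁻¹ * ‖σ₁‖) * (l * ((2 + Λ) * (M * hw h q k)))) := by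
          refine mul_le_mul_of_nonneg_left ((norm_mul_le _ _).trans ?_) hα
          exact mul_le_mul cR cu (norm_nonneg _) (by positivity)
      _ = (α * (dgC * c⁻¹ * ‖σ₁‖) * (2 + Λ)) * (M * hw h q k) := by field_simp
      _ ≤ 1 / 2 * (M * hw h q k) := mul_le_mul_of_nonneg_right hsmall hw1
      _ = _ := by ring
  set M := |M₁| + |M₂|
  have hM0 : 0 ≤ M := by positivity
  have hall : ∀ N : ℕ, ∀ l j m q p k, ‖μ l j m q p k - ν l j m q p k‖ ≤ M / 2 ^ N * hw h q k := by
    intro N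
    induction N with
    | zero =>
      intro l j m q p k
      have h1 := hM₁.value l j m q p k
      have h2 := hM₂.value l j m q p k
      have hw0 := hw_nonneg hh q k
      have h3 : ‖μ l j m q p k - ν l j m q p k‖ ≤ M₁ * hw h q k + M₂ * hw h q k :=
        (norm_sub_le _ _).trans (add_le_add h1 h2)
      simp only [pow_zero, div_one]
      nlinarith [le_abs_self M₁, le_abs_self M₂]
    | succ N ih =>
      intro l j m q p k
      have := hstep (M / 2 ^ N) (by positivity) ih l j m q p k
      rw [pow_succ, ← div_div]
      exact this
  funext l j m q p k
  rw [← sub_eq_zero, ← norm_le_zero_iff]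
  have hlim : Tendsto (fun N : ℕ => M / 2 ^ N * hw h q k) atTop (𝓝 0) := by
    have : Tendsto (fun N : ℕ => M / 2 ^ N) atTop (𝓝 0) :=
      tendsto_const_nhds.div_atTop (tendsto_pow_atTop_atTop_of_one_lt (by norm_num))
    simpa using this.mul_const (hw h q k)
  exact ge_of_tendsto' hlim fun N => hall N l j m q p k

theorem coeff_eq_of_unique {α : ℝ} {n : ℕ} {z : ℂ} {μ : Family d} (hμ : S.IsCoeff h α n z μ)
    (huniq : ∀ ν, S.IsCoeff h α n z ν → ν = μ) : S.coeff h α n z = μ := by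
  have hex : ∃ μ, S.IsCoeff h α n z μ := ⟨μ, hμ⟩
  rw [coeff, dif_pos hex]
  exact huniq _ hex.choose_spec

end Model

/-! ### The self-energy m(z) and the kernel D̂. -/

namespace Model

variable {d : ℕ} {S : Model d} {h : Mom d → ℝ}

theorem energy_ge (hω : DispersionLaw S.ω) {l : ℕ} (q : Fin l → Mom d) :
    l * S.ω 0 ≤ S.energy q := by
  rw [energy]
  calc (l : ℝ) * S.ω 0 = ∑ i : Fin l, S.ω 0 := by simp
    _ ≤ _ := Finset.sum_le_sum fun i _ => hω.min_le _

theorem lt_re_shift {v v' a : ℝ} (hvv : v' = v + a) {z τ : ℂ} (hz : z.re < v') (hτ : a < τ.re) :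
    (z - τ).re < v := by
  rw [Complex.sub_re]; linarith

section Scalar

variable {δ a v v' α e : ℝ} {A B : EFam}

/-- The self-energy `m(z)` in one column. -/
def selfEnergy (S : Model d) (α : ℝ) (A : EFam) (z : ℂ) : ℂ :=
  α * ann S.lamMeasure S.ω A 0 (z, 0) ![]

/-- The scalar kernel of `D̂` in one column. -/
def scalarKer (S : Model d) (α : ℝ) (A B : EFam) (z : ℂ) (s : ℂ × ℂ) : ℂ :=
  α * (ann S.lamMeasure S.ω B 1 (z, s.2) ![s.1] + A 1 (z - s.2, 0) ![s.1])

theorem tube_zero (t : Fin 0 → ℂ) : t ∈ tube a 0 := fun i => i.elim0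

theorem tube_one {s : ℂ} (hs : a < s.re) : ![s] ∈ tube a 1 := fun i => by
  fin_cases i; simpa using hs

theorem differentiableOn_selfEnergy (hω : DispersionLaw S.ω) (hlam : FormFactor S.lam h)
    (haω : ∀ q, a < S.ω q) (hA : HolFam a (halfDom v) A) :
    DifferentiableOn ℂ (S.selfEnergy α A) {z | z.re < v} := by
  have := isFiniteMeasure_lamMeasure hlam
  refine DifferentiableOn.const_mul ?_ _
  refine (hA.diff_ann (ρ := S.lamMeasure) (isOpen_halfDom v)
    hω.contDiff.continuous.measurable haω 0).comp
    (f := fun z : ℂ => (((z, 0), ![]) : (ℂ × ℂ) × (Fin 0 → ℂ))) ?_ fun z hz => ⟨hz, tube_zero _⟩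
  exact Differentiable.differentiableOn (by fun_prop)

/-- The measure and the energies ω are real, so the conjugation symmetry of the family survives
integration. It makes m real on the real axis, which is what forces the zeros of the effective
matrix to be real. -/
theorem selfEnergy_conj (hlam : FormFactor S.lam h)
    (haω : ∀ q, a < S.ω q) (hA : HolFam a (halfDom v) A) {z : ℂ} (hz : z.re < v) :
    S.selfEnergy α A (star z) = star (S.selfEnergy α A z) := by
  have := isFiniteMeasure_lamMeasure hlam
  have h1 := hA.ann_star (ρ := S.lamMeasure) haω (l := 0) (p := (z, 0)) hz (t := ![]) (tube_zero _)
  have h2 : (star ((z, 0) : ℂ × ℂ)) = (star z, 0) := by ext <;> simp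
  rw [h2, Subsingleton.elim (star ![]) ![]] at h1
  rw [selfEnergy, selfEnergy, h1]
  simp

theorem norm_selfEnergy_le (hlam : FormFactor S.lam h) (haω : ∀ q, a < S.ω q) (hα : 0 ≤ α) {M : ℝ}
    (hM : ∀ l, ∀ p ∈ halfDom v, ∀ t ∈ tube a l, ‖A l p t‖ ≤ M) {z : ℂ} (hz : z.re < v) :
    ‖S.selfEnergy α A z‖ ≤ α * (M * S.lamMeasure.real univ) := by
  have := isFiniteMeasure_lamMeasure hlam
  rw [selfEnergy, norm_mul, Complex.norm_real, Real.norm_of_nonneg hα]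
  exact mul_le_mul_of_nonneg_left (norm_ann_le haω (hM 1 (z, 0) hz) (tube_zero _)) hα

/-- Joint holomorphy in z and in both energies serves two purposes: in the energies it gives
smoothness and bounds in q and k, in z it gives analyticity of the kernel. -/
theorem differentiableOn_scalarKer (hω : DispersionLaw S.ω) (hlam : FormFactor S.lam h)
    (haω : ∀ q, a < S.ω q) (hvv : v' = v + a) (hA : HolFam a (halfDom v) A)
    (hB : HolFam a (quarterDom v' a) B) :
    DifferentiableOn ℂ (fun y : ℂ × ℂ × ℂ => S.scalarKer α A B y.1 y.2)
      ({z | z.re < v'} ×ˢ ({s | a < s.re} ×ˢ {s | a < s.re})) := by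
  have := isFiniteMeasure_lamMeasure hlam
  have hv1 : Differentiable ℂ fun y : ℂ × ℂ × ℂ => (![y.2.1] : Fin 1 → ℂ) := by
    rw [differentiable_pi]; intro i; fin_cases i
    simp only [Fin.zero_eta, Matrix.cons_val_zero]; fun_prop
  refine DifferentiableOn.const_mul (DifferentiableOn.fun_add ?_ ?_) _
  · refine (hB.diff_ann (ρ := S.lamMeasure) (isOpen_quarterDom v' a)
      hω.contDiff.continuous.measurable haω 1).comp
      (f := fun y : ℂ × ℂ × ℂ => (((y.1, y.2.2), ![y.2.1]) : (ℂ × ℂ) × (Fin 1 → ℂ))) ?_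
      fun y hy => ⟨⟨hy.1, hy.2.2⟩, tube_one hy.2.1⟩
    exact (Differentiable.prodMk (by fun_prop) hv1).differentiableOn
  · refine (hA.diff 1).comp
      (f := fun y : ℂ × ℂ × ℂ => (((y.1 - y.2.2, 0), ![y.2.1]) : (ℂ × ℂ) × (Fin 1 → ℂ))) ?_
      fun y hy => ⟨lt_re_shift hvv hy.1 hy.2.2, tube_one hy.2.1⟩
    exact (Differentiable.prodMk (by fun_prop) hv1).differentiableOn

theorem norm_scalarKer_le (hlam : FormFactor S.lam h) (haω : ∀ q, a < S.ω q) (hα : 0 ≤ α)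
    (hvv : v' = v + a) {M : ℝ} (hM : ∀ l, ∀ p ∈ halfDom v, ∀ t ∈ tube a l, ‖A l p t‖ ≤ M)
    (hM' : ∀ l, ∀ p ∈ quarterDom v' a, ∀ t ∈ tube a l, ‖B l p t‖ ≤ M)
    {z s τ : ℂ} (hz : z.re < v') (hs : a < s.re) (hτ : a < τ.re) :
    ‖S.scalarKer α A B z (s, τ)‖ ≤ α * (M * S.lamMeasure.real univ + M) := by
  have := isFiniteMeasure_lamMeasure hlam
  rw [scalarKer, norm_mul, Complex.norm_real, Real.norm_of_nonneg hα]
  refine mul_le_mul_of_nonneg_left ((norm_add_le _ _).trans (add_le_add ?_ ?_)) hα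
  · exact norm_ann_le haω (hM' 2 (z, τ) ⟨hz, hτ⟩) (tube_one hs)
  · exact hM 1 _ (lt_re_shift hvv hz hτ) _ (tube_one hs)

theorem snoc_zero_eq {A : Type*} (x : A) : Fin.snoc (α := fun _ => A) ![] x = ![x] := by
  funext i; fin_cases i; rfl

theorem snoc_one_eq {A : Type*} (q x : A) : Fin.snoc (α := fun _ => A) ![q] x = ![q, x] := by
  funext i; fin_cases i <;> rfl

theorem en_one (q : Mom d) : S.en ![q] = ![(S.ω q : ℂ)] := by
  funext i; fin_cases i; rfl

end Scalar

/-- The coefficient functions, the self-energy and the kernel `D̂` for a small coupling. -/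
theorem exists_coeff_data (hω : DispersionLaw S.ω) (hlam : FormFactor S.lam h) (hε : 0 < S.ε)
    {δ a v v' : ℝ} (hδ : 0 < δ) (hδ2 : 2 * δ ≤ S.ω 0) (ha : a = S.ω 0 - δ)
    (hv : v = -S.ε + a - δ) (hv' : v' = -S.ε + 2 * a - δ) :
    ∃ α₀ C : ℝ, 0 < α₀ ∧ 0 ≤ C ∧ ∀ α : ℝ, 0 ≤ α → α < α₀ →
      (∀ z : ℂ, z.re < v → ∃! μ, S.IsCoeff h α 0 z μ) ∧
      (∀ z : ℂ, z.re < v' → ∃! μ, S.IsCoeff h α 1 z μ) ∧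
      (∃ m₁ m₂ : ℂ → ℂ,
        (∀ m ∈ ({m₁, m₂} : Set (ℂ → ℂ)), DifferentiableOn ℂ m {z | z.re < v} ∧
          (∀ z : ℂ, z.re < v → m (star z) = star (m z)) ∧ ∀ z : ℂ, z.re < v → ‖m z‖ ≤ C * α) ∧
        ∀ z : ℂ, z.re < v → S.mMat h α z = dg (m₁ z) (m₂ z)) ∧
      ∃ X₁ X₂ : ℂ → ℂ × ℂ → ℂ,
        (∀ X ∈ ({X₁, X₂} : Set (ℂ → ℂ × ℂ → ℂ)),
          DifferentiableOn ℂ (fun y : ℂ × ℂ × ℂ => X y.1 y.2)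
            ({z | z.re < v'} ×ˢ ({s | a < s.re} ×ˢ {s | a < s.re})) ∧
          ∀ z s τ : ℂ, z.re < v' → a < s.re → a < τ.re → ‖X z (s, τ)‖ ≤ C * α) ∧
        ∀ z : ℂ, z.re < v' → ∀ q k, S.dKer h α z q k =
          (S.lam q * star (S.lam k)) • dg (X₁ z (S.ω q, S.ω k)) (X₂ z (S.ω q, S.ω k)) := by
  have hfin := isFiniteMeasure_lamMeasure hlam
  set Λ' := S.lamMeasure.real univ
  have hΛ' : 0 ≤ Λ' := measureReal_nonneg
  set Λ := ∫ x, h x ^ 2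
  have hΛ : 0 ≤ Λ := integral_nonneg fun x => by positivity
  have hdg := dgC_nonneg
  -- Each summand is one smallness requirement: contraction of the scalar systems, contraction in
  -- the uniqueness proof, and the bound 1 for the scalar solutions. For α < 1/(2(K+1)) one has αK ≤
  -- 1/2, which implies all three.
  set K := (1 + Λ') * (δ / 2)⁻¹ + dgC * (δ / 2)⁻¹ * ‖σ₁‖ * (2 + Λ) + 2 * (δ / 2)⁻¹ with hK
  have hK0 : 0 ≤ K := by positivity
  have haω : ∀ q, a < S.ω q := fun q => by linarith [hω.min_le q]
  have hδa : δ ≤ a := by linarith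
  have hvv : v' = v + a := by rw [hv, hv']; ring
  refine ⟨1 / (2 * (K + 1)), Λ' + 1, by positivity, by positivity, fun α hα hαlt => ?_⟩
  rw [lt_div_iff₀ (by positivity)] at hαlt
  have hαK : α * K ≤ 1 / 2 := by nlinarith
  have hs1 : α / (δ / 2) * (1 + Λ') ≤ 1 / 2 := by
    refine le_trans (le_of_eq ?_) (le_trans (mul_le_mul_of_nonneg_left
      (show (1 + Λ') * (δ / 2)⁻¹ ≤ K by
        have : 0 ≤ dgC * (δ / 2)⁻¹ * ‖σ₁‖ * (2 + Λ) + 2 * (δ / 2)⁻¹ := by positivity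
        rw [hK]; linarith) hα) hαK)
    rw [div_eq_mul_inv]; ring
  have hs2 : α * (dgC * (δ / 2)⁻¹ * ‖σ₁‖) * (2 + Λ) ≤ 1 / 2 := by
    refine le_trans (le_of_eq ?_) (le_trans (mul_le_mul_of_nonneg_left
      (show dgC * (δ / 2)⁻¹ * ‖σ₁‖ * (2 + Λ) ≤ K by
        have : 0 ≤ (1 + Λ') * (δ / 2)⁻¹ := by positivity
        have : 0 ≤ 2 * (δ / 2)⁻¹ := by positivity
        rw [hK]; linarith) hα) hαK)
    ring
  have hs3 : 2 * (α / (δ / 2)) ≤ 1 := by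
    have : α * (2 * (δ / 2)⁻¹) ≤ 1 / 2 := le_trans (mul_le_mul_of_nonneg_left
      (show 2 * (δ / 2)⁻¹ ≤ K by
        have : 0 ≤ (1 + Λ') * (δ / 2)⁻¹ := by positivity
        have : 0 ≤ dgC * (δ / 2)⁻¹ * ‖σ₁‖ * (2 + Λ) := by positivity
        rw [hK]; linarith) hα) hαK
    rw [div_eq_mul_inv]
    linarith
  have hs4 : 0 ≤ 2 * (α / (δ / 2)) := by positivity
  obtain ⟨A₁, B₁, hA₁, hB₁, eA₁, eB₁, bA₁, bB₁⟩ := exists_scalar (e := S.ε) hω hlam hδ hδ2 ha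
    (abs_of_pos hε) hv hv' hα hs1
  obtain ⟨A₂, B₂, hA₂, hB₂, eA₂, eB₂, bA₂, bB₂⟩ := exists_scalar (e := -S.ε) hω hlam hδ hδ2 ha
    (by rw [abs_neg, abs_of_pos hε]) hv hv' hα hs1
  replace bA₁ := fun l p hp t ht => (bA₁ l p hp t ht).trans hs3
  replace bA₂ := fun l p hp t ht => (bA₂ l p hp t ht).trans hs3
  replace bB₁ := fun l p hp t ht => (bB₁ l p hp t ht).trans (pow_le_one₀ hs4 hs3)
  replace bB₂ := fun l p hp t ht => (bB₂ l p hp t ht).trans (pow_le_one₀ hs4 hs3)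
  have hvan : ∀ {A : EFam} {e : ℝ}, (∀ l, ∀ p ∈ halfDom v, ∀ t ∈ tube a l,
      A l p t = sysOp S.lamMeasure S.ω e α 1 unitSource A l p t) →
      ∀ p ∈ halfDom v, ∀ t ∈ tube a 0, A 0 p t = 0 := fun hA p hp t ht => by
    rw [hA 0 p hp t ht, sysOp_eq_zero (by norm_num)]
  have hvanB : ∀ {A B : EFam} {e : ℝ}, (∀ l, ∀ p ∈ quarterDom v' a, ∀ t ∈ tube a l,
      B l p t = sysOp S.lamMeasure S.ω e α 2 (shiftFam A) B l p t) →
      ∀ l, l ≤ 1 → ∀ p ∈ quarterDom v' a, ∀ t ∈ tube a l, B l p t = 0 := fun hB l hl p hp t ht => by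
    rw [hB l p hp t ht, sysOp_eq_zero (by omega)]
  have vz : ∀ {A : EFam} {e : ℝ}, (∀ l, ∀ p ∈ halfDom v, ∀ t ∈ tube a l,
      A l p t = sysOp S.lamMeasure S.ω e α 1 unitSource A l p t) → ∀ z : ℂ, z.re < v →
      ∀ l j m, l ≤ m → ∀ (q : Fin l → Mom d) (p : Fin j → Mom d) (k : Fin m → Mom d),
      zeroFam z A l j m (S.en q) (S.en p) (S.en k) = 0 := by
    intro A e hA z hz l j m hlm q p k
    match j, m with
    | 0, 0 =>
      obtain rfl : l = 0 := by omega
      exact hvan hA (z, 0) hz _ (tube_zero _)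
    | 0, m + 1 => rfl
    | j + 1, m => rfl
  have vo : ∀ {A B : EFam} {e : ℝ}, (∀ l, ∀ p ∈ halfDom v, ∀ t ∈ tube a l,
      A l p t = sysOp S.lamMeasure S.ω e α 1 unitSource A l p t) →
      (∀ l, ∀ p ∈ quarterDom v' a, ∀ t ∈ tube a l,
        B l p t = sysOp S.lamMeasure S.ω (-e) α 2 (shiftFam A) B l p t) → ∀ z : ℂ, z.re < v' →
      ∀ l j m, l ≤ m → ∀ (q : Fin l → Mom d) (p : Fin j → Mom d) (k : Fin m → Mom d),
      oneFam z A B l j m (S.en q) (S.en p) (S.en k) = 0 := by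
    intro A B e hA hB z hz l j m hlm q p k
    match j, m with
    | 0, 0 => rfl
    | 0, 1 => exact hvanB hB l hlm (z, S.en k 0) ⟨hz, S.en_mem haω k 0⟩ _ (S.en_mem haω q)
    | 1, 0 =>
      obtain rfl : l = 0 := by omega
      exact hvan hA _ (lt_re_shift hvv hz (S.en_mem haω p 0)) _ (tube_zero _)
    | 0, m + 2 => rfl
    | 1, m + 1 => rfl
    | j + 2, m => rfl
  have hx0 : ∀ z : ℂ, z.re < v → XHol a 1 (zeroFam z A₁) ∧ XHol a 1 (zeroFam z A₂) := fun z hz =>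
    ⟨xHol_zeroFam hA₁ zero_le_one bA₁ hz, xHol_zeroFam hA₂ zero_le_one bA₂ hz⟩
  have hx1 : ∀ z : ℂ, z.re < v' → XHol a 1 (oneFam z A₁ B₁) ∧ XHol a 1 (oneFam z A₂ B₂) :=
    fun z hz => ⟨xHol_oneFam hvv hA₁ hB₁ zero_le_one bA₁ bB₁ hz,
      xHol_oneFam hvv hA₂ hB₂ zero_le_one bA₂ bB₂ hz⟩
  have hc0 : ∀ z : ℂ, z.re < v → S.IsCoeff h α 0 z (S.fam (zeroFam z A₁) (zeroFam z A₂)) := by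
    intro z hz
    refine isCoeff_fam hlam (isCoeffFamily_fam hω hlam (by linarith) zero_le_one (hx0 z hz).1
      (hx0 z hz).2 (fun l j m hjm => ⟨zeroFam_index l j m hjm, zeroFam_index l j m hjm⟩)
      fun l j m hlm q p k => ⟨vz eA₁ z hz l j m hlm q p k, vz eA₂ z hz l j m hlm q p k⟩)
      (scalarEq_zeroFam hδ hδa haω (abs_of_pos hε) hv eA₁ hz)
      (scalarEq_zeroFam hδ hδa haω (by rw [abs_neg, abs_of_pos hε]) hv eA₂ hz)
      (integrable_xHol hω hlam haω (hx0 z hz).1) (integrable_xHol hω hlam haω (hx0 z hz).2)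
  have hc1 : ∀ z : ℂ, z.re < v' → S.IsCoeff h α 1 z (S.fam (oneFam z A₁ B₁) (oneFam z A₂ B₂)) := by
    intro z hz
    refine isCoeff_fam hlam (isCoeffFamily_fam hω hlam (by linarith) zero_le_one (hx1 z hz).1
      (hx1 z hz).2 (fun l j m hjm => ⟨oneFam_index l j m hjm, oneFam_index l j m hjm⟩)
      fun l j m hlm q p k => ⟨vo eA₁ eB₁ z hz l j m hlm q p k, vo eA₂ eB₂ z hz l j m hlm q p k⟩)
      (scalarEq_oneFam hδ hδa haω (abs_of_pos hε) hv hv' eA₁ eB₁ hz)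
      (scalarEq_oneFam hδ hδa haω (by rw [abs_neg, abs_of_pos hε]) hv hv' eA₂ eB₂ hz)
      (integrable_xHol hω hlam haω (hx1 z hz).1) (integrable_xHol hω hlam haω (hx1 z hz).2)
  have hu0 : ∀ z : ℂ, z.re < v → ∀ ν, S.IsCoeff h α 0 z ν →
      ν = S.fam (zeroFam z A₁) (zeroFam z A₂) := by
    intro z hz ν hν
    refine isCoeff_unique hlam hα (half_pos hδ) (fun l j m hjm hml q p => ?_) hs2 hν (hc0 z hz)
    obtain ⟨rfl, rfl⟩ : j = 0 ∧ m = 0 := by omega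
    have h1 := energy_ge hω q
    have h2 := energy_ge hω p
    have h3 : (1 : ℝ) ≤ l := by exact_mod_cast hml
    rw [abs_of_pos hε]
    push_cast at h2
    nlinarith
  have hu1 : ∀ z : ℂ, z.re < v' → ∀ ν, S.IsCoeff h α 1 z ν →
      ν = S.fam (oneFam z A₁ B₁) (oneFam z A₂ B₂) := by
    intro z hz ν hν
    refine isCoeff_unique hlam hα (half_pos hδ) (fun l j m hjm hml q p => ?_) hs2 hν (hc1 z hz)
    have h1 := energy_ge hω q
    have h2 := energy_ge hω p
    rw [abs_of_pos hε]
    rcases (by omega : (j = 1 ∧ m = 0) ∨ (j = 0 ∧ m = 1)) with ⟨rfl, rfl⟩ | ⟨rfl, rfl⟩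
    · have h3 : (1 : ℝ) ≤ l := by exact_mod_cast hml
      push_cast at h2
      nlinarith
    · have h3 : (2 : ℝ) ≤ l := by exact_mod_cast hml
      push_cast at h2
      nlinarith
  refine ⟨fun z hz => ⟨_, hc0 z hz, hu0 z hz⟩, fun z hz => ⟨_, hc1 z hz, hu1 z hz⟩,
    ⟨S.selfEnergy α A₁, S.selfEnergy α A₂, ?_, ?_⟩,
    ⟨S.scalarKer α A₁ B₁, S.scalarKer α A₂ B₂, ?_, ?_⟩⟩
  · have key : ∀ A : EFam, HolFam a (halfDom v) A →
        (∀ l, ∀ p ∈ halfDom v, ∀ t ∈ tube a l, ‖A l p t‖ ≤ 1) →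
        DifferentiableOn ℂ (S.selfEnergy α A) {z | z.re < v} ∧
          (∀ z : ℂ, z.re < v → S.selfEnergy α A (star z) = star (S.selfEnergy α A z)) ∧
          ∀ z : ℂ, z.re < v → ‖S.selfEnergy α A z‖ ≤ (Λ' + 1) * α := fun A hA hb =>
      ⟨differentiableOn_selfEnergy hω hlam haω hA, fun z hz => selfEnergy_conj hlam haω hA hz,
        fun z hz => (norm_selfEnergy_le hlam haω hα hb hz).trans (by
          show α * (1 * Λ') ≤ _
          nlinarith)⟩
    rintro m (rfl | rfl)
    · exact key A₁ hA₁ bA₁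
    · exact key A₂ hA₂ bA₂
  · intro z hz
    have e1 := annihilateTerm_fam hlam (zeroFam z A₁) (zeroFam z A₂) 0 0 0 ![] ![] ![]
      (integrable_xHol hω hlam haω (hx0 z hz).1 0 0 0 ![] ![] ![])
      (integrable_xHol hω hlam haω (hx0 z hz).2 0 0 0 ![] ![] ![])
    simp only [annihilateTerm, snoc_zero_eq] at e1
    rw [mMat, coeff_eq_of_unique (hc0 z hz) (hu0 z hz)]
    rw [e1]
    -- No momenta are left, and the remaining flip cancels against the leading `σ₁`, so m(z) is
    -- diagonal.
    have e2 : S.wt (![] : Fin 0 → Mom d) (![] : Fin 0 → Mom d) = 1 := by simp [wt]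
    rw [e2, one_smul, pow_one, ← mul_assoc, σ₁_sq, one_mul, dg_smul,
      Subsingleton.elim (S.en (![] : Fin 0 → Mom d)) ![]]
    rfl
  · have key : ∀ A B : EFam, HolFam a (halfDom v) A → HolFam a (quarterDom v' a) B →
        (∀ l, ∀ p ∈ halfDom v, ∀ t ∈ tube a l, ‖A l p t‖ ≤ 1) →
        (∀ l, ∀ p ∈ quarterDom v' a, ∀ t ∈ tube a l, ‖B l p t‖ ≤ 1) →
        DifferentiableOn ℂ (fun y : ℂ × ℂ × ℂ => S.scalarKer α A B y.1 y.2)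
            ({z | z.re < v'} ×ˢ ({s | a < s.re} ×ˢ {s | a < s.re})) ∧
          ∀ z s τ : ℂ, z.re < v' → a < s.re → a < τ.re →
            ‖S.scalarKer α A B z (s, τ)‖ ≤ (Λ' + 1) * α := fun A B hA hB bA bB =>
      ⟨differentiableOn_scalarKer hω hlam haω hvv hA hB, fun z s τ hz hs hτ =>
        (norm_scalarKer_le hlam haω hα hvv bA bB hz hs hτ).trans (by
          show α * (1 * Λ' + 1) ≤ _
          nlinarith)⟩
    rintro X (rfl | rfl)
    · exact key A₁ B₁ hA₁ hB₁ bA₁ bB₁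
    · exact key A₂ B₂ hA₂ hB₂ bA₂ bB₂
  · intro z hz q k
    have e1 := annihilateTerm_fam hlam (oneFam z A₁ B₁) (oneFam z A₂ B₂) 1 0 1 ![q] ![] ![k]
      (integrable_xHol hω hlam haω (hx1 z hz).1 1 0 1 ![q] ![] ![k])
      (integrable_xHol hω hlam haω (hx1 z hz).2 1 0 1 ![q] ![] ![k])
    simp only [annihilateTerm, snoc_one_eq] at e1
    rw [dKer, coeff_eq_of_unique (hc1 z hz) (hu1 z hz)]
    rw [e1]
    have e2 : S.wt ![q] ![k] = S.lam q * star (S.lam k) := by simp [wt]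
    have e3 : S.wt ![q] ![] = S.lam q := by simp [wt]
    -- Both contributions to D̂ contain an even number of flips and the same weight λ(q) conj λ(k),
    -- so D̂ is this weight times a diagonal matrix.
    have e4 : σ₁ * σ₁ ^ (1 + 1 + 1) = 1 := by
      rw [← pow_succ', show 1 + 1 + 1 + 1 = 2 * 2 by norm_num, pow_mul, pow_two σ₁, σ₁_sq, one_pow]
    simp only [fam, e2, e3, en_one]
    rw [smul_smul, mul_smul_comm, mul_smul_comm, ← mul_assoc, ← mul_assoc, e4, one_mul,
      add_zero, pow_one, σ₁_sq, one_mul, mul_comm (star (S.lam k)), smul_comm (α : ℂ),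
      smul_comm (α : ℂ), ← smul_add, dg_smul, dg_smul, dg_add, ← mul_add, ← mul_add]
    rfl

end Model

/-! ### Perturbation of a simple zero -/

section Zero

theorem isOpen_re_lt (v : ℝ) : IsOpen {z : ℂ | z.re < v} :=
  isOpen_lt Complex.continuous_re continuous_const

/-- A bounded holomorphic function on a half-plane is Lipschitz continuous with respect to the
points of a smaller half-plane. -/
theorem norm_sub_le_of_re_lt {F : Type*} [NormedAddCommGroup F] [NormedSpace ℂ F] {f : ℂ → F}
    {v r M : ℝ} (hr : 0 < r) (hf : DifferentiableOn ℂ f {z | z.re < v})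
    (hM : ∀ z : ℂ, z.re < v → ‖f z‖ ≤ M) {x y : ℂ} (hx : x.re ≤ v - r) (hy : y.re < v) :
    ‖f y - f x‖ ≤ 2 * M / r * ‖y - x‖ := by
  have hxv : x.re < v := by linarith
  have hM0 : 0 ≤ M := (norm_nonneg _).trans (hM x hxv)
  -- Nearby points are compared by the Schwarz lemma on the ball of radius r; for distant ones 2M ≤
  -- (2M/r)‖y - x‖ is trivial.
  rcases lt_or_ge ‖y - x‖ r with h | h
  · have hsub : Metric.ball x r ⊆ {z : ℂ | z.re < v} := by
      intro w hw
      rw [Metric.mem_ball, dist_eq_norm] at hw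
      have := (Complex.abs_re_le_norm (w - x)).trans_lt hw
      rw [Complex.sub_re, abs_lt] at this
      simp only [mem_ofPred_eq]
      linarith
    exact norm_sub_le_of_ball hr (hf.mono hsub) (fun w hw => hM w (hsub hw))
      (by simpa [dist_eq_norm] using h)
  · refine (norm_sub_le _ _).trans ?_
    calc ‖f y‖ + ‖f x‖ ≤ 2 * M / r * r := by
          rw [div_mul_cancel₀ _ hr.ne']; linarith [hM y hy, hM x hxv]
      _ ≤ _ := by gcongr

/-- Away from the base point this is the Lipschitz bound. At the base point `dslope` is the
derivative, and the bound follows by continuity. -/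
theorem norm_dslope_le {f : ℂ → ℂ} {v r M : ℝ} (hr : 0 < r)
    (hf : DifferentiableOn ℂ f {z | z.re < v}) (hM : ∀ z : ℂ, z.re < v → ‖f z‖ ≤ M) {x y : ℂ}
    (hx : x.re ≤ v - r) (hy : y.re < v) : ‖dslope f x y‖ ≤ 2 * M / r := by
  have hM0 : 0 ≤ M := (norm_nonneg _).trans (hM y hy)
  have hxv : x.re < v := by linarith
  have hne : ∀ y : ℂ, y.re < v → y ≠ x → ‖dslope f x y‖ ≤ 2 * M / r := by
    intro y hy hyx
    rw [dslope_of_ne _ hyx, slope_def_module, norm_smul, norm_inv,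
      inv_mul_le_iff₀ (norm_pos_iff.mpr (sub_ne_zero.mpr hyx)), mul_comm]
    exact norm_sub_le_of_re_lt hr hf hM hx hy
  rcases eq_or_ne y x with rfl | hyx
  · have hcont : ContinuousAt (dslope f y) y := continuousAt_dslope_same.mpr
      ((hf y hxv).differentiableAt ((isOpen_re_lt v).mem_nhds hxv))
    have h1 : Tendsto (fun w => ‖dslope f y w‖) (𝓝[≠] y) (𝓝 ‖dslope f y y‖) :=
      (hcont.tendsto.mono_left nhdsWithin_le_nhds).norm
    refine le_of_tendsto h1 ?_
    filter_upwards [self_mem_nhdsWithin, mem_nhdsWithin_of_mem_nhds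
      ((isOpen_re_lt v).mem_nhds hxv)] with w hw hwv
    exact hne w hwv hw
  · exact hne y hy hyx

/-- If `m` is small, then `c - ζ - m(ζ)` has at most one zero, which is real and close to `c`, and
its reciprocal has at most a simple pole. -/
theorem exists_simple_zero {c v r b : ℝ} {m : ℂ → ℂ} (hr : 0 < r) (hb0 : 0 ≤ b) (hb : 16 * b ≤ r)
    (hm : DifferentiableOn ℂ m {z | z.re < v}) (hmc : ∀ z : ℂ, z.re < v → m (star z) = star (m z))
    (hmb : ∀ z : ℂ, z.re < v → ‖m z‖ ≤ b) :
    ∃ (e : ℝ) (ρ : ℂ) (g : ℂ → ℂ), |e - c| ≤ b ∧ ‖ρ‖ ≤ 2 ∧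
      DifferentiableOn ℂ g {z | z.re < v - r} ∧ (∀ z : ℂ, z.re < v - r → ‖g z‖ ≤ 16 / r) ∧
      (∀ z : ℂ, z.re < v - r → (c - z - m z = 0 ↔ z = e)) ∧
      ∀ z : ℂ, z.re < v - r → z ≠ e → (c - z - m z)⁻¹ = ρ * (e - z)⁻¹ + g z := by
  -- If c lies well inside the half-plane there is a zero near c. Otherwise c - z - m(z) stays away
  -- from 0 for Re z < v - r, and ρ = 0 will do.
  rcases lt_or_ge c (v - r / 2) with hc | hc
  · have hIcc : ∀ x ∈ Icc (c - b) (c + b), x ≤ v - r / 4 := fun x hx => by linarith [hx.2]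
    have hcont : ContinuousOn (fun x : ℝ => c - x - (m x).re) (Icc (c - b) (c + b)) := by
      refine ContinuousOn.sub (by fun_prop) (Complex.continuous_re.comp_continuousOn ?_)
      refine hm.continuousOn.comp Complex.continuous_ofReal.continuousOn fun x hx => ?_
      simp only [mem_ofPred_eq, Complex.ofReal_re]
      linarith [hIcc x hx]
    have hre : ∀ x : ℝ, x < v → |(m x).re| ≤ b := fun x hx =>
      (Complex.abs_re_le_norm _).trans (hmb x (by simpa using hx))
    -- The real part changes sign between c - b and c + b because |m| ≤ b. The imaginary part of m
    -- vanishes on the real axis by symmetry, so this is a zero of the full function.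
    obtain ⟨e, he, he0⟩ : (0 : ℝ) ∈ (fun x : ℝ => c - x - (m x).re) '' Icc (c - b) (c + b) := by
      refine intermediate_value_Icc' (by linarith) hcont ⟨?_, ?_⟩
      · have := abs_le.mp (hre (c + b) (by linarith))
        linarith
      · have := abs_le.mp (hre (c - b) (by linarith))
        linarith
    have hev : e ≤ v - r / 4 := hIcc e he
    have hev' : (e : ℂ).re < v := by simp only [Complex.ofReal_re]; linarith
    have hme : m e = (c : ℂ) - e := by
      have h1 := hmc e hev'
      simp only [RCLike.star_def, Complex.conj_ofReal] at h1
      have h2 : (m e).im = 0 := Complex.conj_eq_iff_im.mp h1.symm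
      apply Complex.ext
      · simp only [Complex.sub_re, Complex.ofReal_re]; simp only at he0; linarith
      · simpa using h2
    -- This is the factorization c - z - m(z) = (e - z) ψ(z). The slope of m is at most 2b/(r/4) =
    -- 8b/r ≤ 1/2, so ψ has no zeros, `e` is the only zero, and |1/ψ| ≤ 2.
    set ψ : ℂ → ℂ := fun z => 1 + dslope m e z with hψ
    have hds : ∀ z : ℂ, z.re < v → ‖dslope m e z‖ ≤ 1 / 2 := fun z hz => by
      refine (norm_dslope_le (r := r / 4) (by linarith) hm hmb (by simpa using hev) hz).trans ?_
      rw [div_le_iff₀ (by linarith)]; linarith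
    have hψb : ∀ z : ℂ, z.re < v → 1 / 2 ≤ ‖ψ z‖ := fun z hz => by
      have h1 := norm_sub_norm_le (1 : ℂ) (-dslope m e z)
      rw [norm_neg, sub_neg_eq_add, norm_one] at h1
      linarith [hds z hz]
    have hψ0 : ∀ z : ℂ, z.re < v → ψ z ≠ 0 := fun z hz h => by
      have := hψb z hz
      rw [h, norm_zero] at this
      linarith
    have hψd : DifferentiableOn ℂ (fun z => (ψ z)⁻¹) {z | z.re < v} := by
      refine DifferentiableOn.inv ?_ hψ0
      exact ((Complex.differentiableOn_dslope ((isOpen_re_lt v).mem_nhds hev')).mpr hm).const_add 1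
    have hψi : ∀ z : ℂ, z.re < v → ‖(ψ z)⁻¹‖ ≤ 2 := fun z hz => by
      rw [norm_inv]
      exact inv_le_of_inv_le₀ (by norm_num) (by linarith [hψb z hz])
    have hfac : ∀ z : ℂ, c - z - m z = (e - z) * ψ z := fun z => by
      have h1 : (z - e) * dslope m e z = m z - m e := by
        have := sub_smul_dslope m e z
        simpa using this
      simp only [hψ]
      linear_combination h1 - hme
    -- The singular part of 1/((e - z)ψ(z)) has the coefficient 1/ψ(e). The remainder is minus a
    -- slope of 1/ψ, bounded by 2·2/(r/4) = 16/r.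
    refine ⟨e, (ψ e)⁻¹, fun z => -dslope (fun z => (ψ z)⁻¹) e z, ?_, hψi e hev', ?_, ?_, ?_, ?_⟩
    · rw [abs_le]; exact ⟨by linarith [he.1], by linarith [he.2]⟩
    · refine (((Complex.differentiableOn_dslope ((isOpen_re_lt v).mem_nhds hev')).mpr hψd).mono
        fun z hz => ?_).neg
      simp only [mem_ofPred_eq] at hz ⊢; linarith
    · intro z hz
      rw [norm_neg]
      refine (norm_dslope_le (r := r / 4) (by linarith) hψd hψi (by simpa using hev)
        (by linarith)).trans (le_of_eq ?_)
      field_simp; norm_num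
    · intro z hz
      rw [hfac, mul_eq_zero, or_iff_left (hψ0 z (by linarith)), sub_eq_zero, eq_comm]
    · intro z hz hze
      have hez : (e : ℂ) - z ≠ 0 := sub_ne_zero.mpr hze.symm
      have h1 : (z - e) * dslope (fun z => (ψ z)⁻¹) e z = (ψ z)⁻¹ - (ψ e)⁻¹ := by
        have := sub_smul_dslope (fun z => (ψ z)⁻¹) (e : ℂ) z
        simpa using this
      rw [hfac, mul_inv]
      have h2 : (e - z) * (e - z : ℂ)⁻¹ = 1 := mul_inv_cancel₀ hez
      linear_combination (-(e - z : ℂ)⁻¹) * h1 - (dslope (fun z => (ψ z)⁻¹) e z) * h2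
  -- Here Re(c - z) ≥ r/2, while |m| ≤ r/16. The number c is returned as a dummy zero: it lies
  -- outside the region considered.
  · have hlow : ∀ z : ℂ, z.re < v - r → r / 4 ≤ ‖c - z - m z‖ := fun z hz => by
      have h1 := norm_sub_norm_le (c - z : ℂ) (m z)
      have h2 := Complex.re_le_norm (c - z : ℂ)
      simp only [Complex.sub_re, Complex.ofReal_re] at h2
      linarith [hmb z (by linarith)]
    have hne : ∀ z : ℂ, z.re < v - r → c - z - m z ≠ 0 := fun z hz h => by
      have := hlow z hz
      rw [h, norm_zero] at this
      linarith
    refine ⟨c, 0, fun z => (c - z - m z)⁻¹, by simpa using hb0, by simp, ?_, ?_, ?_, ?_⟩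
    · refine DifferentiableOn.inv (DifferentiableOn.sub (by fun_prop) (hm.mono fun z hz => ?_)) hne
      simp only [mem_ofPred_eq] at hz ⊢; linarith
    · intro z hz
      rw [norm_inv]
      refine (inv_anti₀ (by linarith) (hlow z hz)).trans ?_
      rw [inv_div]
      gcongr
      norm_num
    · intro z hz
      refine iff_of_false (hne z hz) ?_
      rintro rfl
      simp only [Complex.ofReal_re] at hz
      linarith
    · intro z hz _
      simp

end Zero

/-! ### Integration by parts along the gradient of the dispersion law -/

section Gradient

variable {d : ℕ} {ω : Mom d → ℝ}

theorem DispersionLaw.contDiff_fderiv (hω : DispersionLaw ω) : ContDiff ℝ 1 (fderiv ℝ ω) :=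
  hω.contDiff.fderiv_right (by norm_num)

/-- The gradient of the dispersion law vanishes to first order only. -/
theorem DispersionLaw.exists_gradient_lower (hω : DispersionLaw ω) (R : ℝ) :
    ∃ c, 0 < c ∧ ∀ q, ‖q‖ ≤ R → c * ‖q‖ ≤ ‖fderiv ℝ ω q‖ := by
  have h0 : fderiv ℝ ω 0 = 0 :=
    IsLocalMin.fderiv_eq_zero (Eventually.of_forall fun q => hω.min_le q)
  have hder : HasFDerivAt (fderiv ℝ ω) (fderiv ℝ (fderiv ℝ ω) 0) 0 :=
    (hω.contDiff_fderiv.differentiable (by norm_num) 0).hasFDerivAt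
  set Q := fderiv ℝ (fderiv ℝ ω) 0
  have hker : LinearMap.ker (Q : Mom d →ₗ[ℝ] (Mom d →L[ℝ] ℝ)) = ⊥ := by
    rw [LinearMap.ker_eq_bot']
    intro v hv
    by_contra hne
    have h1 := hω.nondegenerate v hne
    have h2 : Q v = 0 := hv
    change 0 < Q v v at h1
    rw [h2] at h1
    simp at h1
  -- A positive definite Hessian is injective, hence bounded below in finite dimension, so |∇ω| ≥
  -- |q|/(2K) near 0. Away from 0 the gradient has a positive minimum on the compact remainder.
  obtain ⟨K, hK, hanti⟩ := LinearMap.exists_antilipschitzWith _ hker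
  have hK' : (0 : ℝ) < K := by exact_mod_cast hK
  have hQ : ∀ v, ‖v‖ ≤ K * ‖Q v‖ := fun v => by
    have := hanti.le_mul_dist v 0
    simpa using this
  have hlit := hder.isLittleO.def (show (0 : ℝ) < 1 / (2 * K) by positivity)
  obtain ⟨r, hr, hball⟩ := Metric.eventually_nhds_iff_ball.mp hlit
  have hcomp : IsCompact (Metric.closedBall (0 : Mom d) R ∩ (Metric.ball 0 r)ᶜ) :=
    (isCompact_closedBall _ _).inter_right Metric.isOpen_ball.isClosed_compl
  obtain ⟨m, hm, hmb⟩ := hcomp.exists_forall_le' (f := fun q => ‖fderiv ℝ ω q‖) (a := 0)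
    (hω.contDiff_fderiv.continuous.norm.continuousOn) (fun q hq => by
      refine norm_pos_iff.mpr (hω.no_critical q ?_)
      rintro rfl
      exact hq.2 (Metric.mem_ball_self hr))
  refine ⟨min (1 / (2 * K)) (m / max R 1), by positivity, fun q hq => ?_⟩
  by_cases hqr : q ∈ Metric.ball 0 r
  · have h1 := hball q hqr
    simp only [h0, sub_zero] at h1
    have h2 := norm_sub_norm_le (Q q) (fderiv ℝ ω q)
    rw [norm_sub_rev] at h2
    have h3 : 1 / K * ‖q‖ ≤ ‖Q q‖ := by
      rw [div_mul_eq_mul_div, one_mul, div_le_iff₀ hK', mul_comm]; exact hQ q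
    have h4 : 1 / (K : ℝ) * ‖q‖ = 2 * (1 / (2 * K) * ‖q‖) := by field_simp
    have h5 : min (1 / (2 * (K : ℝ))) (m / max R 1) * ‖q‖ ≤ 1 / (2 * K) * ‖q‖ := by
      gcongr; exact min_le_left _ _
    linarith
  · have h1 := hmb q ⟨by simpa using hq, hqr⟩
    refine le_trans ?_ h1
    calc _ ≤ m / max R 1 * max R 1 := by
          gcongr
          · exact min_le_right _ _
          · exact hq.trans (le_max_left _ _)
      _ = m := by field_simp

/-- The partial derivatives of `ω`. -/
def pd (ω : Mom d → ℝ) (i : Fin d) (q : Mom d) : ℝ := fderiv ℝ ω q (EuclideanSpace.single i 1)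

/-- The squared length of the gradient of `ω`. -/
def gradSq (ω : Mom d → ℝ) (q : Mom d) : ℝ := ∑ i, pd ω i q ^ 2

theorem gradSq_nonneg (q : Mom d) : 0 ≤ gradSq ω q := Finset.sum_nonneg fun _ _ => sq_nonneg _

theorem norm_sq_le_gradSq (q : Mom d) : ‖fderiv ℝ ω q‖ ^ 2 ≤ gradSq ω q := by
  have : ‖fderiv ℝ ω q‖ ≤ √(gradSq ω q) := by
    refine ContinuousLinearMap.opNorm_le_bound _ (Real.sqrt_nonneg _) fun x => ?_
    have hx : fderiv ℝ ω q x = ∑ i, pd ω i q * x i := by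
      conv_lhs => rw [← (EuclideanSpace.basisFun (Fin d) ℝ).sum_repr x]
      rw [map_sum]
      refine Finset.sum_congr rfl fun i _ => ?_
      simp [pd, mul_comm]
    rw [hx, EuclideanSpace.norm_eq, Real.norm_eq_abs]
    refine Real.abs_le_sqrt (Finset.sum_mul_sq_le_sq_mul_sq _ _ _) |>.trans (le_of_eq ?_)
    rw [show ∑ i, pd ω i q ^ 2 = gradSq ω q from rfl, Real.sqrt_mul (gradSq_nonneg q)]
    simp
  calc _ ≤ √(gradSq ω q) ^ 2 := by gcongr
    _ = _ := Real.sq_sqrt (gradSq_nonneg q)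

theorem abs_pd_le (i : Fin d) (q : Mom d) : |pd ω i q| ≤ √(gradSq ω q) :=
  Real.abs_le_sqrt (Finset.single_le_sum (f := fun i => pd ω i q ^ 2) (fun _ _ => sq_nonneg _)
    (Finset.mem_univ i))

theorem contDiff_pd (hω : DispersionLaw ω) (i : Fin d) : ContDiff ℝ 1 (pd ω i) :=
  hω.contDiff_fderiv.clm_apply contDiff_const

theorem norm_fderiv_pd_le (hω : DispersionLaw ω) (i : Fin d) (q : Mom d) :
    ‖fderiv ℝ (pd ω i) q‖ ≤ ‖fderiv ℝ (fderiv ℝ ω) q‖ := by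
  have h1 : HasFDerivAt (pd ω i) ((fderiv ℝ (fderiv ℝ ω) q).flip (EuclideanSpace.single i 1)) q := by
    have := ((hω.contDiff_fderiv.differentiable (by norm_num) q).hasFDerivAt).clm_apply
      (hasFDerivAt_const (EuclideanSpace.single i (1 : ℝ)) q)
    rw [ContinuousLinearMap.comp_zero, zero_add] at this
    exact this
  rw [h1.fderiv]
  refine (ContinuousLinearMap.le_opNorm _ _).trans ?_
  simp

/-- The regularized vector field `∇ω / (|∇ω|² + τ)`. -/
def field (ω : Mom d → ℝ) (τ : ℝ) (i : Fin d) (q : Mom d) : ℝ := pd ω i q / (gradSq ω q + τ)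

theorem contDiff_gradSq (hω : DispersionLaw ω) : ContDiff ℝ 1 (gradSq ω) :=
  ContDiff.sum fun i _ => (contDiff_pd hω i).pow 2

theorem contDiff_field (hω : DispersionLaw ω) {τ : ℝ} (hτ : 0 < τ) (i : Fin d) :
    ContDiff ℝ 1 (field ω τ i) :=
  (contDiff_pd hω i).div ((contDiff_gradSq hω).add contDiff_const) fun q => by
    have := gradSq_nonneg (ω := ω) q; positivity

/-- The bound does not depend on τ, so it survives the removal of the regularization; the same holds
for the derivative below. -/
theorem abs_field_le {τ : ℝ} (hτ : 0 < τ) (i : Fin d) {q : Mom d} (hq : 0 < gradSq ω q) :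
    |field ω τ i q| ≤ (√(gradSq ω q))⁻¹ := by
  rw [field, abs_div, abs_of_pos (show 0 < gradSq ω q + τ by positivity), div_le_iff₀ (by positivity)]
  have hs : 0 < √(gradSq ω q) := Real.sqrt_pos.mpr hq
  calc |pd ω i q| ≤ √(gradSq ω q) := abs_pd_le i q
    _ = (√(gradSq ω q))⁻¹ * gradSq ω q := by
        nth_rw 3 [← Real.mul_self_sqrt hq.le]; field_simp
    _ ≤ _ := by gcongr; linarith

theorem norm_fderiv_gradSq_le (hω : DispersionLaw ω) (q : Mom d) :
    ‖fderiv ℝ (gradSq ω) q‖ ≤ 2 * d * √(gradSq ω q) * ‖fderiv ℝ (fderiv ℝ ω) q‖ := by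
  have h1 : HasFDerivAt (gradSq ω) (∑ i, (2 * pd ω i q) • fderiv ℝ (pd ω i) q) q := by
    have := HasFDerivAt.fun_sum (u := Finset.univ) (A := fun i q => pd ω i q ^ 2)
      (A' := fun i => (2 * pd ω i q) • fderiv ℝ (pd ω i) q) (x := q) fun i _ => by
        have := ((contDiff_pd hω i).differentiable (by norm_num) q).hasFDerivAt.pow 2
        simpa using this
    exact this
  rw [h1.fderiv]
  calc _ ≤ ∑ i : Fin d, 2 * √(gradSq ω q) * ‖fderiv ℝ (fderiv ℝ ω) q‖ := by
        refine (norm_sum_le _ _).trans (Finset.sum_le_sum fun i _ => ?_)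
        rw [norm_smul, Real.norm_eq_abs, abs_mul, abs_two]
        gcongr
        · exact abs_pd_le i q
        · exact norm_fderiv_pd_le hω i q
    _ = _ := by simp; ring

/-- The quotient rule gives order |∇²ω|/|∇ω|². Near the non-degenerate minimum this is |q|⁻², the
singularity that requires three dimensions. -/
theorem norm_fderiv_field_le (hω : DispersionLaw ω) {τ : ℝ} (hτ : 0 < τ) (i : Fin d) {q : Mom d}
    (hq : 0 < gradSq ω q) : ‖fderiv ℝ (field ω τ i) q‖ ≤
      (1 + 2 * d) * ‖fderiv ℝ (fderiv ℝ ω) q‖ * (gradSq ω q)⁻¹ := by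
  set N := gradSq ω q with hN
  set H := ‖fderiv ℝ (fderiv ℝ ω) q‖
  have hs : 0 < N + τ := by positivity
  have h1 := ((contDiff_pd hω i).differentiable (by norm_num) q).hasFDerivAt
  have h2 : HasFDerivAt (fun q => gradSq ω q + τ) (fderiv ℝ (gradSq ω) q) q :=
    ((contDiff_gradSq hω).differentiable (by norm_num) q).hasFDerivAt.add_const τ
  have h3 : HasFDerivAt (fun q => (gradSq ω q + τ)⁻¹)
      ((-((N + τ) ^ 2)⁻¹) • fderiv ℝ (gradSq ω) q) q :=
    (hasDerivAt_inv hs.ne').comp_hasFDerivAt q h2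
  have h4 : HasFDerivAt (field ω τ i) (pd ω i q • ((-((N + τ) ^ 2)⁻¹) • fderiv ℝ (gradSq ω) q) +
      (N + τ)⁻¹ • fderiv ℝ (pd ω i) q) q := by
    rw [show field ω τ i = fun q => pd ω i q * (gradSq ω q + τ)⁻¹ from
      funext fun q => div_eq_mul_inv _ _]
    exact h1.mul h3
  rw [h4.fderiv]
  refine (norm_add_le _ _).trans ?_
  rw [norm_smul, norm_smul, norm_smul, norm_neg, Real.norm_eq_abs, Real.norm_eq_abs,
    Real.norm_eq_abs, abs_of_pos (show 0 < ((N + τ) ^ 2)⁻¹ by positivity),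
    abs_of_pos (show 0 < (N + τ)⁻¹ by positivity)]
  have e1 : (N + τ)⁻¹ ≤ N⁻¹ := inv_anti₀ hq (by linarith)
  calc _ ≤ √N * ((N ^ 2)⁻¹ * (2 * d * √N * H)) + N⁻¹ * H := by
        gcongr
        · exact abs_pd_le i q
        · linarith
        · exact norm_fderiv_gradSq_le hω q
        · exact norm_fderiv_pd_le hω i q
    _ = (√N * √N) * (N ^ 2)⁻¹ * (2 * d * H) + N⁻¹ * H := by ring
    _ = _ := by rw [Real.mul_self_sqrt hq.le]; field_simp; ring

variable {E : Type*} [NormedAddCommGroup E] [NormedSpace ℂ E] [CompleteSpace E]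

/-- The derivative of u∘ω along the field is u'(ω)|∇ω|²/(|∇ω|² + τ). Partial integration in each
coordinate moves the derivative from u∘ω to the field times F; τ > 0 keeps the field C¹ at the
critical point. -/
theorem integral_field_smul (hω : DispersionLaw ω) {τ : ℝ} (hτ : 0 < τ) {F : Mom d → E}
    (hF : ContDiff ℝ 1 F) (hFc : HasCompactSupport F) {u u' : ℝ → ℂ}
    (hu : ∀ y, HasDerivAt u (u' y) y) (hu' : Continuous u') :
    ∫ q, (gradSq ω q / (gradSq ω q + τ)) • u' (ω q) • F q =
      -∑ i, ∫ q, u (ω q) • fderiv ℝ (fun q => field ω τ i q • F q) q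
        (EuclideanSpace.single i 1) := by
  have huc : Continuous u := continuous_iff_continuousAt.mpr fun y => (hu y).continuousAt
  have hωc : Continuous ω := hω.contDiff.continuous
  have hf : ∀ q, HasFDerivAt (fun q => u (ω q)) ((fderiv ℝ ω q).smulRight (u' (ω q))) q := fun q =>
    ((hu (ω q)).hasFDerivAt.comp q
      (hω.contDiff.differentiable (by norm_num) q).hasFDerivAt).congr_fderiv (by ext v; simp)
  have key : ∀ i, ∫ q, u (ω q) • fderiv ℝ (fun q => field ω τ i q • F q) q
        (EuclideanSpace.single i 1) = -∫ q, (pd ω i q * field ω τ i q) • u' (ω q) • F q := by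
    intro i
    have hg : ContDiff ℝ 1 (fun q => field ω τ i q • F q) := (contDiff_field hω hτ i).smul hF
    have hgc : HasCompactSupport (fun q => field ω τ i q • F q) := hFc.smul_left
    have hfd : ∀ q, fderiv ℝ (fun q => u (ω q)) q (EuclideanSpace.single i 1) • field ω τ i q • F q
        = (pd ω i q * field ω τ i q) • u' (ω q) • F q := fun q => by
      rw [(hf q).fderiv]
      simp only [ContinuousLinearMap.smulRight_apply, pd]
      rw [smul_assoc, mul_smul, smul_comm (u' (ω q))]
    have hpf : Continuous fun q => (pd ω i q * field ω τ i q) • u' (ω q) • F q :=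
      ((contDiff_pd hω i).continuous.mul (contDiff_field hω hτ i).continuous).smul
        ((hu'.comp hωc).smul hF.continuous)
    have hfc : Continuous (fun q => fderiv ℝ (fun q => field ω τ i q • F q) q
        (EuclideanSpace.single i 1)) :=
      (hg.continuous_fderiv (by norm_num)).clm_apply continuous_const
    rw [integral_smul_fderiv_eq_neg_fderiv_smul_of_integrable]
    · simp only [hfd]
    · simp only [hfd]
      exact hpf.integrable_of_hasCompactSupport (hFc.smul_left.smul_left)
    · refine ((huc.comp hωc).smul hfc).integrable_of_hasCompactSupport (HasCompactSupport.smul_left ?_)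
      exact hgc.fderiv_apply (𝕜 := ℝ) _
    · exact ((huc.comp hωc).smul hg.continuous).integrable_of_hasCompactSupport hgc.smul_left
    · exact fun q _ => (hf q).differentiableAt
    · exact fun q _ => hg.differentiable (by norm_num) q
  simp only [key, Finset.sum_neg_distrib, neg_neg]
  rw [← integral_finsetSum]
  · refine integral_congr_ae (Eventually.of_forall fun q => ?_)
    simp only
    rw [← Finset.sum_smul]
    congr 1
    simp only [field, gradSq, Finset.sum_div]
    exact Finset.sum_congr rfl fun i _ => by ring
  · intro i _
    refine Continuous.integrable_of_hasCompactSupport ?_ (hFc.smul_left.smul_left)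
    exact ((contDiff_pd hω i).continuous.mul (contDiff_field hω hτ i).continuous).smul
        ((hu'.comp hωc).smul hF.continuous)

end Gradient

/-! ### Boundary values of resolvent integrals -/

section Resolvent

variable {d : ℕ} {ω : Mom d → ℝ}

theorem integrableOn_norm_rpow {s : ℝ} (hd : 3 ≤ d) (hs : s < 3) (R : ℝ) :
    IntegrableOn (fun q : Mom d => ‖q‖ ^ (-s)) (Metric.closedBall 0 R) := by
  have hfin : Module.finrank ℝ (Mom d) = d := by simp
  refine (integrableOn_ball_of_norm_le_rpow (C := 1) (α := s) (r := R + 1) (by omega) ?_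
    (Eventually.of_forall fun q => ?_) ?_).mono_set (Metric.closedBall_subset_ball (by linarith))
  · rw [hfin]
    have : (3 : ℝ) ≤ d := by exact_mod_cast hd
    linarith
  · rw [Real.norm_of_nonneg (by positivity), one_mul]
  · exact (measurable_norm.pow_const _).aestronglyMeasurable

theorem integrableOn_inv_norm_sq (hd : 3 ≤ d) (R : ℝ) :
    IntegrableOn (fun q : Mom d => (‖q‖ ^ 2)⁻¹) (Metric.closedBall 0 R) := by
  refine (integrableOn_norm_rpow (s := 2) hd (by norm_num) R).congr_fun (fun q _ => ?_)
    Metric.isClosed_closedBall.measurableSet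
  simp only
  rw [Real.rpow_neg (norm_nonneg q), Real.rpow_two]

theorem ae_ne_zero (hd : 3 ≤ d) : ∀ᵐ q : Mom d, q ≠ 0 := by
  have : Nontrivial (Mom d) := Module.nontrivial_of_finrank_pos (R := ℝ) (by simp; omega)
  exact Measure.ae_ne volume 0

theorem gradSq_pos (hω : DispersionLaw ω) {q : Mom d} (hq : q ≠ 0) : 0 < gradSq ω q := by
  have := norm_pos_iff.mpr (hω.no_critical q hq)
  exact lt_of_lt_of_le (by positivity) (norm_sq_le_gradSq q)

variable {E : Type*} [NormedAddCommGroup E] [NormedSpace ℂ E] [CompleteSpace E]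

/-- On a ball, |∇ω| ≥ c|q|. If the derivative falls on F the field contributes |q|⁻¹ ≤ R|q|⁻², if it
falls on the field it contributes |q|⁻², all uniformly in τ. -/
theorem exists_bound_fderiv_field_smul (hω : DispersionLaw ω) (R : ℝ) :
    ∃ C, 0 ≤ C ∧ ∀ (F : Mom d → E) (A : ℝ), ContDiff ℝ 1 F → (∀ q, ‖F q‖ ≤ A) →
      (∀ q, ‖fderiv ℝ F q‖ ≤ A) → ∀ (τ : ℝ), 0 < τ → ∀ i, ∀ q ∈ Metric.closedBall 0 R, q ≠ 0 →
        ‖fderiv ℝ (fun q => field ω τ i q • F q) q (EuclideanSpace.single i 1)‖ ≤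
          C * A * (‖q‖ ^ 2)⁻¹ := by
  obtain ⟨c, hc, hlow⟩ := hω.exists_gradient_lower R
  obtain ⟨H, hH⟩ := (isCompact_closedBall (0 : Mom d) R).exists_bound_of_continuousOn
    ((hω.contDiff_fderiv.continuous_fderiv (by norm_num)).continuousOn)
  refine ⟨c⁻¹ * |R| + (1 + 2 * d) * |H| * (c ^ 2)⁻¹, by positivity,
    fun F A hF hA hA' τ hτ i q hq hq0 => ?_⟩
  have hN := gradSq_pos hω hq0
  have hA0 : 0 ≤ A := (norm_nonneg _).trans (hA q)
  have hqn : 0 < ‖q‖ := norm_pos_iff.mpr hq0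
  have hqR : ‖q‖ ≤ R := by simpa using hq
  have h1 := hlow q hqR
  have h2 : c * ‖q‖ ≤ √(gradSq ω q) := h1.trans (Real.le_sqrt_of_sq_le (norm_sq_le_gradSq q))
  have h3 : (c * ‖q‖) ^ 2 ≤ gradSq ω q := le_trans (by gcongr) (norm_sq_le_gradSq q)
  have h4 : (√(gradSq ω q))⁻¹ ≤ c⁻¹ * |R| * (‖q‖ ^ 2)⁻¹ := by
    refine (inv_anti₀ (by positivity) h2).trans ?_
    rw [mul_inv, mul_assoc]
    gcongr
    rw [inv_le_iff_one_le_mul₀ hqn]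
    have : ‖q‖ ≤ |R| := hqR.trans (le_abs_self R)
    calc (1 : ℝ) = ‖q‖ * (‖q‖ ^ 2)⁻¹ * ‖q‖ := by field_simp
      _ ≤ _ := by gcongr
  have h5 : (gradSq ω q)⁻¹ ≤ (c ^ 2)⁻¹ * (‖q‖ ^ 2)⁻¹ := by
    rw [← mul_inv, ← mul_pow]
    exact inv_anti₀ (by positivity) h3
  have hd1 : DifferentiableAt ℝ (field ω τ i) q := (contDiff_field hω hτ i).differentiable (by norm_num) q
  rw [fderiv_fun_smul hd1 (hF.differentiable (by norm_num) q)]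
  have hsing : ‖EuclideanSpace.single i (1 : ℝ)‖ = 1 := by simp
  calc _ ≤ ‖field ω τ i q • fderiv ℝ F q + (fderiv ℝ (field ω τ i) q).smulRight (F q)‖ := by
        refine (ContinuousLinearMap.le_opNorm _ _).trans ?_
        rw [hsing, mul_one]
    _ ≤ (√(gradSq ω q))⁻¹ * A + (1 + 2 * d) * |H| * (gradSq ω q)⁻¹ * A := by
        refine (norm_add_le _ _).trans ?_
        rw [norm_smul, ContinuousLinearMap.norm_smulRight_apply]
        gcongr
        · exact abs_field_le hτ i hN
        · exact hA' q
        · refine (norm_fderiv_field_le hω hτ i hN).trans ?_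
          gcongr
          exact (hH q hq).trans (le_abs_self H)
        · exact hA q
    _ ≤ c⁻¹ * |R| * (‖q‖ ^ 2)⁻¹ * A + (1 + 2 * d) * |H| * ((c ^ 2)⁻¹ * (‖q‖ ^ 2)⁻¹) * A := by
        gcongr
    _ = _ := by ring

/-- The decisive estimate: a singular function u'(ω) is traded for its less singular primitive u(ω)
at the price of one derivative of F and the weight |q|⁻², integrable for d ≥ 3. The constant depends
neither on u nor on F. -/
theorem exists_norm_integral_le (hω : DispersionLaw ω) (hd : 3 ≤ d) (R : ℝ) :
    ∃ C, 0 ≤ C ∧ ∀ (F : Mom d → E) (A : ℝ), ContDiff ℝ 1 F → tsupport F ⊆ Metric.closedBall 0 R →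
      (∀ q, ‖F q‖ ≤ A) → (∀ q, ‖fderiv ℝ F q‖ ≤ A) → ∀ (u u' : ℝ → ℂ),
      (∀ y, HasDerivAt u (u' y) y) → Continuous u' → ‖∫ q, u' (ω q) • F q‖ ≤
        C * A * ∫ q in Metric.closedBall 0 R, ‖u (ω q)‖ * (‖q‖ ^ 2)⁻¹ := by
  obtain ⟨C, hC, hb⟩ := exists_bound_fderiv_field_smul (E := E) hω R
  refine ⟨d * C, by positivity, fun F A hF hsupp hA hA' u u' hu hu' => ?_⟩
  have huc : Continuous u := continuous_iff_continuousAt.mpr fun y => (hu y).continuousAt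
  have hωc : Continuous ω := hω.contDiff.continuous
  have hFc : HasCompactSupport F :=
    (isCompact_closedBall (0 : Mom d) R).of_isClosed_subset (isClosed_tsupport F) hsupp
  have hA0 : 0 ≤ A := (norm_nonneg _).trans (hA 0)
  have hreg : ∀ τ : ℝ, 0 < τ → ‖∫ q, (gradSq ω q / (gradSq ω q + τ)) • u' (ω q) • F q‖ ≤
      d * C * A * ∫ q in Metric.closedBall 0 R, ‖u (ω q)‖ * (‖q‖ ^ 2)⁻¹ := by
    intro τ hτ
    rw [integral_field_smul hω hτ hF hFc hu hu', norm_neg]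
    refine (norm_sum_le _ _).trans ?_
    have hi : ∀ i ∈ Finset.univ, ‖∫ q, u (ω q) • fderiv ℝ (fun q => field ω τ i q • F q) q
        (EuclideanSpace.single i 1)‖ ≤
        C * A * ∫ q in Metric.closedBall 0 R, ‖u (ω q)‖ * (‖q‖ ^ 2)⁻¹ := by
      intro i _
      rw [← setIntegral_eq_integral_of_forall_compl_eq_zero (s := Metric.closedBall 0 R),
        ← integral_const_mul]
      · refine norm_integral_le_of_norm_le (Integrable.const_mul ?_ _) ?_
        · exact (integrableOn_inv_norm_sq hd R).continuousOn_mul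
            ((huc.comp hωc).norm.continuousOn) (isCompact_closedBall _ _)
        · filter_upwards [ae_restrict_mem Metric.isClosed_closedBall.measurableSet,
            ae_restrict_of_ae (ae_ne_zero hd)] with q hq hq0
          rw [norm_smul]
          calc _ ≤ ‖u (ω q)‖ * (C * A * (‖q‖ ^ 2)⁻¹) := by
                gcongr; exact hb F A hF hA hA' τ hτ i q hq hq0
            _ = _ := by ring
      · intro q hq
        have : q ∉ tsupport (fun q => field ω τ i q • F q) := fun h =>
          hq (hsupp (tsupport_smul_subset_right _ _ h))
        rw [fderiv_of_notMem_tsupport (𝕜 := ℝ) this]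
        simp
    refine (Finset.sum_le_sum hi).trans (le_of_eq ?_)
    simp; ring
  -- The weight |∇ω|²/(|∇ω|² + τ) lies in [0, 1] and tends to 1 except at q = 0, so dominated
  -- convergence removes the regularization.
  have hlim : Tendsto (fun τ : ℝ => ∫ q, (gradSq ω q / (gradSq ω q + τ)) • u' (ω q) • F q)
      (𝓝[>] 0) (𝓝 (∫ q, u' (ω q) • F q)) := by
    refine tendsto_integral_filter_of_dominated_convergence (fun q => ‖u' (ω q) • F q‖) ?_ ?_ ?_ ?_
    · filter_upwards [self_mem_nhdsWithin] with τ hτ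
      have hg := (contDiff_gradSq hω).continuous
      have hθ : Continuous fun q => gradSq ω q / (gradSq ω q + τ) :=
        hg.div (hg.add continuous_const) fun q => by
          have := gradSq_nonneg (ω := ω) q
          have hτ' : (0 : ℝ) < τ := hτ
          positivity
      exact (hθ.smul ((hu'.comp hωc).smul hF.continuous)).aestronglyMeasurable
    · filter_upwards [self_mem_nhdsWithin] with τ hτ
      refine Eventually.of_forall fun q => ?_
      have := gradSq_nonneg (ω := ω) q
      have hτ' : (0 : ℝ) < τ := hτ
      rw [norm_smul, Real.norm_of_nonneg (by positivity)]
      refine mul_le_of_le_one_left (norm_nonneg _) ?_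
      rw [div_le_one (by positivity)]
      linarith
    · exact (((hu'.comp hωc).smul hF.continuous).integrable_of_hasCompactSupport
        hFc.smul_left).norm
    · filter_upwards [ae_ne_zero hd] with q hq
      have hN := gradSq_pos hω hq
      have h1 : Tendsto (fun τ : ℝ => gradSq ω q / (gradSq ω q + τ)) (𝓝 0) (𝓝 1) := by
        have : ContinuousAt (fun τ : ℝ => gradSq ω q / (gradSq ω q + τ)) 0 := by
          refine ContinuousAt.div (by fun_prop) (by fun_prop) ?_
          simpa using hN.ne'
        have := this.tendsto
        simpa [hN.ne'] using this
      simpa using (h1.mono_left nhdsWithin_le_nhds).smul_const (u' (ω q) • F q)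
  exact le_of_tendsto hlim.norm (by filter_upwards [self_mem_nhdsWithin] with τ hτ using hreg τ hτ)

/-- A primitive of a function comparable with `|y - ζ|^(-1/2)`. -/
theorem hasDerivAt_mul_rpow (x : ℝ) {τ : ℝ} (hτ : 0 < τ) (y : ℝ) :
    HasDerivAt (fun y => (y - x) * ((y - x) ^ 2 + τ) ^ (-(1 / 4) : ℝ))
      (((y - x) ^ 2 + τ) ^ (-(1 / 4) : ℝ) * (1 - (y - x) ^ 2 / (2 * ((y - x) ^ 2 + τ)))) y := by
  have hs : 0 < (y - x) ^ 2 + τ := by positivity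
  have h1 : HasDerivAt (fun y => y - x) 1 y := (hasDerivAt_id y).sub_const x
  have h2 : HasDerivAt (fun y => (y - x) ^ 2 + τ) (2 * (y - x)) y := by
    simpa using (h1.pow 2).add_const τ
  have h3 := h1.mul (h2.rpow_const (p := (-(1 / 4) : ℝ)) (Or.inl hs.ne'))
  refine h3.congr_deriv ?_
  rw [show (-(1 / 4) - 1 : ℝ) = -(1 / 4) + (-1) by norm_num, Real.rpow_add hs, Real.rpow_neg_one]
  field_simp
  ring

/-- The function |y - ζ|^(-1/2) is comparable with the derivative of (y - x)((y - x)² + τ)^(-1/4),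
where x = Re ζ and τ = (Im ζ)². This primitive is bounded on bounded sets uniformly in ζ, so partial
integration against a cutoff gives a bound independent of Im ζ. -/
theorem exists_integral_rpow_le (hω : DispersionLaw ω) (hd : 3 ≤ d) {R : ℝ} (hR : 0 < R) (c₁ : ℝ) :
    ∃ C, 0 ≤ C ∧ ∀ ζ : ℂ, ζ.im ≠ 0 → ζ.re ≤ c₁ →
      ∫ q in Metric.closedBall 0 R, ‖(ω q : ℂ) - ζ‖ ^ (-(1 / 2) : ℝ) ≤ C := by
  obtain ⟨C, hC, hb⟩ := exists_norm_integral_le (E := ℂ) hω hd (R + 1)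
  let χ : ContDiffBump (0 : Mom d) := ⟨R, R + 1, hR, by linarith⟩
  have hχ : ContDiff ℝ 1 (fun q => (χ q : ℂ)) := Complex.ofRealCLM.contDiff.comp χ.contDiff
  have hχs : tsupport (fun q => (χ q : ℂ)) ⊆ Metric.closedBall 0 (R + 1) := by
    refine closure_minimal (fun q hq => ?_) Metric.isClosed_closedBall
    by_contra hq'
    refine hq ?_
    have : R + 1 ≤ dist q 0 := by
      have := Metric.mem_closedBall.not.mp hq'
      linarith
    simp [χ.zero_of_le_dist this]
  have hχc : HasCompactSupport (fun q => (χ q : ℂ)) :=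
    (isCompact_closedBall (0 : Mom d) (R + 1)).of_isClosed_subset (isClosed_tsupport _) hχs
  obtain ⟨A, hA⟩ := (hχc.fderiv (𝕜 := ℝ)).exists_bound_of_continuous
    (hχ.continuous_fderiv (by norm_num))
  have hωc : Continuous ω := hω.contDiff.continuous
  obtain ⟨Ω, hΩ⟩ := (isCompact_closedBall (0 : Mom d) (R + 1)).exists_bound_of_continuousOn
    hωc.continuousOn
  set I := ∫ q in Metric.closedBall (0 : Mom d) (R + 1), (‖q‖ ^ 2)⁻¹
  have hI : 0 ≤ I := integral_nonneg fun q => by positivity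
  set V := volume.real (Metric.closedBall (0 : Mom d) R)
  have hκ := hω.pos 0
  refine ⟨2 * (C * max 1 A * ((1 + Ω + |c₁|) * I)) + ω 0 ^ (-(1 / 2) : ℝ) * V, ?_, ?_⟩
  · have hΩ0 : 0 ≤ Ω := (norm_nonneg _).trans (hΩ 0 (by simp; linarith))
    positivity
  intro ζ hζ hζc
  have hΩ0 : 0 ≤ Ω := (norm_nonneg _).trans (hΩ 0 (by simp; linarith))
  have hw : ∀ q, 0 < ‖(ω q : ℂ) - ζ‖ := fun q => norm_pos_iff.mpr fun h => hζ <| by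
    have := congrArg Complex.im h
    simpa using this
  have hwc : Continuous fun q => ‖(ω q : ℂ) - ζ‖ ^ (-(1 / 2) : ℝ) :=
    Continuous.rpow_const (by fun_prop) fun q => Or.inl (hw q).ne'
  -- For Re ζ ≤ 0 the distance |ω - ζ| is at least ω(0), and no cancellation is needed. In the other
  -- case |Re ζ| ≤ |c₁|, which keeps the primitive bounded.
  rcases le_or_gt ζ.re 0 with h0 | h0
  · have h1 : ∀ q ∈ Metric.closedBall 0 R, ‖(ω q : ℂ) - ζ‖ ^ (-(1 / 2) : ℝ) ≤
        ω 0 ^ (-(1 / 2) : ℝ) := fun q _ => by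
      refine Real.rpow_le_rpow_of_nonpos hκ ?_ (by norm_num)
      have := Complex.re_le_norm ((ω q : ℂ) - ζ)
      simp only [Complex.sub_re, Complex.ofReal_re] at this
      linarith [hω.min_le q]
    have h2 := setIntegral_mono_on (hwc.continuousOn.integrableOn_compact (isCompact_closedBall _ _))
      (continuousOn_const.integrableOn_compact (isCompact_closedBall (0 : Mom d) R))
      Metric.isClosed_closedBall.measurableSet h1 (μ := volume)
    refine h2.trans ?_
    rw [setIntegral_const, smul_eq_mul, mul_comm]
    have : 0 ≤ 2 * (C * max 1 A * ((1 + Ω + |c₁|) * I)) := by positivity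
    linarith
  · set x := ζ.re
    set τ := ζ.im ^ 2
    have hτ : 0 < τ := by positivity
    set ψ : ℝ → ℝ := fun y => ((y - x) ^ 2 + τ) ^ (-(1 / 4) : ℝ) with hψ
    set ψ' : ℝ → ℝ := fun y => ψ y * (1 - (y - x) ^ 2 / (2 * ((y - x) ^ 2 + τ))) with hψ'
    have hs : ∀ y, 0 < (y - x) ^ 2 + τ := fun y => by positivity
    have hψc : Continuous ψ := Continuous.rpow_const (by fun_prop) fun y => Or.inl (hs y).ne'
    have hψ'c : Continuous ψ' := hψc.mul (continuous_const.sub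
      (Continuous.div (by fun_prop) (by fun_prop) fun y => (mul_pos two_pos (hs y)).ne'))
    have hψ0 : ∀ y, 0 < ψ y := fun y => Real.rpow_pos_of_pos (hs y) _
    -- The correction factor in the derivative lies between 1/2 and 1. Thus the derivative is
    -- positive and dominates half of the function to be integrated.
    have hψ'l : ∀ y, ψ y / 2 ≤ ψ' y := fun y => by
      have : (y - x) ^ 2 / (2 * ((y - x) ^ 2 + τ)) ≤ 1 / 2 := by
        rw [div_le_iff₀ (mul_pos two_pos (hs y))]; linarith
      have := mul_le_mul_of_nonneg_left this (hψ0 y).le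
      simp only [hψ']
      linarith
    have hψw : ∀ q, ‖(ω q : ℂ) - ζ‖ ^ (-(1 / 2) : ℝ) = ψ (ω q) := fun q => by
      have h1 : ‖(ω q : ℂ) - ζ‖ = ((ω q - x) ^ 2 + τ) ^ (1 / 2 : ℝ) := by
        rw [← Real.sqrt_eq_rpow, Complex.norm_eq_sqrt_sq_add_sq]
        simp [x, τ]
      rw [h1, ← Real.rpow_mul (hs _).le]
      norm_num [hψ]
    have hu : ∀ y, HasDerivAt (fun y => (((y - x) * ψ y : ℝ) : ℂ)) (ψ' y : ℂ) y := fun y =>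
      (hasDerivAt_mul_rpow x hτ y).ofReal_comp
    have hub : ∀ y, |(y - x) * ψ y| ≤ 1 + |y - x| := fun y => by
      rw [abs_mul, abs_of_pos (hψ0 y)]
      rcases le_or_gt 1 ((y - x) ^ 2 + τ) with h1 | h1
      · have : ψ y ≤ 1 := Real.rpow_le_one_of_one_le_of_nonpos h1 (by norm_num)
        nlinarith [abs_nonneg (y - x)]
      · have h2 : |y - x| ≤ ((y - x) ^ 2 + τ) ^ (1 / 2 : ℝ) := by
          rw [← Real.sqrt_eq_rpow]; exact Real.abs_le_sqrt (by linarith)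
        calc |y - x| * ψ y ≤ ((y - x) ^ 2 + τ) ^ (1 / 2 : ℝ) * ψ y :=
              mul_le_mul_of_nonneg_right h2 (hψ0 y).le
          _ = ((y - x) ^ 2 + τ) ^ (1 / 4 : ℝ) := by
            rw [hψ, ← Real.rpow_add (hs y)]; norm_num
          _ ≤ 1 := Real.rpow_le_one (hs y).le h1.le (by norm_num)
          _ ≤ _ := by linarith [abs_nonneg (y - x)]
    have h1 := hb (fun q => (χ q : ℂ)) (max 1 A) hχ hχs (fun q => by
        simpa [abs_of_nonneg (χ.nonneg (x := q))] using Or.inl χ.le_one)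
      (fun q => (hA q).trans (le_max_right _ _)) _ _ hu (by fun_prop)
    have h2 : ∫ q in Metric.closedBall (0 : Mom d) (R + 1),
        ‖(((ω q - x) * ψ (ω q) : ℝ) : ℂ)‖ * (‖q‖ ^ 2)⁻¹ ≤ (1 + Ω + |c₁|) * I := by
      rw [← integral_const_mul]
      refine setIntegral_mono_on ?_ ((integrableOn_inv_norm_sq hd _).const_mul _)
        Metric.isClosed_closedBall.measurableSet fun q hq => ?_
      · exact (integrableOn_inv_norm_sq hd _).continuousOn_mul
          (Continuous.continuousOn (by fun_prop)) (isCompact_closedBall _ _)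
      · gcongr
        rw [Complex.norm_real, Real.norm_eq_abs]
        refine (hub _).trans ?_
        have := hΩ q hq
        rw [Real.norm_eq_abs] at this
        have h3 := abs_sub (ω q) x
        have h4 : |x| ≤ |c₁| := abs_le_abs_of_nonneg h0.le hζc
        linarith
    have h3 : ∫ q, (ψ' (ω q) : ℂ) • (χ q : ℂ) = ((∫ q, ψ' (ω q) * χ q : ℝ) : ℂ) := by
      simp only [smul_eq_mul, ← Complex.ofReal_mul]
      exact integral_ofReal (𝕜 := ℂ)
    rw [h3, Complex.norm_real, Real.norm_eq_abs] at h1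
    have hint : Integrable fun q => ψ' (ω q) * χ q :=
      ((hψ'c.comp hωc).mul χ.continuous).integrable_of_hasCompactSupport
        (HasCompactSupport.mul_left χ.hasCompactSupport)
    have h4 : ∫ q in Metric.closedBall 0 R, ψ (ω q) / 2 ≤ ∫ q, ψ' (ω q) * χ q := by
      refine le_trans ?_ (setIntegral_le_integral (s := Metric.closedBall 0 R) hint
        (Eventually.of_forall fun q => ?_))
      · refine setIntegral_mono_on ?_ hint.integrableOn Metric.isClosed_closedBall.measurableSet ?_
        · exact (Continuous.continuousOn (by fun_prop)).integrableOn_compact (isCompact_closedBall _ _)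
        · intro q hq
          rw [χ.one_of_mem_closedBall hq, mul_one]
          exact hψ'l _
      · exact mul_nonneg ((half_pos (hψ0 _)).le.trans (hψ'l _)) χ.nonneg
    rw [integral_div] at h4
    simp only [hψw]
    have h5 : 0 ≤ ω 0 ^ (-(1 / 2) : ℝ) * V := by positivity
    have h6 : C * max 1 A * ∫ q in Metric.closedBall (0 : Mom d) (R + 1),
        ‖(((ω q - x) * ψ (ω q) : ℝ) : ℂ)‖ * (‖q‖ ^ 2)⁻¹ ≤ C * max 1 A * ((1 + Ω + |c₁|) * I) := by
      gcongr
    linarith [le_abs_self (∫ q, ψ' (ω q) * χ q)]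

end Resolvent

/-! ### Hölder continuity of resolvent integrals. -/

section Holder

theorem le_rpow_tenth {x : ℝ} (h0 : 0 ≤ x) (h1 : x ≤ 1) : x ≤ x ^ (1 / 10 : ℝ) := by
  rcases h0.eq_or_lt with rfl | h
  · simp
  · calc x = x ^ (1 : ℝ) := (Real.rpow_one x).symm
      _ ≤ _ := Real.rpow_le_rpow_of_exponent_ge h h1 (by norm_num)

theorem rpow_tenth_mul_le {c x : ℝ} (hc : 1 ≤ c) (hx : 0 ≤ x) :
    (c * x) ^ (1 / 10 : ℝ) ≤ c * x ^ (1 / 10 : ℝ) := by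
  rw [Real.mul_rpow (by linarith) hx]
  gcongr
  calc c ^ (1 / 10 : ℝ) ≤ c ^ (1 : ℝ) := Real.rpow_le_rpow_of_exponent_le hc (by norm_num)
    _ = c := Real.rpow_one c

theorem log_le_tenth {x : ℝ} (hx : 1 ≤ x) {y : ℝ} (hxy : x ≤ 3 * y) :
    Real.log x ≤ 30 * y ^ (1 / 10 : ℝ) := by
  have hy : 0 ≤ y := by linarith
  calc Real.log x ≤ x ^ (1 / 10 : ℝ) / (1 / 10) := Real.log_le_rpow_div (by linarith) (by norm_num)
    _ ≤ (3 * y) ^ (1 / 10 : ℝ) / (1 / 10) := by gcongr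
    _ ≤ 3 * y ^ (1 / 10 : ℝ) / (1 / 10) := by
        gcongr; exact rpow_tenth_mul_le (by norm_num) hy
    _ = _ := by ring

/-- The logarithm vanishes to first order at 1 and grows more slowly than any power at ∞ and at 0.
The power of t - 1 controls large |t|, that of t⁻¹ - 1 controls small |t|, and the argument is
bounded by π. -/
theorem norm_log_le_tenth {t : ℂ} (ht : t ≠ 0) :
    ‖Complex.log t‖ ≤ 40 * (‖t - 1‖ ^ (1 / 10 : ℝ) + ‖t⁻¹ - 1‖ ^ (1 / 10 : ℝ)) := by
  have ht0 : 0 < ‖t‖ := norm_pos_iff.mpr ht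
  have p1 : 0 ≤ ‖t - 1‖ ^ (1 / 10 : ℝ) := by positivity
  have p2 : 0 ≤ ‖t⁻¹ - 1‖ ^ (1 / 10 : ℝ) := by positivity
  rcases le_or_gt ‖t - 1‖ (1 / 2) with h | h
  · have h1 := Complex.norm_log_one_add_half_le_self h
    rw [add_sub_cancel] at h1
    have h2 := le_rpow_tenth (norm_nonneg (t - 1)) (by linarith)
    linarith
  · have harg : ‖Complex.log t‖ ≤ |Real.log ‖t‖| + 8 * ‖t - 1‖ ^ (1 / 10 : ℝ) := by
      have h1 : ‖Complex.log t‖ ≤ |(Complex.log t).re| + |(Complex.log t).im| :=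
        Complex.norm_le_abs_re_add_abs_im _
      rw [Complex.log_re, Complex.log_im] at h1
      have h2 : |Complex.arg t| ≤ 4 := (Complex.abs_arg_le_pi t).trans Real.pi_le_four
      have h3 : (1 : ℝ) ≤ (2 * ‖t - 1‖) ^ (1 / 10 : ℝ) :=
        Real.one_le_rpow (by linarith) (by norm_num)
      have h4 := rpow_tenth_mul_le (c := 2) (by norm_num) (norm_nonneg (t - 1))
      linarith
    rcases le_or_gt 1 ‖t‖ with h1 | h1
    · have h2 : ‖t‖ ≤ 3 * ‖t - 1‖ := by
        have := norm_sub_norm_le t 1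
        rw [norm_one] at this
        linarith
      have h3 := log_le_tenth h1 h2
      rw [abs_of_nonneg (Real.log_nonneg h1)] at harg
      linarith
    · have h2 : ‖t⁻¹ - 1‖ = ‖t - 1‖ / ‖t‖ := by
        rw [← norm_div, ← norm_neg]
        congr 1
        field_simp
        ring
      have h3 : 1 / 2 ≤ ‖t⁻¹ - 1‖ := by
        rw [h2, le_div_iff₀ ht0]; nlinarith
      have h4 : ‖t‖⁻¹ ≤ 3 * ‖t⁻¹ - 1‖ := by
        have := norm_sub_norm_le t⁻¹ 1
        rw [norm_one, norm_inv] at this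
        linarith
      have h5 := log_le_tenth ((one_le_inv₀ ht0).mpr h1.le) h4
      rw [Real.log_inv] at h5
      rw [abs_of_nonpos (Real.log_nonpos ht0.le h1.le)] at harg
      linarith

/-- Young's inequality with the exponents 5/4 and 5. The exponent 1/10 is small enough for both
resulting singularities to be integrable: |q|^(-5/2) in three dimensions, and |ω - ζ|^(-1/2) by
`exists_integral_rpow_le`. -/
theorem young_tenth {x w : ℝ} (hx : 0 < x) (hw : 0 < w) :
    (x ^ 2)⁻¹ * w ^ (-(1 / 10) : ℝ) ≤ x ^ (-(5 / 2) : ℝ) + w ^ (-(1 / 2) : ℝ) := by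
  have h := Real.young_inequality_of_nonneg (a := x ^ (-2 : ℝ)) (b := w ^ (-(1 / 10) : ℝ))
    (by positivity) (by positivity) (p := 5 / 4) (q := 5)
    (Real.holderConjugate_iff.mpr (by norm_num))
  rw [← Real.rpow_mul hx.le, ← Real.rpow_mul hw.le] at h
  norm_num at h
  have p1 : 0 < x ^ (-(5 / 2) : ℝ) := by positivity
  have p2 : 0 < w ^ (-(1 / 2) : ℝ) := by positivity
  norm_num at p1 p2 ⊢
  linarith

/-- Two points on the same side of the real axis never have a quotient in (-∞, 0]. So the principal
logarithm of the quotient is smooth along the whole energy axis, and this is why the two sides of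
the cut are treated separately. -/
theorem div_mem_slitPlane {w₁ w₂ : ℂ} (h : 0 < w₁.im * w₂.im) : w₁ / w₂ ∈ Complex.slitPlane := by
  rw [Complex.mem_slitPlane_iff_not_le_zero]
  intro hle
  have hw₂ : w₂ ≠ 0 := by rintro rfl; simp at h
  obtain ⟨hre, him⟩ := Complex.le_def.mp hle
  have h1 : w₁ = w₁ / w₂ * w₂ := (div_mul_cancel₀ _ hw₂).symm
  have h2 := congrArg Complex.im h1
  rw [Complex.mul_im, him] at h2
  simp only [Complex.zero_im, zero_mul, add_zero, Complex.zero_re] at h2 hre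
  rw [h2] at h
  nlinarith [sq_nonneg w₂.im]

theorem ofReal_sub_ne_zero {ζ : ℂ} (h : ζ.im ≠ 0) (y : ℝ) : (y : ℂ) - ζ ≠ 0 := fun h0 => h <| by
  simpa using congrArg Complex.im h0

/-- The logarithm whose derivative is the difference of two resolvents. -/
theorem hasDerivAt_log_div {ζ₁ ζ₂ : ℂ} (h : 0 < ζ₁.im * ζ₂.im) (y : ℝ) :
    HasDerivAt (fun y : ℝ => Complex.log ((y - ζ₁) / (y - ζ₂)))
      ((y - ζ₁)⁻¹ - (y - ζ₂)⁻¹) y := by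
  have h1 : (y - ζ₁ : ℂ) ≠ 0 := ofReal_sub_ne_zero (left_ne_zero_of_mul h.ne') y
  have h2 : (y - ζ₂ : ℂ) ≠ 0 := ofReal_sub_ne_zero (right_ne_zero_of_mul h.ne') y
  have hd : ∀ ζ : ℂ, HasDerivAt (fun y : ℝ => (y : ℂ) - ζ) 1 y := fun ζ =>
    (HasDerivAt.ofReal_comp (hasDerivAt_id y)).sub_const ζ
  have h3 := ((hd ζ₁).div (hd ζ₂) h2).clog_real (div_mem_slitPlane (by simpa using h))
  refine h3.congr_deriv ?_
  simp only [Pi.div_apply]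
  field_simp

/-- Both t - 1 and t⁻¹ - 1, for t = w₁/w₂, are ±(w₁ - w₂) over one of the two points; this extracts
the Hölder factor. -/
theorem norm_log_div_le {w₁ w₂ : ℂ} (h₁ : w₁ ≠ 0) (h₂ : w₂ ≠ 0) :
    ‖Complex.log (w₁ / w₂)‖ ≤ 40 * ‖w₁ - w₂‖ ^ (1 / 10 : ℝ) *
      (‖w₁‖ ^ (-(1 / 10) : ℝ) + ‖w₂‖ ^ (-(1 / 10) : ℝ)) := by
  refine (norm_log_le_tenth (div_ne_zero h₁ h₂)).trans (le_of_eq ?_)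
  have e1 : w₁ / w₂ - 1 = (w₁ - w₂) / w₂ := by field_simp
  have e2 : (w₁ / w₂)⁻¹ - 1 = (w₂ - w₁) / w₁ := by field_simp
  rw [e1, e2, norm_div, norm_div, Real.div_rpow (norm_nonneg _) (norm_nonneg _),
    Real.div_rpow (norm_nonneg _) (norm_nonneg _), norm_sub_rev w₂ w₁,
    Real.rpow_neg (norm_nonneg _), Real.rpow_neg (norm_nonneg _)]
  ring

variable {d : ℕ} {ω : Mom d → ℝ} {E : Type*} [NormedAddCommGroup E] [NormedSpace ℂ E]
  [CompleteSpace E]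

/-- The difference of two resolvents is the derivative of log((y - ζ₁)/(y - ζ₂)). After partial
integration the logarithm gives |ζ₁ - ζ₂|^(1/10) times |ω - ζ_j|^(-1/10), and `young_tenth`
separates this from |q|⁻². -/
theorem exists_norm_integral_resolvent_sub_le (hω : DispersionLaw ω) (hd : 3 ≤ d) {R : ℝ}
    (hR : 0 < R) (c₁ : ℝ) : ∃ C, 0 ≤ C ∧ ∀ (F : Mom d → E) (A : ℝ), ContDiff ℝ 1 F →
      tsupport F ⊆ Metric.closedBall 0 R → (∀ q, ‖F q‖ ≤ A) → (∀ q, ‖fderiv ℝ F q‖ ≤ A) →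
      ∀ ζ₁ ζ₂ : ℂ, 0 < ζ₁.im * ζ₂.im → ζ₁.re ≤ c₁ → ζ₂.re ≤ c₁ →
      ‖∫ q, ((ω q - ζ₁ : ℂ)⁻¹ - (ω q - ζ₂ : ℂ)⁻¹) • F q‖ ≤ C * A * ‖ζ₁ - ζ₂‖ ^ (1 / 10 : ℝ) := by
  obtain ⟨C, hC, hb⟩ := exists_norm_integral_le (E := E) hω hd R
  obtain ⟨C', hC', hb'⟩ := exists_integral_rpow_le hω hd hR c₁
  set I := ∫ q in Metric.closedBall (0 : Mom d) R, ‖q‖ ^ (-(5 / 2) : ℝ)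
  have hI : 0 ≤ I := integral_nonneg fun q => by positivity
  have hωc : Continuous ω := hω.contDiff.continuous
  refine ⟨C * (40 * (2 * (I + C'))), by positivity, fun F A hF hs hA hA' ζ₁ ζ₂ him h₁ h₂ => ?_⟩
  have hA0 : 0 ≤ A := (norm_nonneg _).trans (hA 0)
  have hi₁ : ζ₁.im ≠ 0 := left_ne_zero_of_mul him.ne'
  have hi₂ : ζ₂.im ≠ 0 := right_ne_zero_of_mul him.ne'
  have hcont : Continuous fun y : ℝ => ((y - ζ₁ : ℂ)⁻¹ - (y - ζ₂ : ℂ)⁻¹) :=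
    (Continuous.inv₀ (by fun_prop) (ofReal_sub_ne_zero hi₁)).sub
      (Continuous.inv₀ (by fun_prop) (ofReal_sub_ne_zero hi₂))
  refine (hb F A hF hs hA hA' _ _ (hasDerivAt_log_div him) hcont).trans ?_
  set Δ := ‖ζ₁ - ζ₂‖ ^ (1 / 10 : ℝ)
  have hΔ : 0 ≤ Δ := by positivity
  have hint : ∀ ζ : ℂ, ζ.im ≠ 0 → IntegrableOn (fun q => ‖(ω q : ℂ) - ζ‖ ^ (-(1 / 2) : ℝ))
      (Metric.closedBall (0 : Mom d) R) := fun ζ hζ =>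
    (Continuous.rpow_const (by fun_prop) fun q => Or.inl
      (norm_ne_zero_iff.mpr (ofReal_sub_ne_zero hζ _))).continuousOn.integrableOn_compact
        (isCompact_closedBall _ _)
  have hq := integrableOn_norm_rpow (s := 5 / 2) hd (by norm_num) R
  have hbd : ∫ q in Metric.closedBall (0 : Mom d) R,
      ‖Complex.log ((ω q - ζ₁) / (ω q - ζ₂))‖ * (‖q‖ ^ 2)⁻¹ ≤
      ∫ q in Metric.closedBall (0 : Mom d) R, 40 * Δ * ((‖q‖ ^ (-(5 / 2) : ℝ) +
        ‖(ω q : ℂ) - ζ₁‖ ^ (-(1 / 2) : ℝ)) + (‖q‖ ^ (-(5 / 2) : ℝ) +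
        ‖(ω q : ℂ) - ζ₂‖ ^ (-(1 / 2) : ℝ))) := by
    refine integral_mono_of_nonneg (Eventually.of_forall fun q => by positivity)
      (((hq.add (hint ζ₁ hi₁)).add (hq.add (hint ζ₂ hi₂))).const_mul _) ?_
    filter_upwards [ae_restrict_of_ae (ae_ne_zero hd)] with q hq0
    have hqn : 0 < ‖q‖ := norm_pos_iff.mpr hq0
    have n₁ := ofReal_sub_ne_zero hi₁ (ω q)
    have n₂ := ofReal_sub_ne_zero hi₂ (ω q)
    have e1 : (ω q : ℂ) - ζ₁ - (ω q - ζ₂) = ζ₂ - ζ₁ := by ring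
    have h3 := norm_log_div_le n₁ n₂
    rw [e1, norm_sub_rev ζ₂ ζ₁] at h3
    calc _ ≤ (40 * Δ * (‖(ω q : ℂ) - ζ₁‖ ^ (-(1 / 10) : ℝ) + ‖(ω q : ℂ) - ζ₂‖ ^ (-(1 / 10) : ℝ))) *
          (‖q‖ ^ 2)⁻¹ := by gcongr
      _ = 40 * Δ * ((‖q‖ ^ 2)⁻¹ * ‖(ω q : ℂ) - ζ₁‖ ^ (-(1 / 10) : ℝ) +
          (‖q‖ ^ 2)⁻¹ * ‖(ω q : ℂ) - ζ₂‖ ^ (-(1 / 10) : ℝ)) := by ring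
      _ ≤ _ := by
        gcongr
        · exact young_tenth hqn (norm_pos_iff.mpr n₁)
        · exact young_tenth hqn (norm_pos_iff.mpr n₂)
  have hsum : ∫ q in Metric.closedBall (0 : Mom d) R, ((‖q‖ ^ (-(5 / 2) : ℝ) +
      ‖(ω q : ℂ) - ζ₁‖ ^ (-(1 / 2) : ℝ)) + (‖q‖ ^ (-(5 / 2) : ℝ) +
      ‖(ω q : ℂ) - ζ₂‖ ^ (-(1 / 2) : ℝ))) = _ :=
    (integral_add (hq.add (hint ζ₁ hi₁)) (hq.add (hint ζ₂ hi₂))).trans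
      (congrArg₂ (· + ·) (integral_add hq (hint ζ₁ hi₁)) (integral_add hq (hint ζ₂ hi₂)))
  rw [integral_const_mul, hsum] at hbd
  calc _ ≤ C * A * (40 * Δ * (I + C' + (I + C'))) := by
        refine mul_le_mul_of_nonneg_left (hbd.trans ?_) (by positivity)
        gcongr
        · exact hb' ζ₁ hi₁ h₁
        · exact hb' ζ₂ hi₂ h₂
    _ = _ := by ring

/-- Resolvent integrals of functions with one derivative are bounded and Hölder continuous in the
upper and in the lower half-plane. -/
theorem exists_norm_integral_resolvent_le (hω : DispersionLaw ω) (hd : 3 ≤ d) {c₁ : ℝ}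
    (hc₁ : c₁ < 2 * ω 0) {w : Mom d → ℝ} (hw : Integrable w) :
    ∃ C, 0 ≤ C ∧ ∀ (G : Mom d → E) (M : ℝ), ContDiff ℝ 1 G → (∀ q, ‖G q‖ ≤ M) →
      (∀ q, ‖fderiv ℝ G q‖ ≤ M) → (∀ q, ‖G q‖ ≤ M * w q) →
      (∀ ζ : ℂ, ζ.im ≠ 0 → ζ.re ≤ c₁ → ‖∫ q, (ω q - ζ : ℂ)⁻¹ • G q‖ ≤ C * M) ∧
      ∀ ζ₁ ζ₂ : ℂ, 0 < ζ₁.im * ζ₂.im → ζ₁.re ≤ c₁ → ζ₂.re ≤ c₁ →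
        ‖∫ q, ((ω q - ζ₁ : ℂ)⁻¹ - (ω q - ζ₂ : ℂ)⁻¹) • G q‖ ≤
          C * M * ‖ζ₁ - ζ₂‖ ^ (1 / 10 : ℝ) := by
  -- A level strictly between c₁ and 2κ: the set {ω ≤ c₂} is still bounded, and off it the
  -- resolvents are at most 1/(c₂ - c₁).
  set c₂ := (c₁ + 2 * ω 0) / 2
  have hc₂ : c₁ < c₂ := by simp only [c₂]; linarith
  obtain ⟨R₀, hR₀⟩ := (hω.bounded_sublevel c₂ (by simp only [c₂]; linarith)).subset_closedBall 0
  set R := max R₀ 1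
  have hR : 0 < R := by positivity
  obtain ⟨C, hC, hb⟩ := exists_norm_integral_resolvent_sub_le (E := E) hω hd
    (R := R + 1) (by linarith) c₁
  let χ : ContDiffBump (0 : Mom d) := ⟨R, R + 1, hR, by linarith⟩
  have hχ : ContDiff ℝ 1 χ := χ.contDiff
  obtain ⟨A, hA⟩ := (χ.hasCompactSupport.fderiv (𝕜 := ℝ)).exists_bound_of_continuous
    (hχ.continuous_fderiv (by norm_num))
  have hA0 : 0 ≤ A := (norm_nonneg _).trans (hA 0)
  have hωc : Continuous ω := hω.contDiff.continuous
  set I := ∫ q, |w q|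
  have hI : 0 ≤ I := integral_nonneg fun q => abs_nonneg _
  set g := c₂ - c₁
  have hg : 0 < g := by simp only [g]; linarith
  set C₃ := C * (1 + A) + (g ^ 2)⁻¹ * I
  have hC₃ : 0 ≤ C₃ := by positivity
  have hfar : ∀ q, χ q ≠ 1 → c₂ ≤ ω q := fun q hq => by
    by_contra hlt
    refine hq (χ.one_of_mem_closedBall ?_)
    exact Metric.closedBall_subset_closedBall (le_max_left _ _) (hR₀ (not_le.mp hlt).le)
  have main : ∀ (G : Mom d → E) (M : ℝ), ContDiff ℝ 1 G → (∀ q, ‖G q‖ ≤ M) →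
      (∀ q, ‖fderiv ℝ G q‖ ≤ M) → (∀ q, ‖G q‖ ≤ M * w q) →
      ∀ ζ₁ ζ₂ : ℂ, 0 < ζ₁.im * ζ₂.im → ζ₁.re ≤ c₁ → ζ₂.re ≤ c₁ → ‖ζ₁ - ζ₂‖ ≤ 1 →
        ‖∫ q, ((ω q - ζ₁ : ℂ)⁻¹ - (ω q - ζ₂ : ℂ)⁻¹) • G q‖ ≤
          C₃ * M * ‖ζ₁ - ζ₂‖ ^ (1 / 10 : ℝ) := by
    intro G M hG hM hM' hMw ζ₁ ζ₂ him h₁ h₂ h12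
    have hM0 : 0 ≤ M := (norm_nonneg _).trans (hM 0)
    have hi₁ : ζ₁.im ≠ 0 := left_ne_zero_of_mul him.ne'
    have hi₂ : ζ₂.im ≠ 0 := right_ne_zero_of_mul him.ne'
    set U : Mom d → ℂ := fun q => (ω q - ζ₁ : ℂ)⁻¹ - (ω q - ζ₂ : ℂ)⁻¹
    have hU : Continuous U :=
      (Continuous.inv₀ (by fun_prop) fun q => ofReal_sub_ne_zero hi₁ _).sub
        (Continuous.inv₀ (by fun_prop) fun q => ofReal_sub_ne_zero hi₂ _)
    set F : Mom d → E := fun q => χ q • G q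
    have hF : ContDiff ℝ 1 F := hχ.smul hG
    have hFc : HasCompactSupport F := χ.hasCompactSupport.smul_right
    have hFb : ∀ q, ‖F q‖ ≤ (1 + A) * M := fun q => by
      simp only [F]
      rw [norm_smul, Real.norm_of_nonneg χ.nonneg]
      calc _ ≤ 1 * M := by
            gcongr
            · exact χ.le_one
            · exact hM q
        _ ≤ _ := by gcongr; linarith
    have hFd : ∀ q, ‖fderiv ℝ F q‖ ≤ (1 + A) * M := fun q => by
      simp only [F]
      rw [fderiv_fun_smul (hχ.differentiable (by norm_num) q) (hG.differentiable (by norm_num) q)]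
      refine (norm_add_le _ _).trans ?_
      rw [norm_smul, ContinuousLinearMap.norm_smulRight_apply, Real.norm_of_nonneg χ.nonneg]
      calc _ ≤ 1 * M + A * M := by
            gcongr
            · exact χ.le_one
            · exact hM' q
            · exact hA q
            · exact hM q
        _ = _ := by ring
    have hnear := hb F ((1 + A) * M) hF (by
      refine (tsupport_smul_subset_left _ _).trans (le_of_eq χ.tsupport_eq)) hFb hFd ζ₁ ζ₂ him h₁ h₂
    have hUb : ∀ q, χ q ≠ 1 → ‖U q‖ ≤ (g ^ 2)⁻¹ * ‖ζ₁ - ζ₂‖ ^ (1 / 10 : ℝ) := fun q hq => by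
      have h3 : ∀ ζ : ℂ, ζ.re ≤ c₁ → g ≤ ‖(ω q : ℂ) - ζ‖ := fun ζ hζ => by
        have := Complex.re_le_norm ((ω q : ℂ) - ζ)
        simp only [Complex.sub_re, Complex.ofReal_re] at this
        simp only [g]
        linarith [hfar q hq]
      have n₁ := ofReal_sub_ne_zero hi₁ (ω q)
      have n₂ := ofReal_sub_ne_zero hi₂ (ω q)
      have e : U q = (ζ₁ - ζ₂) * ((ω q - ζ₁ : ℂ)⁻¹ * (ω q - ζ₂ : ℂ)⁻¹) := by
        simp only [U]; field_simp; ring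
      rw [e, norm_mul, norm_mul, norm_inv, norm_inv, mul_comm, sq, mul_inv]
      gcongr
      · exact h3 ζ₁ h₁
      · exact h3 ζ₂ h₂
      · exact le_rpow_tenth (norm_nonneg _) h12
    -- The cut-off part has compact support and is treated by partial integration. The rest lives
    -- where the resolvents are regular and is controlled by the integrable function `w`.
    have hsplit : ∀ q, U q • G q = U q • F q + (1 - χ q) • U q • G q := fun q => by
      change U q • G q = U q • χ q • G q + (1 - χ q) • U q • G q
      rw [smul_comm (U q) (χ q) (G q), ← add_smul, add_sub_cancel, one_smul]
    have hfarb : ∀ q, ‖(1 - χ q) • U q • G q‖ ≤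
        (g ^ 2)⁻¹ * ‖ζ₁ - ζ₂‖ ^ (1 / 10 : ℝ) * M * |w q| := fun q => by
      by_cases hq : χ q = 1
      · rw [hq]; simp; positivity
      · rw [norm_smul, norm_smul, Real.norm_of_nonneg (by linarith [χ.le_one (x := q)])]
        calc _ ≤ 1 * (((g ^ 2)⁻¹ * ‖ζ₁ - ζ₂‖ ^ (1 / 10 : ℝ)) * (M * |w q|)) := by
              gcongr
              · linarith [χ.nonneg (x := q)]
              · exact hUb q hq
              · exact (hMw q).trans (by gcongr; exact le_abs_self _)
          _ = _ := by ring
    have hint2 : Integrable fun q => (1 - χ q) • U q • G q := by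
      refine (hw.abs.const_mul ((g ^ 2)⁻¹ * ‖ζ₁ - ζ₂‖ ^ (1 / 10 : ℝ) * M)).mono' ?_
        (Eventually.of_forall hfarb)
      exact ((continuous_const.sub χ.continuous).smul (hU.smul hG.continuous)).aestronglyMeasurable
    have hint1 : Integrable fun q => U q • F q :=
      (hU.smul hF.continuous).integrable_of_hasCompactSupport hFc.smul_left
    change ‖∫ q, U q • G q‖ ≤ _
    rw [show (fun q => U q • G q) = fun q => U q • F q + (1 - χ q) • U q • G q from funext hsplit,
      integral_add hint1 hint2]
    refine (norm_add_le _ _).trans ?_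
    have h4 := norm_integral_le_of_norm_le (hw.abs.const_mul _) (Eventually.of_forall hfarb)
    rw [integral_const_mul] at h4
    calc _ ≤ C * ((1 + A) * M) * ‖ζ₁ - ζ₂‖ ^ (1 / 10 : ℝ) +
          (g ^ 2)⁻¹ * ‖ζ₁ - ζ₂‖ ^ (1 / 10 : ℝ) * M * I := add_le_add hnear h4
      _ = _ := by simp only [C₃]; ring
  have hbound : ∀ (G : Mom d → E) (M : ℝ), ContDiff ℝ 1 G → (∀ q, ‖G q‖ ≤ M) →
      (∀ q, ‖fderiv ℝ G q‖ ≤ M) → (∀ q, ‖G q‖ ≤ M * w q) →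
      ∀ ζ : ℂ, ζ.im ≠ 0 → ζ.re ≤ c₁ →
        Integrable (fun q => (ω q - ζ : ℂ)⁻¹ • G q) ∧
        ‖∫ q, (ω q - ζ : ℂ)⁻¹ • G q‖ ≤ (C₃ + I) * M := by
    intro G M hG hM hM' hMw
    have hM0 : 0 ≤ M := (norm_nonneg _).trans (hM 0)
    have hres : ∀ ζ : ℂ, ζ.im ≠ 0 → ∀ q, ‖(ω q - ζ : ℂ)⁻¹ • G q‖ ≤ |ζ.im|⁻¹ * M * |w q| := by
      intro ζ hζ q
      rw [norm_smul, norm_inv, mul_assoc]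
      gcongr
      · have := Complex.abs_im_le_norm ((ω q : ℂ) - ζ)
        simpa using this
      · exact (hMw q).trans (by gcongr; exact le_abs_self _)
    have hint : ∀ ζ : ℂ, ζ.im ≠ 0 → Integrable (fun q => (ω q - ζ : ℂ)⁻¹ • G q) := fun ζ hζ =>
      (hw.abs.const_mul (|ζ.im|⁻¹ * M)).mono' ((Continuous.inv₀ (by fun_prop) fun q =>
        ofReal_sub_ne_zero hζ _).smul hG.continuous).aestronglyMeasurable
        (Eventually.of_forall (hres ζ hζ))
    intro ζ hζ hre
    refine ⟨hint ζ hζ, ?_⟩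
    -- Boundedness follows from Hölder continuity by comparing ζ with ζ ± i on the same side of the
    -- axis, where the resolvent is at most 1.
    obtain ⟨s, hs1, hsim⟩ : ∃ s : ℝ, |s| = 1 ∧ 0 < ζ.im * s := by
      rcases lt_or_gt_of_ne hζ with h | h
      · exact ⟨-1, by simp, by linarith⟩
      · exact ⟨1, by simp, by linarith⟩
    set ξ : ℂ := ζ + s * Complex.I
    have hξ : ξ.im = ζ.im + s := by simp [ξ]
    have hξr : ξ.re = ζ.re := by simp [ξ]
    have hs2 : s * s = 1 := by rw [← abs_mul_abs_self, hs1, one_mul]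
    have him : 0 < ζ.im * ξ.im := by rw [hξ]; nlinarith [sq_nonneg ζ.im]
    have hd1 : ‖ζ - ξ‖ = 1 := by
      simp [ξ, hs1]
    have hξi : 1 ≤ |ξ.im| := by
      rw [hξ]
      have : 1 ≤ s * (ζ.im + s) := by nlinarith
      calc (1 : ℝ) ≤ |s * (ζ.im + s)| := this.trans (le_abs_self _)
        _ = |ζ.im + s| := by rw [abs_mul, hs1, one_mul]
    have hξ0 : ξ.im ≠ 0 := right_ne_zero_of_mul him.ne'
    have h1 := main G M hG hM hM' hMw ζ ξ him hre (hξr ▸ hre) hd1.le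
    rw [hd1, Real.one_rpow, mul_one] at h1
    have h2 : ‖∫ q, (ω q - ξ : ℂ)⁻¹ • G q‖ ≤ M * I := by
      have := norm_integral_le_of_norm_le (hw.abs.const_mul _)
        (Eventually.of_forall (hres ξ hξ0))
      rw [integral_const_mul] at this
      refine this.trans ?_
      gcongr
      refine mul_le_of_le_one_left hM0 (inv_le_one_of_one_le₀ hξi)
    simp only [sub_smul] at h1
    rw [integral_sub (hint ζ hζ) (hint ξ hξ0)] at h1
    have h3 := norm_sub_norm_le (∫ q, (ω q - ζ : ℂ)⁻¹ • G q) (∫ q, (ω q - ξ : ℂ)⁻¹ • G q)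
    linarith
  refine ⟨2 * (C₃ + I), by positivity, fun G M hG hM hM' hMw => ?_⟩
  have hM0 : 0 ≤ M := (norm_nonneg _).trans (hM 0)
  have hb' := hbound G M hG hM hM' hMw
  have hCM : 0 ≤ (C₃ + I) * M := by positivity
  refine ⟨fun ζ hζ hre => ((hb' ζ hζ hre).2).trans (by linarith), fun ζ₁ ζ₂ him h₁ h₂ => ?_⟩
  -- For points more than 1 apart the Hölder estimate is a consequence of the uniform bound.
  rcases le_or_gt ‖ζ₁ - ζ₂‖ 1 with h12 | h12
  · refine (main G M hG hM hM' hMw ζ₁ ζ₂ him h₁ h₂ h12).trans ?_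
    gcongr
    linarith
  · obtain ⟨i₁, n₁⟩ := hb' ζ₁ (left_ne_zero_of_mul him.ne') h₁
    obtain ⟨i₂, n₂⟩ := hb' ζ₂ (right_ne_zero_of_mul him.ne') h₂
    simp only [sub_smul]
    rw [integral_sub i₁ i₂]
    have h3 : (1 : ℝ) ≤ ‖ζ₁ - ζ₂‖ ^ (1 / 10 : ℝ) := Real.one_le_rpow h12.le (by norm_num)
    calc _ ≤ (C₃ + I) * M + (C₃ + I) * M := (norm_sub_le _ _).trans (add_le_add n₁ n₂)
      _ = 2 * (C₃ + I) * M * 1 := by ring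
      _ ≤ _ := by gcongr

end Holder

/-! ### The space `𝒦₁` is complete -/

section Complete

variable {d : ℕ} {h : Mom d → ℝ} {f g : Mom d → Mom d → M₂}

instance : NormedAddCommGroup M₂ := inferInstance

instance : NormedSpace ℝ M₂ := inferInstance

instance : CompleteSpace M₂ := inferInstance

instance : NormedAddCommGroup (Mom d →L[ℝ] M₂) := inferInstance

instance : NormedSpace ℝ (Mom d →L[ℝ] M₂) := inferInstance

instance : NormedAddCommGroup (Mom d →L[ℝ] Mom d →L[ℝ] M₂) := inferInstance

instance : NormedSpace ℝ (Mom d →L[ℝ] Mom d →L[ℝ] M₂) := inferInstance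

instance : CompleteSpace (Mom d →L[ℝ] M₂) := ContinuousLinearMap.instCompleteSpace

instance : CompleteSpace (Mom d →L[ℝ] Mom d →L[ℝ] M₂) := ContinuousLinearMap.instCompleteSpace

/-- Continuity of both first partial derivatives gives joint C¹ regularity. Only the mixed
derivative in the order ∂_k ∂_q is required, so no symmetry of second derivatives enters. -/
theorem KernelSmooth.of_partials {f₁ f₂ : Mom d → Mom d → Mom d →L[ℝ] M₂}
    {f₃ : Mom d → Mom d → Mom d →L[ℝ] Mom d →L[ℝ] M₂}
    (h₁ : ∀ q k, HasFDerivAt (fun q' => f q' k) (f₁ q k) q)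
    (h₂ : ∀ q k, HasFDerivAt (fun k' => f q k') (f₂ q k) k)
    (h₃ : ∀ q k, HasFDerivAt (fun k' => f₁ q k') (f₃ q k) k)
    (c₁ : Continuous (Function.uncurry f₁)) (c₂ : Continuous (Function.uncurry f₂))
    (c₃ : Continuous (Function.uncurry f₃)) :
    KernelSmooth f ∧ dq f = f₁ ∧ dk f = f₂ ∧ dkdq f = f₃ := by
  have e₁ : dq f = f₁ := funext fun q => funext fun k => (h₁ q k).fderiv
  have e₂ : dk f = f₂ := funext fun q => funext fun k => (h₂ q k).fderiv
  have e₃ : dkdq f = f₃ := funext fun q => funext fun k => by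
    simp only [dkdq, e₁]
    exact (h₃ q k).fderiv
  refine ⟨⟨?_, ?_, ?_⟩, e₁, e₂, e₃⟩
  · refine contDiff_one_iff_hasFDerivAt.mpr
      ⟨fun v => (f₁ v.1 v.2).coprod (f₂ v.1 v.2), ?_, fun v => ?_⟩
    · have : (fun v : Mom d × Mom d => (f₁ v.1 v.2).coprod (f₂ v.1 v.2)) = fun v =>
          (f₁ v.1 v.2).comp (ContinuousLinearMap.fst ℝ (Mom d) (Mom d)) +
          (f₂ v.1 v.2).comp (ContinuousLinearMap.snd ℝ (Mom d) (Mom d)) := by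
        funext v; ext <;> simp
      rw [this]
      exact (c₁.clm_comp continuous_const).add (c₂.clm_comp continuous_const)
    · exact (hasStrictFDerivAt_uncurry_coprod (f := f) (f₁ := f₁) (f₂ := f₂)
        (Eventually.of_forall fun v => h₁ v.1 v.2) (Eventually.of_forall fun v => h₂ v.1 v.2)
        c₁.continuousAt c₂.continuousAt).hasFDerivAt
  · intro q
    rw [e₁]
    exact fun k => (h₃ q k).differentiableAt
  · rw [e₃]
    exact c₃

theorem KernelSmooth.hasFDerivAt_q (hf : KernelSmooth f) (q k : Mom d) :
    HasFDerivAt (fun q' => f q' k) (dq f q k) q := (hf.diff_q k q).hasFDerivAt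

theorem KernelSmooth.hasFDerivAt_k (hf : KernelSmooth f) (q k : Mom d) :
    HasFDerivAt (fun k' => f q k') (dk f q k) k := (hf.diff_k q k).hasFDerivAt

theorem KernelSmooth.hasFDerivAt_dq (hf : KernelSmooth f) (q k : Mom d) :
    HasFDerivAt (fun k' => dq f q k') (dkdq f q k) k := (hf.differentiable_dq q k).hasFDerivAt

theorem KernelSmooth.continuous (hf : KernelSmooth f) : Continuous (Function.uncurry f) :=
  hf.contDiff.continuous

theorem KernelSmooth.hasFDerivAt_uncurry (hf : KernelSmooth f) (q k : Mom d) :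
    HasFDerivAt (Function.uncurry f) (fderiv ℝ (Function.uncurry f) (q, k)) (q, k) :=
  (hf.contDiff.differentiable (by norm_num) _).hasFDerivAt

theorem KernelSmooth.dq_eq (hf : KernelSmooth f) (q k : Mom d) : dq f q k =
    (fderiv ℝ (Function.uncurry f) (q, k)).comp (ContinuousLinearMap.inl ℝ (Mom d) (Mom d)) := by
  have h1 : HasFDerivAt (fun q' : Mom d => (q', k)) (ContinuousLinearMap.inl ℝ (Mom d) (Mom d)) q :=
    hasFDerivAt_prodMk_left q k
  exact ((hf.hasFDerivAt_uncurry q k).comp q h1).fderiv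

theorem KernelSmooth.dk_eq (hf : KernelSmooth f) (q k : Mom d) : dk f q k =
    (fderiv ℝ (Function.uncurry f) (q, k)).comp (ContinuousLinearMap.inr ℝ (Mom d) (Mom d)) := by
  have h1 : HasFDerivAt (fun k' : Mom d => (q, k')) (ContinuousLinearMap.inr ℝ (Mom d) (Mom d)) k :=
    hasFDerivAt_prodMk_right q k
  exact ((hf.hasFDerivAt_uncurry q k).comp k h1).fderiv

theorem KernelSmooth.continuous_dq (hf : KernelSmooth f) : Continuous (Function.uncurry (dq f)) := by
  have : Function.uncurry (dq f) = fun v => (fderiv ℝ (Function.uncurry f) v).comp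
      (ContinuousLinearMap.inl ℝ (Mom d) (Mom d)) := funext fun v => hf.dq_eq v.1 v.2
  rw [this]
  exact (hf.contDiff.continuous_fderiv (by norm_num)).clm_comp continuous_const

theorem KernelSmooth.continuous_dk (hf : KernelSmooth f) : Continuous (Function.uncurry (dk f)) := by
  have : Function.uncurry (dk f) = fun v => (fderiv ℝ (Function.uncurry f) v).comp
      (ContinuousLinearMap.inr ℝ (Mom d) (Mom d)) := funext fun v => hf.dk_eq v.1 v.2
  rw [this]
  exact (hf.contDiff.continuous_fderiv (by norm_num)).clm_comp continuous_const

theorem K₁.ker_sub (f g : K₁ h) : (f - g).ker = f.ker - g.ker := rfl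

theorem KernelSmooth.sub_eq (hf : KernelSmooth f) (hg : KernelSmooth g) :
    dq (f - g) = dq f - dq g ∧ dk (f - g) = dk f - dk g ∧ dkdq (f - g) = dkdq f - dkdq g := by
  have e : f - g = f + (-1 : ℂ) • g := by rw [neg_one_smul, sub_eq_add_neg]
  rw [e, dq_add hf (hg.smul _), dk_add hf (hg.smul _), dkdq_add hf (hg.smul _), dq_smul hg,
    dk_smul hg, dkdq_smul hg]
  refine ⟨by rw [neg_one_smul, sub_eq_add_neg], by rw [neg_one_smul, sub_eq_add_neg],
    funext fun q => funext fun k => ?_⟩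
  exact (congrArg (dkdq f q k + ·) (neg_one_smul ℂ (dkdq g q k))).trans (sub_eq_add_neg _ _).symm

/-- Uniform limits of sequences controlled by a Cauchy sequence. -/
theorem exists_uniform_limit {X Y ι : Type*} [NormedAddCommGroup X] [NormedAddCommGroup Y]
    [CompleteSpace Y] {u : ℕ → X} (hu : CauchySeq u) {a : ℕ → ι → Y} {w : ι → ℝ}
    (hw0 : ∀ x, 0 ≤ w x) (hw1 : ∀ x, w x ≤ 1)
    (ha : ∀ n m x, ‖a n x - a m x‖ ≤ ‖u n - u m‖ * w x) :
    ∃ b : ι → Y, TendstoUniformly a b atTop ∧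
      ∀ ε > 0, ∃ N, ∀ n ≥ N, ∀ x, ‖a n x - b x‖ ≤ ε * w x := by
  have hc : ∀ x, CauchySeq fun n => a n x := fun x => by
    rw [Metric.cauchySeq_iff] at hu ⊢
    intro ε hε
    obtain ⟨N, hN⟩ := hu ε hε
    refine ⟨N, fun m hm n hn => ?_⟩
    rw [dist_eq_norm]
    have h1 := hN m hm n hn
    rw [dist_eq_norm] at h1
    exact ((ha m n x).trans (mul_le_of_le_one_right (norm_nonneg _) (hw1 x))).trans_lt h1
  choose b hb using fun x => cauchySeq_tendsto_of_complete (hc x)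
  have hq : ∀ ε > 0, ∃ N, ∀ n ≥ N, ∀ x, ‖a n x - b x‖ ≤ ε * w x := by
    intro ε hε
    obtain ⟨N, hN⟩ := Metric.cauchySeq_iff.mp hu ε hε
    refine ⟨N, fun n hn x => ?_⟩
    refine le_of_tendsto ((tendsto_const_nhds.sub (hb x)).norm) ?_
    filter_upwards [eventually_ge_atTop N] with m hm
    refine (ha n m x).trans (mul_le_mul_of_nonneg_right ?_ (hw0 x))
    have := hN n hn m hm
    rw [dist_eq_norm] at this
    exact this.le
  refine ⟨b, ?_, hq⟩
  rw [Metric.tendstoUniformly_iff]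
  intro ε hε
  obtain ⟨N, hN⟩ := hq (ε / 2) (by positivity)
  filter_upwards [eventually_ge_atTop N] with n hn x
  rw [dist_comm, dist_eq_norm]
  have := (hN n hn x).trans (mul_le_of_le_one_right (by positivity) (hw1 x))
  linarith

/-- As h ≤ 1, the norm dominates the sup norms of a kernel and of its three derivatives. All four
converge uniformly, and the limits of the derivatives are the derivatives of the limit. -/
theorem K₁.completeSpace (h0 : ∀ q, 0 ≤ h q) (h1 : ∀ q, h q ≤ 1) : CompleteSpace (K₁ h) := by
  refine Metric.complete_of_cauchySeq_tendsto fun u hu => ?_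
  set w : Mom d × Mom d → ℝ := fun v => h v.1 * h v.2
  have hw0 : ∀ v, 0 ≤ w v := fun v => mul_nonneg (h0 _) (h0 _)
  have hw1 : ∀ v, w v ≤ 1 := fun v => mul_le_one₀ (h1 _) (h0 _) (h1 _)
  have hs := fun n => (u n).smooth
  have hB := fun n m => (u n - u m).bound_norm
  simp only [K₁.ker_sub] at hB
  have hE := fun n m => (hs n).sub_eq (hs m)
  obtain ⟨b, hb, hb'⟩ := exists_uniform_limit hu (a := fun n => Function.uncurry (u n).ker) hw0 hw1
    fun n m v => (hB n m).b00 v.1 v.2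
  obtain ⟨b₁, hb₁, hb₁'⟩ := exists_uniform_limit hu (a := fun n => Function.uncurry (dq (u n).ker))
    hw0 hw1 fun n m v => by
      have := (hB n m).b10 v.1 v.2
      rwa [(hE n m).1] at this
  obtain ⟨b₂, hb₂, hb₂'⟩ := exists_uniform_limit hu (a := fun n => Function.uncurry (dk (u n).ker))
    hw0 hw1 fun n m v => by
      have := (hB n m).b01 v.1 v.2
      rwa [(hE n m).2.1] at this
  obtain ⟨b₃, hb₃, hb₃'⟩ := exists_uniform_limit hu
    (a := fun n => Function.uncurry (dkdq (u n).ker)) hw0 hw1 fun n m v => by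
      have := (hB n m).b11 v.1 v.2
      rwa [(hE n m).2.2] at this
  have hsm := KernelSmooth.of_partials (f := Function.curry b) (f₁ := Function.curry b₁)
    (f₂ := Function.curry b₂) (f₃ := Function.curry b₃)
    (fun q k => hasFDerivAt_of_tendstoUniformly (l := atTop) (f := fun n q' => (u n).ker q' k)
      (f' := fun n q' => dq (u n).ker q' k) (hb₁.comp fun q' => (q', k))
      (fun n q' => (hs n).hasFDerivAt_q q' k) (fun q' => hb.tendsto_at (q', k)) q)
    (fun q k => hasFDerivAt_of_tendstoUniformly (l := atTop) (f := fun n k' => (u n).ker q k')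
      (f' := fun n k' => dk (u n).ker q k') (hb₂.comp fun k' => (q, k'))
      (fun n k' => (hs n).hasFDerivAt_k q k') (fun k' => hb.tendsto_at (q, k')) k)
    (fun q k => hasFDerivAt_of_tendstoUniformly (l := atTop) (f := fun n k' => dq (u n).ker q k')
      (f' := fun n k' => dkdq (u n).ker q k') (hb₃.comp fun k' => (q, k'))
      (fun n k' => (hs n).hasFDerivAt_dq q k') (fun k' => hb₁.tendsto_at (q, k')) k)
    (by
      rw [Function.uncurry_curry]
      exact hb₁.continuous (Frequently.of_forall fun n => (hs n).continuous_dq))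
    (by
      rw [Function.uncurry_curry]
      exact hb₂.continuous (Frequently.of_forall fun n => (hs n).continuous_dk))
    (by
      rw [Function.uncurry_curry]
      exact hb₃.continuous (Frequently.of_forall fun n => (hs n).continuous_dkdq))
  obtain ⟨hfs, e₁, e₂, e₃⟩ := hsm
  have hdiff : ∀ ε > 0, ∃ N, ∀ n ≥ N, KernelBound h ((u n).ker - Function.curry b) ε := by
    intro ε hε
    obtain ⟨N, hN⟩ := hb' ε hε
    obtain ⟨N₁, hN₁⟩ := hb₁' ε hε
    obtain ⟨N₂, hN₂⟩ := hb₂' ε hε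
    obtain ⟨N₃, hN₃⟩ := hb₃' ε hε
    refine ⟨max (max N N₁) (max N₂ N₃), fun n hn => ?_⟩
    simp only [ge_iff_le, max_le_iff] at hn
    obtain ⟨g₁, g₂, g₃⟩ := (hs n).sub_eq hfs
    exact
      { nonneg := hε.le
        b00 := fun q k => hN n hn.1.1 (q, k)
        b10 := fun q k => by rw [g₁, e₁]; exact hN₁ n hn.1.2 (q, k)
        b01 := fun q k => by rw [g₂, e₂]; exact hN₂ n hn.2.1 (q, k)
        b11 := fun q k => by rw [g₃, e₃]; exact hN₃ n hn.2.2 (q, k) }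
  obtain ⟨N, hN⟩ := hdiff 1 one_pos
  -- The limit inherits a finite bound because it differs from a member of the sequence by a kernel
  -- with bound 1.
  have hmem : Function.curry b ∈ kernelSubmodule h := by
    have h2 : (u N).ker - Function.curry b ∈ kernelSubmodule h :=
      ⟨by
        have := hfs.smul (-1)
        rw [neg_one_smul] at this
        rw [sub_eq_add_neg]
        exact (hs N).add this, 1, hN N le_rfl⟩
    have h3 := (kernelSubmodule h).sub_mem (u N).2 h2
    have h4 : ((u N).1 : Mom d → Mom d → M₂) - ((u N).ker - Function.curry b) = Function.curry b :=
      sub_sub_cancel _ _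
    rwa [h4] at h3
  let F : K₁ h := ⟨Function.curry b, hmem⟩
  refine ⟨F, Metric.tendsto_atTop.mpr fun ε hε => ?_⟩
  obtain ⟨N, hN⟩ := hdiff (ε / 2) (by positivity)
  refine ⟨N, fun n hn => ?_⟩
  rw [dist_eq_norm]
  have := K₁.norm_le (f := u n - F) (C := ε / 2) (hN n hn)
  linarith

end Complete

/-! ### Composition of kernels -/

section Parametric

variable {d : ℕ} {X E : Type*} [NormedAddCommGroup X] [NormedSpace ℝ X] [NormedAddCommGroup E]
  [NormedSpace ℝ E]

theorem hasFDerivAt_integral_of_continuous {F : X → Mom d → E} {F' : X → Mom d → X →L[ℝ] E}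
    {w : Mom d → ℝ} (hw : Integrable w) (hF : Continuous (Function.uncurry F))
    (hF' : Continuous (Function.uncurry F')) (hd : ∀ x p, HasFDerivAt (fun y => F y p) (F' x p) x)
    (hb : ∀ x p, ‖F x p‖ ≤ w p) (hb' : ∀ x p, ‖F' x p‖ ≤ w p) (x : X) :
    HasFDerivAt (fun x => ∫ p, F x p) (∫ p, F' x p) x := by
  have hc : ∀ y, Continuous (F y) := fun y => hF.comp (Continuous.prodMk_right y)
  exact hasFDerivAt_integral_of_dominated_of_fderiv_le (s := univ) univ_mem
    (Eventually.of_forall fun y => (hc y).aestronglyMeasurable)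
    (hw.mono' (hc x).aestronglyMeasurable (Eventually.of_forall (hb x)))
    (hF'.comp (Continuous.prodMk_right x)).aestronglyMeasurable
    (Eventually.of_forall fun p y _ => hb' y p) hw (Eventually.of_forall fun p y _ => hd y p)

theorem continuous_integral_of_continuous {Z : Type*} [TopologicalSpace Z]
    [FirstCountableTopology Z] {F : Z → Mom d → E} {w : Mom d → ℝ}
    (hw : Integrable w) (hF : Continuous (Function.uncurry F)) (hb : ∀ x p, ‖F x p‖ ≤ w p) :
    Continuous fun x => ∫ p, F x p :=
  continuous_of_dominated
    (fun y => (hF.comp (Continuous.prodMk_right y)).aestronglyMeasurable)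
    (fun y => Eventually.of_forall (hb y)) hw
    (Eventually.of_forall fun p => hF.comp (Continuous.prodMk_left p))

end Parametric

section Algebra

variable {d : ℕ} {𝔸 : Type*} [NormedRing 𝔸] [NormedAlgebra ℝ 𝔸]

/-- The bilinear map `(A, m) ↦ (v ↦ A v * m)`. -/
def insL : (Mom d →L[ℝ] 𝔸) →L[ℝ] 𝔸 →L[ℝ] (Mom d →L[ℝ] 𝔸) :=
  ((ContinuousLinearMap.compL ℝ 𝔸 (𝔸 →L[ℝ] 𝔸) (Mom d →L[ℝ] 𝔸)).flip
    (ContinuousLinearMap.mul ℝ 𝔸).flip).comp (ContinuousLinearMap.compL ℝ (Mom d) 𝔸 𝔸).flip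

theorem insL_apply (A : Mom d →L[ℝ] 𝔸) (m : 𝔸) (v : Mom d) : insL A m v = A v * m := rfl

theorem norm_insL_apply_le (A : Mom d →L[ℝ] 𝔸) (m : 𝔸) : ‖insL A m‖ ≤ ‖A‖ * ‖m‖ :=
  ContinuousLinearMap.opNorm_le_bound _ (by positivity) fun v => by
    rw [insL_apply]
    calc _ ≤ ‖A v‖ * ‖m‖ := norm_mul_le _ _
      _ ≤ ‖A‖ * ‖v‖ * ‖m‖ := by gcongr; exact A.le_opNorm v
      _ = _ := by ring

theorem norm_insL_le (A : Mom d →L[ℝ] 𝔸) : ‖insL A‖ ≤ ‖A‖ :=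
  ContinuousLinearMap.opNorm_le_bound _ (norm_nonneg _) fun m => norm_insL_apply_le A m

theorem norm_mulL_le (m : 𝔸) : ‖ContinuousLinearMap.mul ℝ 𝔸 m‖ ≤ ‖m‖ :=
  ContinuousLinearMap.opNorm_le_bound _ (norm_nonneg _) fun _ => norm_mul_le _ _

attribute [irreducible] insL

variable {f g : Mom d → Mom d → 𝔸} {f₁ g₂ : Mom d → Mom d → Mom d →L[ℝ] 𝔸} {W : Mom d → 𝔸}
  {a b : Mom d → ℝ} {B : ℝ}

theorem hasFDerivAt_comp_left (hf : Continuous (Function.uncurry f))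
    (hf₁ : Continuous (Function.uncurry f₁)) (hg : Continuous (Function.uncurry g))
    (hW : Continuous W) (fd : ∀ q p, HasFDerivAt (fun q' => f q' p) (f₁ q p) q)
    (fb : ∀ q p, ‖f q p‖ ≤ a p) (fb₁ : ∀ q p, ‖f₁ q p‖ ≤ a p) (gb : ∀ p k, ‖g p k‖ ≤ b p)
    (Wb : ∀ p, ‖W p‖ ≤ B) (hab : Integrable fun p => a p * b p) (q k : Mom d) :
    HasFDerivAt (fun q' => ∫ p, f q' p * W p * g p k) (∫ p, insL (f₁ q p) (W p * g p k)) q := by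
  have ha : ∀ p, 0 ≤ a p := fun p => (norm_nonneg _).trans (fb 0 p)
  have hB : 0 ≤ B := (norm_nonneg _).trans (Wb 0)
  have hgk : Continuous fun p => g p k := hg.comp (Continuous.prodMk_left k)
  refine hasFDerivAt_integral_of_continuous (F := fun q p => f q p * W p * g p k)
    (F' := fun q p => insL (f₁ q p) (W p * g p k)) (hab.const_mul B) ?_ ?_ (fun q p => ?_)
    (fun q p => ?_) (fun q p => ?_) q
  · exact (hf.mul (hW.comp continuous_snd)).mul (hgk.comp continuous_snd)
  · exact ((insL (𝔸 := 𝔸)).continuous.comp hf₁).clm_apply ((hW.mul hgk).comp continuous_snd)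
  · have h1 := ((ContinuousLinearMap.mul ℝ 𝔸).flip (W p * g p k)).hasFDerivAt.comp q (fd q p)
    have h2 : ((ContinuousLinearMap.mul ℝ 𝔸).flip (W p * g p k)) ∘ (fun q' => f q' p) =
        fun q => f q p * W p * g p k := funext fun q => (mul_assoc _ _ _).symm
    rw [h2] at h1
    exact h1.congr_fderiv (ContinuousLinearMap.ext fun v => (insL_apply _ _ v).symm)
  · calc _ ≤ ‖f q p‖ * ‖W p‖ * ‖g p k‖ := (norm_mul_le _ _).trans (by gcongr; exact norm_mul_le _ _)
      _ ≤ a p * B * b p := by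
        gcongr
        · exact mul_nonneg (ha p) hB
        · exact ha p
        · exact fb q p
        · exact Wb p
        · exact gb p k
      _ = _ := by ring
  · calc _ ≤ ‖f₁ q p‖ * (‖W p‖ * ‖g p k‖) :=
        (norm_insL_apply_le _ _).trans (by gcongr; exact norm_mul_le _ _)
      _ ≤ a p * (B * b p) := by
        gcongr
        · exact ha p
        · exact fb₁ q p
        · exact Wb p
        · exact gb p k
      _ = _ := by ring

theorem hasFDerivAt_comp_right {G : Type*} [NormedAddCommGroup G] [NormedSpace ℝ G]
    {L : Mom d → 𝔸 →L[ℝ] G} (hL : Continuous L) (hLb : ∀ p, ‖L p‖ ≤ a p)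
    (hg : Continuous (Function.uncurry g)) (hg₂ : Continuous (Function.uncurry g₂))
    (gd : ∀ p k, HasFDerivAt (fun k' => g p k') (g₂ p k) k)
    (gb : ∀ p k, ‖g p k‖ ≤ b p) (gb₂ : ∀ p k, ‖g₂ p k‖ ≤ b p)
    (hab : Integrable fun p => a p * b p) (k : Mom d) :
    HasFDerivAt (fun k' => ∫ p, L p (g p k')) (∫ p, (L p).comp (g₂ p k)) k := by
  have ha : ∀ p, 0 ≤ a p := fun p => (norm_nonneg _).trans (hLb p)
  refine hasFDerivAt_integral_of_continuous (F := fun k p => L p (g p k))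
    (F' := fun k p => (L p).comp (g₂ p k)) hab ?_ ?_ (fun k p => ?_)
    (fun k p => ?_) (fun k p => ?_) k
  · exact (hL.comp continuous_snd).clm_apply (hg.comp continuous_swap)
  · exact (hL.comp continuous_snd).clm_comp (hg₂.comp continuous_swap)
  · exact (L p).hasFDerivAt.comp k (gd p k)
  · refine ((L p).le_opNorm _).trans ?_
    gcongr
    · exact ha p
    · exact hLb p
    · exact gb p k
  · refine (ContinuousLinearMap.opNorm_comp_le _ _).trans ?_
    gcongr
    · exact ha p
    · exact hLb p
    · exact gb₂ p k

theorem continuous_comp_left (hf₁ : Continuous (Function.uncurry f₁))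
    (hg : Continuous (Function.uncurry g)) (hW : Continuous W)
    (fb₁ : ∀ q p, ‖f₁ q p‖ ≤ a p) (gb : ∀ p k, ‖g p k‖ ≤ b p)
    (Wb : ∀ p, ‖W p‖ ≤ B) (hab : Integrable fun p => a p * b p) :
    Continuous (Function.uncurry fun q k => ∫ p, insL (f₁ q p) (W p * g p k)) := by
  have ha : ∀ p, 0 ≤ a p := fun p => (norm_nonneg _).trans (fb₁ 0 p)
  have hB : 0 ≤ B := (norm_nonneg _).trans (Wb 0)
  refine continuous_integral_of_continuous (Z := Mom d × Mom d)
    (F := fun v p => insL (f₁ v.1 p) (W p * g p v.2)) (hab.const_mul B) ?_ (fun v p => ?_)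
  · refine ((insL (𝔸 := 𝔸)).continuous.comp (hf₁.comp (f := fun x : (Mom d × Mom d) × Mom d =>
      (x.1.1, x.2)) (by fun_prop))).clm_apply ((hW.comp continuous_snd).mul
        (hg.comp (f := fun x : (Mom d × Mom d) × Mom d => (x.2, x.1.2)) (by fun_prop)))
  · calc _ ≤ ‖f₁ v.1 p‖ * (‖W p‖ * ‖g p v.2‖) :=
        (norm_insL_apply_le _ _).trans (by gcongr; exact norm_mul_le _ _)
      _ ≤ a p * (B * b p) := by
        gcongr
        · exact ha p
        · exact fb₁ _ p
        · exact Wb p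
        · exact gb p _
      _ = _ := by ring

theorem continuous_comp_right {G : Type*} [NormedAddCommGroup G] [NormedSpace ℝ G]
    {L : Mom d → Mom d → 𝔸 →L[ℝ] G} (hL : Continuous (Function.uncurry L))
    (hLb : ∀ q p, ‖L q p‖ ≤ a p) (hg₂ : Continuous (Function.uncurry g₂))
    (gb₂ : ∀ p k, ‖g₂ p k‖ ≤ b p) (hab : Integrable fun p => a p * b p) :
    Continuous (Function.uncurry fun q k => ∫ p, (L q p).comp (g₂ p k)) := by
  have ha : ∀ p, 0 ≤ a p := fun p => (norm_nonneg _).trans (hLb 0 p)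
  refine continuous_integral_of_continuous (Z := Mom d × Mom d)
    (F := fun v p => (L v.1 p).comp (g₂ p v.2)) hab ?_ (fun v p => ?_)
  · exact (hL.comp (f := fun x : (Mom d × Mom d) × Mom d => (x.1.1, x.2)) (by fun_prop)).clm_comp
        (hg₂.comp (f := fun x : (Mom d × Mom d) × Mom d => (x.2, x.1.2)) (by fun_prop))
  · refine (ContinuousLinearMap.opNorm_comp_le _ _).trans ?_
    gcongr
    · exact ha p
    · exact hLb _ p
    · exact gb₂ p _

theorem prodKer_partials (hf : Continuous (Function.uncurry f))
    (hf₁ : Continuous (Function.uncurry f₁)) (hg : Continuous (Function.uncurry g))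
    (hg₂ : Continuous (Function.uncurry g₂)) (hW : Continuous W)
    (fd : ∀ q p, HasFDerivAt (fun q' => f q' p) (f₁ q p) q)
    (gd : ∀ p k, HasFDerivAt (fun k' => g p k') (g₂ p k) k)
    (fb : ∀ q p, ‖f q p‖ ≤ a p) (fb₁ : ∀ q p, ‖f₁ q p‖ ≤ a p) (gb : ∀ p k, ‖g p k‖ ≤ b p)
    (gb₂ : ∀ p k, ‖g₂ p k‖ ≤ b p) (Wb : ∀ p, ‖W p‖ ≤ B) (hab : Integrable fun p => a p * b p) :
    (∀ q k, HasFDerivAt (fun q' => ∫ p, f q' p * W p * g p k)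
      (∫ p, insL (f₁ q p) (W p * g p k)) q) ∧
    (∀ q k, HasFDerivAt (fun k' => ∫ p, f q p * W p * g p k')
      (∫ p, (ContinuousLinearMap.mul ℝ 𝔸 (f q p * W p)).comp (g₂ p k)) k) ∧
    (∀ q k, HasFDerivAt (fun k' => ∫ p, insL (f₁ q p) (W p * g p k'))
      (∫ p, ((insL (f₁ q p)).comp (ContinuousLinearMap.mul ℝ 𝔸 (W p))).comp (g₂ p k)) k) ∧
    Continuous (Function.uncurry fun q k => ∫ p, insL (f₁ q p) (W p * g p k)) ∧
    Continuous (Function.uncurry fun q k =>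
      ∫ p, (ContinuousLinearMap.mul ℝ 𝔸 (f q p * W p)).comp (g₂ p k)) ∧
    Continuous (Function.uncurry fun q k =>
      ∫ p, ((insL (f₁ q p)).comp (ContinuousLinearMap.mul ℝ 𝔸 (W p))).comp (g₂ p k)) := by
  have ha : ∀ p, 0 ≤ a p := fun p => (norm_nonneg _).trans (fb 0 p)
  have hB : 0 ≤ B := (norm_nonneg _).trans (Wb 0)
  have hint : Integrable fun p => a p * B * b p :=
    (hab.const_mul B).congr (Eventually.of_forall fun p => by simp only; ring)
  have hWs : Continuous fun v : Mom d × Mom d => W v.2 := hW.comp continuous_snd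
  have hL2 : Continuous (Function.uncurry fun q p => ContinuousLinearMap.mul ℝ 𝔸 (f q p * W p)) :=
    (ContinuousLinearMap.mul ℝ 𝔸).continuous.comp (hf.mul hWs)
  have hL3 : Continuous (Function.uncurry fun q p => (insL (f₁ q p)).comp
      (ContinuousLinearMap.mul ℝ 𝔸 (W p))) :=
    ((insL (𝔸 := 𝔸)).continuous.comp hf₁).clm_comp
      ((ContinuousLinearMap.mul ℝ 𝔸).continuous.comp hWs)
  have hL2b : ∀ q p, ‖ContinuousLinearMap.mul ℝ 𝔸 (f q p * W p)‖ ≤ a p * B := fun q p => by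
    refine (norm_mulL_le _).trans ((norm_mul_le _ _).trans ?_)
    gcongr
    · exact ha p
    · exact fb q p
    · exact Wb p
  have hL3b : ∀ q p, ‖(insL (f₁ q p)).comp (ContinuousLinearMap.mul ℝ 𝔸 (W p))‖ ≤
      a p * B := fun q p => by
    refine (ContinuousLinearMap.opNorm_comp_le _ _).trans ?_
    gcongr
    · exact ha p
    · exact (norm_insL_le _).trans (fb₁ q p)
    · exact (norm_mulL_le _).trans (Wb p)
  exact ⟨hasFDerivAt_comp_left hf hf₁ hg hW fd fb fb₁ gb Wb hab,
    fun q => hasFDerivAt_comp_right (L := fun p => ContinuousLinearMap.mul ℝ 𝔸 (f q p * W p))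
      (hL2.comp (Continuous.prodMk_right q)) (hL2b q) hg hg₂ gd gb gb₂ hint,
    fun q => by
      have := hasFDerivAt_comp_right (L := fun p => (insL (f₁ q p)).comp
        (ContinuousLinearMap.mul ℝ 𝔸 (W p)))
        (hL3.comp (Continuous.prodMk_right q)) (hL3b q) hg hg₂ gd gb gb₂ hint
      exact this,
    continuous_comp_left hf₁ hg hW fb₁ gb Wb hab,
    continuous_comp_right hL2 hL2b hg₂ gb₂ hint, continuous_comp_right hL3 hL3b hg₂ gb₂ hint⟩

end Algebra

/-- The properties of the dominating function of the form factor. -/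
structure IsWeight {d : ℕ} (h : Mom d → ℝ) : Prop where
  pos : ∀ q, 0 < h q
  le_one : ∀ q, h q ≤ 1
  continuous : Continuous h
  memLp : MemLp h 2 volume

section Product

variable {d : ℕ} {h : Mom d → ℝ} {f g : Mom d → Mom d → M₂} {W : Mom d → M₂} {B C C' : ℝ}

theorem IsWeight.integrable_sq (hh : IsWeight h) : Integrable fun q => h q ^ 2 :=
  hh.memLp.integrable_sq

theorem FormFactor.isWeight {lam : Mom d → ℂ} (hl : FormFactor lam h) : IsWeight h :=
  ⟨hl.h_pos, hl.h_le_one, hl.h_continuous, hl.h_memLp⟩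

/-- `∫ f(q,p) W(p) g(p,k) dp`. -/
def prodKer (W : Mom d → M₂) (f g : Mom d → Mom d → M₂) (q k : Mom d) : M₂ :=
  ∫ p, f q p * W p * g p k

/-- The outer weights are at most 1, so the integrands are dominated by multiples of h(p)²,
independently of q and k. This suffices for smoothness; the decay in q and k is recovered
afterwards. -/
theorem prodKer_smooth (hh : IsWeight h) (hf : KernelSmooth f) (hg : KernelSmooth g)
    (bf : KernelBound h f C) (bg : KernelBound h g C') (hW : Continuous W) (Wb : ∀ p, ‖W p‖ ≤ B) :
    KernelSmooth (prodKer W f g) ∧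
    dq (prodKer W f g) = (fun q k => ∫ p, insL (dq f q p) (W p * g p k)) ∧
    dk (prodKer W f g) =
      (fun q k => ∫ p, (ContinuousLinearMap.mul ℝ M₂ (f q p * W p)).comp (dk g p k)) ∧
    dkdq (prodKer W f g) = (fun q k => ∫ p, ((insL (dq f q p)).comp
      (ContinuousLinearMap.mul ℝ M₂ (W p))).comp (dk g p k)) := by
  have hC := bf.nonneg
  have hC' := bg.nonneg
  have le1 : ∀ x, ∀ q p : Mom d, x ≤ C * (h q * h p) → x ≤ C * h p := fun x q p hx =>
    hx.trans (mul_le_mul_of_nonneg_left (mul_le_of_le_one_left (hh.pos p).le (hh.le_one q)) hC)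
  have le2 : ∀ x, ∀ p k : Mom d, x ≤ C' * (h p * h k) → x ≤ C' * h p := fun x p k hx =>
    hx.trans (mul_le_mul_of_nonneg_left (mul_le_of_le_one_right (hh.pos p).le (hh.le_one k)) hC')
  have hint : Integrable fun p => C * h p * (C' * h p) := by
    refine (hh.integrable_sq.const_mul (C * C')).congr (Eventually.of_forall fun p => ?_)
    simp only; ring
  obtain ⟨p₁, p₂, p₃, p₄, p₅, p₆⟩ := prodKer_partials hf.continuous hf.continuous_dq hg.continuous
    hg.continuous_dk hW hf.hasFDerivAt_q hg.hasFDerivAt_k (fun q p => le1 _ q p (bf.b00 q p))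
    (fun q p => le1 _ q p (bf.b10 q p)) (fun p k => le2 _ p k (bg.b00 p k))
    (fun p k => le2 _ p k (bg.b01 p k)) Wb hint
  exact KernelSmooth.of_partials p₁ p₂ p₃ p₄ p₅ p₆

end Product

/-! ### Weights controlled only through integrals. -/

section Tame

open scoped BoundedContinuousFunction

variable {d : ℕ} {h : Mom d → ℝ} {W : Mom d → M₂} {B c : ℝ}

/-- The functions `W` for which `∫ A W B` is controlled by `c` for all `A`, `B` that are dominated,
with their gradients, by `h`. -/
def TameBound (h : Mom d → ℝ) (W : Mom d → M₂) (c : ℝ) : Prop :=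
  ∀ (A B : Mom d → M₂) (a b : ℝ), ContDiff ℝ 1 A → ContDiff ℝ 1 B →
    (∀ p, ‖A p‖ ≤ a * h p) → (∀ p, ‖fderiv ℝ A p‖ ≤ a * h p) →
    (∀ p, ‖B p‖ ≤ b * h p) → (∀ p, ‖fderiv ℝ B p‖ ≤ b * h p) →
    ‖∫ p, A p * W p * B p‖ ≤ c * a * b

theorem norm_mul_mul_le (hW : ∀ p, ‖W p‖ ≤ B) {x y : M₂} {a b : ℝ} {p : Mom d}
    (hx : ‖x‖ ≤ a * h p) (hy : ‖y‖ ≤ b * h p) : ‖x * W p * y‖ ≤ B * a * b * h p ^ 2 := by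
  have h0 : 0 ≤ a * h p := (norm_nonneg _).trans hx
  have hB : 0 ≤ B := (norm_nonneg _).trans (hW 0)
  calc _ ≤ ‖x‖ * ‖W p‖ * ‖y‖ := (norm_mul_le _ _).trans (by gcongr; exact norm_mul_le _ _)
    _ ≤ a * h p * B * (b * h p) := by
      gcongr
      exact hW p
    _ = _ := by ring

theorem integrable_mul_mul (hh : IsWeight h) (hWc : Continuous W) (hW : ∀ p, ‖W p‖ ≤ B)
    {A A' : Mom d → M₂} {a b : ℝ} (hA : Continuous A) (hA' : Continuous A')
    (ha : ∀ p, ‖A p‖ ≤ a * h p) (hb : ∀ p, ‖A' p‖ ≤ b * h p) :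
    Integrable fun p => A p * W p * A' p :=
  (hh.integrable_sq.const_mul (B * a * b)).mono'
    ((hA.mul hWc).mul hA').aestronglyMeasurable
    (Eventually.of_forall fun p => norm_mul_mul_le hW (ha p) (hb p))

/-- The trivial bound. It makes the products well defined at each z, but for R(z) it is not uniform
near the cut. -/
theorem tameBound_of_bound (hh : IsWeight h) (hW : ∀ p, ‖W p‖ ≤ B) :
    TameBound h W (B * ∫ p, h p ^ 2) := by
  intro A A' a b _ _ ha _ hb _
  have := norm_integral_le_of_norm_le (hh.integrable_sq.const_mul (B * a * b))
    (Eventually.of_forall fun p => norm_mul_mul_le hW (ha p) (hb p))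
  rw [integral_const_mul] at this
  exact this.trans (le_of_eq (by ring))

/-- `KernelSmooth` provides ∂_k ∂_q, which does not say that p ↦ ∂_k g(p, k) is differentiable, so
the hypothesis on W cannot be applied to it. It is applied instead to the differences g(·, k') -
g(·, k): by the mean value inequality they and their p-gradients are O(‖k' - k‖), and the resulting
Lipschitz constant bounds the derivative. -/
theorem TameBound.norm_deriv_le (ht : TameBound h W c) (hc : 0 ≤ c) (hh : IsWeight h)
    (hWc : Continuous W) (hW : ∀ p, ‖W p‖ ≤ B) {A : Mom d → M₂} {a : ℝ} (ha0 : 0 ≤ a)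
    (hA : ContDiff ℝ 1 A) (ha : ∀ p, ‖A p‖ ≤ a * h p) (ha' : ∀ p, ‖fderiv ℝ A p‖ ≤ a * h p)
    {g : Mom d → Mom d → M₂} (hg : KernelSmooth g) {C : ℝ} (bg : KernelBound h g C) {k : Mom d}
    {F' : Mom d →L[ℝ] M₂} (hF : HasFDerivAt (fun k' => ∫ p, A p * W p * g p k') F' k) :
    ‖F'‖ ≤ c * a * (C * h k) := by
  have hC := bg.nonneg
  have hgc : ∀ k', ContDiff ℝ 1 fun p => g p k' := fun k' =>
    hg.contDiff.comp (contDiff_id.prodMk contDiff_const)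
  have hint : ∀ k', Integrable fun p => A p * W p * g p k' := fun k' =>
    integrable_mul_mul hh hWc hW hA.continuous (hgc k').continuous ha (b := C * h k') fun p =>
      (bg.b00 p k').trans (le_of_eq (by ring))
  -- Near k the weight h(k') is at most h(k) + ε by continuity of h; letting ε tend to 0 restores
  -- the exact weight h(k).
  have key : ∀ ε : ℝ, 0 < ε → ‖F'‖ ≤ c * a * (C * (h k + ε)) := by
    intro ε hε
    have hpos : 0 ≤ h k + ε := by linarith [hh.pos k]
    refine hF.le_of_lip' (by positivity) ?_
    have hev : ∀ᶠ k' in 𝓝 k, h k' < h k + ε :=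
      hh.continuous.continuousAt.eventually_lt_const (by linarith)
    obtain ⟨δ, hδ, hball⟩ := Metric.eventually_nhds_iff_ball.mp hev
    filter_upwards [Metric.ball_mem_nhds k hδ] with k' hk'
    have hk := Metric.mem_ball_self (x := k) hδ
    have hle : ∀ p, ∀ x ∈ Metric.ball k δ, C * (h p * h x) ≤ C * (h k + ε) * h p := fun p x hx => by
      calc C * (h p * h x) = C * h x * h p := by ring
        _ ≤ _ := by
          gcongr
          · exact (hh.pos p).le
          · exact (hball x hx).le
    rw [← integral_sub (hint k') (hint k)]
    have e : ∀ p, A p * W p * g p k' - A p * W p * g p k = A p * W p * (g p k' - g p k) := fun p =>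
      (mul_sub _ _ _).symm
    simp only [e]
    refine (ht A (fun p => g p k' - g p k) a (C * (h k + ε) * ‖k' - k‖) hA
      ((hgc k').sub (hgc k)) ha ha' (fun p => ?_) (fun p => ?_)).trans (le_of_eq (by ring))
    · refine ((convex_ball k δ).norm_image_sub_le_of_norm_hasFDerivWithin_le
        (fun x _ => (hg.hasFDerivAt_k p x).hasFDerivWithinAt)
        (fun x hx => (bg.b01 p x).trans (hle p x hx)) hk hk').trans (le_of_eq (by ring))
    · have h1 : fderiv ℝ (fun p => g p k' - g p k) p = dq g p k' - dq g p k :=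
        ((hg.hasFDerivAt_q p k').sub (hg.hasFDerivAt_q p k)).fderiv
      rw [h1]
      refine ((convex_ball k δ).norm_image_sub_le_of_norm_hasFDerivWithin_le
        (fun x _ => (hg.hasFDerivAt_dq p x).hasFDerivWithinAt)
        (fun x hx => (bg.b11 p x).trans (hle p x hx)) hk hk').trans (le_of_eq (by ring))
  have hlim : Tendsto (fun ε : ℝ => c * a * (C * (h k + ε))) (𝓝[>] 0) (𝓝 (c * a * (C * h k))) := by
    have : ContinuousAt (fun ε : ℝ => c * a * (C * (h k + ε))) 0 := by fun_prop
    have := this.tendsto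
    simp only [add_zero] at this
    exact this.mono_left nhdsWithin_le_nhds
  exact ge_of_tendsto hlim (by filter_upwards [self_mem_nhdsWithin] with ε hε using key ε hε)

/-- Derivatives in q fall on f alone: the direction v gives the factor A = ∂_q f(q, ·) v, which is
C¹ because f has a mixed derivative. Derivatives in k are covered by `TameBound.norm_deriv_le`. Thus
one scalar-type bound for W controls all four components of the norm. -/
theorem TameBound.kernelBound (ht : TameBound h W c) (hc : 0 ≤ c) (hh : IsWeight h)
    (hWc : Continuous W) (hW : ∀ p, ‖W p‖ ≤ B) {f g : Mom d → Mom d → M₂} (hf : KernelSmooth f)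
    (hg : KernelSmooth g) {C C' : ℝ} (bf : KernelBound h f C) (bg : KernelBound h g C') :
    KernelBound h (prodKer W f g) (c * C * C') := by
  have hC := bf.nonneg
  have hC' := bg.nonneg
  obtain ⟨hs, e₁, e₂, e₃⟩ := prodKer_smooth hh hf hg bf bg hWc hW
  have h0 : ∀ q, 0 ≤ h q := fun q => (hh.pos q).le
  have hgc : ∀ k', ContDiff ℝ 1 fun p => g p k' := fun k' =>
    hg.contDiff.comp (contDiff_id.prodMk contDiff_const)
  have hfc : ∀ q, ContDiff ℝ 1 fun p => f q p := fun q =>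
    hf.contDiff.comp (contDiff_const.prodMk contDiff_id)
  have f0 : ∀ q p, ‖f q p‖ ≤ C * h q * h p := fun q p => (bf.b00 q p).trans (le_of_eq (by ring))
  have f1 : ∀ q p, ‖fderiv ℝ (fun p => f q p) p‖ ≤ C * h q * h p := fun q p =>
    (bf.b01 q p).trans (le_of_eq (by ring))
  have g0 : ∀ k p, ‖g p k‖ ≤ C' * h k * h p := fun k p => (bg.b00 p k).trans (le_of_eq (by ring))
  have g1 : ∀ k p, ‖fderiv ℝ (fun p => g p k) p‖ ≤ C' * h k * h p := fun k p =>
    (bg.b10 p k).trans (le_of_eq (by ring))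
  have dd : ∀ q v p, HasFDerivAt (fun p => dq f q p v) ((dkdq f q p).flip v) p := fun q v p => by
    have := (hf.hasFDerivAt_dq q p).clm_apply (hasFDerivAt_const v p)
    rw [ContinuousLinearMap.comp_zero, zero_add] at this
    exact this
  have dc : ∀ q v, ContDiff ℝ 1 fun p => dq f q p v := fun q v =>
    contDiff_one_iff_hasFDerivAt.mpr ⟨fun p => (dkdq f q p).flip v,
      ((ContinuousLinearMap.flipₗᵢ ℝ (Mom d) (Mom d) M₂).continuous.comp (hf.continuous_dkdq.comp
        (Continuous.prodMk_right q))).clm_apply continuous_const, dd q v⟩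
  have d0 : ∀ q v p, ‖dq f q p v‖ ≤ C * h q * ‖v‖ * h p := fun q v p =>
    ((dq f q p).le_opNorm v).trans (by
      calc _ ≤ C * (h q * h p) * ‖v‖ := by gcongr; exact bf.b10 q p
        _ = _ := by ring)
  have d1 : ∀ q v p, ‖fderiv ℝ (fun p => dq f q p v) p‖ ≤ C * h q * ‖v‖ * h p := fun q v p => by
    rw [(dd q v p).fderiv]
    refine ContinuousLinearMap.opNorm_le_bound _ (by have := h0 q; have := h0 p; positivity)
      fun u => ?_
    rw [ContinuousLinearMap.flip_apply]
    calc _ ≤ ‖dkdq f q p u‖ * ‖v‖ := ContinuousLinearMap.le_opNorm _ _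
      _ ≤ C * (h q * h p) * ‖u‖ * ‖v‖ := by
        gcongr
        exact ((dkdq f q p).le_opNorm u).trans (by gcongr; exact bf.b11 q p)
      _ = _ := by ring
  have hdq : ∀ q k v, dq (prodKer W f g) q k v = ∫ p, dq f q p v * W p * g p k := fun q k v => by
    have hi : Integrable fun p => insL (dq f q p) (W p * g p k) := by
      have hgk : Continuous fun p => g p k := (hgc k).continuous
      refine (hh.integrable_sq.const_mul (B * (C * h q) * (C' * h k))).mono'
        (((insL (𝔸 := M₂)).continuous.comp (hf.continuous_dq.comp
          (Continuous.prodMk_right q))).clm_apply (hWc.mul hgk)).aestronglyMeasurable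
        (Eventually.of_forall fun p => ?_)
      have hB : 0 ≤ B := (norm_nonneg _).trans (hW 0)
      have := h0 q
      have := h0 p
      calc _ ≤ ‖dq f q p‖ * (‖W p‖ * ‖g p k‖) :=
            (norm_insL_apply_le _ _).trans (by gcongr; exact norm_mul_le _ _)
        _ ≤ C * (h q * h p) * (B * (C' * h k * h p)) := by
            gcongr
            · exact bf.b10 q p
            · exact hW p
            · exact g0 k p
        _ = _ := by ring
    rw [e₁, ContinuousLinearMap.integral_apply hi]
    simp only [insL_apply, mul_assoc]
  have d00 : ∀ q v k, HasFDerivAt (fun k' => ∫ p, dq f q p v * W p * g p k')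
      ((dkdq (prodKer W f g) q k).flip v) k := fun q v k => by
    have := (hs.hasFDerivAt_dq q k).clm_apply (hasFDerivAt_const v k)
    rw [ContinuousLinearMap.comp_zero, zero_add] at this
    simp only [hdq] at this
    exact this
  refine ⟨by positivity, fun q k => ?_, fun q k => ?_, fun q k => ?_, fun q k => ?_⟩
  · exact (ht _ _ _ _ (hfc q) (hgc k) (f0 q) (f1 q) (g0 k) (g1 k)).trans (le_of_eq (by ring))
  · refine ContinuousLinearMap.opNorm_le_bound _ (by have := h0 q; have := h0 k; positivity)
      fun v => ?_
    rw [hdq]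
    exact (ht _ _ _ _ (dc q v) (hgc k) (d0 q v) (d1 q v) (g0 k) (g1 k)).trans (le_of_eq (by ring))
  · exact (ht.norm_deriv_le hc hh hWc hW (mul_nonneg hC (h0 q)) (hfc q) (f0 q) (f1 q) hg bg
      (hs.hasFDerivAt_k q k)).trans (le_of_eq (by ring))
  · have hpos : 0 ≤ c * C * C' * (h q * h k) := by have := h0 q; have := h0 k; positivity
    refine ContinuousLinearMap.opNorm_le_bound _ hpos fun u => ?_
    refine ContinuousLinearMap.opNorm_le_bound _ (by positivity) fun v => ?_
    have h1 := ht.norm_deriv_le hc hh hWc hW (by have := h0 q; positivity) (dc q v) (d0 q v)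
      (d1 q v) hg bg (d00 q v k)
    calc ‖dkdq (prodKer W f g) q k u v‖ = ‖(dkdq (prodKer W f g) q k).flip v u‖ := rfl
      _ ≤ c * (C * h q * ‖v‖) * (C' * h k) * ‖u‖ :=
        (ContinuousLinearMap.le_opNorm _ _).trans (by gcongr)
      _ = _ := by ring

end Tame

/-! ### The product of kernels as a bounded multilinear map. -/

section MulK

open scoped BoundedContinuousFunction

variable {d : ℕ} {h : Mom d → ℝ}

theorem K₁.norm_ker_le (f : K₁ h) (q p : Mom d) :
    ‖f.ker q p‖ ≤ ‖f‖ * h q * h p := (f.bound_norm.b00 q p).trans (le_of_eq (by ring))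

theorem K₁.norm_ker_le' (f : K₁ h) (p k : Mom d) :
    ‖f.ker p k‖ ≤ ‖f‖ * h k * h p := (f.bound_norm.b00 p k).trans (le_of_eq (by ring))

theorem K₁.continuous_right (f : K₁ h) (q : Mom d) : Continuous fun p => f.ker q p :=
  f.smooth.continuous.comp (Continuous.prodMk_right q)

theorem K₁.continuous_left (f : K₁ h) (k : Mom d) : Continuous fun p => f.ker p k :=
  f.smooth.continuous.comp (Continuous.prodMk_left k)

theorem integrable_prodKer (hh : IsWeight h) (W : Mom d →ᵇ M₂) (f g : K₁ h) (q k : Mom d) :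
    Integrable fun p => f.ker q p * W p * g.ker p k :=
  integrable_mul_mul hh W.continuous W.norm_coe_le_norm (f.continuous_right q) (g.continuous_left k)
    (f.norm_ker_le q) (fun p => g.norm_ker_le' p k)

theorem integral_sq_nonneg : 0 ≤ ∫ p, h p ^ 2 := integral_nonneg fun _ => sq_nonneg _

theorem kernelBound_prodKer (hh : IsWeight h) (W : Mom d →ᵇ M₂) (f g : K₁ h) :
    KernelBound h (prodKer W f.ker g.ker) ((‖W‖ * ∫ p, h p ^ 2) * ‖f‖ * ‖g‖) :=
  (tameBound_of_bound hh W.norm_coe_le_norm).kernelBound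
    (mul_nonneg (norm_nonneg _) integral_sq_nonneg) hh W.continuous W.norm_coe_le_norm f.smooth
    g.smooth f.bound_norm g.bound_norm

/-- The kernel `∫ f(q,p) W(p) g(p,k) dp` as an element of `𝒦₁`. -/
def mulK (hh : IsWeight h) (W : Mom d →ᵇ M₂) (f g : K₁ h) : K₁ h :=
  ⟨prodKer W f.ker g.ker, (prodKer_smooth hh f.smooth g.smooth f.bound_norm g.bound_norm
    W.continuous W.norm_coe_le_norm).1, _, kernelBound_prodKer hh W f g⟩

theorem mulK_ker (hh : IsWeight h) (W : Mom d →ᵇ M₂) (f g : K₁ h) :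
    (mulK hh W f g).ker = prodKer W f.ker g.ker := rfl

theorem K₁.ext_ker {f g : K₁ h} (hfg : ∀ q k, f.ker q k = g.ker q k) : f = g :=
  K₁.ext (funext fun q => funext fun k => hfg q k)

theorem K₁.ker_add_apply (f g : K₁ h) (q k : Mom d) : (f + g).ker q k = f.ker q k + g.ker q k := rfl

theorem K₁.ker_smul_apply (c : ℂ) (f : K₁ h) (q k : Mom d) : (c • f).ker q k = c • f.ker q k := rfl

theorem mulK_add_left (hh : IsWeight h) (W : Mom d →ᵇ M₂) (f f' g : K₁ h) :
    mulK hh W (f + f') g = mulK hh W f g + mulK hh W f' g := K₁.ext_ker fun q k => by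
  rw [K₁.ker_add_apply]
  simp only [mulK_ker, prodKer, K₁.ker_add_apply, add_mul]
  exact integral_add (integrable_prodKer hh W f g q k) (integrable_prodKer hh W f' g q k)

theorem mulK_add_right (hh : IsWeight h) (W : Mom d →ᵇ M₂) (f g g' : K₁ h) :
    mulK hh W f (g + g') = mulK hh W f g + mulK hh W f g' := K₁.ext_ker fun q k => by
  rw [K₁.ker_add_apply]
  simp only [mulK_ker, prodKer, K₁.ker_add_apply, mul_add]
  exact integral_add (integrable_prodKer hh W f g q k) (integrable_prodKer hh W f g' q k)

theorem mulK_add_weight (hh : IsWeight h) (W W' : Mom d →ᵇ M₂) (f g : K₁ h) :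
    mulK hh (W + W') f g = mulK hh W f g + mulK hh W' f g := K₁.ext_ker fun q k => by
  rw [K₁.ker_add_apply]
  simp only [mulK_ker, prodKer, BoundedContinuousFunction.coe_add, Pi.add_apply, mul_add, add_mul]
  exact integral_add (integrable_prodKer hh W f g q k) (integrable_prodKer hh W' f g q k)

theorem mulK_smul_left (hh : IsWeight h) (W : Mom d →ᵇ M₂) (c : ℂ) (f g : K₁ h) :
    mulK hh W (c • f) g = c • mulK hh W f g := K₁.ext_ker fun q k => by
  rw [K₁.ker_smul_apply]
  simp only [mulK_ker, prodKer, K₁.ker_smul_apply, smul_mul_assoc]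
  exact integral_smul _ _

theorem mulK_smul_right (hh : IsWeight h) (W : Mom d →ᵇ M₂) (c : ℂ) (f g : K₁ h) :
    mulK hh W f (c • g) = c • mulK hh W f g := K₁.ext_ker fun q k => by
  rw [K₁.ker_smul_apply]
  simp only [mulK_ker, prodKer, K₁.ker_smul_apply, mul_smul_comm]
  exact integral_smul _ _

theorem mulK_smul_weight (hh : IsWeight h) (W : Mom d →ᵇ M₂) (c : ℂ) (f g : K₁ h) :
    mulK hh (c • W) f g = c • mulK hh W f g := K₁.ext_ker fun q k => by
  rw [K₁.ker_smul_apply]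
  simp only [mulK_ker, prodKer, BoundedContinuousFunction.coe_smul, mul_smul_comm, smul_mul_assoc]
  exact integral_smul _ _

theorem norm_mulK_le (hh : IsWeight h) (W : Mom d →ᵇ M₂) (f g : K₁ h) :
    ‖mulK hh W f g‖ ≤ (‖W‖ * ∫ p, h p ^ 2) * ‖f‖ * ‖g‖ :=
  K₁.norm_le (kernelBound_prodKer hh W f g)

/-- The product of kernels with a fixed weight, as a bilinear map. -/
def mulK₂ (hh : IsWeight h) (W : Mom d →ᵇ M₂) : K₁ h →L[ℂ] K₁ h →L[ℂ] K₁ h :=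
  LinearMap.mkContinuous₂ (LinearMap.mk₂ ℂ (mulK hh W) (mulK_add_left hh W) (mulK_smul_left hh W)
    (mulK_add_right hh W) (mulK_smul_right hh W)) (‖W‖ * ∫ p, h p ^ 2)
    fun f g => norm_mulK_le hh W f g

theorem norm_mulK₂_le (hh : IsWeight h) (W : Mom d →ᵇ M₂) :
    ‖mulK₂ hh W‖ ≤ (∫ p, h p ^ 2) * ‖W‖ :=
  (LinearMap.mkContinuous₂_norm_le _ (mul_nonneg (norm_nonneg _) integral_sq_nonneg) fun f g =>
    norm_mulK_le hh W f g).trans (le_of_eq (mul_comm _ _))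

/-- The product of kernels, as a trilinear map. -/
def mulKL (hh : IsWeight h) : (Mom d →ᵇ M₂) →L[ℂ] K₁ h →L[ℂ] K₁ h →L[ℂ] K₁ h :=
  LinearMap.mkContinuous
    { toFun := mulK₂ hh
      map_add' := fun W W' => by
        ext f g
        exact mulK_add_weight hh W W' f g
      map_smul' := fun c W => by
        ext f g
        exact mulK_smul_weight hh W c f g } (∫ p, h p ^ 2) (norm_mulK₂_le hh)

theorem TameBound.norm_mulKL_le {W : Mom d →ᵇ M₂} {c : ℝ} (ht : TameBound h W c) (hc : 0 ≤ c)
    (hh : IsWeight h) (f g : K₁ h) : ‖mulKL hh W f g‖ ≤ c * ‖f‖ * ‖g‖ :=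
  K₁.norm_le (ht.kernelBound hc hh W.continuous W.norm_coe_le_norm f.smooth g.smooth f.bound_norm
    g.bound_norm)

theorem TameBound.norm_mulKL_le' {W : Mom d →ᵇ M₂} {c : ℝ} (ht : TameBound h W c) (hc : 0 ≤ c)
    (hh : IsWeight h) (f : K₁ h) : ‖mulKL hh W f‖ ≤ c * ‖f‖ :=
  ContinuousLinearMap.opNorm_le_bound _ (by positivity) fun g => ht.norm_mulKL_le hc hh f g

/-- Fubini's theorem; the double integrand is dominated by a multiple of h(p)² h(p')². Associativity
allows the kernel equation to be written with the unknown on either side. -/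
theorem mulK_assoc (hh : IsWeight h) (W V : Mom d →ᵇ M₂) (f g k : K₁ h) :
    mulK hh W (mulK hh V f g) k = mulK hh V f (mulK hh W g k) := K₁.ext_ker fun q k' => by
  simp only [mulK_ker, prodKer]
  have e1 : ∀ p', (∫ p, f.ker q p * V p * g.ker p p') * W p' * k.ker p' k' =
      ∫ p, f.ker q p * V p * g.ker p p' * (W p' * k.ker p' k') := fun p' => by
    rw [mul_assoc, integral_mul_const_of_integrable (integrable_prodKer hh V f g q p')]
  have e2 : ∀ p, f.ker q p * V p * ∫ p', g.ker p p' * W p' * k.ker p' k' =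
      ∫ p', f.ker q p * V p * g.ker p p' * (W p' * k.ker p' k') := fun p => by
    rw [← integral_const_mul_of_integrable (integrable_prodKer hh W g k p k')]
    simp only [mul_assoc]
  simp only [e1, e2]
  refine integral_integral_swap ?_
  have hsq : Integrable (fun v : Mom d × Mom d =>
      (‖f‖ * h q * ‖V‖ * ‖g‖ * ‖W‖ * ‖k‖ * h k') * (h v.1 ^ 2 * h v.2 ^ 2))
      (volume.prod volume) := (hh.integrable_sq.mul_prod hh.integrable_sq).const_mul _
  refine hsq.mono' (Continuous.aestronglyMeasurable ?_) (Eventually.of_forall fun v => ?_)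
  · have h1 : Continuous fun v : Mom d × Mom d => f.ker q v.2 :=
      (f.continuous_right q).comp continuous_snd
    have h2 : Continuous fun v : Mom d × Mom d => g.ker v.2 v.1 :=
      g.smooth.continuous.comp continuous_swap
    have h3 : Continuous fun v : Mom d × Mom d => k.ker v.1 k' :=
      (k.continuous_left k').comp continuous_fst
    exact ((h1.mul (V.continuous.comp continuous_snd)).mul h2).mul
      ((W.continuous.comp continuous_fst).mul h3)
  · simp only [Function.uncurry]
    have p0 := fun x => (hh.pos x).le
    have := p0 q; have := p0 v.1; have := p0 v.2
    calc _ ≤ ‖f.ker q v.2‖ * ‖V v.2‖ * ‖g.ker v.2 v.1‖ * (‖W v.1‖ * ‖k.ker v.1 k'‖) := by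
          refine (norm_mul_le _ _).trans ?_
          gcongr
          · exact (norm_mul_le _ _).trans (by gcongr; exact norm_mul_le _ _)
          · exact norm_mul_le _ _
      _ ≤ (‖f‖ * h q * h v.2) * ‖V‖ * (‖g‖ * h v.2 * h v.1) *
          (‖W‖ * (‖k‖ * h k' * h v.1)) := by
          gcongr
          · exact f.norm_ker_le _ _
          · exact V.norm_coe_le_norm _
          · exact g.norm_ker_le _ _
          · exact W.norm_coe_le_norm _
          · exact k.norm_ker_le' _ _
      _ = _ := by ring

end MulK

/-! ### The solution of the kernel equation -/

section Solution

open scoped BoundedContinuousFunction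

variable {d : ℕ} {h : Mom d → ℝ}

/-- The solution `K` of `K = D + D W K`. -/
def solK (hh : IsWeight h) (W : Mom d →ᵇ M₂) (D : K₁ h) : K₁ h :=
  Ring.inverse (1 - mulKL hh W D) D

variable {hh : IsWeight h} {W : Mom d →ᵇ M₂} {D : K₁ h}

theorem IsWeight.completeSpace (hh : IsWeight h) : CompleteSpace (K₁ h) :=
  K₁.completeSpace (fun q => (hh.pos q).le) hh.le_one

theorem isUnit_one_sub_mulKL (hA : ‖mulKL hh W D‖ < 1) : IsUnit (1 - mulKL hh W D) := by
  have := hh.completeSpace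
  exact isUnit_one_sub_of_norm_lt_one hA

theorem solK_eq (hA : ‖mulKL hh W D‖ < 1) :
    solK hh W D = D + mulK hh W D (solK hh W D) := by
  have h1 := Ring.mul_inverse_cancel _ (isUnit_one_sub_mulKL hA)
  have h2 : solK hh W D - mulK hh W D (solK hh W D) = D :=
    congrArg (fun T : K₁ h →L[ℂ] K₁ h => T D) h1
  exact sub_eq_iff_eq_add.mp h2

/-- Write K for the solution. By associativity, x = K - K W D and x = D give the same value of x - D
W x, namely D - D W D. Injectivity of 1 - D W yields the equation in reversed order, which is needed
for the left inverse of B(z). -/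
theorem solK_eq' (hA : ‖mulKL hh W D‖ < 1) :
    solK hh W D = D + mulK hh W (solK hh W D) D := by
  set K := solK hh W D with hK
  have h1 : K = D + mulK hh W D K := solK_eq hA
  have hinj : ∀ x y : K₁ h, x - mulK hh W D x = y - mulK hh W D y → x = y := fun x y hxy => by
    have h2 := Ring.inverse_mul_cancel _ (isUnit_one_sub_mulKL hA)
    have h3 : ∀ x, Ring.inverse (1 - mulKL hh W D) (x - mulK hh W D x) = x := fun x =>
      congrArg (fun T : K₁ h →L[ℂ] K₁ h => T x) h2
    rw [← h3 x, ← h3 y, hxy]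
  have hl : ∀ x y g : K₁ h, mulK hh W (x - y) g = mulK hh W x g - mulK hh W y g := fun x y g => by
    have := (mulKL hh W).map_sub x y
    exact congrArg (fun T : K₁ h →L[ℂ] K₁ h => T g) this
  have hr : ∀ g x y : K₁ h, mulK hh W g (x - y) = mulK hh W g x - mulK hh W g y := fun g x y =>
    (mulKL hh W g).map_sub x y
  have h4 : K - mulK hh W K D = D := by
    refine hinj _ _ ?_
    have h5 : K - mulK hh W D K = D := sub_eq_iff_eq_add.mpr h1
    rw [hr, ← mulK_assoc]
    calc K - mulK hh W K D - (mulK hh W D K - mulK hh W (mulK hh W D K) D)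
        = (K - mulK hh W D K) - (mulK hh W K D - mulK hh W (mulK hh W D K) D) := by abel
      _ = (K - mulK hh W D K) - mulK hh W (K - mulK hh W D K) D := by rw [hl]
      _ = D - mulK hh W D D := by rw [h5]
  exact (sub_eq_iff_eq_add.mp h4)

theorem norm_solK_le (hA : ‖mulKL hh W D‖ ≤ 1 / 2) : ‖solK hh W D‖ ≤ 2 * ‖D‖ := by
  have h1 := solK_eq (hh := hh) (W := W) (D := D) (by linarith)
  have h2 : ‖mulK hh W D (solK hh W D)‖ ≤ 1 / 2 * ‖solK hh W D‖ :=
    ((mulKL hh W D).le_opNorm _).trans (by gcongr)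
  have h3 := norm_add_le D (mulK hh W D (solK hh W D))
  rw [← h1] at h3
  linarith

/-- The identity K - K' = (D - D') + D W (K - K') + D (W - W') K' + (D - D') W' K', in which the
second term is absorbed on the left. The weights enter only through integral bounds, never through
sup norms, so the estimate is uniform up to the cut. -/
theorem norm_solK_sub_le {W' : Mom d →ᵇ M₂} {D' : K₁ h} {c c' M : ℝ} (hc : 0 ≤ c) (hc' : 0 ≤ c')
    (hA : ‖mulKL hh W D‖ ≤ 1 / 2) (hA' : ‖mulKL hh W' D'‖ ≤ 1 / 2) (hD : ‖D‖ ≤ M) (hD' : ‖D'‖ ≤ M)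
    (ht : TameBound h W' c) (ht' : TameBound h (W - W' : Mom d →ᵇ M₂) c') :
    ‖solK hh W D - solK hh W' D'‖ ≤ 2 * (‖D - D'‖ + c' * M * (2 * M) + c * ‖D - D'‖ * (2 * M)) := by
  set K := solK hh W D
  set K' := solK hh W' D'
  have hM : 0 ≤ M := (norm_nonneg _).trans hD
  have h1 : K = D + mulKL hh W D K := solK_eq (by linarith)
  have h2 : K' = D' + mulKL hh W' D' K' := solK_eq (by linarith)
  have hK' : ‖K'‖ ≤ 2 * M := (norm_solK_le hA').trans (by linarith)
  have h3 : K - K' = (D - D') + mulKL hh W D (K - K') + mulKL hh (W - W') D K' +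
      mulKL hh W' (D - D') K' := by
    simp only [map_sub, sub_apply]
    nth_rewrite 1 [h1, h2]
    abel
  have h4 := (mulKL hh W D).le_opNorm (K - K')
  have h5 := ht'.norm_mulKL_le hc' hh D K'
  have h6 := ht.norm_mulKL_le hc hh (D - D') K'
  have h7 : ‖K - K'‖ ≤ ‖D - D'‖ + ‖mulKL hh W D (K - K')‖ + ‖mulKL hh (W - W') D K'‖ +
      ‖mulKL hh W' (D - D') K'‖ := by
    nth_rewrite 1 [h3]
    exact norm_add₄_le
  have h8 : ‖mulKL hh W D‖ * ‖K - K'‖ ≤ 1 / 2 * ‖K - K'‖ := by gcongr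
  have h9 : c' * ‖D‖ * ‖K'‖ ≤ c' * M * (2 * M) := by gcongr
  have h10 : c * ‖D - D'‖ * ‖K'‖ ≤ c * ‖D - D'‖ * (2 * M) := by gcongr
  linarith

theorem differentiableAt_solK {W : ℂ → Mom d →ᵇ M₂} {D : ℂ → K₁ h} {z : ℂ}
    (hW : DifferentiableAt ℂ W z) (hD : DifferentiableAt ℂ D z) (hA : ‖mulKL hh (W z) (D z)‖ < 1) :
    DifferentiableAt ℂ (fun z => solK hh (W z) (D z)) z := by
  have := hh.completeSpace
  have h1 : DifferentiableAt ℂ (fun z => 1 - mulKL hh (W z) (D z)) z :=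
    (differentiableAt_const _).sub
      ((((mulKL hh).differentiableAt).comp z hW).clm_apply hD)
  have h2 : DifferentiableAt ℂ (fun z => Ring.inverse (1 - mulKL hh (W z) (D z))) z := by
    obtain ⟨u, hu⟩ := isUnit_one_sub_mulKL hA
    have h3 : DifferentiableAt ℂ Ring.inverse (1 - mulKL hh (W z) (D z)) := by
      rw [← hu]
      exact differentiableAt_inverse u.isUnit
    exact h3.comp z h1
  exact h2.clm_apply hD

/-- Used to carry the uniform bound from non-real z to real z to the left of the cut. -/
theorem TameBound.of_tendsto (hh : IsWeight h) {W : ℕ → Mom d →ᵇ M₂} {W₀ : Mom d →ᵇ M₂} {c : ℝ}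
    (ht : ∀ᶠ n in atTop, TameBound h (W n) c) (hW : Tendsto W atTop (𝓝 W₀)) :
    TameBound h W₀ c := by
  intro A B a b hA hB ha ha' hb hb'
  have hi : ∀ V : Mom d →ᵇ M₂, Integrable fun p => A p * V p * B p := fun V =>
    integrable_mul_mul hh V.continuous V.norm_coe_le_norm hA.continuous hB.continuous ha hb
  have h1 : Tendsto (fun n => c * a * b + ‖W₀ - W n‖ * (∫ p, h p ^ 2) * a * b) atTop
      (𝓝 (c * a * b + 0 * (∫ p, h p ^ 2) * a * b)) := by
    refine tendsto_const_nhds.add (((Tendsto.mul_const _ ?_).mul_const _).mul_const _)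
    have := (tendsto_const_nhds (x := W₀)).sub hW
    simpa using this.norm
  rw [zero_mul, zero_mul, zero_mul, add_zero] at h1
  refine ge_of_tendsto h1 ?_
  filter_upwards [ht] with n hn
  have h2 := hn A B a b hA hB ha ha' hb hb'
  have h3 := tameBound_of_bound hh (W₀ - W n).norm_coe_le_norm A B a b hA hB ha ha' hb hb'
  have h4 : ∫ p, A p * W₀ p * B p = (∫ p, A p * W n p * B p) + ∫ p, A p * (W₀ - W n) p * B p := by
    rw [← integral_add (hi _) (hi _)]
    refine integral_congr_ae (Eventually.of_forall fun p => ?_)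
    simp only [BoundedContinuousFunction.coe_sub, Pi.sub_apply]
    noncomm_ring
  rw [h4]
  exact (norm_add_le _ _).trans (add_le_add h2 h3)

open Classical in
/-- A bounded continuous matrix function, as an element of the Banach space of these. -/
def toBCF (f : Mom d → M₂) : Mom d →ᵇ M₂ :=
  if hf : Continuous f ∧ ∃ C, ∀ x, ‖f x‖ ≤ C then
    BoundedContinuousFunction.ofNormedAddCommGroup f hf.1 hf.2.choose hf.2.choose_spec else 0

theorem toBCF_apply {f : Mom d → M₂} (hf : Continuous f) {C : ℝ} (hC : ∀ x, ‖f x‖ ≤ C) (q : Mom d) :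
    toBCF f q = f q := by
  rw [toBCF, dif_pos ⟨hf, C, hC⟩]
  rfl

/-- The element of `𝒦₁` with a given kernel. -/
def K₁.of (f : Mom d → Mom d → M₂) (hf : f ∈ kernelSubmodule h) : K₁ h := ⟨f, hf⟩

open Classical in
/-- A smooth dominated kernel, as an element of `𝒦₁`. -/
def toK (h : Mom d → ℝ) (f : Mom d → Mom d → M₂) : K₁ h :=
  if hf : f ∈ kernelSubmodule h then K₁.of f hf else 0

theorem toK_ker {f : Mom d → Mom d → M₂} (hf : KernelSmooth f) {C : ℝ} (hC : KernelBound h f C) :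
    (toK h f).ker = f := by
  have hm : f ∈ kernelSubmodule h := ⟨hf, C, hC⟩
  rw [toK, dif_pos hm]
  rfl

/-- Boundary values of a function that is Hölder continuous on one side of the real axis. -/
theorem exists_boundary_values {X : Type*} [NormedAddCommGroup X] [CompleteSpace X] {F : ℂ → X}
    {b C r s : ℝ} (hs : s ≠ 0) (hr : 0 < r)
    (hF : ∀ z₁ z₂ : ℂ, 0 < s * z₁.im → 0 < s * z₂.im → z₁.re < b → z₂.re < b →
      ‖F z₁ - F z₂‖ ≤ C * ‖z₁ - z₂‖ ^ r) :
    ∃ G : ℝ → X, (∀ x < b, Tendsto (fun t : ℝ => F (x + s * t * Complex.I)) (𝓝[>] 0) (𝓝 (G x))) ∧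
      ∀ x₁ < b, ∀ x₂ < b, ‖G x₁ - G x₂‖ ≤ C * |x₁ - x₂| ^ r := by
  have him : ∀ (x t : ℝ), 0 < t → 0 < s * (x + s * t * Complex.I : ℂ).im := fun x t ht => by
    have : (x + s * t * Complex.I : ℂ).im = s * t := by simp
    rw [this]
    have := mul_self_pos.mpr hs
    nlinarith
  have hre : ∀ (x t : ℝ), (x + s * t * Complex.I : ℂ).re = x := fun x t => by simp
  -- On a vertical segment the Hölder estimate gives |C|(|s||t₁ - t₂|)^r, which makes the values
  -- Cauchy as t decreases to 0. The sign of s selects the side of the axis.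
  have hlim : ∀ x : ℝ, x < b → ∃ g, Tendsto (fun t : ℝ => F (x + s * t * Complex.I)) (𝓝[>] 0)
      (𝓝 g) := fun x hx => by
    refine cauchy_map_iff_exists_tendsto.mp ?_
    rw [Metric.cauchy_iff]
    refine ⟨inferInstance, fun ε hε => ?_⟩
    have h1 : Tendsto (fun t : ℝ => |C| * (|s| * t) ^ r) (𝓝 0) (𝓝 0) := by
      have : ContinuousAt (fun t : ℝ => |C| * (|s| * t) ^ r) 0 :=
        continuousAt_const.mul (ContinuousAt.rpow_const (by fun_prop) (Or.inr hr.le))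
      have := this.tendsto
      simpa [Real.zero_rpow hr.ne'] using this
    obtain ⟨δ, hδ, hball⟩ := Metric.eventually_nhds_iff_ball.mp (h1.eventually_lt_const hε)
    refine ⟨(fun t : ℝ => F (x + s * t * Complex.I)) '' Ioo 0 δ,
      image_mem_map (Ioo_mem_nhdsGT hδ), ?_⟩
    have key : ∀ t₁ ∈ Ioo 0 δ, ∀ t₂ ∈ Ioo 0 δ,
        dist (F (x + s * t₁ * Complex.I)) (F (x + s * t₂ * Complex.I)) < ε := by
      intro t₁ h₁ t₂ h₂
      rw [dist_eq_norm]
      refine (hF _ _ (him x t₁ h₁.1) (him x t₂ h₂.1) (by rwa [hre]) (by rwa [hre])).trans_lt ?_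
      have e1 : (x + s * t₁ * Complex.I - (x + s * t₂ * Complex.I) : ℂ) =
          ((s * (t₁ - t₂) : ℝ) : ℂ) * Complex.I := by push_cast; ring
      rw [e1, norm_mul, Complex.norm_I, mul_one, Complex.norm_real, Real.norm_eq_abs, abs_mul]
      have h3 : |t₁ - t₂| < δ := by rw [abs_lt]; constructor <;> linarith [h₁.1, h₁.2, h₂.1, h₂.2]
      have h4 := hball |t₁ - t₂| (by simpa using h3)
      exact (mul_le_mul_of_nonneg_right (le_abs_self C) (by positivity)).trans_lt h4
    rintro _ ⟨t₁, h₁, rfl⟩ _ ⟨t₂, h₂, rfl⟩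
    exact key t₁ h₁ t₂ h₂
  choose! G hG using hlim
  refine ⟨G, hG, fun x₁ h₁ x₂ h₂ => ?_⟩
  refine le_of_tendsto ((hG x₁ h₁).sub (hG x₂ h₂)).norm ?_
  filter_upwards [self_mem_nhdsWithin] with t ht
  refine (hF _ _ (him x₁ t ht) (him x₂ t ht) (by rwa [hre]) (by rwa [hre])).trans (le_of_eq ?_)
  have e1 : (x₁ + s * t * Complex.I - (x₂ + s * t * Complex.I) : ℂ) = ((x₁ - x₂ : ℝ) : ℂ) := by
    push_cast; ring
  rw [e1, Complex.norm_real, Real.norm_eq_abs]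

end Solution

/-! ### Kernels depending holomorphically on the energies -/

section EnergyKernel

variable {d : ℕ} {G : Type*} [NormedAddCommGroup G] [NormedSpace ℂ G]

/-- The bilinear map `(A, m) ↦ (v ↦ A v • m)`. -/
def smulInsL : (Mom d →L[ℝ] ℂ) →L[ℝ] G →L[ℝ] (Mom d →L[ℝ] G) :=
  ((ContinuousLinearMap.compL ℝ G (ℂ →L[ℝ] G) (Mom d →L[ℝ] G)).flip
    (ContinuousLinearMap.lsmul ℝ ℂ).flip).comp (ContinuousLinearMap.compL ℝ (Mom d) ℂ G).flip

theorem smulInsL_eq (A : Mom d →L[ℝ] ℂ) (m : G) : smulInsL A m = A.smulRight m := rfl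

theorem norm_smulInsL_apply (A : Mom d →L[ℝ] ℂ) (m : G) : ‖smulInsL A m‖ = ‖A‖ * ‖m‖ := by
  rw [smulInsL_eq]
  have hv : ∀ v, ‖A.smulRight m v‖ = ‖A v‖ * ‖m‖ := fun v => norm_smul _ _
  refine le_antisymm (ContinuousLinearMap.opNorm_le_bound _ (by positivity) fun v => ?_) ?_
  · rw [hv, mul_right_comm]
    gcongr
    exact A.le_opNorm v
  · rcases eq_or_ne m 0 with rfl | hm
    · simp
    rw [← le_div_iff₀ (norm_pos_iff.mpr hm)]
    refine ContinuousLinearMap.opNorm_le_bound _ (by positivity) fun v => ?_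
    rw [div_mul_eq_mul_div, le_div_iff₀ (norm_pos_iff.mpr hm), ← hv]
    exact ContinuousLinearMap.le_opNorm _ v

theorem norm_smulInsL_le (A : Mom d →L[ℝ] ℂ) : ‖smulInsL (G := G) A‖ ≤ ‖A‖ :=
  ContinuousLinearMap.opNorm_le_bound _ (norm_nonneg _) fun m => (norm_smulInsL_apply A m).le

attribute [irreducible] smulInsL

/-- `f₁`, `f₂`, `f₃` are the continuous partial derivatives `∂_q f`, `∂_k f`, `∂_k ∂_q f`. -/
structure HasPartials (f : Mom d → Mom d → G) (f₁ f₂ : Mom d → Mom d → Mom d →L[ℝ] G)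
    (f₃ : Mom d → Mom d → Mom d →L[ℝ] Mom d →L[ℝ] G) : Prop where
  h₁ : ∀ q k, HasFDerivAt (fun q' => f q' k) (f₁ q k) q
  h₂ : ∀ q k, HasFDerivAt (fun k' => f q k') (f₂ q k) k
  h₃ : ∀ q k, HasFDerivAt (fun k' => f₁ q k') (f₃ q k) k
  c₀ : Continuous (Function.uncurry f)
  c₁ : Continuous (Function.uncurry f₁)
  c₂ : Continuous (Function.uncurry f₂)
  c₃ : Continuous (Function.uncurry f₃)

/-- A common bound for a function and its partial derivatives. -/
structure PartialsBound (w : Mom d → Mom d → ℝ) (f : Mom d → Mom d → G)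
    (f₁ f₂ : Mom d → Mom d → Mom d →L[ℝ] G)
    (f₃ : Mom d → Mom d → Mom d →L[ℝ] Mom d →L[ℝ] G) : Prop where
  b₀ : ∀ q k, ‖f q k‖ ≤ w q k
  b₁ : ∀ q k, ‖f₁ q k‖ ≤ w q k
  b₂ : ∀ q k, ‖f₂ q k‖ ≤ w q k
  b₃ : ∀ q k, ‖f₃ q k‖ ≤ w q k

variable {f : Mom d → Mom d → G} {f₁ f₂ : Mom d → Mom d → Mom d →L[ℝ] G}
  {f₃ : Mom d → Mom d → Mom d →L[ℝ] Mom d →L[ℝ] G} {a : Mom d → ℂ} {u : Mom d → ℝ} {C : ℝ}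
  {w : Mom d → Mom d → ℝ}

theorem HasPartials.smul_left (hf : HasPartials f f₁ f₂ f₃) (ha : ContDiff ℝ 1 a) :
    HasPartials (fun q k => a q • f q k)
      (fun q k => a q • f₁ q k + smulInsL (fderiv ℝ a q) (f q k)) (fun q k => a q • f₂ q k)
      (fun q k => a q • f₃ q k + (smulInsL (fderiv ℝ a q)).comp (f₂ q k)) := by
  have hd : ∀ q, HasFDerivAt a (fderiv ℝ a q) q := fun q =>
    (ha.differentiable (by norm_num) q).hasFDerivAt
  have hac : Continuous fun v : Mom d × Mom d => a v.1 := ha.continuous.comp continuous_fst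
  have hdc : Continuous fun v : Mom d × Mom d => smulInsL (G := G) (fderiv ℝ a v.1) :=
    (smulInsL (G := G)).continuous.comp
      ((ha.continuous_fderiv (by norm_num)).comp continuous_fst)
  refine ⟨fun q k => ?_, fun q k => (hf.h₂ q k).const_smul (a q), fun q k => ?_,
    hac.smul hf.c₀, ?_, hac.smul hf.c₂, ?_⟩
  · rw [smulInsL_eq]
    exact (hd q).smul (hf.h₁ q k)
  · have h1 : HasFDerivAt (fun k' => smulInsL (fderiv ℝ a q) (f q k'))
        ((smulInsL (fderiv ℝ a q)).comp (f₂ q k)) k :=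
      (smulInsL (G := G) (fderiv ℝ a q)).hasFDerivAt.comp k (hf.h₂ q k)
    exact ((hf.h₃ q k).const_smul (a q)).add h1
  · exact (hac.smul hf.c₁).add (hdc.clm_apply hf.c₀)
  · exact (hac.smul hf.c₃).add (hdc.clm_comp hf.c₂)

theorem PartialsBound.smul_left (hf : PartialsBound w f f₁ f₂ f₃) (hC : 0 ≤ C)
    (ha : ∀ q, ‖a q‖ ≤ u q) (ha' : ∀ q, ‖fderiv ℝ a q‖ ≤ C * u q) :
    PartialsBound (fun q k => (1 + C) * u q * w q k) (fun q k => a q • f q k)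
      (fun q k => a q • f₁ q k + smulInsL (fderiv ℝ a q) (f q k)) (fun q k => a q • f₂ q k)
      (fun q k => a q • f₃ q k + (smulInsL (fderiv ℝ a q)).comp (f₂ q k)) := by
  have hu : ∀ q, 0 ≤ u q := fun q => (norm_nonneg _).trans (ha q)
  have hw : ∀ q k, 0 ≤ w q k := fun q k => (norm_nonneg _).trans (hf.b₀ q k)
  have e1 : ∀ q k, u q * w q k ≤ (1 + C) * u q * w q k := fun q k => by
    have := mul_nonneg hC (mul_nonneg (hu q) (hw q k))
    linarith
  have e2 : ∀ q k, u q * w q k + C * u q * w q k = (1 + C) * u q * w q k := fun q k => by ring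
  refine ⟨fun q k => ?_, fun q k => ?_, fun q k => ?_, fun q k => ?_⟩
  · rw [norm_smul]
    exact (mul_le_mul (ha q) (hf.b₀ q k) (norm_nonneg _) (hu q)).trans (e1 q k)
  · refine (norm_add_le _ _).trans ?_
    rw [norm_smul, norm_smulInsL_apply, ← e2]
    exact add_le_add (mul_le_mul (ha q) (hf.b₁ q k) (norm_nonneg _) (hu q))
      (mul_le_mul (ha' q) (hf.b₀ q k) (norm_nonneg _) (mul_nonneg hC (hu q)))
  · rw [norm_smul]
    exact (mul_le_mul (ha q) (hf.b₂ q k) (norm_nonneg _) (hu q)).trans (e1 q k)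
  · refine (norm_add_le _ _).trans ?_
    rw [norm_smul, ← e2]
    exact add_le_add (mul_le_mul (ha q) (hf.b₃ q k) (norm_nonneg _) (hu q))
      ((ContinuousLinearMap.opNorm_comp_le _ _).trans (mul_le_mul ((norm_smulInsL_le _).trans (ha' q))
        (hf.b₂ q k) (norm_nonneg _) (mul_nonneg hC (hu q))))

theorem HasPartials.smul_right (hf : HasPartials f f₁ f₂ f₃) (ha : ContDiff ℝ 1 a) :
    HasPartials (fun q k => a k • f q k) (fun q k => a k • f₁ q k)
      (fun q k => a k • f₂ q k + smulInsL (fderiv ℝ a k) (f q k))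
      (fun q k => a k • f₃ q k + smulInsL (fderiv ℝ a k) (f₁ q k)) := by
  have hd : ∀ q, HasFDerivAt a (fderiv ℝ a q) q := fun q =>
    (ha.differentiable (by norm_num) q).hasFDerivAt
  have hac : Continuous fun v : Mom d × Mom d => a v.2 := ha.continuous.comp continuous_snd
  have hdc : Continuous fun v : Mom d × Mom d => fderiv ℝ a v.2 :=
    (ha.continuous_fderiv (by norm_num)).comp continuous_snd
  refine ⟨fun q k => (hf.h₁ q k).const_smul (a k), fun q k => ?_, fun q k => ?_,
    hac.smul hf.c₀, hac.smul hf.c₁, ?_, ?_⟩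
  · rw [smulInsL_eq]
    exact (hd k).smul (hf.h₂ q k)
  · rw [smulInsL_eq]
    exact (hd k).smul (hf.h₃ q k)
  · exact (hac.smul hf.c₂).add (((smulInsL (G := G)).continuous.comp hdc).clm_apply hf.c₀)
  · exact (hac.smul hf.c₃).add
      (((smulInsL (G := Mom d →L[ℝ] G)).continuous.comp hdc).clm_apply hf.c₁)

theorem PartialsBound.smul_right (hf : PartialsBound w f f₁ f₂ f₃) (hC : 0 ≤ C)
    (ha : ∀ q, ‖a q‖ ≤ u q) (ha' : ∀ q, ‖fderiv ℝ a q‖ ≤ C * u q) :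
    PartialsBound (fun q k => (1 + C) * u k * w q k) (fun q k => a k • f q k)
      (fun q k => a k • f₁ q k) (fun q k => a k • f₂ q k + smulInsL (fderiv ℝ a k) (f q k))
      (fun q k => a k • f₃ q k + smulInsL (fderiv ℝ a k) (f₁ q k)) := by
  have hu : ∀ q, 0 ≤ u q := fun q => (norm_nonneg _).trans (ha q)
  have hw : ∀ q k, 0 ≤ w q k := fun q k => (norm_nonneg _).trans (hf.b₀ q k)
  have e1 : ∀ q k, u k * w q k ≤ (1 + C) * u k * w q k := fun q k => by
    have := mul_nonneg hC (mul_nonneg (hu k) (hw q k))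
    linarith
  have e2 : ∀ q k, u k * w q k + C * u k * w q k = (1 + C) * u k * w q k := fun q k => by ring
  refine ⟨fun q k => ?_, fun q k => ?_, fun q k => ?_, fun q k => ?_⟩
  · rw [norm_smul]
    exact (mul_le_mul (ha k) (hf.b₀ q k) (norm_nonneg _) (hu k)).trans (e1 q k)
  · rw [norm_smul]
    exact (mul_le_mul (ha k) (hf.b₁ q k) (norm_nonneg _) (hu k)).trans (e1 q k)
  · refine (norm_add_le _ _).trans ?_
    rw [norm_smul, norm_smulInsL_apply, ← e2]
    exact add_le_add (mul_le_mul (ha k) (hf.b₂ q k) (norm_nonneg _) (hu k))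
      (mul_le_mul (ha' k) (hf.b₀ q k) (norm_nonneg _) (mul_nonneg hC (hu k)))
  · refine (norm_add_le _ _).trans ?_
    rw [norm_smul, norm_smulInsL_apply, ← e2]
    exact add_le_add (mul_le_mul (ha k) (hf.b₃ q k) (norm_nonneg _) (hu k))
      (mul_le_mul (ha' k) (hf.b₁ q k) (norm_nonneg _) (mul_nonneg hC (hu k)))

variable {ω : Mom d → ℝ} {α : ℝ}

/-- The derivative of `ω`, with complex values. -/
def dω (ω : Mom d → ℝ) (q : Mom d) : Mom d →L[ℝ] ℂ := Complex.ofRealCLM.comp (fderiv ℝ ω q)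

theorem norm_dω_le (q : Mom d) : ‖dω ω q‖ ≤ ‖fderiv ℝ ω q‖ := by
  refine (ContinuousLinearMap.opNorm_comp_le _ _).trans ?_
  rw [Complex.ofRealCLM_norm, one_mul]

theorem hasFDerivAt_comp_energy (hω : ContDiff ℝ 2 ω) {Y : ℂ → G} {q : Mom d}
    (hY : DifferentiableAt ℂ Y (ω q)) :
    HasFDerivAt (fun x => Y (ω x)) (smulInsL (dω ω q) (fderiv ℂ Y (ω q) 1)) q := by
  have h1 : HasFDerivAt (fun x => (ω x : ℂ)) (dω ω q) q :=
    Complex.ofRealCLM.hasFDerivAt.comp q (hω.differentiable (by norm_num) q).hasFDerivAt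
  have h2 := (hY.hasFDerivAt.restrictScalars ℝ).comp q h1
  refine h2.congr_fderiv (ContinuousLinearMap.ext fun v => ?_)
  rw [smulInsL_eq]
  have := (fderiv ℂ Y (ω q)).map_smul (dω ω q v) 1
  rw [smul_eq_mul, mul_one] at this
  exact this

theorem isOpen_lt_re (α : ℝ) : IsOpen {s : ℂ | α < s.re} :=
  isOpen_lt continuous_const Complex.continuous_re

theorem norm_fderiv_one_le {Y : ℂ → G} {M : ℝ} (hY : DifferentiableOn ℂ Y {s | α < s.re})
    (hM : ∀ s : ℂ, α < s.re → ‖Y s‖ ≤ M) {s : ℂ} (hs : α < s.re) :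
    ‖fderiv ℂ Y s 1‖ ≤ 2 * M / (s.re - α) := by
  have hsub : Metric.ball s (s.re - α) ⊆ {s : ℂ | α < s.re} := by
    intro w hw
    rw [Metric.mem_ball, dist_eq_norm] at hw
    have := (Complex.abs_re_le_norm (w - s)).trans_lt hw
    rw [Complex.sub_re, abs_lt] at this
    simp only [mem_ofPred_eq]
    linarith
  have h1 := norm_fderiv_le_of_ball (sub_pos.mpr hs) (hY.mono hsub) fun y hy => hM y (hsub hy)
  refine ((fderiv ℂ Y s).le_opNorm 1).trans ?_
  rwa [norm_one, mul_one]

/-- Each of ∂_q and ∂_k costs a factor |∇ω| ≤ C(ω - α), which cancels against 2/(ω - α) from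
Cauchy's estimate in the corresponding energy. The mixed derivative uses the estimate once in each
variable, whence the constant (1 + 2C)². -/
theorem exists_energy_partials [CompleteSpace G] (hω : ContDiff ℝ 2 ω) (hα : ∀ q, α < ω q)
    (hC : 0 ≤ C) (hg : ∀ q, ‖fderiv ℝ ω q‖ ≤ C * (ω q - α)) {V : ℂ × ℂ → G} {M : ℝ}
    (hV : DifferentiableOn ℂ V ({s | α < s.re} ×ˢ {s | α < s.re}))
    (hM : ∀ s τ : ℂ, α < s.re → α < τ.re → ‖V (s, τ)‖ ≤ M) :
    ∃ f₁ f₂ f₃, HasPartials (fun q k => V (ω q, ω k)) f₁ f₂ f₃ ∧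
      PartialsBound (fun _ _ => (1 + 2 * C) ^ 2 * M) (fun q k => V (ω q, ω k)) f₁ f₂ f₃ := by
  set H : Set ℂ := {s | α < s.re}
  have hH : IsOpen H := isOpen_lt_re α
  have hHH : IsOpen (H ×ˢ H) := hH.prod hH
  have hmem : ∀ q, (ω q : ℂ) ∈ H := fun q => by simpa [H] using hα q
  set V₁ : ℂ × ℂ → G := fun x => fderiv ℂ V x (1, 0)
  set V₂ : ℂ × ℂ → G := fun x => fderiv ℂ V x (0, 1)
  have hV₁ : DifferentiableOn ℂ V₁ (H ×ˢ H) := differentiableOn_fderiv_apply hHH hV (1, 0)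
  have hV₂ : DifferentiableOn ℂ V₂ (H ×ˢ H) := differentiableOn_fderiv_apply hHH hV (0, 1)
  set V₃ : ℂ × ℂ → G := fun x => fderiv ℂ V₁ x (0, 1)
  have hV₃ : DifferentiableOn ℂ V₃ (H ×ˢ H) := differentiableOn_fderiv_apply hHH hV₁ (0, 1)
  have sl : ∀ (U : ℂ × ℂ → G), DifferentiableOn ℂ U (H ×ˢ H) → ∀ s ∈ H, ∀ τ ∈ H,
      HasFDerivAt (fun s => U (s, τ)) ((fderiv ℂ U (s, τ)).comp (ContinuousLinearMap.inl ℂ ℂ ℂ)) s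
        := fun U hU s hs τ hτ =>
    ((hU _ ⟨hs, hτ⟩).differentiableAt (hHH.mem_nhds ⟨hs, hτ⟩)).hasFDerivAt.comp s
      (hasFDerivAt_prodMk_left s τ)
  have sr : ∀ (U : ℂ × ℂ → G), DifferentiableOn ℂ U (H ×ˢ H) → ∀ s ∈ H, ∀ τ ∈ H,
      HasFDerivAt (fun τ => U (s, τ)) ((fderiv ℂ U (s, τ)).comp (ContinuousLinearMap.inr ℂ ℂ ℂ)) τ
        := fun U hU s hs τ hτ =>
    ((hU _ ⟨hs, hτ⟩).differentiableAt (hHH.mem_nhds ⟨hs, hτ⟩)).hasFDerivAt.comp τ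
      (hasFDerivAt_prodMk_right s τ)
  have dl : ∀ (U : ℂ × ℂ → G), DifferentiableOn ℂ U (H ×ˢ H) → ∀ s ∈ H, ∀ τ ∈ H,
      fderiv ℂ (fun s => U (s, τ)) s 1 = fderiv ℂ U (s, τ) (1, 0) := fun U hU s hs τ hτ => by
    rw [(sl U hU s hs τ hτ).fderiv]; rfl
  have dr : ∀ (U : ℂ × ℂ → G), DifferentiableOn ℂ U (H ×ˢ H) → ∀ s ∈ H, ∀ τ ∈ H,
      fderiv ℂ (fun τ => U (s, τ)) τ 1 = fderiv ℂ U (s, τ) (0, 1) := fun U hU s hs τ hτ => by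
    rw [(sr U hU s hs τ hτ).fderiv]; rfl
  have b1 : ∀ s ∈ H, ∀ τ ∈ H, ‖V₁ (s, τ)‖ ≤ 2 * M / (s.re - α) := fun s hs τ hτ => by
    simp only [V₁]
    rw [← dl V hV s hs τ hτ]
    exact norm_fderiv_one_le (fun s hs => (sl V hV s hs τ hτ).differentiableAt.differentiableWithinAt)
      (fun s hs => hM s τ hs hτ) hs
  have b2 : ∀ s ∈ H, ∀ τ ∈ H, ‖V₂ (s, τ)‖ ≤ 2 * M / (τ.re - α) := fun s hs τ hτ => by
    simp only [V₂]
    rw [← dr V hV s hs τ hτ]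
    exact norm_fderiv_one_le (fun τ hτ => (sr V hV s hs τ hτ).differentiableAt.differentiableWithinAt)
      (fun τ hτ => hM s τ hs hτ) hτ
  have b3 : ∀ s ∈ H, ∀ τ ∈ H, ‖V₃ (s, τ)‖ ≤ 2 * (2 * M / (s.re - α)) / (τ.re - α) :=
      fun s hs τ hτ => by
    simp only [V₃]
    rw [← dr V₁ hV₁ s hs τ hτ]
    exact norm_fderiv_one_le
      (fun τ hτ => (sr V₁ hV₁ s hs τ hτ).differentiableAt.differentiableWithinAt)
      (fun τ hτ => b1 s hs τ hτ) hτ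
  have cont : ∀ (U : ℂ × ℂ → G), DifferentiableOn ℂ U (H ×ˢ H) →
      Continuous (Function.uncurry fun q k => U (ω q, ω k)) := fun U hU => by
    have hωc := hω.continuous
    exact hU.continuousOn.comp_continuous (f := fun v : Mom d × Mom d => ((ω v.1 : ℂ), (ω v.2 : ℂ)))
      (by fun_prop) fun v => ⟨hmem _, hmem _⟩
  have hdc : Continuous (dω ω) :=
    continuous_const.clm_comp (hω.continuous_fderiv (by norm_num))
  have hs1 : Continuous fun v : Mom d × Mom d => smulInsL (G := G) (dω ω v.1) :=
    (smulInsL (G := G)).continuous.comp (hdc.comp continuous_fst)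
  have hs2 : Continuous fun v : Mom d × Mom d => smulInsL (G := G) (dω ω v.2) :=
    (smulInsL (G := G)).continuous.comp (hdc.comp continuous_snd)
  refine ⟨fun q k => smulInsL (dω ω q) (V₁ (ω q, ω k)), fun q k => smulInsL (dω ω k) (V₂ (ω q, ω k)),
    fun q k => (smulInsL (dω ω q)).comp (smulInsL (dω ω k) (V₃ (ω q, ω k))),
    ⟨fun q k => ?_, fun q k => ?_, fun q k => ?_, cont V hV, hs1.clm_apply (cont V₁ hV₁),
      hs2.clm_apply (cont V₂ hV₂), hs1.clm_comp (hs2.clm_apply (cont V₃ hV₃))⟩, ?_⟩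
  · have := hasFDerivAt_comp_energy hω (sl V hV _ (hmem q) _ (hmem k)).differentiableAt
    rwa [dl V hV _ (hmem q) _ (hmem k)] at this
  · have := hasFDerivAt_comp_energy hω (sr V hV _ (hmem q) _ (hmem k)).differentiableAt
    rwa [dr V hV _ (hmem q) _ (hmem k)] at this
  · have := hasFDerivAt_comp_energy hω (sr V₁ hV₁ _ (hmem q) _ (hmem k)).differentiableAt
    rw [dr V₁ hV₁ _ (hmem q) _ (hmem k)] at this
    exact (smulInsL (dω ω q)).hasFDerivAt.comp k this
  · have hM0 : 0 ≤ M := (norm_nonneg _).trans (hM _ _ (hmem 0) (hmem 0))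
    have hd : ∀ q, ‖dω ω q‖ ≤ C * (ω q - α) := fun q => (norm_dω_le q).trans (hg q)
    have hp : ∀ q, 0 < ω q - α := fun q => sub_pos.mpr (hα q)
    have hpow : 1 ≤ (1 + 2 * C) ^ 2 := one_le_pow₀ (by linarith)
    have l1 : 2 * C * M ≤ (1 + 2 * C) ^ 2 * M := by
      gcongr; nlinarith
    have l2 : 4 * C ^ 2 * M ≤ (1 + 2 * C) ^ 2 * M := by
      gcongr; nlinarith
    refine ⟨fun q k => (hM _ _ (hmem q) (hmem k)).trans (le_mul_of_one_le_left hM0 hpow),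
      fun q k => ?_, fun q k => ?_, fun q k => ?_⟩
    · rw [norm_smulInsL_apply]
      have h1 := b1 _ (hmem q) _ (hmem k)
      rw [Complex.ofReal_re] at h1
      refine le_trans (mul_le_mul (hd q) h1 (norm_nonneg _) (mul_nonneg hC (hp q).le)) ?_
      refine le_trans (le_of_eq ?_) l1
      field_simp [(hp q).ne']
    · rw [norm_smulInsL_apply]
      have h1 := b2 _ (hmem q) _ (hmem k)
      rw [Complex.ofReal_re] at h1
      refine le_trans (mul_le_mul (hd k) h1 (norm_nonneg _) (mul_nonneg hC (hp k).le)) ?_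
      refine le_trans (le_of_eq ?_) l1
      field_simp [(hp k).ne']
    · refine (ContinuousLinearMap.opNorm_comp_le _ _).trans ?_
      rw [norm_smulInsL_apply]
      have h1 := b3 _ (hmem q) _ (hmem k)
      rw [Complex.ofReal_re, Complex.ofReal_re] at h1
      refine le_trans (mul_le_mul ((norm_smulInsL_le _).trans (hd q)) (mul_le_mul (hd k) h1
        (norm_nonneg _) (mul_nonneg hC (hp k).le)) (by positivity) (mul_nonneg hC (hp q).le)) ?_
      refine le_trans (le_of_eq ?_) l2
      have := (hp q).ne'
      have := (hp k).ne'
      field_simp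
      ring

/-- The kernels `λ(q) conj λ(k) V(ω(q), ω(k))` with `V` holomorphic belong to `𝒦₁`. -/
theorem exists_kernelBound_energy (hω : DispersionLaw ω) {lam : Mom d → ℂ} {h : Mom d → ℝ}
    (hl : FormFactor lam h) (hα : α < ω 0) :
    ∃ C, 0 ≤ C ∧ ∀ (V : ℂ × ℂ → M₂) (M : ℝ),
      DifferentiableOn ℂ V ({s | α < s.re} ×ˢ {s | α < s.re}) →
      (∀ s τ : ℂ, α < s.re → α < τ.re → ‖V (s, τ)‖ ≤ M) →
      KernelSmooth (fun q k => (lam q * star (lam k)) • V (ω q, ω k)) ∧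
      KernelBound h (fun q k => (lam q * star (lam k)) • V (ω q, ω k)) (C * M) := by
  obtain ⟨C₀, hC₀, hg⟩ := hω.exists_gradient_bound hα
  obtain ⟨C₁, hC₁, hlg⟩ := hl.gradient_bound
  have hαω : ∀ q, α < ω q := fun q => hα.trans_le (hω.min_le q)
  refine ⟨(1 + C₁) * (1 + C₁) * (1 + 2 * C₀) ^ 2, by positivity, fun V M hV hM => ?_⟩
  have hM0 : 0 ≤ M := (norm_nonneg _).trans (hM (ω 0) (ω 0) (by simpa using hα) (by simpa using hα))
  obtain ⟨f₁, f₂, f₃, hp, hb⟩ := exists_energy_partials hω.contDiff hαω hC₀ hg hV hM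
  have hs : ContDiff ℝ 1 fun k => star (lam k) := Complex.conjCLE.contDiff.comp hl.contDiff
  have hsb : ∀ k, ‖star (lam k)‖ ≤ h k := fun k => by rw [norm_star]; exact hl.bound k
  have hsd : ∀ k, ‖fderiv ℝ (fun k => star (lam k)) k‖ ≤ C₁ * h k := fun k => by
    have h1 : HasFDerivAt (fun k => star (lam k))
        ((Complex.conjCLE : ℂ →L[ℝ] ℂ).comp (fderiv ℝ lam k)) k :=
      Complex.conjCLE.hasFDerivAt.comp k (hl.contDiff.differentiable (by norm_num) k).hasFDerivAt
    rw [h1.fderiv]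
    refine (ContinuousLinearMap.opNorm_comp_le _ _).trans ?_
    rw [Complex.conjCLE_norm, one_mul]
    exact hlg k
  -- The factors conj λ(k) and λ(q) are attached one after the other; each contributes its weight
  -- and the constant 1 + C₁.
  have hp' := (hp.smul_right hs).smul_left hl.contDiff
  have hb' := (hb.smul_right hC₁.le hsb hsd).smul_left hC₁.le hl.bound hlg
  have e : (fun q k => (lam q * star (lam k)) • V (ω q, ω k)) =
      fun q k => lam q • star (lam k) • V (ω q, ω k) := funext fun q => funext fun k => mul_smul _ _ _
  obtain ⟨k₁, k₂, k₃, k₄⟩ := KernelSmooth.of_partials hp'.h₁ hp'.h₂ hp'.h₃ hp'.c₁ hp'.c₂ hp'.c₃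
  rw [e]
  refine ⟨k₁, by positivity, fun q k => ?_, fun q k => ?_, fun q k => ?_, fun q k => ?_⟩
  · exact (hb'.b₀ q k).trans (le_of_eq (by ring))
  · rw [k₂]; exact (hb'.b₁ q k).trans (le_of_eq (by ring))
  · rw [k₃]; exact (hb'.b₂ q k).trans (le_of_eq (by ring))
  · rw [k₄]; exact (hb'.b₃ q k).trans (le_of_eq (by ring))

end EnergyKernel

/-! ### Bounds for the multiplication operators `R(z, q)` -/

section Pole

variable {d : ℕ} {h : Mom d → ℝ} {f f₁ f₂ : Mom d → ℂ} {c c' B : ℝ}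

/-- The functions `f` for which `∫ f G` is controlled by `c` for all differentiable `G` dominated by
`h²`. -/
def ScalarTame (h : Mom d → ℝ) (f : Mom d → ℂ) (c : ℝ) : Prop :=
  ∀ (G : Mom d → M₂) (M : ℝ), ContDiff ℝ 1 G → (∀ q, ‖G q‖ ≤ M) → (∀ q, ‖fderiv ℝ G q‖ ≤ M) →
    (∀ q, ‖G q‖ ≤ M * h q ^ 2) → ‖∫ q, f q • G q‖ ≤ c * M

theorem integrable_smul_of_bound (hh : IsWeight h) (hfc : Continuous f) (hf : ∀ q, ‖f q‖ ≤ B)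
    {G : Mom d → M₂} {M : ℝ} (hG : Continuous G) (hM : ∀ q, ‖G q‖ ≤ M * h q ^ 2) :
    Integrable fun q => f q • G q := by
  refine (hh.integrable_sq.const_mul (B * M)).mono' (hfc.smul hG).aestronglyMeasurable
    (Eventually.of_forall fun q => ?_)
  rw [norm_smul, mul_assoc]
  exact mul_le_mul (hf q) (hM q) (norm_nonneg _) ((norm_nonneg _).trans (hf q))

theorem scalarTame_of_bound (hh : IsWeight h) (hf : ∀ q, ‖f q‖ ≤ B) :
    ScalarTame h f (B * ∫ q, h q ^ 2) := by
  intro G M _ _ _ hM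
  have := norm_integral_le_of_norm_le (f := fun q => f q • G q) (hh.integrable_sq.const_mul (B * M))
    (Eventually.of_forall fun q => by
      rw [norm_smul, mul_assoc]
      exact mul_le_mul (hf q) (hM q) (norm_nonneg _) ((norm_nonneg _).trans (hf q)))
  rw [integral_const_mul] at this
  exact this.trans (le_of_eq (by ring))

theorem ScalarTame.const_mul (hf : ScalarTame h f c) (ρ : ℂ) :
    ScalarTame h (fun q => ρ * f q) (‖ρ‖ * c) := by
  intro G M h1 h2 h3 h4
  simp only [mul_smul]
  rw [integral_smul, norm_smul, mul_assoc]
  exact mul_le_mul_of_nonneg_left (hf G M h1 h2 h3 h4) (norm_nonneg _)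

theorem ScalarTame.mono (hf : ScalarTame h f c) (hc : c ≤ c') : ScalarTame h f c' :=
  fun G M h1 h2 h3 h4 => (hf G M h1 h2 h3 h4).trans
    (mul_le_mul_of_nonneg_right hc ((norm_nonneg _).trans (h2 0)))

theorem ScalarTame.add (hh : IsWeight h) (hf₁ : ScalarTame h f₁ c) (hf₂ : ScalarTame h f₂ c')
    (hc₁ : Continuous f₁) (hc₂ : Continuous f₂) (hb₁ : ∃ B, ∀ q, ‖f₁ q‖ ≤ B)
    (hb₂ : ∃ B, ∀ q, ‖f₂ q‖ ≤ B) : ScalarTame h (fun q => f₁ q + f₂ q) (c + c') := by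
  intro G M h1 h2 h3 h4
  obtain ⟨B₁, hB₁⟩ := hb₁
  obtain ⟨B₂, hB₂⟩ := hb₂
  simp only [add_smul]
  rw [integral_add (integrable_smul_of_bound hh hc₁ hB₁ h1.continuous h4)
    (integrable_smul_of_bound hh hc₂ hB₂ h1.continuous h4), add_mul]
  exact (norm_add_le _ _).trans (add_le_add (hf₁ G M h1 h2 h3 h4) (hf₂ G M h1 h2 h3 h4))

/-- The product A N B is a single C¹ function. By the product rule it and its gradient are bounded
by 2‖N‖ab h², and h ≤ 1. -/
theorem ScalarTame.tameBound_smul (hh : IsWeight h) (hf : ScalarTame h f c) (N : M₂) :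
    TameBound h (fun q => f q • N) (c * (2 * ‖N‖)) := by
  intro A A' a b hA hA' ha ha' hb hb'
  have e : ∀ p, A p * (f p • N) * A' p = f p • (A p * N * A' p) := fun p => by
    rw [mul_smul_comm, smul_mul_assoc]
  simp only [e]
  have hh1 : ∀ q, h q ^ 2 ≤ 1 := fun q => pow_le_one₀ (hh.pos q).le (hh.le_one q)
  have hn : ∀ (x y : M₂) q, ‖x‖ ≤ a * h q → ‖y‖ ≤ b * h q →
      ‖x * N * y‖ ≤ ‖N‖ * a * b * h q ^ 2 := fun x y q hx hy =>
    norm_mul_mul_le (W := fun _ => N) (fun _ => le_rfl) hx hy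
  have ha0 : 0 ≤ a := nonneg_of_mul_nonneg_left ((norm_nonneg _).trans (ha 0)) (hh.pos 0)
  have hb0 : 0 ≤ b := nonneg_of_mul_nonneg_left ((norm_nonneg _).trans (hb 0)) (hh.pos 0)
  have hP : 0 ≤ ‖N‖ * a * b := by positivity
  have hG2 : ∀ q, ‖A q * N * A' q‖ ≤ 2 * ‖N‖ * a * b * h q ^ 2 := fun q =>
    (hn _ _ q (ha q) (hb q)).trans (by nlinarith [mul_nonneg hP (sq_nonneg (h q))])
  have hdA := fun q => (hA.differentiable (by norm_num) q).hasFDerivAt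
  have hdA' := fun q => (hA'.differentiable (by norm_num) q).hasFDerivAt
  refine (hf (fun p => A p * N * A' p) (2 * ‖N‖ * a * b) ((hA.mul contDiff_const).mul hA')
    (fun q => (hG2 q).trans (mul_le_of_le_one_right (by positivity) (hh1 q))) (fun q => ?_)
    hG2).trans (le_of_eq (by ring))
  have hfd : HasFDerivAt (fun p => A p * N * A' p) _ q :=
    ((hdA q).mul' (hasFDerivAt_const N q)).mul' (hdA' q)
  rw [hfd.fderiv]
  refine ContinuousLinearMap.opNorm_le_bound _ (by positivity) fun v => ?_
  have e1 : ∀ (T : Mom d →L[ℝ] M₂) (x : M₂), ‖T v‖ ≤ ‖T‖ * ‖v‖ := fun T _ => T.le_opNorm v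
  have k1 := norm_mul_mul_le (h := h) (W := fun _ => N) (fun _ => le_rfl) (a := a) (b := b * ‖v‖)
    (p := q) (x := A q) (y := fderiv ℝ A' q v) (ha q) ((e1 _ 0).trans (by
      have := hb' q
      have := norm_nonneg v
      nlinarith))
  have k2 := norm_mul_mul_le (h := h) (W := fun _ => N) (fun _ => le_rfl) (a := a * ‖v‖) (b := b)
    (p := q) (x := fderiv ℝ A q v) (y := A' q) ((e1 _ 0).trans (by
      have := ha' q
      have := norm_nonneg v
      nlinarith)) (hb q)
  have e2 : ∀ X : M₂, X = A q * N * fderiv ℝ A' q v + fderiv ℝ A q v * N * A' q →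
      ‖X‖ ≤ 2 * ‖N‖ * a * b * ‖v‖ := by
    rintro _ rfl
    refine (norm_add_le _ _).trans ((add_le_add k1 k2).trans ?_)
    have := mul_le_mul_of_nonneg_left (hh1 q) (mul_nonneg hP (norm_nonneg v))
    linarith
  exact e2 _ (by simp)

theorem ScalarTame.tameBound_dg (hh : IsWeight h) (hf₁ : ScalarTame h f₁ c)
    (hf₂ : ScalarTame h f₂ c) (hc₁ : Continuous f₁) (hc₂ : Continuous f₂)
    (hb₁ : ∃ B, ∀ q, ‖f₁ q‖ ≤ B) (hb₂ : ∃ B, ∀ q, ‖f₂ q‖ ≤ B) :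
    TameBound h (fun q => dg (f₁ q) (f₂ q)) (c * (2 * dgC)) := by
  intro A A' a b hA hA' ha ha' hb hb'
  have k1 := hf₁.tameBound_smul hh (dg 1 0) A A' a b hA hA' ha ha' hb hb'
  have k2 := hf₂.tameBound_smul hh (dg 0 1) A A' a b hA hA' ha ha' hb hb'
  have hi : ∀ (f : Mom d → ℂ) (N : M₂), Continuous f → (∃ B, ∀ q, ‖f q‖ ≤ B) →
      Integrable fun p => A p * (f p • N) * A' p := by
    rintro f N hc ⟨B, hB⟩
    refine integrable_mul_mul hh (W := fun p => f p • N) (B := B * ‖N‖) (hc.smul continuous_const)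
      (fun p => ?_) hA.continuous hA'.continuous ha hb
    rw [norm_smul]
    gcongr
    exact hB p
  have e : ∀ p, A p * dg (f₁ p) (f₂ p) * A' p =
      A p * (f₁ p • dg 1 0) * A' p + A p * (f₂ p • dg 0 1) * A' p := fun p => by
    rw [dg_decomp, mul_add, add_mul]
  simp only [e]
  rw [integral_add (hi _ _ hc₁ hb₁) (hi _ _ hc₂ hb₂)]
  refine (norm_add_le _ _).trans ((add_le_add k1 k2).trans (le_of_eq ?_))
  rw [dgC]
  ring

/-- `ρ (ω(q) + e - z)⁻¹ + g(z - ω(q))`. -/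
def poleFn (ω : Mom d → ℝ) (e : ℝ) (ρ : ℂ) (g : ℂ → ℂ) (z : ℂ) (q : Mom d) : ℂ :=
  ρ * (ω q - (z - e) : ℂ)⁻¹ + g (z - ω q)

variable {ω : Mom d → ℝ} {e : ℝ} {ρ : ℂ} {g : ℂ → ℂ} {w r L : ℝ}

/-- Interpolation: a bounded quantity with a Lipschitz estimate obeys a Hölder estimate of order
1/10, the order forced by the pole part. -/
theorem le_rpow_tenth_of_le {x L K : ℝ} (hx : 0 ≤ x) (hL : 0 ≤ L) (hK : 0 ≤ K) {y : ℝ} (h1 : y ≤ L)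
    (h2 : y ≤ K * x) : y ≤ (L + K) * x ^ (1 / 10 : ℝ) := by
  have hp : 0 ≤ x ^ (1 / 10 : ℝ) := Real.rpow_nonneg hx _
  rcases le_total x 1 with h | h
  · have := mul_le_mul_of_nonneg_left (le_rpow_tenth hx h) hK
    nlinarith [mul_nonneg hL hp]
  · have := Real.one_le_rpow h (by norm_num : (0 : ℝ) ≤ 1 / 10)
    nlinarith [mul_nonneg hK hp, mul_le_mul_of_nonneg_left this hL]

theorem exists_inv_bound (hωc : Continuous ω) {ζ : ℂ} (hζ : ζ.im ≠ 0) :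
    Continuous (fun q => (ω q - ζ : ℂ)⁻¹) ∧ ∀ q, ‖(ω q - ζ : ℂ)⁻¹‖ ≤ |ζ.im|⁻¹ := by
  refine ⟨Continuous.inv₀ (by fun_prop) fun q => ofReal_sub_ne_zero hζ (ω q), fun q => ?_⟩
  rw [norm_inv]
  refine inv_anti₀ (abs_pos.mpr hζ) ?_
  have := Complex.abs_im_le_norm (ω q - ζ : ℂ)
  simpa using this

theorem continuous_comp_sub_energy (hωc : Continuous ω) (hmin : ∀ q, ω 0 ≤ ω q)
    (hg : DifferentiableOn ℂ g {z | z.re < w}) {z : ℂ} (hz : z.re < w + ω 0) :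
    Continuous fun q => g (z - ω q) :=
  hg.continuousOn.comp_continuous (by fun_prop) fun q => by
    simp only [mem_ofPred_eq, Complex.sub_re, Complex.ofReal_re]
    linarith [hmin q]

/-- The pole part is a resolvent at z - e, and `b ≤ c₁ + e` keeps this point to the left of c₁ < 2κ.
The regular part is bounded, and it is Lipschitz in z because `b ≤ w - r + ω 0` keeps z - ω(q) at
distance r from the boundary of the half-plane. The constant does not depend on the pole data. -/
theorem exists_scalarTame (hω : DispersionLaw ω) (hd : 3 ≤ d) (hh : IsWeight h) {c₁ : ℝ}
    (hc₁ : c₁ < 2 * ω 0) (hr : 0 < r) (hL : 0 ≤ L) :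
    ∃ c, 0 ≤ c ∧ ∀ (e : ℝ) (ρ : ℂ) (g : ℂ → ℂ) (w b : ℝ), ‖ρ‖ ≤ 2 →
      DifferentiableOn ℂ g {z | z.re < w} → (∀ z : ℂ, z.re < w → ‖g z‖ ≤ L) → b ≤ w - r + ω 0 →
      b ≤ c₁ + e →
      (∀ z : ℂ, z.im ≠ 0 → z.re ≤ b → ScalarTame h (poleFn ω e ρ g z) c) ∧
      ∀ z₁ z₂ : ℂ, 0 < z₁.im * z₂.im → z₁.re ≤ b → z₂.re ≤ b →
        ScalarTame h (fun q => poleFn ω e ρ g z₁ q - poleFn ω e ρ g z₂ q)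
          (c * ‖z₁ - z₂‖ ^ (1 / 10 : ℝ)) := by
  obtain ⟨C, hC, hres⟩ := exists_norm_integral_resolvent_le (E := M₂) hω hd hc₁ hh.integrable_sq
  have hI : 0 ≤ ∫ q, h q ^ 2 := integral_sq_nonneg
  have hωc := hω.contDiff.continuous
  refine ⟨2 * C + (2 * L + 2 * L / r) * ∫ q, h q ^ 2, by positivity,
    fun e ρ g w b hρ hg hgL hb hbc => ⟨fun z hz hzb => ?_, fun z₁ z₂ him hz₁ hz₂ => ?_⟩⟩
  · have hmem : ∀ q, (z - ω q).re < w := fun q => by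
      simp only [Complex.sub_re, Complex.ofReal_re]
      linarith [hω.min_le q]
    have hzi : (z - e : ℂ).im ≠ 0 := by simpa using hz
    have k1 : ScalarTame h (fun q => (ω q - (z - e) : ℂ)⁻¹) C := fun G M h1 h2 h3 h4 =>
      (hres G M h1 h2 h3 h4).1 (z - e) hzi (by simp; linarith)
    obtain ⟨hi, hib⟩ := exists_inv_bound hωc hzi
    refine ((k1.const_mul ρ).add hh (scalarTame_of_bound (f := fun q => g (z - ω q)) hh
      fun q => hgL _ (hmem q)) (continuous_const.mul hi)
      (continuous_comp_sub_energy hωc hω.min_le hg (by linarith))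
      ⟨‖ρ‖ * |(z - e : ℂ).im|⁻¹, fun q => ?_⟩ ⟨L, fun q => hgL _ (hmem q)⟩).mono ?_
    · rw [norm_mul]
      gcongr
      exact hib q
    · have : ‖ρ‖ * C ≤ 2 * C := by gcongr
      have h5 : 0 ≤ (L + 2 * L / r) * ∫ q, h q ^ 2 := by positivity
      linarith
  · have hmem : ∀ z : ℂ, z.re ≤ b → ∀ q, (z - ω q).re ≤ w - r := fun z hz q => by
      simp only [Complex.sub_re, Complex.ofReal_re]
      linarith [hω.min_le q]
    have hlt : ∀ z : ℂ, z.re ≤ b → ∀ q, (z - ω q).re < w := fun z hz q =>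
      (hmem z hz q).trans_lt (by linarith)
    have hi₁ : (z₁ - e : ℂ).im ≠ 0 := by
      rw [Complex.sub_im, Complex.ofReal_im, sub_zero]; exact fun h0 => by simp [h0] at him
    have hi₂ : (z₂ - e : ℂ).im ≠ 0 := by
      rw [Complex.sub_im, Complex.ofReal_im, sub_zero]; exact fun h0 => by simp [h0] at him
    have k1 : ScalarTame h (fun q => (ω q - (z₁ - e) : ℂ)⁻¹ - (ω q - (z₂ - e) : ℂ)⁻¹)
        (C * ‖z₁ - z₂‖ ^ (1 / 10 : ℝ)) := fun G M h1 h2 h3 h4 => by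
      refine ((hres G M h1 h2 h3 h4).2 (z₁ - e) (z₂ - e) (by simpa using him) (by simp; linarith)
        (by simp; linarith)).trans (le_of_eq ?_)
      rw [sub_sub_sub_cancel_right]
      ring
    obtain ⟨ci₁, ib₁⟩ := exists_inv_bound hωc hi₁
    obtain ⟨ci₂, ib₂⟩ := exists_inv_bound hωc hi₂
    have hgd : ∀ q, ‖g (z₁ - ω q) - g (z₂ - ω q)‖ ≤
        (2 * L + 2 * L / r) * ‖z₁ - z₂‖ ^ (1 / 10 : ℝ) := fun q => by
      refine le_rpow_tenth_of_le (norm_nonneg _) (by positivity) (by positivity) ?_ ?_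
      · exact (norm_sub_le _ _).trans (by linarith [hgL _ (hlt z₁ hz₁ q), hgL _ (hlt z₂ hz₂ q)])
      · have := norm_sub_le_of_re_lt hr hg hgL (hmem z₂ hz₂ q) (hlt z₁ hz₁ q)
        rwa [sub_sub_sub_cancel_right] at this
    have hcg := fun z (hz : z.re ≤ b) =>
      continuous_comp_sub_energy (z := z) hωc hω.min_le hg (by linarith)
    have key := (k1.const_mul ρ).add hh (scalarTame_of_bound hh hgd)
      (continuous_const.mul (ci₁.sub ci₂)) ((hcg z₁ hz₁).sub (hcg z₂ hz₂))
      ⟨‖ρ‖ * (|(z₁ - e : ℂ).im|⁻¹ + |(z₂ - e : ℂ).im|⁻¹), fun q => by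
        rw [norm_mul]
        gcongr
        exact (norm_sub_le _ _).trans (add_le_add (ib₁ q) (ib₂ q))⟩ ⟨_, hgd⟩
    have e1 : (fun q => poleFn ω e ρ g z₁ q - poleFn ω e ρ g z₂ q) = fun q =>
        ρ * ((ω q - (z₁ - e) : ℂ)⁻¹ - (ω q - (z₂ - e) : ℂ)⁻¹) +
          (g (z₁ - ω q) - g (z₂ - ω q)) := funext fun q => by simp only [poleFn]; ring
    rw [e1]
    refine key.mono ?_
    have hp : 0 ≤ ‖z₁ - z₂‖ ^ (1 / 10 : ℝ) := by positivity
    have : ‖ρ‖ * (C * ‖z₁ - z₂‖ ^ (1 / 10 : ℝ)) ≤ 2 * (C * ‖z₁ - z₂‖ ^ (1 / 10 : ℝ)) := by gcongr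
    linarith

/-- The region where `R(z, q)` is regular. -/
def slitHalfPlane (a b : ℝ) : Set ℂ := {z | z.re < b} \ cut a

theorem isOpen_slitHalfPlane (a b : ℝ) : IsOpen (slitHalfPlane a b) := by
  refine (isOpen_re_lt b).sdiff ?_
  have : cut a = {z : ℂ | z.im = 0} ∩ {z | a ≤ z.re} := rfl
  rw [this]
  exact (isClosed_eq Complex.continuous_im continuous_const).inter
    (isClosed_le continuous_const Complex.continuous_re)

theorem energy_add_mem_cut (hmin : ∀ q, ω 0 ≤ ω q) {e₀ : ℝ} (he : e₀ ≤ e) (q : Mom d) :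
    (ω q + e : ℂ) ∈ cut (e₀ + ω 0) := by
  constructor
  · simp
  · simp only [Complex.add_re, Complex.ofReal_re]
    linarith [hmin q]

theorem energy_sub_ne_zero (hmin : ∀ q, ω 0 ≤ ω q) {e₀ b : ℝ} (he : e₀ ≤ e) {z : ℂ}
    (hz : z ∈ slitHalfPlane (e₀ + ω 0) b) (q : Mom d) : (ω q - (z - e) : ℂ) ≠ 0 := fun h0 => by
  refine hz.2 ?_
  have : z = ω q + e := by linear_combination -h0
  rw [this]
  exact energy_add_mem_cut hmin he q

/-- All poles ω(q) + e lie on the cut. A ball that avoids the cut, halved, keeps distance s from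
every one of them, so the bound is uniform in q. -/
theorem exists_poleFn_bound (hmin : ∀ q, ω 0 ≤ ω q) {e₀ b : ℝ} (he : e₀ ≤ e) (hρ : ‖ρ‖ ≤ 2)
    (hgL : ∀ z : ℂ, z.re < w → ‖g z‖ ≤ L) (hb : b ≤ w + ω 0) {z₀ : ℂ} {s : ℝ} (hs : 0 < s)
    (hsub : Metric.ball z₀ (2 * s) ⊆ slitHalfPlane (e₀ + ω 0) b) {z : ℂ} (hz : z ∈ Metric.ball z₀ s)
    (q : Mom d) : ‖poleFn ω e ρ g z q‖ ≤ 2 / s + L := by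
  have hzU := hsub (Metric.ball_subset_ball (by linarith) hz)
  have h1 : s ≤ ‖(ω q - (z - e) : ℂ)‖ := by
    by_contra! hlt
    refine (hsub (?_ : (ω q + e : ℂ) ∈ _)).2 (energy_add_mem_cut hmin he q)
    have e1 : (ω q - (z - e) : ℂ) = (ω q + e) - z := by ring
    rw [e1, ← dist_eq_norm] at hlt
    rw [Metric.mem_ball] at hz ⊢
    linarith [dist_triangle (ω q + e : ℂ) z z₀]
  have h2 : (z - ω q).re < w := by
    have := hzU.1
    simp only [mem_ofPred_eq] at this
    simp only [Complex.sub_re, Complex.ofReal_re]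
    linarith [hmin q]
  refine (norm_add_le _ _).trans (add_le_add ?_ (hgL _ h2))
  rw [norm_mul, norm_inv, div_eq_mul_inv]
  gcongr

theorem differentiableOn_poleFn (hmin : ∀ q, ω 0 ≤ ω q) {e₀ b : ℝ} (he : e₀ ≤ e)
    (hg : DifferentiableOn ℂ g {z | z.re < w}) (hb : b ≤ w + ω 0) (q : Mom d) :
    DifferentiableOn ℂ (fun z => poleFn ω e ρ g z q) (slitHalfPlane (e₀ + ω 0) b) := by
  have h1 : DifferentiableOn ℂ (fun z : ℂ => (ω q - (z - e) : ℂ)⁻¹)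
      (slitHalfPlane (e₀ + ω 0) b) :=
    DifferentiableOn.inv (by fun_prop) fun z hz => energy_sub_ne_zero hmin he hz q
  refine (h1.const_mul ρ).add (hg.comp (by fun_prop) fun z hz => ?_)
  have := hz.1
  simp only [mem_ofPred_eq, Complex.sub_re, Complex.ofReal_re] at this ⊢
  linarith [hmin q]

theorem continuous_poleFn (hωc : Continuous ω) (hmin : ∀ q, ω 0 ≤ ω q) {e₀ b : ℝ} (he : e₀ ≤ e)
    (hg : DifferentiableOn ℂ g {z | z.re < w}) (hb : b ≤ w + ω 0) {z : ℂ}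
    (hz : z ∈ slitHalfPlane (e₀ + ω 0) b) : Continuous (poleFn ω e ρ g z) :=
  (continuous_const.mul (Continuous.inv₀ (by fun_prop)
    fun q => energy_sub_ne_zero hmin he hz q)).add
    (continuous_comp_sub_energy hωc hmin hg ((show z.re < b from hz.1).trans_le hb))

end Pole

/-! ### The multiplication operators as bounded continuous functions -/

section Resolvent

open scoped BoundedContinuousFunction

variable {d : ℕ} {h : Mom d → ℝ} {ω : Mom d → ℝ} {e₀ w L b e₁ e₂ : ℝ} {ρ₁ ρ₂ : ℂ} {g₁ g₂ : ℂ → ℂ}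
  {W : ℂ → Mom d → M₂}

/-- The data of `ρ / (e - z) + g(z)` on the half-plane `Re z < w`, with `g` bounded by `L`. -/
structure PoleData (e₀ w L e : ℝ) (ρ : ℂ) (g : ℂ → ℂ) : Prop where
  le : e₀ ≤ e
  norm_le : ‖ρ‖ ≤ 2
  differentiableOn : DifferentiableOn ℂ g {z | z.re < w}
  bound : ∀ z : ℂ, z.re < w → ‖g z‖ ≤ L

theorem PoleData.exists_bound {e : ℝ} {ρ : ℂ} {g : ℂ → ℂ} (hp : PoleData e₀ w L e ρ g)
    (hmin : ∀ q, ω 0 ≤ ω q) (hb : b ≤ w + ω 0) {z : ℂ} (hz : z ∈ slitHalfPlane (e₀ + ω 0) b) :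
    ∃ s, 0 < s ∧ Metric.ball z s ⊆ slitHalfPlane (e₀ + ω 0) b ∧
      ∀ z' ∈ Metric.ball z s, ∀ q, ‖poleFn ω e ρ g z' q‖ ≤ 2 / s + L := by
  obtain ⟨s, hs, hsub⟩ := Metric.isOpen_iff.mp (isOpen_slitHalfPlane _ _) z hz
  refine ⟨s / 2, by positivity, (Metric.ball_subset_ball (by linarith)).trans hsub,
    fun z' hz' q => exists_poleFn_bound hmin hp.le hp.norm_le hp.bound hb (by positivity) ?_ hz' q⟩
  rwa [mul_div_cancel₀ s two_ne_zero]

/-- `W(z, q)` is diagonal, with the entries `ρ / (e - ζ) + g(ζ)` at `ζ = z - ω(q)`. -/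
structure IsResolvent (ω : Mom d → ℝ) (e₀ w L b : ℝ) (W : ℂ → Mom d → M₂) (e₁ e₂ : ℝ) (ρ₁ ρ₂ : ℂ)
    (g₁ g₂ : ℂ → ℂ) : Prop where
  pole₁ : PoleData e₀ w L e₁ ρ₁ g₁
  pole₂ : PoleData e₀ w L e₂ ρ₂ g₂
  le : b ≤ w + ω 0
  eq : ∀ z ∈ slitHalfPlane (e₀ + ω 0) b, ∀ q,
    W z q = dg (poleFn ω e₁ ρ₁ g₁ z q) (poleFn ω e₂ ρ₂ g₂ z q)

theorem continuous_dg {f₁ f₂ : Mom d → ℂ} (h₁ : Continuous f₁) (h₂ : Continuous f₂) :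
    Continuous fun q => dg (f₁ q) (f₂ q) := by
  have : (fun q => dg (f₁ q) (f₂ q)) = fun q => dgL (f₁ q, f₂ q) :=
    funext fun q => (dgL_apply (f₁ q, f₂ q)).symm
  rw [this]
  exact dgL.continuous.comp (h₁.prodMk h₂)

theorem IsResolvent.exists_bound (hω : DispersionLaw ω)
    (hW : IsResolvent ω e₀ w L b W e₁ e₂ ρ₁ ρ₂ g₁ g₂) {z : ℂ}
    (hz : z ∈ slitHalfPlane (e₀ + ω 0) b) : ∃ s M, 0 < s ∧ 0 ≤ M ∧
      Metric.ball z s ⊆ slitHalfPlane (e₀ + ω 0) b ∧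
      ∀ z' ∈ Metric.ball z s, ∀ q, ‖W z' q‖ ≤ M := by
  obtain ⟨s₁, p₁, b₁, c₁⟩ := hW.pole₁.exists_bound hω.min_le hW.le hz
  obtain ⟨s₂, p₂, b₂, c₂⟩ := hW.pole₂.exists_bound hω.min_le hW.le hz
  have hL : 0 ≤ L := by
    have hw : (z - ω 0 : ℂ).re < w := by
      have : z.re < b := hz.1
      rw [Complex.sub_re, Complex.ofReal_re]
      linarith [hW.le]
    exact (norm_nonneg _).trans (hW.pole₁.bound _ hw)
  refine ⟨min s₁ s₂, dgC * (2 / s₁ + L + (2 / s₂ + L)), lt_min p₁ p₂,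
    mul_nonneg dgC_nonneg (by positivity),
    (Metric.ball_subset_ball (min_le_left _ _)).trans b₁, fun z' hz' q => ?_⟩
  have hz₁ := Metric.ball_subset_ball (min_le_left _ _) hz'
  rw [hW.eq z' (b₁ hz₁)]
  have k₁ : 0 ≤ 2 / s₁ + L := by positivity
  have k₂ : 0 ≤ 2 / s₂ + L := by positivity
  exact norm_dg_le ((c₁ z' hz₁ q).trans (by linarith))
    ((c₂ z' (Metric.ball_subset_ball (min_le_right _ _) hz') q).trans (by linarith))

theorem IsResolvent.toBCF_apply (hω : DispersionLaw ω)
    (hW : IsResolvent ω e₀ w L b W e₁ e₂ ρ₁ ρ₂ g₁ g₂) {z : ℂ}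
    (hz : z ∈ slitHalfPlane (e₀ + ω 0) b) (q : Mom d) : toBCF (W z) q = W z q := by
  obtain ⟨s, M, hs, -, -, hM⟩ := hW.exists_bound hω hz
  refine SpinBoson.toBCF_apply ?_ (hM z (Metric.mem_ball_self hs)) q
  rw [funext (hW.eq z hz)]
  exact continuous_dg
    (continuous_poleFn hω.contDiff.continuous hω.min_le hW.pole₁.le hW.pole₁.differentiableOn hW.le hz)
    (continuous_poleFn hω.contDiff.continuous hω.min_le hW.pole₂.le hW.pole₂.differentiableOn hW.le hz)

/-- Pointwise holomorphy together with a locally uniform bound gives holomorphy in the sup norm; the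
momentum q serves as the index in `differentiableAt_of_family`. -/
theorem IsResolvent.differentiableOn (hω : DispersionLaw ω)
    (hW : IsResolvent ω e₀ w L b W e₁ e₂ ρ₁ ρ₂ g₁ g₂) :
    DifferentiableOn ℂ (fun z => toBCF (W z)) (slitHalfPlane (e₀ + ω 0) b) := by
  intro z hz
  obtain ⟨s, M, hs, hM0, hsub, hM⟩ := hW.exists_bound hω hz
  refine DifferentiableAt.differentiableWithinAt (differentiableAt_of_family
    (φ := fun q z => W z q) hs zero_le_one hM0 (fun q => ?_) (fun q z' hz' => hM z' hz' q)
    fun z₁ hz₁ z₂ hz₂ c₀ c₁ c₂ B hB hle => ?_)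
  · have hd₁ := (differentiableOn_poleFn (ρ := ρ₁) hω.min_le hW.pole₁.le hW.pole₁.differentiableOn
      hW.le q).mono hsub
    have hd₂ := (differentiableOn_poleFn (ρ := ρ₂) hω.min_le hW.pole₂.le hW.pole₂.differentiableOn
      hW.le q).mono hsub
    refine (dgL.differentiable.comp_differentiableOn (hd₁.prodMk hd₂)).congr fun z' hz' => ?_
    rw [hW.eq z' (hsub hz'), Function.comp_apply, dgL_apply]
  · rw [one_mul, BoundedContinuousFunction.norm_le hB]
    intro q
    simp only [BoundedContinuousFunction.coe_add, BoundedContinuousFunction.coe_smul, Pi.add_apply]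
    rw [hW.toBCF_apply hω hz, hW.toBCF_apply hω (hsub hz₁), hW.toBCF_apply hω (hsub hz₂)]
    exact hle q

theorem mem_slitHalfPlane_of_im_ne_zero {a b : ℝ} {z : ℂ} (hz : z.im ≠ 0) (hb : z.re < b) :
    z ∈ slitHalfPlane a b := ⟨hb, fun h0 => hz h0.1⟩

/-- The bounds for `R(z)` and its differences are uniform. -/
theorem exists_tameBound_resolvent (hω : DispersionLaw ω) (hd : 3 ≤ d) (hh : IsWeight h) {c₁ r : ℝ}
    (hc₁ : c₁ < 2 * ω 0) (hr : 0 < r) (hL : 0 ≤ L) :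
    ∃ c, 0 ≤ c ∧ ∀ (e₀ w b e₁ e₂ : ℝ) (ρ₁ ρ₂ : ℂ) (g₁ g₂ : ℂ → ℂ) (W : ℂ → Mom d → M₂),
      IsResolvent ω e₀ w L b W e₁ e₂ ρ₁ ρ₂ g₁ g₂ → b ≤ w - r + ω 0 → b ≤ c₁ + e₀ →
      (∀ z ∈ slitHalfPlane (e₀ + ω 0) b, TameBound h (toBCF (W z)) c) ∧
      ∀ z₁ z₂ : ℂ, 0 < z₁.im * z₂.im → z₁.re < b → z₂.re < b →
        TameBound h (toBCF (W z₁) - toBCF (W z₂) : Mom d →ᵇ M₂)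
          (c * ‖z₁ - z₂‖ ^ (1 / 10 : ℝ)) := by
  obtain ⟨c, hc, key⟩ := exists_scalarTame hω hd hh hc₁ hr hL
  refine ⟨c * (2 * dgC), mul_nonneg hc (mul_nonneg two_pos.le dgC_nonneg),
    fun e₀ w b e₁ e₂ ρ₁ ρ₂ g₁ g₂ W hW hbw hbe => ?_⟩
  have hmin := hω.min_le
  have hωc := hω.contDiff.continuous
  obtain ⟨k₁, l₁⟩ := key e₁ ρ₁ g₁ w b hW.pole₁.norm_le hW.pole₁.differentiableOn hW.pole₁.bound hbw
    (by linarith [hW.pole₁.le])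
  obtain ⟨k₂, l₂⟩ := key e₂ ρ₂ g₂ w b hW.pole₂.norm_le hW.pole₂.differentiableOn hW.pole₂.bound hbw
    (by linarith [hW.pole₂.le])
  have cont₁ := fun z hz => continuous_poleFn (ρ := ρ₁) (z := z) hωc hmin hW.pole₁.le
    hW.pole₁.differentiableOn hW.le hz
  have cont₂ := fun z hz => continuous_poleFn (ρ := ρ₂) (z := z) hωc hmin hW.pole₂.le
    hW.pole₂.differentiableOn hW.le hz
  have bd₁ : ∀ z ∈ slitHalfPlane (e₀ + ω 0) b, ∃ B, ∀ q, ‖poleFn ω e₁ ρ₁ g₁ z q‖ ≤ B := fun z hz => by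
    obtain ⟨s, hs, -, hB⟩ := hW.pole₁.exists_bound hmin hW.le hz
    exact ⟨_, hB z (Metric.mem_ball_self hs)⟩
  have bd₂ : ∀ z ∈ slitHalfPlane (e₀ + ω 0) b, ∃ B, ∀ q, ‖poleFn ω e₂ ρ₂ g₂ z q‖ ≤ B := fun z hz => by
    obtain ⟨s, hs, -, hB⟩ := hW.pole₂.exists_bound hmin hW.le hz
    exact ⟨_, hB z (Metric.mem_ball_self hs)⟩
  have hfun : ∀ z ∈ slitHalfPlane (e₀ + ω 0) b, (toBCF (W z) : Mom d → M₂) =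
      fun q => dg (poleFn ω e₁ ρ₁ g₁ z q) (poleFn ω e₂ ρ₂ g₂ z q) := fun z hz => funext fun q => by
    rw [hW.toBCF_apply hω hz, hW.eq z hz]
  have him : ∀ z : ℂ, z.im ≠ 0 → z.re < b → TameBound h (toBCF (W z)) (c * (2 * dgC)) :=
      fun z hz hzb => by
    have hzU := mem_slitHalfPlane_of_im_ne_zero (a := e₀ + ω 0) hz hzb
    rw [hfun z hzU]
    exact (k₁ z hz hzb.le).tameBound_dg hh (k₂ z hz hzb.le) (cont₁ z hzU) (cont₂ z hzU) (bd₁ z hzU)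
      (bd₂ z hzU)
  refine ⟨fun z hz => ?_, fun z₁ z₂ hz hz₁ hz₂ => ?_⟩
  · by_cases hzi : z.im = 0
    -- A real z off the cut is approached from above, where the bound is known with the same
    -- constant.
    · have hseq : Tendsto (fun n : ℕ => z + ((1 / ((n : ℝ) + 1) : ℝ) : ℂ) * Complex.I) atTop
          (𝓝 z) := by
        have h1 := (Complex.continuous_ofReal.tendsto 0).comp tendsto_one_div_add_atTop_nhds_zero_nat
        have h2 := (h1.mul_const Complex.I).const_add z
        simpa using h2
      have hct : ContinuousAt (fun z => toBCF (W z)) z :=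
        ((hW.differentiableOn hω z hz).differentiableAt
          ((isOpen_slitHalfPlane _ _).mem_nhds hz)).continuousAt
      refine TameBound.of_tendsto hh (Eventually.of_forall fun n => ?_) (hct.tendsto.comp hseq)
      refine him _ ?_ ?_
      · have : (0 : ℝ) < 1 / ((n : ℝ) + 1) := by positivity
        rw [Complex.add_im, hzi, zero_add, Complex.im_ofReal_mul, Complex.I_im, mul_one]
        exact this.ne'
      · have := hz.1
        simpa using this
    · exact him z hzi hz.1
  · have hi₁ : z₁.im ≠ 0 := fun h0 => by simp [h0] at hz
    have hi₂ : z₂.im ≠ 0 := fun h0 => by simp [h0] at hz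
    have hU₁ := mem_slitHalfPlane_of_im_ne_zero (a := e₀ + ω 0) hi₁ hz₁
    have hU₂ := mem_slitHalfPlane_of_im_ne_zero (a := e₀ + ω 0) hi₂ hz₂
    have e : ((toBCF (W z₁) - toBCF (W z₂) : Mom d →ᵇ M₂) : Mom d → M₂) = fun q =>
        dg (poleFn ω e₁ ρ₁ g₁ z₁ q - poleFn ω e₁ ρ₁ g₁ z₂ q)
          (poleFn ω e₂ ρ₂ g₂ z₁ q - poleFn ω e₂ ρ₂ g₂ z₂ q) := by
      rw [BoundedContinuousFunction.coe_sub, hfun z₁ hU₁, hfun z₂ hU₂]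
      exact funext fun q => dg_sub _ _ _ _
    have bsub : ∀ f f' : Mom d → ℂ, (∃ B, ∀ q, ‖f q‖ ≤ B) → (∃ B, ∀ q, ‖f' q‖ ≤ B) →
        ∃ B, ∀ q, ‖f q - f' q‖ ≤ B := by
      rintro f f' ⟨B, hB⟩ ⟨B', hB'⟩
      exact ⟨B + B', fun q => (norm_sub_le _ _).trans (add_le_add (hB q) (hB' q))⟩
    rw [e]
    have := (l₁ z₁ z₂ hz hz₁.le hz₂.le).tameBound_dg hh (l₂ z₁ z₂ hz hz₁.le hz₂.le)
      ((cont₁ z₁ hU₁).sub (cont₁ z₂ hU₂)) ((cont₂ z₁ hU₁).sub (cont₂ z₂ hU₂))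
      (bsub _ _ (bd₁ z₁ hU₁) (bd₁ z₂ hU₂)) (bsub _ _ (bd₂ z₁ hU₁) (bd₂ z₂ hU₂))
    rwa [mul_right_comm] at this

/-- The kernels `λ(q) conj λ(k) V(z; ω(q), ω(k))` form a holomorphic family in `𝒦₁`. -/
theorem exists_holomorphic_kernel (hω : DispersionLaw ω) {lam : Mom d → ℂ} (hl : FormFactor lam h)
    {a : ℝ} (ha : a < ω 0) :
    ∃ C, 0 ≤ C ∧ ∀ (X : ℂ → ℂ × ℂ → ℂ × ℂ) (v M : ℝ) (D : ℂ → Mom d → Mom d → M₂),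
      DifferentiableOn ℂ (fun y : ℂ × ℂ × ℂ => X y.1 y.2)
        ({z | z.re < v} ×ˢ ({s | a < s.re} ×ˢ {s | a < s.re})) →
      (∀ z s τ : ℂ, z.re < v → a < s.re → a < τ.re → ‖X z (s, τ)‖ ≤ M) →
      (∀ z : ℂ, z.re < v → ∀ q k, D z q k = (lam q * star (lam k)) • dgL (X z (ω q, ω k))) →
      (∀ z : ℂ, z.re < v → (toK h (D z)).ker = D z ∧ ‖toK h (D z)‖ ≤ C * M) ∧
      DifferentiableOn ℂ (fun z => toK h (D z)) {z | z.re < v} := by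
  obtain ⟨C, hC, key⟩ := exists_kernelBound_energy hω hl ha
  refine ⟨C * ‖dgL‖, by positivity, fun X v M D hX hM hD => ?_⟩
  have hpt : ∀ z : ℂ, z.re < v → DifferentiableOn ℂ (X z) ({s | a < s.re} ×ˢ {s | a < s.re}) :=
    fun z hz => hX.comp (f := fun y : ℂ × ℂ => (z, y)) (by fun_prop) fun y hy => ⟨hz, hy⟩
  have hker : ∀ z : ℂ, z.re < v → (toK h (D z)).ker = D z ∧ ‖toK h (D z)‖ ≤ C * ‖dgL‖ * M :=
      fun z hz => by
    obtain ⟨k₁, k₂⟩ := key (fun y => dgL (X z y)) (‖dgL‖ * M)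
      (dgL.differentiable.comp_differentiableOn (hpt z hz)) fun s τ hs hτ =>
        (dgL.le_opNorm _).trans (by gcongr; exact hM z s τ hz hs hτ)
    have e : D z = fun q k => (lam q * star (lam k)) • dgL (X z (ω q, ω k)) :=
      funext fun q => funext fun k => hD z hz q k
    rw [← e] at k₁ k₂
    have e2 := toK_ker k₁ k₂
    refine ⟨e2, K₁.norm_le ?_⟩
    rw [e2, mul_assoc]
    exact k₂
  refine ⟨hker, fun z hz => ?_⟩
  have := hl.isWeight.completeSpace
  obtain ⟨r, hr, hsub⟩ := Metric.isOpen_iff.mp (isOpen_re_lt v) z hz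
  have hM0 : 0 ≤ M := (norm_nonneg _).trans
    (hM z (ω 0) (ω 0) hz (by simpa using ha) (by simpa using ha))
  -- The family is indexed by pairs of complex energies in the half-plane. The kernel bound is
  -- linear in the sup of the energy function, so it applies to three-point combinations in z as
  -- well.
  refine DifferentiableAt.differentiableWithinAt (differentiableAt_of_family
    (ι := {y : ℂ × ℂ // a < y.1.re ∧ a < y.2.re}) (φ := fun y z => X z y) (C := C * ‖dgL‖)
    hr (by positivity) hM0 (fun y => ?_)
    (fun y z' hz' => hM z' y.1.1 y.1.2 (hsub hz') y.2.1 y.2.2)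
    fun z₁ hz₁ z₂ hz₂ c₀ c₁ c₂ B hB hle => ?_)
  · exact hX.comp (f := fun z : ℂ => (z, y.1)) (by fun_prop)
      fun z' hz' => ⟨hsub hz', y.2.1, y.2.2⟩
  · obtain ⟨k₁, k₂⟩ := key (fun y => dgL (c₀ • X z y + c₁ • X z₁ y + c₂ • X z₂ y)) (‖dgL‖ * B)
      (dgL.differentiable.comp_differentiableOn ((((hpt z hz).const_smul c₀).add
        ((hpt z₁ (hsub hz₁)).const_smul c₁)).add ((hpt z₂ (hsub hz₂)).const_smul c₂)))
      fun s τ hs hτ => (dgL.le_opNorm _).trans (by gcongr; exact hle ⟨(s, τ), hs, hτ⟩)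
    refine K₁.norm_le ?_
    have e : (c₀ • toK h (D z) + c₁ • toK h (D z₁) + c₂ • toK h (D z₂)).ker = fun q k =>
        (lam q * star (lam k)) • dgL (c₀ • X z (ω q, ω k) + c₁ • X z₁ (ω q, ω k) +
          c₂ • X z₂ (ω q, ω k)) := funext fun q => funext fun k => by
      rw [K₁.ker_add_apply, K₁.ker_add_apply, K₁.ker_smul_apply, K₁.ker_smul_apply,
        K₁.ker_smul_apply, (hker z hz).1, (hker z₁ (hsub hz₁)).1, (hker z₂ (hsub hz₂)).1, hD z hz,
        hD z₁ (hsub hz₁), hD z₂ (hsub hz₂)]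
      simp only [map_add, map_smul, smul_add]
      simp only [smul_comm (lam q * star (lam k))]
    rw [e, mul_assoc]
    exact k₂

end Resolvent

/-! ### Operators in the one-boson space -/

section Operators

open scoped BoundedContinuousFunction

variable {d : ℕ} {h : Mom d → ℝ}

theorem exists_clm_of_ae {φ : OneBoson d → Mom d → Spin}
    (hadd : ∀ f g, φ (f + g) =ᵐ[volume] fun q => φ f q + φ g q)
    (hsmul : ∀ (c : ℂ) f, φ (c • f) =ᵐ[volume] fun q => c • φ f q) {C : ℝ}
    (hmem : ∀ f, MemLp (φ f) 2 volume) (hb : ∀ f, ‖(hmem f).toLp‖ ≤ C * ‖f‖) :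
    ∃ T : OneBoson d →L[ℂ] OneBoson d, ∀ f, T f =ᵐ[volume] φ f := by
  refine ⟨LinearMap.mkContinuous
    { toFun := fun f => (hmem f).toLp
      map_add' := fun f g => Lp.ext ?_
      map_smul' := fun c f => Lp.ext ?_ } C hb, fun f => (hmem f).coeFn_toLp⟩
  · filter_upwards [(hmem (f + g)).coeFn_toLp, (hmem f).coeFn_toLp, (hmem g).coeFn_toLp,
      Lp.coeFn_add (hmem f).toLp (hmem g).toLp, hadd f g] with q h1 h2 h3 h4 h5
    rw [h1, h4, h5, Pi.add_apply, h2, h3]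
  · filter_upwards [(hmem (c • f)).coeFn_toLp, (hmem f).coeFn_toLp,
      Lp.coeFn_smul c (hmem f).toLp, hsmul c f] with q h1 h2 h3 h4
    rw [h1, h4, RingHom.id_apply, h3, Pi.smul_apply, h2]

theorem aestronglyMeasurable_mul_apply {W : Mom d → M₂} (hW : Continuous W) {f : Mom d → Spin}
    (hf : AEStronglyMeasurable f volume) : AEStronglyMeasurable (fun q => W q (f q)) volume :=
  (ContinuousLinearMap.apply ℂ Spin).flip.flip.aestronglyMeasurable_comp₂
    hf hW.aestronglyMeasurable

theorem exists_mulOp (W : Mom d →ᵇ M₂) :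
    ∃ T : OneBoson d →L[ℂ] OneBoson d, ∀ f : OneBoson d, T f =ᵐ[volume] fun q => W q (f q) := by
  have hle : ∀ (f : OneBoson d) q, ‖W q (f q)‖ ≤ ‖W‖ * ‖f q‖ := fun f q =>
    ((W q).le_opNorm _).trans (by gcongr; exact W.norm_coe_le_norm q)
  have hmem : ∀ f : OneBoson d, MemLp (fun q => W q (f q)) 2 volume := fun f =>
    (Lp.memLp f).of_le_mul (c := ‖W‖)
      (aestronglyMeasurable_mul_apply W.continuous (Lp.aestronglyMeasurable f))
      (Eventually.of_forall (hle f))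
  refine exists_clm_of_ae (φ := fun f q => W q (f q)) (C := ‖W‖) (fun f g => ?_) (fun c f => ?_)
    hmem fun f => ?_
  · filter_upwards [Lp.coeFn_add f g] with q hq
    rw [hq, Pi.add_apply, map_add]
  · filter_upwards [Lp.coeFn_smul c f] with q hq
    rw [hq, Pi.smul_apply, map_smul]
  · refine Lp.norm_le_mul_norm_of_ae_le_mul ?_
    filter_upwards [(hmem f).coeFn_toLp] with q hq
    rw [hq]
    exact hle f q

/-- Multiplication by a bounded continuous matrix function. -/
def mulOp (W : Mom d →ᵇ M₂) : OneBoson d →L[ℂ] OneBoson d := (exists_mulOp W).choose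

theorem mulOp_ae (W : Mom d →ᵇ M₂) (f : OneBoson d) : mulOp W f =ᵐ[volume] fun q => W q (f q) :=
  (exists_mulOp W).choose_spec f

theorem IsWeight.integrable_mul_norm (hh : IsWeight h) (f : OneBoson d) :
    Integrable fun k => h k * ‖f k‖ :=
  hh.memLp.integrable_mul (Lp.memLp f).norm

theorem IsWeight.integral_mul_norm_le (hh : IsWeight h) (f : OneBoson d) :
    ∫ k, h k * ‖f k‖ ≤ ‖hh.memLp.toLp‖ * ‖f‖ := by
  set F : Lp ℝ 2 (volume : Measure (Mom d)) := (Lp.memLp f).norm.toLp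
  have h1 : inner ℝ hh.memLp.toLp F = ∫ k, h k * ‖f k‖ := by
    rw [L2.inner_def]
    refine integral_congr_ae ?_
    filter_upwards [hh.memLp.coeFn_toLp, (Lp.memLp f).norm.coeFn_toLp] with k e1 e2
    rw [e1, e2]
    simp [mul_comm]
  have h2 : ‖F‖ ≤ 1 * ‖f‖ := by
    refine Lp.norm_le_mul_norm_of_ae_le_mul ?_
    filter_upwards [(Lp.memLp f).norm.coeFn_toLp] with k e
    rw [e, one_mul, norm_norm]
  rw [← h1]
  rw [one_mul] at h2
  exact (real_inner_le_norm _ _).trans (by gcongr)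

theorem K₁.integrable_ker_apply (hh : IsWeight h) (g : K₁ h) (f : OneBoson d) (q : Mom d) :
    Integrable fun k => g.ker q k (f k) := by
  refine ((hh.integrable_mul_norm f).const_mul (‖g‖ * h q)).mono'
    (aestronglyMeasurable_mul_apply (g.continuous_right q) (Lp.aestronglyMeasurable f))
    (Eventually.of_forall fun k => ?_)
  rw [← mul_assoc]
  exact ((g.ker q k).le_opNorm _).trans (by gcongr; exact g.norm_ker_le q k)

theorem K₁.norm_integral_ker_le (hh : IsWeight h) (g : K₁ h) (f : OneBoson d) (q : Mom d) :
    ‖∫ k, g.ker q k (f k)‖ ≤ ‖g‖ * ‖hh.memLp.toLp‖ * ‖f‖ * ‖h q‖ := by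
  have h1 := norm_integral_le_of_norm_le (f := fun k => g.ker q k (f k))
    ((hh.integrable_mul_norm f).const_mul (‖g‖ * h q))
    (Eventually.of_forall fun k => by
      rw [← mul_assoc]
      exact ((g.ker q k).le_opNorm _).trans (by gcongr; exact g.norm_ker_le q k))
  rw [integral_const_mul] at h1
  have h2 := mul_le_mul_of_nonneg_left (hh.integral_mul_norm_le f)
    (mul_nonneg (norm_nonneg g) (hh.pos q).le)
  rw [Real.norm_of_nonneg (hh.pos q).le]
  linarith

theorem exists_intOp (hh : IsWeight h) (g : K₁ h) :
    ∃ T : OneBoson d →L[ℂ] OneBoson d, ∀ f : OneBoson d,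
      T f =ᵐ[volume] fun q => ∫ k, g.ker q k (f k) := by
  have hmeas : ∀ f : OneBoson d, AEStronglyMeasurable (fun q => ∫ k, g.ker q k (f k)) volume :=
      fun f => by
    have h1 : StronglyMeasurable fun v : Mom d × Mom d => f v.2 :=
      (Lp.stronglyMeasurable f).comp_measurable measurable_snd
    have h2 : StronglyMeasurable fun v : Mom d × Mom d => g.ker v.1 v.2 :=
      g.smooth.continuous.stronglyMeasurable
    have h3 : StronglyMeasurable fun v : Mom d × Mom d => g.ker v.1 v.2 (f v.2) :=
      (isBoundedBilinearMap_apply (𝕜 := ℂ) (E := Spin) (F := Spin)).continuous.comp_stronglyMeasurable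
        (h2.prodMk h1)
    exact h3.integral_prod_right.aestronglyMeasurable
  have hmem : ∀ f : OneBoson d, MemLp (fun q => ∫ k, g.ker q k (f k)) 2 volume := fun f =>
    hh.memLp.of_le_mul (hmeas f) (Eventually.of_forall (g.norm_integral_ker_le hh f))
  refine exists_clm_of_ae (φ := fun f q => ∫ k, g.ker q k (f k))
    (C := ‖g‖ * ‖hh.memLp.toLp‖ * ‖hh.memLp.toLp‖) (fun f f' => ?_) (fun c f => ?_) hmem fun f => ?_
  · refine Eventually.of_forall fun q => ?_
    have e : (fun k => g.ker q k ((f + f' : OneBoson d) k)) =ᵐ[volume]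
        fun k => g.ker q k (f k) + g.ker q k (f' k) := by
      filter_upwards [Lp.coeFn_add f f'] with k hk
      rw [hk, Pi.add_apply, map_add]
    exact (integral_congr_ae e).trans (integral_add (g.integrable_ker_apply hh f q)
      (g.integrable_ker_apply hh f' q))
  · refine Eventually.of_forall fun q => ?_
    have e : (fun k => g.ker q k ((c • f : OneBoson d) k)) =ᵐ[volume]
        fun k => c • g.ker q k (f k) := by
      filter_upwards [Lp.coeFn_smul c f] with k hk
      rw [hk, Pi.smul_apply, map_smul]
    exact (integral_congr_ae e).trans (integral_smul _ _)
  · have h1 : ‖(hmem f).toLp‖ ≤ ‖g‖ * ‖hh.memLp.toLp‖ * ‖f‖ * ‖hh.memLp.toLp‖ := by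
      refine Lp.norm_le_mul_norm_of_ae_le_mul ?_
      filter_upwards [(hmem f).coeFn_toLp, hh.memLp.coeFn_toLp] with q hq hq'
      rw [hq, hq']
      exact g.norm_integral_ker_le hh f q
    linarith

/-- The integral operator with kernel `g`. -/
def intOp (hh : IsWeight h) (g : K₁ h) : OneBoson d →L[ℂ] OneBoson d := (exists_intOp hh g).choose

theorem intOp_ae (hh : IsWeight h) (g : K₁ h) (f : OneBoson d) :
    intOp hh g f =ᵐ[volume] fun q => ∫ k, g.ker q k (f k) :=
  (exists_intOp hh g).choose_spec f

theorem intOp_add (hh : IsWeight h) (g g' : K₁ h) (f : OneBoson d) :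
    intOp hh (g + g') f = intOp hh g f + intOp hh g' f := by
  refine Lp.ext ?_
  filter_upwards [intOp_ae hh (g + g') f, intOp_ae hh g f, intOp_ae hh g' f,
    Lp.coeFn_add (intOp hh g f) (intOp hh g' f)] with q h1 h2 h3 h4
  rw [h1, h4, Pi.add_apply, h2, h3, ← integral_add (g.integrable_ker_apply hh f q)
    (g'.integrable_ker_apply hh f q)]
  rfl

/-- Fubini's theorem, with the dominating function h(k)‖f(k)‖ h(p)². It turns the kernel equations
into identities between operators. -/
theorem intOp_mulK (hh : IsWeight h) (W : Mom d →ᵇ M₂) (g g' : K₁ h) (f : OneBoson d) :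
    intOp hh (mulK hh W g g') f = intOp hh g (mulOp W (intOp hh g' f)) := by
  refine Lp.ext ?_
  filter_upwards [intOp_ae hh (mulK hh W g g') f, intOp_ae hh g (mulOp W (intOp hh g' f))]
    with q h1 h2
  rw [h1, h2]
  have e1 : (fun p => g.ker q p ((mulOp W (intOp hh g' f) : OneBoson d) p)) =ᵐ[volume]
      fun p => ∫ k, (g.ker q p * W p * g'.ker p k) (f k) := by
    filter_upwards [mulOp_ae W (intOp hh g' f), intOp_ae hh g' f] with p h3 h4
    rw [h3, h4]
    exact ((g.ker q p * W p).integral_comp_comm (g'.integrable_ker_apply hh f p)).symm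
  have e2 : ∀ k, (mulK hh W g g').ker q k (f k) = ∫ p, (g.ker q p * W p * g'.ker p k) (f k) :=
    fun k => ContinuousLinearMap.integral_apply (integrable_prodKer hh W g g' q k) (f k)
  rw [integral_congr_ae e1]
  simp only [e2]
  refine integral_integral_swap ?_
  have hsq : Integrable (fun v : Mom d × Mom d =>
      (‖g‖ * h q * ‖W‖ * ‖g'‖) * ((h v.1 * ‖f v.1‖) * h v.2 ^ 2)) (volume.prod volume) :=
    ((hh.integrable_mul_norm f).mul_prod hh.integrable_sq).const_mul _
  refine hsq.mono' ?_ (Eventually.of_forall fun v => ?_)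
  · have c1 : Continuous fun v : Mom d × Mom d => g.ker q v.2 :=
      (g.continuous_right q).comp continuous_snd
    have c2 : Continuous fun v : Mom d × Mom d => g'.ker v.2 v.1 :=
      g'.smooth.continuous.comp continuous_swap
    have c3 : Continuous fun v : Mom d × Mom d => g.ker q v.2 * W v.2 * g'.ker v.2 v.1 :=
      (c1.mul (W.continuous.comp continuous_snd)).mul c2
    have m1 : StronglyMeasurable fun v : Mom d × Mom d => f v.1 :=
      (Lp.stronglyMeasurable f).comp_measurable measurable_fst
    exact ((isBoundedBilinearMap_apply (𝕜 := ℂ) (E := Spin)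
      (F := Spin)).continuous.comp_stronglyMeasurable
        (c3.stronglyMeasurable.prodMk m1)).aestronglyMeasurable
  · simp only [Function.uncurry]
    have p0 := fun x => (hh.pos x).le
    have := p0 q; have := p0 v.1; have := p0 v.2
    calc _ ≤ ‖g.ker q v.2 * W v.2 * g'.ker v.2 v.1‖ * ‖f v.1‖ := ContinuousLinearMap.le_opNorm _ _
      _ ≤ ‖g.ker q v.2‖ * ‖W v.2‖ * ‖g'.ker v.2 v.1‖ * ‖f v.1‖ := by
          gcongr
          exact (norm_mul_le _ _).trans (by gcongr; exact norm_mul_le _ _)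
      _ ≤ (‖g‖ * h q * h v.2) * ‖W‖ * (‖g'‖ * h v.2 * h v.1) * ‖f v.1‖ := by
          gcongr
          · exact g.norm_ker_le _ _
          · exact W.norm_coe_le_norm _
          · exact g'.norm_ker_le _ _
      _ = _ := by ring

end Operators

/-! ### The family K(z): bounds, analyticity and boundary values. -/

section Kernel

open scoped BoundedContinuousFunction

variable {d : ℕ} {h : Mom d → ℝ}

theorem holderOnWith_of_norm_sub_le {X : Type*} [NormedAddCommGroup X] {G : ℝ → X} {s : Set ℝ}
    {C : ℝ} {r : NNReal} (hC : 0 ≤ C)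
    (hG : ∀ x ∈ s, ∀ y ∈ s, ‖G x - G y‖ ≤ C * |x - y| ^ (r : ℝ)) :
    HolderOnWith C.toNNReal r G s := by
  intro x hx y hy
  rw [edist_dist, edist_dist, ENNReal.ofReal_rpow_of_nonneg dist_nonneg r.coe_nonneg,
    ← ENNReal.ofReal_coe_nnreal, Real.coe_toNNReal C hC, ← ENNReal.ofReal_mul hC, dist_eq_norm,
    Real.dist_eq]
  exact ENNReal.ofReal_le_ofReal (hG x hx y hy)

/-- The properties of the solutions `K(z)` of `K = D + D W K` that follow from those of `W(z)` and
`D(z)`. -/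
theorem solK_family (hh : IsWeight h) {W : ℂ → Mom d →ᵇ M₂} {D : ℂ → K₁ h} {a b δ c M : ℝ}
    (hδ : 0 < δ) (hc : 0 ≤ c) (hM0 : 0 ≤ M) (hcM : c * M ≤ 1 / 2)
    (hW : DifferentiableOn ℂ W (slitHalfPlane a b))
    (ht : ∀ z ∈ slitHalfPlane a b, TameBound h (W z) c)
    (ht' : ∀ z₁ z₂ : ℂ, 0 < z₁.im * z₂.im → z₁.re < b → z₂.re < b →
      TameBound h (W z₁ - W z₂ : Mom d →ᵇ M₂) (c * ‖z₁ - z₂‖ ^ (1 / 10 : ℝ)))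
    (hD : DifferentiableOn ℂ D {z | z.re < b + δ}) (hM : ∀ z : ℂ, z.re < b + δ → ‖D z‖ ≤ M) :
    (∀ z ∈ slitHalfPlane a b, ‖mulKL hh (W z) (D z)‖ < 1) ∧
    (∀ z ∈ slitHalfPlane a b, ‖solK hh (W z) (D z)‖ ≤ 2 * M) ∧
    AnalyticOnNhd ℂ (fun z => solK hh (W z) (D z)) (slitHalfPlane a b) ∧
    ∃ Kp Km : ℝ → K₁ h, (∀ x < b,
      Tendsto (fun t : ℝ => solK hh (W (x + t * Complex.I)) (D (x + t * Complex.I))) (𝓝[>] 0)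
        (𝓝 (Kp x)) ∧
      Tendsto (fun t : ℝ => solK hh (W (x - t * Complex.I)) (D (x - t * Complex.I))) (𝓝[>] 0)
        (𝓝 (Km x))) ∧
      ∃ C r : NNReal, 0 < r ∧ r ≤ 1 ∧ HolderOnWith C r Kp (Iio b) ∧ HolderOnWith C r Km (Iio b) := by
  have := hh.completeSpace
  have hlt : ∀ z : ℂ, z.re < b → z.re < b + δ := fun z hz => by linarith
  have hA : ∀ z ∈ slitHalfPlane a b, ‖mulKL hh (W z) (D z)‖ ≤ 1 / 2 := fun z hz =>
    ((ht z hz).norm_mulKL_le' hc hh (D z)).trans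
      ((mul_le_mul_of_nonneg_left (hM z (hlt z hz.1)) hc).trans hcM)
  have hopen := isOpen_slitHalfPlane a b
  have hdiff : DifferentiableOn ℂ (fun z => solK hh (W z) (D z)) (slitHalfPlane a b) :=
    fun z hz => (differentiableAt_solK ((hW z hz).differentiableAt (hopen.mem_nhds hz))
      ((hD z (hlt z hz.1)).differentiableAt ((isOpen_re_lt _).mem_nhds (hlt z hz.1)))
      ((hA z hz).trans_lt (by norm_num))).differentiableWithinAt
  -- The three terms of `norm_solK_sub_le` with Hölder moduli inserted. The kernel D is Lipschitz
  -- because it is bounded and holomorphic on a half-plane larger by δ.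
  set H : ℝ := 2 * ((2 * M + 2 * M / δ) + c * M * (2 * M) + c * (2 * M + 2 * M / δ) * (2 * M))
  have hH : 0 ≤ H := by positivity
  have hhol : ∀ z₁ z₂ : ℂ, 0 < z₁.im * z₂.im → z₁.re < b → z₂.re < b →
      ‖solK hh (W z₁) (D z₁) - solK hh (W z₂) (D z₂)‖ ≤ H * ‖z₁ - z₂‖ ^ (1 / 10 : ℝ) := by
    intro z₁ z₂ him hz₁ hz₂
    have m₁ : z₁ ∈ slitHalfPlane a b :=
      mem_slitHalfPlane_of_im_ne_zero (fun h0 => by simp [h0] at him) hz₁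
    have m₂ : z₂ ∈ slitHalfPlane a b :=
      mem_slitHalfPlane_of_im_ne_zero (fun h0 => by simp [h0] at him) hz₂
    have hp : 0 ≤ ‖z₁ - z₂‖ ^ (1 / 10 : ℝ) := by positivity
    have hDd : ‖D z₁ - D z₂‖ ≤ (2 * M + 2 * M / δ) * ‖z₁ - z₂‖ ^ (1 / 10 : ℝ) := by
      refine le_rpow_tenth_of_le (norm_nonneg _) (by positivity) (by positivity) ?_ ?_
      · exact (norm_sub_le _ _).trans (by linarith [hM z₁ (hlt z₁ hz₁), hM z₂ (hlt z₂ hz₂)])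
      · exact norm_sub_le_of_re_lt hδ hD hM (by linarith) (hlt z₁ hz₁)
    refine (norm_solK_sub_le hc (mul_nonneg hc hp) (hA z₁ m₁) (hA z₂ m₂) (hM z₁ (hlt z₁ hz₁))
      (hM z₂ (hlt z₂ hz₂)) (ht z₂ m₂) (ht' z₁ z₂ him hz₁ hz₂)).trans ?_
    calc _ ≤ 2 * ((2 * M + 2 * M / δ) * ‖z₁ - z₂‖ ^ (1 / 10 : ℝ) +
          c * ‖z₁ - z₂‖ ^ (1 / 10 : ℝ) * M * (2 * M) +
          c * ((2 * M + 2 * M / δ) * ‖z₁ - z₂‖ ^ (1 / 10 : ℝ)) * (2 * M)) := by gcongr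
      _ = _ := by ring
  obtain ⟨Kp, hp, hp'⟩ := exists_boundary_values (F := fun z => solK hh (W z) (D z)) (b := b)
    (C := H) (r := 1 / 10) (s := 1) one_ne_zero (by norm_num) fun z₁ z₂ h1 h2 =>
      hhol z₁ z₂ (by nlinarith)
  obtain ⟨Km, hm, hm'⟩ := exists_boundary_values (F := fun z => solK hh (W z) (D z)) (b := b)
    (C := H) (r := 1 / 10) (s := -1) (by norm_num) (by norm_num) fun z₁ z₂ h1 h2 =>
      hhol z₁ z₂ (by nlinarith)
  refine ⟨fun z hz => (hA z hz).trans_lt (by norm_num), fun z hz => (norm_solK_le (hA z hz)).trans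
    (mul_le_mul_of_nonneg_left (hM z (hlt z hz.1)) two_pos.le), hdiff.analyticOnNhd hopen, Kp, Km,
    fun x hx => ⟨?_, ?_⟩, H.toNNReal, 1 / 10, by norm_num, ?_,
    holderOnWith_of_norm_sub_le hH fun x hx y hy => ?_,
    holderOnWith_of_norm_sub_le hH fun x hx y hy => ?_⟩
  · have := hp x hx
    simpa only [Complex.ofReal_one, one_mul] using this
  · have := hm x hx
    have e : ∀ t : ℝ, (x + ((-1 : ℝ) : ℂ) * t * Complex.I : ℂ) = x - t * Complex.I := fun t => by
      push_cast; ring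
    simpa only [e] using this
  · rw [← NNReal.coe_le_coe]; norm_num
  · have := hp' x hx y hy
    rwa [show ((1 / 10 : NNReal) : ℝ) = 1 / 10 by norm_num]
  · have := hm' x hx y hy
    rwa [show ((1 / 10 : NNReal) : ℝ) = 1 / 10 by norm_num]

end Kernel

/-! ### The inverse of B(z) as an operator. -/

namespace Model

open scoped BoundedContinuousFunction

variable {d : ℕ} (S : Model d) {h : Mom d → ℝ} {α : ℝ} {z : ℂ}

/-- The inverse of `B(z)`, in terms of the solution of the kernel equation. -/
theorem isInverse_of_kernel (hh : IsWeight h) (hωc : Continuous S.ω)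
    {W : Mom d →ᵇ M₂} {D K : K₁ h} (hD : D.ker = S.dKer h α z)
    (hWl : ∀ q, W q * S.multMat h α z q = 1) (hWr : ∀ q, S.multMat h α z q * W q = 1)
    (hc : Continuous (S.multMat h α z)) {C : ℝ}
    (hC : ∀ q, ‖S.multMat h α z q - (S.ω q : ℂ) • (1 : M₂)‖ ≤ C)
    (hK : K = D + mulK hh W D K) (hK' : K = D + mulK hh W K D) :
    S.IsInverse h α z (mulOp W ∘L (1 + intOp hh K ∘L mulOp W)) := by
  have hC0 : 0 ≤ C := (norm_nonneg _).trans (hC 0)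
  have e1 : ∀ f, intOp hh K f = intOp hh D f + intOp hh D (mulOp W (intOp hh K f)) := fun f => by
    rw [← intOp_mulK, ← intOp_add, ← hK]
  have e2 : ∀ f, intOp hh K f = intOp hh D f + intOp hh K (mulOp W (intOp hh D f)) := fun f => by
    rw [← intOp_mulK, ← intOp_add, ← hK']
  have hT : ∀ f, (mulOp W ∘L (1 + intOp hh K ∘L mulOp W)) f =
      mulOp W (f + intOp hh K (mulOp W f)) := fun f => rfl
  have hB : ∀ u : OneBoson d, S.opB h α z u =ᵐ[volume]
      fun q => S.multMat h α z q (u q) - intOp hh D u q := fun u => by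
    filter_upwards [intOp_ae hh D u] with q hq
    rw [hq, hD]
    rfl
  -- The multiplier of B(z) differs from ω by a bounded matrix, so ωW is bounded although ω is not.
  -- Hence the range of the inverse lies in the domain.
  have hωW : ∀ q, ‖(S.ω q : ℂ) • W q‖ ≤ 1 + ‖W‖ * C := fun q => by
    have e : (S.ω q : ℂ) • W q =
        1 - W q * (S.multMat h α z q - (S.ω q : ℂ) • (1 : M₂)) := by
      rw [mul_sub, hWl, mul_smul_comm, mul_one, sub_sub_cancel]
    rw [e]
    refine (norm_sub_le _ _).trans (add_le_add ContinuousLinearMap.norm_id_le ?_)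
    exact (norm_mul_le _ _).trans (by gcongr; exacts [W.norm_coe_le_norm q, hC q])
  refine ⟨fun u q => ?_, fun u hu => ?_, fun g => ?_, fun g => ?_, fun u hu g hg => ?_⟩
  · rw [← hD]
    exact D.integrable_ker_apply hh u q
  · refine MemLp.ae_eq (hB u).symm (MemLp.sub ?_ (Lp.memLp (intOp hh D u)))
    have h1 : MemLp (fun q => (S.multMat h α z q - (S.ω q : ℂ) • (1 : M₂)) (u q)) 2 volume := by
      refine (Lp.memLp u).of_le_mul (c := C) (aestronglyMeasurable_mul_apply (hc.sub
        ((Complex.continuous_ofReal.comp hωc).smul continuous_const))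
          (Lp.aestronglyMeasurable u)) (Eventually.of_forall fun q => ?_)
      exact (ContinuousLinearMap.le_opNorm _ _).trans (by gcongr; exact hC q)
    refine MemLp.ae_eq (Eventually.of_forall fun q => ?_) (h1.add hu)
    simp
  · have h1 : (fun q => (S.ω q : ℂ) • W q ((g + intOp hh K (mulOp W g) : OneBoson d) q)) =ᵐ[volume]
        fun q => (S.ω q : ℂ) • (mulOp W ∘L (1 + intOp hh K ∘L mulOp W)) g q := by
      filter_upwards [mulOp_ae W (g + intOp hh K (mulOp W g))] with q hq
      rw [hT, hq]
    refine MemLp.ae_eq h1 ((Lp.memLp (g + intOp hh K (mulOp W g))).of_le_mul (c := 1 + ‖W‖ * C)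
      ((Complex.continuous_ofReal.comp hωc).aestronglyMeasurable.smul
        (aestronglyMeasurable_mul_apply W.continuous (Lp.aestronglyMeasurable _)))
      (Eventually.of_forall fun q => ?_))
    exact (((S.ω q : ℂ) • W q).le_opNorm _).trans (by gcongr; exact hωW q)
  -- For the right inverse, K = D + D W K says precisely that y - D W y = g, while the multiplier of
  -- B(z) cancels W.
  · set y := g + intOp hh K (mulOp W g) with hy
    have h1 : y - intOp hh D (mulOp W y) = g := by
      rw [hy, map_add, map_add]
      nth_rewrite 1 [e1]
      abel
    filter_upwards [hB (mulOp W y), mulOp_ae W y, Lp.coeFn_sub y (intOp hh D (mulOp W y))]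
      with q h2 h3 h4
    rw [hT, h2, h3]
    rw [h1, Pi.sub_apply] at h4
    rw [h4, ← mul_apply_eq_comp, hWr, one_apply_eq_self]
  -- For the left inverse, y is the multiplier of B(z) applied to u, so W y = u. Then K W g = K u -
  -- K W D u = D u by the reversed equation K = D + K W D.
  · set y := g + intOp hh D u with hy
    have h1 : mulOp W y = u := by
      refine Lp.ext ?_
      filter_upwards [mulOp_ae W y, hg, hB u, Lp.coeFn_add g (intOp hh D u)] with q h2 h3 h4 h5
      have h6 : y q = S.multMat h α z q (u q) := by
        rw [hy, h5, Pi.add_apply, ← h3, h4, sub_add_cancel]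
      rw [h2, h6, ← mul_apply_eq_comp, hWl, one_apply_eq_self]
    have h2 : g = y - intOp hh D u := by rw [hy, add_sub_cancel_right]
    have h3 : mulOp W g = u - mulOp W (intOp hh D u) := by
      nth_rewrite 1 [h2]
      rw [(mulOp W).map_sub, h1]
    have h4 : intOp hh K (mulOp W g) = intOp hh D u := by
      rw [h3, (intOp hh K).map_sub]
      exact sub_eq_iff_eq_add.mpr (e2 u)
    rw [hT, h4, h1]

theorem inverse_formula (hh : IsWeight h) {W : Mom d →ᵇ M₂} (K : K₁ h) (f : OneBoson d) :
    (mulOp W ∘L (1 + intOp hh K ∘L mulOp W)) f =ᵐ[volume] fun q =>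
      W q (f q + ∫ k, K.ker q k (W k (f k))) := by
  have hT : (mulOp W ∘L (1 + intOp hh K ∘L mulOp W)) f =
      mulOp W (f + intOp hh K (mulOp W f)) := rfl
  rw [hT]
  filter_upwards [mulOp_ae W (f + intOp hh K (mulOp W f)), Lp.coeFn_add f (intOp hh K (mulOp W f)),
    intOp_ae hh K (mulOp W f)] with q h1 h2 h3
  rw [h1, h2, Pi.add_apply, h3]
  congr 2
  refine integral_congr_ae ?_
  filter_upwards [mulOp_ae W f] with k hk
  rw [hk]

end Model

/-! ### The zeros of the effective matrix and the form of R(z, q). -/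

namespace Model

variable {d : ℕ} (S : Model d) {h : Mom d → ℝ} {α : ℝ}

theorem effMat_eq_dg {m₁ m₂ : ℂ → ℂ} {ζ : ℂ} (hm : S.mMat h α ζ = dg (m₁ ζ) (m₂ ζ)) :
    S.effMat h α ζ = dg ((S.ε : ℝ) - ζ - m₁ ζ) ((-S.ε : ℝ) - ζ - m₂ ζ) := by
  rw [effMat, hm, σ₃_eq_dg, ← dg_one, dg_smul, dg_smul, dg_sub, dg_sub]
  congr 1 <;> push_cast <;> ring

/-- `e₁`, `e₂` are the simple zeros of the diagonal entries of `ε σ₃ - ζ - m(ζ)`. -/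
structure IsSpectral (h : Mom d → ℝ) (α w L b e₁ e₂ : ℝ) (ρ₁ ρ₂ : ℂ) (g₁ g₂ m₁ m₂ : ℂ → ℂ) :
    Prop where
  pole₁ : PoleData e₂ w L e₁ ρ₁ g₁
  pole₂ : PoleData e₂ w L e₂ ρ₂ g₂
  le : b ≤ w + S.ω 0
  eq : ∀ ζ : ℂ, ζ.re < w → S.mMat h α ζ = dg (m₁ ζ) (m₂ ζ)
  continuousOn₁ : ContinuousOn m₁ {z | z.re < w}
  continuousOn₂ : ContinuousOn m₂ {z | z.re < w}
  zero₁ : ∀ z : ℂ, z.re < w → ((S.ε : ℝ) - z - m₁ z = 0 ↔ z = e₁)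
  zero₂ : ∀ z : ℂ, z.re < w → ((-S.ε : ℝ) - z - m₂ z = 0 ↔ z = e₂)
  inv₁ : ∀ z : ℂ, z.re < w → z ≠ e₁ → ((S.ε : ℝ) - z - m₁ z)⁻¹ = ρ₁ * (e₁ - z)⁻¹ + g₁ z
  inv₂ : ∀ z : ℂ, z.re < w → z ≠ e₂ → ((-S.ε : ℝ) - z - m₂ z)⁻¹ = ρ₂ * (e₂ - z)⁻¹ + g₂ z

variable {S} {w L b e₁ e₂ : ℝ} {ρ₁ ρ₂ : ℂ} {g₁ g₂ m₁ m₂ : ℂ → ℂ}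

/-- The determinant is the product of the two diagonal entries, so only e₁ and e₂ can occur, and e₂
≤ e₁. The zero e₁ may lie outside the admissible interval. -/
theorem IsSpectral.isLeast (hs : S.IsSpectral h α w L b e₁ e₂ ρ₁ ρ₂ g₁ g₂ m₁ m₂) {η : ℝ}
    (hw : -S.ε + S.κ - η ≤ w) (he : e₂ < -S.ε + S.κ - η) : IsLeast (S.effZeros h α η) e₂ := by
  have hdet : ∀ x : ℝ, x < -S.ε + S.κ - η → ((S.effMat h α (x : ℂ)).det = 0 ↔ x = e₁ ∨ x = e₂) :=
      fun x hx => by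
    have hxw : (x : ℂ).re < w := by rw [Complex.ofReal_re]; linarith
    rw [S.effMat_eq_dg (hs.eq _ hxw), det_dg, mul_eq_zero, hs.zero₁ _ hxw, hs.zero₂ _ hxw,
      Complex.ofReal_inj, Complex.ofReal_inj]
  refine ⟨⟨he, (hdet e₂ he).mpr (Or.inr rfl)⟩, fun x hx => ?_⟩
  rcases (hdet x hx.1).mp hx.2 with h0 | h0
  · rw [h0]; exact hs.pole₁.le
  · exact h0.ge

theorem IsSpectral.re_lt (hω : DispersionLaw S.ω)
    (hs : S.IsSpectral h α w L b e₁ e₂ ρ₁ ρ₂ g₁ g₂ m₁ m₂) {z : ℂ} (hz : z.re < b) (q : Mom d) :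
    (z - S.ω q : ℂ).re < w := by
  rw [Complex.sub_re, Complex.ofReal_re]
  linarith [hω.min_le q, hs.le]

theorem IsSpectral.multMat_eq (hω : DispersionLaw S.ω)
    (hs : S.IsSpectral h α w L b e₁ e₂ ρ₁ ρ₂ g₁ g₂ m₁ m₂) {z : ℂ} (hz : z.re < b) (q : Mom d) :
    S.multMat h α z q = dg ((S.ε : ℝ) - (z - S.ω q) - m₁ (z - S.ω q))
      ((-S.ε : ℝ) - (z - S.ω q) - m₂ (z - S.ω q)) :=
  S.effMat_eq_dg (hs.eq _ (hs.re_lt hω hz q))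

theorem IsSpectral.ne_zero (hω : DispersionLaw S.ω)
    (hs : S.IsSpectral h α w L b e₁ e₂ ρ₁ ρ₂ g₁ g₂ m₁ m₂) {z : ℂ}
    (hz : z ∈ slitHalfPlane (e₂ + S.ω 0) b) (q : Mom d) :
    (z - S.ω q : ℂ) ≠ e₁ ∧ (z - S.ω q : ℂ) ≠ e₂ := by
  have k₁ := energy_sub_ne_zero hω.min_le hs.pole₁.le hz q
  have k₂ := energy_sub_ne_zero hω.min_le hs.pole₂.le hz q
  exact ⟨fun h0 => k₁ (by rw [← h0]; ring), fun h0 => k₂ (by rw [← h0]; ring)⟩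

theorem IsSpectral.isUnit (hω : DispersionLaw S.ω)
    (hs : S.IsSpectral h α w L b e₁ e₂ ρ₁ ρ₂ g₁ g₂ m₁ m₂) {z : ℂ}
    (hz : z ∈ slitHalfPlane (e₂ + S.ω 0) b) (q : Mom d) : IsUnit (S.multMat h α z q) := by
  obtain ⟨n₁, n₂⟩ := hs.ne_zero hω hz q
  have hr := hs.re_lt hω hz.1 q
  rw [hs.multMat_eq hω hz.1]
  exact isUnit_dg (fun h0 => n₁ ((hs.zero₁ _ hr).mp h0)) fun h0 => n₂ ((hs.zero₂ _ hr).mp h0)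

theorem IsSpectral.isResolvent (hω : DispersionLaw S.ω)
    (hs : S.IsSpectral h α w L b e₁ e₂ ρ₁ ρ₂ g₁ g₂ m₁ m₂) :
    IsResolvent S.ω e₂ w L b (fun z q => Ring.inverse (S.multMat h α z q)) e₁ e₂ ρ₁ ρ₂ g₁ g₂ := by
  refine ⟨hs.pole₁, hs.pole₂, hs.le, fun z hz q => ?_⟩
  obtain ⟨n₁, n₂⟩ := hs.ne_zero hω hz q
  have hr := hs.re_lt hω hz.1 q
  rw [hs.multMat_eq hω hz.1, inverse_dg (fun h0 => n₁ ((hs.zero₁ _ hr).mp h0))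
    fun h0 => n₂ ((hs.zero₂ _ hr).mp h0), hs.inv₁ _ hr n₁, hs.inv₂ _ hr n₂]
  simp only [poleFn]
  congr 4 <;> ring

theorem IsSpectral.continuous_multMat (hω : DispersionLaw S.ω)
    (hs : S.IsSpectral h α w L b e₁ e₂ ρ₁ ρ₂ g₁ g₂ m₁ m₂) {z : ℂ} (hz : z.re < b) :
    Continuous (S.multMat h α z) := by
  have hωc := hω.contDiff.continuous
  rw [funext (hs.multMat_eq hω hz)]
  have hc : Continuous fun q => (z - S.ω q : ℂ) := by fun_prop
  have c₁ := hs.continuousOn₁.comp_continuous hc fun q => hs.re_lt hω hz q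
  have c₂ := hs.continuousOn₂.comp_continuous hc fun q => hs.re_lt hω hz q
  exact continuous_dg ((continuous_const.sub hc).sub c₁) ((continuous_const.sub hc).sub c₂)

/-- For fixed z the multiplier of B(z) is a bounded perturbation of multiplication by ω, which is
why the domain does not depend on z. -/
theorem IsSpectral.norm_multMat_sub_le (hω : DispersionLaw S.ω)
    (hs : S.IsSpectral h α w L b e₁ e₂ ρ₁ ρ₂ g₁ g₂ m₁ m₂) {M : ℝ}
    (h₁ : ∀ z : ℂ, z.re < w → ‖m₁ z‖ ≤ M) (h₂ : ∀ z : ℂ, z.re < w → ‖m₂ z‖ ≤ M) {z : ℂ}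
    (hz : z.re < b) (q : Mom d) :
    ‖S.multMat h α z q - (S.ω q : ℂ) • (1 : M₂)‖ ≤ dgC * (|S.ε| + ‖z‖ + M) := by
  have hr := hs.re_lt hω hz q
  rw [hs.multMat_eq hω hz, ← dg_one, dg_smul, dg_sub]
  have key : ∀ (x : ℝ) (m : ℂ), |x| ≤ |S.ε| → ‖m‖ ≤ M →
      ‖(x : ℂ) - (z - S.ω q) - m - S.ω q * 1‖ ≤ |S.ε| + ‖z‖ + M := fun x m hx hm => by
    have e : (x : ℂ) - (z - S.ω q) - m - S.ω q * 1 = x - z - m := by ring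
    rw [e]
    have h3 := norm_sub_le (x - z : ℂ) m
    have h4 := norm_sub_le (x : ℂ) z
    rw [Complex.norm_real, Real.norm_eq_abs] at h4
    linarith
  exact norm_dg_le (key _ _ le_rfl (h₁ _ hr)) (key _ _ (abs_neg _).le (h₂ _ hr))

end Model

end SpinBoson

end

/-! ### Assembly of the proposition. -/

theorem mainTheorem4 {d : ℕ} (hd : 3 ≤ d) (S : SpinBoson.Model d) (h : SpinBoson.Mom d → ℝ)
    (hε : 0 < S.ε)
    (hω : SpinBoson.DispersionLaw S.ω)
    (hlam : SpinBoson.FormFactor S.lam h)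
    (hlevel : ∀ x : ℝ, S.κ ≤ x → ∃ q, S.ω q = x ∧ S.lam q ≠ 0) :
    ∃ η₀ : ℝ, 0 < η₀ ∧ ∀ η : ℝ, 0 < η → η < η₀ →
    ∃ α₀ : ℝ, 0 < α₀ ∧ ∀ α : ℝ, 0 ≤ α → α < α₀ →
      -- the coefficient functions that define `m(z)` and the kernel of `B(z)` are well defined
      (∀ z ∈ S.halfPlane 0 η, ∃! μ, S.IsCoeff h α 0 z μ) ∧
      (∀ z ∈ S.halfPlane 1 η, ∃! μ, S.IsCoeff h α 1 z μ) ∧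
      ∃ e₀ : ℝ, IsLeast (S.effZeros h α η) e₀ ∧
      ∃ K : ℂ → SpinBoson.K₁ h,
        -- the inverse exists and has the stated form
        (∀ z ∈ S.halfPlane 1 η \ SpinBoson.cut (e₀ + S.κ),
          (∀ q, IsUnit (S.multMat h α z q)) ∧
          ∃ T : SpinBoson.OneBoson d →L[ℂ] SpinBoson.OneBoson d,
            S.IsInverse h α z T ∧
            ∀ f : SpinBoson.OneBoson d, T f =ᵐ[volume] fun q =>
              Ring.inverse (S.multMat h α z q)
                (f q + ∫ k, (K z).ker q k (Ring.inverse (S.multMat h α z k) (f k)))) ∧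
        -- uniform bound to the left of the cut
        (∃ L : ℝ, ∀ z : ℂ, z.re < e₀ + S.κ → ‖K z‖ ≤ L) ∧
        -- analyticity off the cut
        AnalyticOnNhd ℂ K (S.halfPlane 1 η \ SpinBoson.cut (e₀ + S.κ)) ∧
        -- boundary values on the cut, and their Hölder continuity
        ∃ Kp Km : ℝ → SpinBoson.K₁ h,
          (∀ x ∈ Ico (e₀ + S.κ) (-S.ε + 2 * S.κ - η),
            Tendsto (fun t : ℝ => K (x + t * Complex.I)) (𝓝[>] 0) (𝓝 (Kp x)) ∧
            Tendsto (fun t : ℝ => K (x - t * Complex.I)) (𝓝[>] 0) (𝓝 (Km x))) ∧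
          ∃ C r : NNReal, 0 < r ∧ r ≤ 1 ∧
            HolderOnWith C r Kp (Ico (e₀ + S.κ) (-S.ε + 2 * S.κ - η)) ∧
            HolderOnWith C r Km (Ico (e₀ + S.κ) (-S.ε + 2 * S.κ - η)) := by
  have hκ : 0 < S.κ := hω.pos 0
  -- The restriction η < κ places -ε strictly below -ε + κ - η, so that the perturbed zero near -ε
  -- lies in the interval where e₀ is sought.
  refine ⟨S.κ, hκ, fun η hη hηκ => ?_⟩
  -- The margin η is spent in quarters. For n = 1, two are lost because the energies range over Re t
  -- > κ - δ, and one keeps the denominators away from 0. The last is the shrinking needed for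
  -- Cauchy estimates in z.
  obtain ⟨δ, hδ⟩ : ∃ δ, η = 4 * δ := ⟨η / 4, by ring⟩
  have hδ0 : 0 < δ := by linarith
  have hκω : S.ω 0 = S.κ := rfl
  have hh := hlam.isWeight
  obtain ⟨α₁, C, hα₁, hC, hcoeff⟩ := S.exists_coeff_data hω hlam hε hδ0 (by rw [hκω]; linarith)
    (a := S.κ - δ) (v := -S.ε + S.κ - 2 * δ) (v' := -S.ε + 2 * S.κ - 3 * δ) rfl (by ring) (by ring)
  obtain ⟨c, hc, htame⟩ := SpinBoson.exists_tameBound_resolvent (c₁ := 2 * S.κ - 3 * δ) (r := δ)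
    (L := 16 / δ) hω hd hh (by rw [hκω]; linarith) hδ0 (by positivity)
  obtain ⟨CD, hCD, hker⟩ := SpinBoson.exists_holomorphic_kernel (a := S.κ - δ) hω hlam
    (by rw [hκω]; linarith)
  -- The four requirements on the size x = Cα of m and D̂: existence of simple zeros, the order e₂ ≤
  -- e₁, the position of e₂ in the admissible interval, and convergence of the Neumann series.
  obtain ⟨t, ht0, ht⟩ : ∃ t : ℝ, 0 < t ∧ ∀ x : ℝ, 0 ≤ x → x < t →
      16 * x ≤ δ ∧ x < S.ε ∧ x < S.κ - η ∧ c * (CD * x) ≤ 1 / 2 := by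
    refine ⟨min (min (δ / 16) S.ε) (min (S.κ - η) (1 / (2 * (c * CD + 1)))),
      lt_min (lt_min (by positivity) hε) (lt_min (by linarith) (by positivity)), fun x hx0 hx => ?_⟩
    obtain ⟨h12, h34⟩ := lt_min_iff.mp hx
    obtain ⟨h1, h2⟩ := lt_min_iff.mp h12
    obtain ⟨h3, h4⟩ := lt_min_iff.mp h34
    refine ⟨by linarith, h2, h3, ?_⟩
    rw [lt_div_iff₀ (by positivity)] at h4
    nlinarith
  refine ⟨min α₁ (t / (C + 1)), lt_min hα₁ (by positivity), fun α hα0 hα => ?_⟩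
  obtain ⟨hαα₁, hαt⟩ := lt_min_iff.mp hα
  rw [lt_div_iff₀ (by positivity)] at hαt
  have hx0 : 0 ≤ C * α := by positivity
  obtain ⟨hb16, hbε, hbκ, hcM⟩ := ht (C * α) hx0 (by linarith)
  obtain ⟨hz0, hz1, ⟨m₁, m₂, hm, hmMat⟩, X₁, X₂, hX, hdKer⟩ := hcoeff α hα0 hαα₁
  obtain ⟨hm₁d, hm₁s, hm₁b⟩ := hm m₁ (by simp)
  obtain ⟨hm₂d, hm₂s, hm₂b⟩ := hm m₂ (by simp)
  obtain ⟨hX₁d, hX₁b⟩ := hX X₁ (by simp)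
  obtain ⟨hX₂d, hX₂b⟩ := hX X₂ (by simp)
  obtain ⟨e₁, ρ₁, g₁, he₁, hρ₁, hg₁, hgb₁, hzero₁, hinv₁⟩ :=
    SpinBoson.exists_simple_zero (c := S.ε) hδ0 hx0 hb16 hm₁d hm₁s hm₁b
  obtain ⟨e₂, ρ₂, g₂, he₂, hρ₂, hg₂, hgb₂, hzero₂, hinv₂⟩ :=
    SpinBoson.exists_simple_zero (c := -S.ε) hδ0 hx0 hb16 hm₂d hm₂s hm₂b
  rw [abs_le] at he₁ he₂
  -- The zeros are within Cα < ε of -ε and ε respectively, so they cannot cross.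
  have he : e₂ ≤ e₁ := by linarith
  set w : ℝ := -S.ε + S.κ - 2 * δ - δ with hw
  set b : ℝ := -S.ε + 2 * S.κ - 4 * δ with hb
  have hwv : ∀ {ζ : ℂ}, ζ.re < w → ζ.re < -S.ε + S.κ - 2 * δ := fun hζ => by linarith
  have hspec : S.IsSpectral h α w (16 / δ) b e₁ e₂ ρ₁ ρ₂ g₁ g₂ m₁ m₂ :=
    { pole₁ := ⟨he, hρ₁, hg₁, hgb₁⟩
      pole₂ := ⟨le_rfl, hρ₂, hg₂, hgb₂⟩
      le := by rw [hκω]; linarith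
      eq := fun ζ hζ => hmMat ζ (hwv hζ)
      continuousOn₁ := hm₁d.continuousOn.mono fun ζ hζ => hwv hζ
      continuousOn₂ := hm₂d.continuousOn.mono fun ζ hζ => hwv hζ
      zero₁ := hzero₁
      zero₂ := hzero₂
      inv₁ := hinv₁
      inv₂ := hinv₂ }
  have hres := hspec.isResolvent hω
  obtain ⟨htame₁, htame₂⟩ := htame e₂ w b e₁ e₂ ρ₁ ρ₂ g₁ g₂ _ hres (by rw [hκω]; linarith)
    (by linarith)
  have hbδ : b + δ = -S.ε + 2 * S.κ - 3 * δ := by rw [hb]; ring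
  obtain ⟨hD, hDd⟩ := hker (fun z y => (X₁ z y, X₂ z y)) (b + δ) (C * α) (S.dKer h α)
    (by rw [hbδ]; exact hX₁d.prodMk hX₂d)
    (fun z s τ hz hs hτ => by
      rw [hbδ] at hz
      exact max_le (hX₁b z s τ hz hs hτ) (hX₂b z s τ hz hs hτ))
    (fun z hz q k => by
      rw [hbδ] at hz
      rw [hdKer z hz q k, SpinBoson.dgL_apply])
  obtain ⟨hA, hKb, hKan, Kp, Km, hlim, hhol⟩ := SpinBoson.solK_family hh hδ0 hc
    (mul_nonneg hCD hx0) hcM (hres.differentiableOn hω) htame₁ htame₂ hDd fun z hz => (hD z hz).2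
  have hhalf : S.halfPlane 1 η = {z | z.re < b} := by
    ext z
    simp only [SpinBoson.Model.halfPlane, mem_ofPred_eq, hb, hδ, Nat.cast_one]
    constructor <;> intro h0 <;> linarith
  have hbη : -S.ε + 2 * S.κ - η = b := by rw [hb, hδ]
  -- The ground state energy is the zero of the lower entry, the one that perturbs -ε.
  refine ⟨fun z hz => hz0 z ?_, fun z hz => hz1 z ?_, e₂, hspec.isLeast (by linarith) (by linarith),
    fun z => SpinBoson.solK hh (SpinBoson.toBCF fun q => Ring.inverse (S.multMat h α z q))
      (SpinBoson.toK h (S.dKer h α z)), fun z hz => ?_, ⟨2 * (CD * (C * α)), fun z hz => hKb z ?_⟩,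
    ?_, Kp, Km, fun x hx => hlim x ?_, ?_⟩
  · simp only [SpinBoson.Model.halfPlane, mem_ofPred_eq, Nat.cast_zero] at hz
    linarith
  · rw [hhalf] at hz
    have : z.re < b := hz
    linarith
  · rw [hhalf] at hz
    have hzb : z.re < b := hz.1
    have hWq := hres.toBCF_apply hω hz
    have hunit := hspec.isUnit hω hz
    refine ⟨hunit, _, S.isInverse_of_kernel hh hω.contDiff.continuous
      (hD z (by linarith)).1 (fun q => ?_) (fun q => ?_) (hspec.continuous_multMat hω hzb)
      (hspec.norm_multMat_sub_le hω (fun ζ hζ => hm₁b ζ (hwv hζ)) (fun ζ hζ => hm₂b ζ (hwv hζ)) hzb)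
      (SpinBoson.solK_eq (hA z hz)) (SpinBoson.solK_eq' (hA z hz)), fun f => ?_⟩
    · rw [hWq, Ring.inverse_mul_cancel _ (hunit q)]
    · rw [hWq, Ring.mul_inverse_cancel _ (hunit q)]
    · refine (SpinBoson.Model.inverse_formula hh _ f).trans (Eventually.of_forall fun q => ?_)
      simp only [hWq]
  -- Since Cα < κ - η, the cut starts at e₂ + κ < b. Everything to the left of it therefore belongs
  -- to the slit half-plane, and the Neumann bound applies.
  · refine ⟨show z.re < b by linarith, fun hcut => ?_⟩
    have : e₂ + S.κ ≤ z.re := hcut.2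
    linarith
  · rw [hhalf]
    exact hKan
  · rw [← hbη]
    exact hx.2
  · rw [hbη]
    obtain ⟨C', r, hr0, hr1, hp, hm'⟩ := hhol
    exact ⟨C', r, hr0, hr1, hp.mono fun x hx => hx.2, hm'.mono fun x hx => hx.2⟩
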